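/- **Setting.** Let $F(\mathbf X)=\sum_{i=1}^m \mathrm{softmax}(\mathbf X\Theta_i\mathbf X^\top)\mathbf X\mathbf W_i$ (softmax applied row-wise) be a multi-head attention layer with $\Theta_i,\mathbf W_i\in\mathbb R^{d\times d}$, $\mathbf X\in\mathbb R^{k\times d}$, $m\ge1$, $k,d\ge 2$. Examples are pairs $(\mathbf X,\mathbf Y)$ with $\mathbf X$ uniform on $\{\pm1\}^{k\times d}$, drawn independently, and $\mathbf Y=F(\mathbf X)$. Write $\mathbf X_{a:}$ for the $a$-th row, $\|\cdot\|_F$, $\|\cdot\|_{\rm op}$ for the Frobenius and operator norms, $Z=\sum_i\|\Theta_i\|_F^{-2}$. Let $\varepsilon, A>0$, $c\in\mathbb N$. The layer is called *non-degenerate* (with constants $\varepsilon,A,c$ and parameters $\lambda,\kappa,r,\upsilon,\chi$) if * $\Theta_1\ne0$, $\lambda\in(0,1)$, $\|\Theta_i\|_F\le\|\Theta_1\|_F$ and $\|\Theta_i\|_F^2\ge\lambda\|\Theta_1\|_F^2$ for all $i$, and $m^{3/2}\log m/\sqrt r\le\varepsilon\lambda$; * $|\langle\Theta_i,\Theta_j\rangle|\le\kappa\|\Theta_i\|_F\|\Theta_j\|_F$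 for $i\ne j$, where $0<\kappa\le \varepsilon\lambda^{13/2}/(m^{13/2}\log^2 d)$; * $\|\Theta_i\|_F^2\ge r\|\Theta_i\|_{\rm op}^2$ for all $i$, where $\log^c(dmk)/(\kappa\lambda)\le\varepsilon r$ and $r\le\varepsilon d^{1/4}$; * every row and every column of every $\Theta_i$ has Euclidean norm at most $\frac{\upsilon}{\sqrt d}\|\Theta_1\|_F$, where $1\le\upsilon\le\varepsilon\sqrt d/r^2$; * $|\mathrm{tr}\,\Theta_i|\le\chi\|\Theta_i\|_F$ for all $i$, where $1\le\chi\le\sqrt{\log d}$; * $\|\mathbf W_i\|_F\le1$ for all $i$; * $m\le Ak$ and $k\le Ar$. **Procedure.** LeastSquaresRefine$(\widetilde\Theta,\theta,n)$ draws examples until $n$ of them have satisfied $\mathbf X_{1:}\widetilde\Theta(\mathbf X_{2:})^\top>\theta$, and outputs a minimizer $\widehat{\mathbf W}\in\mathbb R^{d\times d}$ of $\bigl(\sum\|\mathbf Y_{1:}-\mathbf X_{2:}\widehat{\mathbf W}\|^2\bigr)^{1/2}$, the sum being over the $n$ accepted examples. **Lemma.** There are one program for a real random access machine (exact real arithmetic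 and comparisons, integer address registers, unit cost per operation and per draw of an example) and a $q\in\mathbb N$ such that for all $\gamma,A>0$ there are constants $\varepsilon,K,\gamma_1>0$, $c\in\mathbb N$ and a function $n=n(d,k,m,\lambda,\omega)\in\mathbb N$ with the following property. Let the layer be non-degenerate with constants $\varepsilon,A,c$; let $$1\le\omega\le\varepsilon\,\lambda^{7/4}\sqrt{\frac{m\kappa r}{\log d}},\qquad \mu\le\varepsilon\,\frac{\lambda^{5/2}}{\omega^3m^3\log^2d},\qquad \Bigl\|\widetilde\Theta-\frac1Z\sum_{i=1}^m\frac{\Theta_i}{\|\Theta_i\|_F^2}\Bigr\|_F\le\mu\|\Theta_1\|_F ,$$ and put $C_0=\gamma_1\omega\sqrt{m\log d}/\lambda^2$. Then $\tfrac32C_0\|\widetilde\Theta\|_F\in[C_0/\sqrt Z,\,2C_0/\sqrt Z]$, and for every threshold $\theta\in[C_0/\sqrt Z,\,2C_0/\sqrt Z]$, with probability at least $1-d^{-\gamma}$, 1. LeastSquaresRefine$(\widetilde\Theta,\theta,n)$ stops after drawing some number $N\le d^{K\omega^2m/\lambda^4}$ of examples; 2. every output of it (every minimizer) satisfies $$\Bigl\|\widehat{\mathbf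 W}-\sum_i\mathbf W_i\Bigr\|_F\le 2mdk^{3/2}\exp\bigl(-\omega\sqrt{\log d}\,\|\Theta_1\|_F+K\omega^2\bigr);$$ 3. the program, on input $d,k,n,\widetilde\Theta,\theta$, draws exactly these $N$ examples, halts after at most $(Nd)^q$ steps, and returns such a minimizer. -/

import Mathlib

namespace AttentionLearning

open Matrix MeasureTheory

noncomputable section

/-! Matrix norms, softmax and multi-head attention. -/

/-- The Frobenius norm. -/
def frob {a b : ℕ} (M : Matrix (Fin a) (Fin b) ℝ) : ℝ :=
  Real.sqrt (∑ i, ∑ j, M i j ^ 2)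

/-- The Frobenius (trace) inner product. -/
def frobInner {a b : ℕ} (M N : Matrix (Fin a) (Fin b) ℝ) : ℝ :=
  ∑ i, ∑ j, M i j * N i j

/-- The operator norm with respect to Euclidean norms. -/
def opNorm {d : ℕ} (M : Matrix (Fin d) (Fin d) ℝ) : ℝ :=
  ‖Matrix.toEuclideanCLM (n := Fin d) (𝕜 := ℝ) M‖

/-- Softmax applied to every row. -/
def rowSoftmax {a b : ℕ} (M : Matrix (Fin a) (Fin b) ℝ) : Matrix (Fin a) (Fin b) ℝ :=
  Matrix.of fun i j => Real.exp (M i j) / ∑ l, Real.exp (M i l)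

/-- The multi-head attention layer with attention matrices `Θ i` and projection matrices `W i`. -/
def attention {m k d : ℕ} (Θ W : Fin m → Matrix (Fin d) (Fin d) ℝ)
    (X : Matrix (Fin k) (Fin d) ℝ) : Matrix (Fin k) (Fin d) ℝ :=
  ∑ i, rowSoftmax (X * Θ i * Xᵀ) * X * W i

/-! The input distribution. -/

/-- Points of the cube `{±1}^{k×d}`, coded by Booleans. -/
abbrev Cube (k d : ℕ) : Type := Fin k → Fin d → Bool

/-- The `±1` matrix coded by a point of the cube. -/
def signMatrix {k d : ℕ} (x : Cube k d) : Matrix (Fin k) (Fin d) ℝ :=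
  Matrix.of fun a j => if x a j then 1 else -1

/-- The law of an infinite sequence of independent uniformly random points of the cube. -/
def uniformStream (k d : ℕ) : Measure (ℕ → Cube k d) :=
  Measure.infinitePi fun _ => ProbabilityTheory.uniformOn (Set.univ : Set (Cube k d))

/-! The weighted average of the attention matrices. -/

/-- `Z = ∑ᵢ 1 / ‖Θᵢ‖_F²`. -/
def weightZ {m d : ℕ} (Θ : Fin m → Matrix (Fin d) (Fin d) ℝ) : ℝ :=
  ∑ i, 1 / frob (Θ i) ^ 2

/-- `(1/Z) ∑ᵢ Θᵢ / ‖Θᵢ‖_F²`. -/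
def weightedAverage {m d : ℕ} (Θ : Fin m → Matrix (Fin d) (Fin d) ℝ) :
    Matrix (Fin d) (Fin d) ℝ :=
  (1 / weightZ Θ) • ∑ i, (1 / frob (Θ i) ^ 2) • Θ i

/-! The standing non-degeneracy assumptions. -/

/-- The non-degeneracy assumptions on the layer. The number `ε` is the constant hidden in every
`≪`, `A` is the constant hidden in every `≲`, and `c` is the exponent of the logarithm in the lower
bound on the effective rank `r`. The matrix `Θ 0` is the attention
matrix of largest norm. -/
structure NonDegenerate (ε A : ℝ) (c : ℕ) {m k d : ℕ} [NeZero m]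
    (Θ W : Fin m → Matrix (Fin d) (Fin d) ℝ) (lam κ r υ χ : ℝ) : Prop where
  two_le_d : 2 ≤ d
  two_le_k : 2 ≤ k
  Θ_ne_zero : Θ 0 ≠ 0
  /-- comparable norms, the first attention matrix being the largest -/
  lam_pos : 0 < lam
  lam_lt_one : lam < 1
  norm_le : ∀ i, frob (Θ i) ≤ frob (Θ 0)
  le_norm : ∀ i, lam * frob (Θ 0) ^ 2 ≤ frob (Θ i) ^ 2
  lam_big : (m : ℝ) ^ (3 / 2 : ℝ) * Real.log m / Real.sqrt r ≤ ε * lam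
  /-- incoherence -/
  κ_pos : 0 < κ
  κ_le : κ ≤ ε * lam ^ (13 / 2 : ℝ) / ((m : ℝ) ^ (13 / 2 : ℝ) * Real.log d ^ 2)
  incoherent : ∀ i j, i ≠ j → |frobInner (Θ i) (Θ j)| ≤ κ * frob (Θ i) * frob (Θ j)
  /-- effective rank -/
  r_big : Real.log ((d : ℝ) * m * k) ^ c / (κ * lam) ≤ ε * r
  r_small : r ≤ ε * (d : ℝ) ^ (1 / 4 : ℝ)
  effective_rank : ∀ i, r * opNorm (Θ i) ^ 2 ≤ frob (Θ i) ^ 2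
  /-- light rows and columns -/
  one_le_υ : 1 ≤ υ
  υ_small : υ ≤ ε * (Real.sqrt d / r ^ 2)
  light_col : ∀ i j, Real.sqrt (∑ l, Θ i l j ^ 2) ≤ υ / Real.sqrt d * frob (Θ 0)
  light_row : ∀ i j, Real.sqrt (∑ l, Θ i j l ^ 2) ≤ υ / Real.sqrt d * frob (Θ 0)
  /-- small trace -/
  one_le_χ : 1 ≤ χ
  χ_le : χ ≤ Real.sqrt (Real.log d)
  trace_le : ∀ i, |(Θ i).trace| ≤ χ * frob (Θ i)
  /-- normalization of the projection matrices -/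
  W_le : ∀ i, frob (W i) ≤ 1
  /-- number of heads and of tokens -/
  heads_le : (m : ℝ) ≤ A * k
  tokens_le : (k : ℝ) ≤ A * r

/-! The procedure. -/

section Procedure

variable {m k d : ℕ} [NeZero k]

/-- The acceptance test `X_{1:} Θt (X_{2:})ᵀ > θ` on the first two tokens. -/
def Accepts (Θt : Matrix (Fin d) (Fin d) ℝ) (θ : ℝ) (x : Cube k d) : Prop :=
  θ < (signMatrix x * Θt * (signMatrix x)ᵀ) 0 1

open Classical in
/-- The accepted indices among the first `T` draws. -/
def accepted (Θt : Matrix (Fin d) (Fin d) ℝ) (θ : ℝ) (xs : ℕ → Cube k d) (T : ℕ) : Finset ℕ :=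
  (Finset.range T).filter fun t => Accepts Θt θ (xs t)

/-- The procedure stops drawing after exactly `T` draws: the `n`-th accepted example is the
`T`-th example drawn. -/
def StopsAt (Θt : Matrix (Fin d) (Fin d) ℝ) (θ : ℝ) (n : ℕ) (xs : ℕ → Cube k d) (T : ℕ) : Prop :=
  (accepted Θt θ xs T).card = n ∧ ∀ T' < T, (accepted Θt θ xs T').card < n

/-- The least-squares objective
`(∑ ‖Y_{1:} - X_{2:} V‖²)^{1/2}`, the sum being over the accepted examples `(X, Y = F X)`. -/
def lsLoss (F : Matrix (Fin k) (Fin d) ℝ → Matrix (Fin k) (Fin d) ℝ)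
    (Θt : Matrix (Fin d) (Fin d) ℝ) (θ : ℝ) (xs : ℕ → Cube k d) (T : ℕ)
    (V : Matrix (Fin d) (Fin d) ℝ) : ℝ :=
  Real.sqrt (∑ t ∈ accepted Θt θ xs T,
    ∑ j, (F (signMatrix (xs t)) 0 j - (signMatrix (xs t) * V) 1 j) ^ 2)

/-- `V` is an output of the procedure when it stops after `T` draws: a minimizer of the
least-squares objective over all real `d × d` matrices. -/
def IsLSOutput (F : Matrix (Fin k) (Fin d) ℝ → Matrix (Fin k) (Fin d) ℝ)
    (Θt : Matrix (Fin d) (Fin d) ℝ) (θ : ℝ) (xs : ℕ → Cube k d) (T : ℕ)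
    (V : Matrix (Fin d) (Fin d) ℝ) : Prop :=
  ∀ V', lsLoss F Θt θ xs T V ≤ lsLoss F Θt θ xs T V'

end Procedure

/-! A uniform real random access machine with a step count, in structured form. It has registers
for natural numbers (loop counters and addresses) and two-dimensional arrays of exact real numbers,
and it may draw labelled examples. Every elementary command and every test costs one step. -/

/-- An array entry: the name of the array, and the address registers with its row and column. -/
structure Cell where
  arr : ℕ
  row : ℕ
  col : ℕ

/-- The arithmetic operations on real numbers. -/
inductive RealOp
  | add
  | sub
  | mul
  | div

/-- The value of an arithmetic operation. -/
def RealOp.eval : RealOp → ℝ → ℝ → ℝ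
  | .add, x, y => x + y
  | .sub, x, y => x - y
  | .mul, x, y => x * y
  | .div, x, y => x / y

/-- Programs. -/
inductive Cmd
  /-- put the constant `v` into address register `i` -/
  | setIdx (i v : ℕ)
  /-- put the sum of registers `j` and `l` into register `i` -/
  | addIdx (i j l : ℕ)
  /-- put the truncated difference of registers `j` and `l` into register `i` -/
  | subIdx (i j l : ℕ)
  /-- put the integer constant `v` into the array entry `z` -/
  | setReal (z : Cell) (v : ℤ)
  /-- put the result of an arithmetic operation on the entries `x`, `y` into the entry `z` -/
  | arith (o : RealOp) (z x y : Cell)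
  /-- draw the next example `(X, Y)`, and store `X` in the array `a`, then `Y` in the array `b` -/
  | draw (a b : ℕ)
  | seq (p q : Cmd)
  /-- branch on whether register `i` is less than register `j` -/
  | ifIdx (i j : ℕ) (p q : Cmd)
  /-- branch on whether the entry `x` is less than the entry `y` -/
  | ifReal (x y : Cell) (p q : Cmd)
  /-- repeat as long as register `i` is less than register `j` -/
  | whileIdx (i j : ℕ) (p : Cmd)

/-- Configurations: address registers, arrays, and the number of examples drawn so far. -/
structure State where
  idx : ℕ → ℕ
  mem : ℕ → ℕ → ℕ → ℝ
  draws : ℕ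

/-- The content of an array entry. -/
def State.get (s : State) (z : Cell) : ℝ := s.mem z.arr (s.idx z.row) (s.idx z.col)

/-- Overwrite a register. -/
def State.putIdx (s : State) (i v : ℕ) : State :=
  { s with idx := Function.update s.idx i v }

/-- Overwrite an array entry. -/
def State.put (s : State) (z : Cell) (v : ℝ) : State :=
  let row := Function.update (s.mem z.arr (s.idx z.row)) (s.idx z.col) v
  { s with mem := Function.update s.mem z.arr (Function.update (s.mem z.arr) (s.idx z.row) row) }

/-- A labelled example as the machine sees it: two arrays. -/
abbrev LabelledPair : Type := (ℕ → ℕ → ℝ) × (ℕ → ℕ → ℝ)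

/-- Store an example and count the draw. -/
def State.load (s : State) (a b : ℕ) (e : LabelledPair) : State :=
  { s with mem := Function.update (Function.update s.mem a e.1) b e.2, draws := s.draws + 1 }

/-- `Exec S p s t s'`: when the examples drawn are `S 0, S 1, …`, the program `p` started in `s`
halts in `s'` after `t` steps. -/
inductive Exec (S : ℕ → LabelledPair) : Cmd → State → ℕ → State → Prop
  | setIdx (i v : ℕ) (s : State) : Exec S (.setIdx i v) s 1 (s.putIdx i v)
  | addIdx (i j l : ℕ) (s : State) :
      Exec S (.addIdx i j l) s 1 (s.putIdx i (s.idx j + s.idx l))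
  | subIdx (i j l : ℕ) (s : State) :
      Exec S (.subIdx i j l) s 1 (s.putIdx i (s.idx j - s.idx l))
  | setReal (z : Cell) (v : ℤ) (s : State) : Exec S (.setReal z v) s 1 (s.put z (v : ℝ))
  | arith (o : RealOp) (z x y : Cell) (s : State) :
      Exec S (.arith o z x y) s 1 (s.put z (o.eval (s.get x) (s.get y)))
  | draw (a b : ℕ) (s : State) : Exec S (.draw a b) s 1 (s.load a b (S s.draws))
  | seq {p q : Cmd} {s s₁ s₂ : State} {t₁ t₂ : ℕ} :
      Exec S p s t₁ s₁ → Exec S q s₁ t₂ s₂ → Exec S (.seq p q) s (t₁ + t₂) s₂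
  | ifIdx_true {i j : ℕ} {p q : Cmd} {s s₁ : State} {t : ℕ} :
      s.idx i < s.idx j → Exec S p s t s₁ → Exec S (.ifIdx i j p q) s (t + 1) s₁
  | ifIdx_false {i j : ℕ} {p q : Cmd} {s s₁ : State} {t : ℕ} :
      ¬ s.idx i < s.idx j → Exec S q s t s₁ → Exec S (.ifIdx i j p q) s (t + 1) s₁
  | ifReal_true {x y : Cell} {p q : Cmd} {s s₁ : State} {t : ℕ} :
      s.get x < s.get y → Exec S p s t s₁ → Exec S (.ifReal x y p q) s (t + 1) s₁
  | ifReal_false {x y : Cell} {p q : Cmd} {s s₁ : State} {t : ℕ} :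
      ¬ s.get x < s.get y → Exec S q s t s₁ → Exec S (.ifReal x y p q) s (t + 1) s₁
  | while_true {i j : ℕ} {p : Cmd} {s s₁ s₂ : State} {t₁ t₂ : ℕ} :
      s.idx i < s.idx j → Exec S p s t₁ s₁ → Exec S (.whileIdx i j p) s₁ t₂ s₂ →
        Exec S (.whileIdx i j p) s (t₁ + t₂ + 1) s₂
  | while_false {i j : ℕ} {p : Cmd} {s : State} :
      ¬ s.idx i < s.idx j → Exec S (.whileIdx i j p) s 1 s

/-- A matrix as an array, with zeros outside the index range. -/
def pad {a b : ℕ} (M : Matrix (Fin a) (Fin b) ℝ) : ℕ → ℕ → ℝ := fun i j =>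
  if h : i < a ∧ j < b then M ⟨i, h.1⟩ ⟨j, h.2⟩ else 0

/-- The stream of labelled examples `(X, F X)`. -/
def examples {k d : ℕ} (F : Matrix (Fin k) (Fin d) ℝ → Matrix (Fin k) (Fin d) ℝ)
    (xs : ℕ → Cube k d) : ℕ → LabelledPair := fun t =>
  (pad (signMatrix (xs t)), pad (F (signMatrix (xs t))))

/-- The input: `d`, `k`, `n` in the registers `0`, `1`, `2`, the matrix `Θt` in the array `0`,
the threshold `θ` in the first entry of the array `1`; everything else is zero. -/
def inputState (k n : ℕ) {d : ℕ} (Θt : Matrix (Fin d) (Fin d) ℝ) (θ : ℝ) : State where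
  idx := fun i => if i = 0 then d else if i = 1 then k else if i = 2 then n else 0
  mem := fun a i j =>
    if a = 0 then pad Θt i j else if a = 1 ∧ i = 0 ∧ j = 0 then θ else 0
  draws := 0

/-- The output: the leading `d × d` block of the array `2`. -/
def State.output (d : ℕ) (s : State) : Matrix (Fin d) (Fin d) ℝ :=
  Matrix.of fun i j => s.mem 2 i j

/-- The order `ω √(m log d) / λ²` of the margin that the procedure waits for. -/
def marginScale (d m : ℕ) (lam ω : ℝ) : ℝ :=
  ω * Real.sqrt (m * Real.log d) / lam ^ 2

end

end AttentionLearning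

/-!
# Learning the sum of the projection matrices of an attention layer by least squares

Let `V` be the approximation `Θt` of the weighted average of the attention matrices, and `θ` the
threshold; a sample is accepted if `x V yᵀ > θ` for its first two rows `x` and `y`.

*Why accepted samples are informative.* The attention matrices `Θ i` are nearly orthogonal, so
`‖V‖²` and all inner products `⟨V, Θ i⟩` are close to `1 / Z` (`NonDegenerate.normBounds`).
Heuristically the product `x a * y b` has conditional mean `θ V a b / ‖V‖²` given acceptance, so that
the form of `Θ i` at the first two tokens is about `θ` for every head, while it stays much smaller at
all other tokens. Precisely, by Chernoff bounds with the tilt `θ / ‖V‖²`, acceptance jointly with an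
unexpected value of one form has probability at most `exp (-θ² / 2‖V‖² - θ² / 2500 S²)`, where
`S = ‖Θ 0‖` is the largest of the norms (`Regime.accept_pair_le`, `Regime.accept_other_le`,
`Regime.accept_self_le`). The exponential moments of quadratic forms in the signs `x` that occur here
are bounded by a Hanson–Wright inequality (`hansonWright`), which follows from decoupling and a
recursion that halves the squared operator norm in each round (`signExp_exp_sq_le`).

*From joint to conditional probabilities.* For a typical first row `x`, acceptance is
the event that the Rademacher sum with coefficient vector `x V` exceeds a threshold of `T = θ / ‖x V‖`
standard deviations. Its probability is at least of order `exp (-T² / 2) / T`, and a flip of any one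
sign keeps the event with conditional probability bounded below (`rademacher_tail`). This is shown by
an exponential tilt which centres the sum at the threshold, and a comparison of the tilted sum with a
Gaussian variable on windows of unit width (`lindeberg`); the third moments of the tilted signs are
themselves of fourth order, so that the comparison has a fourth-order error and tolerates a growing
`T`. Hence the acceptance probability is at least `d⁻⁴ exp (-θ² / 2‖V‖²)` (`Regime.accProb_ge`). As
`θ / S` is a large multiple of `√log d`, an accepted sample is unfocused, that is, has an unexpected
form, with probability at most any prescribed power of `1 / d` (`Regime.accept_unfocused_le`). Stability
under flips bounds the conditional second moments of `w yᵀ` below by a multiple of `‖w‖² / d`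
(`le_signExp_sq_of_flip`, `Regime.gram_ge`).

*Conclusion.* With `n = d ^ (G + 10)` accepted samples, Chebyshev's inequality over the stream bounds
the number of draws, and transfers the lower bound to the empirical Gram matrix; a union bound makes
all accepted samples focused (`goodRun_prob`). On focused samples softmax puts all but a fraction
`k exp (-θ / 4)` of its weight at the second token, so the residual of `∑ W i` is tiny
(`Focused.residual_le`), and the Gram matrix turns this into the bound on the error of every minimizer
(`GoodRun.frob_sub_le`).

*The program* tests each example, accumulates the normal equations of the accepted ones, and solves
them by Gauss–Jordan elimination. No pivoting is needed, because the Gram matrix is positive definite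
on the event in question (`gaussJordan_solves`, `lsProgram_correct`). Its text does not depend on any
parameter, and `(T d) ^ 8` steps suffice (`steps_le`).
-/

namespace AttentionLearning

open Matrix MeasureTheory

noncomputable section

/-! ### Expectations over finite product spaces -/

section ProductExpectation

variable {ι β : Type*} [Fintype ι] [DecidableEq ι] [Fintype β]

/-- The expectation of `F` when the coordinates of a point of `ι → β` are independent and the
coordinate `i` has the weights `w i`. -/
def prodExp (w : ι → β → ℝ) (F : (ι → β) → ℝ) : ℝ := ∑ y, (∏ i, w i (y i)) * F y

/-- A family of probability weights. -/
structure IsWeight (w : ι → β → ℝ) : Prop where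
  nonneg : ∀ i b, 0 ≤ w i b
  sum_eq : ∀ i, ∑ b, w i b = 1

variable {w : ι → β → ℝ} {F G : (ι → β) → ℝ}

theorem prodExp_add (w : ι → β → ℝ) (F G : (ι → β) → ℝ) :
    prodExp w (fun y => F y + G y) = prodExp w F + prodExp w G := by
  simp [prodExp, mul_add, Finset.sum_add_distrib]

theorem prodExp_sub (w : ι → β → ℝ) (F G : (ι → β) → ℝ) :
    prodExp w (fun y => F y - G y) = prodExp w F - prodExp w G := by
  simp [prodExp, mul_sub, Finset.sum_sub_distrib]

theorem prodExp_const_mul (w : ι → β → ℝ) (c : ℝ) (F : (ι → β) → ℝ) :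
    prodExp w (fun y => c * F y) = c * prodExp w F := by
  simp only [prodExp, Finset.mul_sum]
  exact Finset.sum_congr rfl fun _ _ => by ring

theorem prodExp_mul_const (w : ι → β → ℝ) (F : (ι → β) → ℝ) (c : ℝ) :
    prodExp w (fun y => F y * c) = prodExp w F * c := by
  simp only [prodExp, Finset.sum_mul]
  exact Finset.sum_congr rfl fun _ _ => by ring

theorem prodExp_sum {κ : Type*} (s : Finset κ) (w : ι → β → ℝ) (F : κ → (ι → β) → ℝ) :
    prodExp w (fun y => ∑ k ∈ s, F k y) = ∑ k ∈ s, prodExp w (F k) := by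
  simp only [prodExp, Finset.mul_sum]
  exact Finset.sum_comm

/-- The expectation of a product of functions of single coordinates factors. -/
theorem prodExp_prod (w : ι → β → ℝ) (g : ι → β → ℝ) :
    prodExp w (fun y => ∏ i, g i (y i)) = ∏ i, ∑ b, w i b * g i b := by
  simp only [prodExp, ← Finset.prod_mul_distrib]
  rw [Finset.prod_univ_sum, Fintype.piFinset_univ]

theorem IsWeight.prodExp_const (hw : IsWeight w) (c : ℝ) : prodExp w (fun _ => c) = c := by
  have h := prodExp_prod w (fun _ _ => 1)
  simp only [Finset.prod_const_one, mul_one, hw.sum_eq] at h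
  have h2 := prodExp_const_mul w c (fun _ => 1)
  simpa [h] using h2

theorem IsWeight.prodExp_mono (hw : IsWeight w) (h : ∀ y, F y ≤ G y) :
    prodExp w F ≤ prodExp w G :=
  Finset.sum_le_sum fun y _ =>
    mul_le_mul_of_nonneg_left (h y) (Finset.prod_nonneg fun i _ => hw.nonneg i _)

theorem IsWeight.prodExp_nonneg (hw : IsWeight w) (h : ∀ y, 0 ≤ F y) : 0 ≤ prodExp w F :=
  Finset.sum_nonneg fun y _ => mul_nonneg (Finset.prod_nonneg fun i _ => hw.nonneg i _) (h y)

/-- Resampling one coordinate does not change the expectation. -/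
theorem IsWeight.prodExp_update (hw : IsWeight w) (j : ι) (F : (ι → β) → ℝ) :
    prodExp w (fun y => ∑ b, w j b * F (Function.update y j b)) = prodExp w F := by
  simp only [prodExp]
  rw [← Equiv.sum_comp (Equiv.funSplitAt j β).symm, ← Equiv.sum_comp (Equiv.funSplitAt j β).symm,
    Fintype.sum_prod_type, Fintype.sum_prod_type]
  have hprod : ∀ (b : β) (z : {i // i ≠ j} → β),
      ∏ i, w i ((Equiv.funSplitAt j β).symm (b, z) i) = w j b * ∏ i : {i // i ≠ j}, w i (z i) := by
    intro b z
    rw [Fintype.prod_eq_mul_prod_subtype_ne _ j]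
    congr 1
    · simp [Equiv.funSplitAt, Equiv.piSplitAt]
    · refine Finset.prod_congr rfl fun i _ => ?_
      simp [Equiv.funSplitAt, Equiv.piSplitAt, i.2]
  have hupd : ∀ (b c : β) (z : {i // i ≠ j} → β),
      Function.update ((Equiv.funSplitAt j β).symm (c, z)) j b =
        (Equiv.funSplitAt j β).symm (b, z) := by
    intro b c z
    funext i
    by_cases hi : i = j
    · subst hi; simp [Equiv.funSplitAt, Equiv.piSplitAt]
    · simp [Equiv.funSplitAt, Equiv.piSplitAt, hi]
  simp only [hprod, hupd]
  rw [Finset.sum_comm]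
  conv_rhs => rw [Finset.sum_comm]
  refine Finset.sum_congr rfl fun z _ => ?_
  rw [← Finset.sum_mul, ← Finset.sum_mul, hw.sum_eq, one_mul, Finset.mul_sum]
  exact Finset.sum_congr rfl fun b _ => by ring

/-- Resampling the coordinates in a set does not change the expectation. -/
theorem IsWeight.prodExp_piecewise (hw : IsWeight w) (S : Finset ι) (F : (ι → β) → ℝ) :
    prodExp w (fun y => prodExp w fun y' => F (S.piecewise y' y)) = prodExp w F := by
  induction S using Finset.induction_on generalizing F with
  | empty => simp [hw.prodExp_const]
  | insert j S hj ih =>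
    have h1 : ∀ y, (prodExp w fun y' => F ((insert j S).piecewise y' y)) =
        prodExp w fun y' => ∑ b, w j b * F (Function.update (S.piecewise y' y) j b) := by
      intro y
      rw [← hw.prodExp_update j]
      congr 1
      funext y'
      refine Finset.sum_congr rfl fun b _ => ?_
      congr 2
      funext i
      by_cases hi : i = j
      · subst hi; simp
      · by_cases hiS : i ∈ S <;> simp [hi, hiS]
    simp only [h1]
    rw [ih (fun y => ∑ b, w j b * F (Function.update y j b)), hw.prodExp_update]

/-- The uniform weights. -/
def unif (ι β : Type*) [Fintype β] : ι → β → ℝ := fun _ _ => 1 / Fintype.card β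

theorem prodExp_unif (F : (ι → β) → ℝ) :
    prodExp (unif ι β) F = (∑ y, F y) / Fintype.card (ι → β) := by
  simp [prodExp, unif, div_eq_inv_mul, Finset.mul_sum]

/-- The law of one coordinate. -/
theorem IsWeight.prodExp_eval (hw : IsWeight w) (j : ι) (g : β → ℝ) :
    prodExp w (fun y => g (y j)) = ∑ b, w j b * g b := by
  rw [← hw.prodExp_update j]
  simp [hw.prodExp_const]

/-- Jensen's inequality for the exponential function. -/
theorem IsWeight.exp_prodExp_le (hw : IsWeight w) (F : (ι → β) → ℝ) :
    Real.exp (prodExp w F) ≤ prodExp w fun y => Real.exp (F y) := by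
  set c := prodExp w F with hc
  have h : ∀ y, Real.exp c * (F y + (1 - c)) ≤ Real.exp (F y) := by
    intro y
    have h1 := Real.add_one_le_exp (F y - c)
    have h2 : Real.exp (F y) = Real.exp c * Real.exp (F y - c) := by
      rw [← Real.exp_add]; ring_nf
    rw [h2]
    exact mul_le_mul_of_nonneg_left (by linarith) (Real.exp_pos _).le
  have h3 := hw.prodExp_mono h
  rw [prodExp_const_mul, prodExp_add, hw.prodExp_const, ← hc] at h3
  linarith

end ProductExpectation

theorem isWeight_unif {ι β : Type*} [Fintype β] [Nonempty β] : IsWeight (unif ι β) where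
  nonneg _ _ := by unfold unif; positivity
  sum_eq _ := by simp [unif]

/-! ### Sign vectors -/

/-- The sign coded by a Boolean. -/
def sg (b : Bool) : ℝ := if b then 1 else -1

/-- The sign vector coded by a vector of Booleans. -/
def sv {ι : Type*} (x : ι → Bool) : ι → ℝ := fun i => sg (x i)

theorem sg_sq (b : Bool) : sg b * sg b = 1 := by cases b <;> simp [sg]

theorem sg_not (b : Bool) : sg (!b) = -sg b := by cases b <;> simp [sg]

theorem abs_sg (b : Bool) : |sg b| = 1 := by cases b <;> simp [sg]

section Signs

variable {n : ℕ}

/-- The expectation over uniformly random sign vectors. -/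
abbrev signExp (F : (Fin n → Bool) → ℝ) : ℝ := prodExp (unif (Fin n) Bool) F

theorem isWeight_sign : IsWeight (unif (Fin n) Bool) := isWeight_unif

/-- The moment generating function of a Rademacher sum. -/
theorem signExp_exp (u : Fin n → ℝ) :
    signExp (fun y => Real.exp (u ⬝ᵥ sv y)) = ∏ i, Real.cosh (u i) := by
  have h : ∀ y : Fin n → Bool, Real.exp (u ⬝ᵥ sv y) = ∏ i, Real.exp (u i * sg (y i)) := by
    intro y
    rw [dotProduct, Real.exp_sum]; rfl
  simp only [signExp, h]
  rw [prodExp_prod _ (fun i b => Real.exp (u i * sg b))]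
  refine Finset.prod_congr rfl fun i _ => ?_
  simp [unif, sg, Real.cosh_eq]
  ring

/-- Linear forms in random signs are subgaussian. -/
theorem signExp_exp_le (u : Fin n → ℝ) :
    signExp (fun y => Real.exp (u ⬝ᵥ sv y)) ≤ Real.exp ((u ⬝ᵥ u) / 2) := by
  rw [signExp_exp]
  refine (Finset.prod_le_prod (fun i _ => (Real.cosh_pos _).le)
    fun i _ => Real.cosh_le_exp_half_sq (u i)).trans_eq ?_
  rw [← Real.exp_sum, dotProduct, Finset.sum_div]
  congr 1
  exact Finset.sum_congr rfl fun i _ => by ring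

theorem sv_dotProduct_self (x : Fin n → Bool) : sv x ⬝ᵥ sv x = n := by
  simp [dotProduct, sv, sg_sq]

end Signs

end

noncomputable section

/-! ### Exponential moments of quadratic forms in random signs -/

section HansonWright

variable {n : ℕ}

theorem frob_sq {a b : ℕ} (M : Matrix (Fin a) (Fin b) ℝ) : frob M ^ 2 = ∑ i, ∑ j, M i j ^ 2 :=
  Real.sq_sqrt (Finset.sum_nonneg fun _ _ => Finset.sum_nonneg fun _ _ => sq_nonneg _)

theorem frob_nonneg {a b : ℕ} (M : Matrix (Fin a) (Fin b) ℝ) : 0 ≤ frob M := Real.sqrt_nonneg _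

theorem dotProduct_self_nonneg' {ι : Type*} [Fintype ι] (z : ι → ℝ) : 0 ≤ z ⬝ᵥ z :=
  Finset.sum_nonneg fun _ _ => mul_self_nonneg _

/-- The square of the operator norm of `B` is at most `q`, stated for the action on row vectors. -/
def OpSqLE (B : Matrix (Fin n) (Fin n) ℝ) (q : ℝ) : Prop :=
  ∀ z : Fin n → ℝ, (z ᵥ* B) ⬝ᵥ (z ᵥ* B) ≤ q * (z ⬝ᵥ z)

theorem dotProduct_sq_le {ι : Type*} [Fintype ι] (a b : ι → ℝ) :
    (a ⬝ᵥ b) ^ 2 ≤ (a ⬝ᵥ a) * (b ⬝ᵥ b) := by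
  have h := Finset.sum_mul_sq_le_sq_mul_sq Finset.univ a b
  simpa [dotProduct, sq] using h

/-- The operator norm is invariant under transposition. With `u = B z`, Cauchy–Schwarz gives
`|u|⁴ = ⟨u B, z⟩² ≤ q |u|² |z|²`. -/
theorem OpSqLE.transpose {B : Matrix (Fin n) (Fin n) ℝ} {q : ℝ} (hq : 0 ≤ q) (h : OpSqLE B q) :
    OpSqLE Bᵀ q := by
  intro z
  rw [vecMul_transpose]
  set u := B *ᵥ z with hu
  have h1 : u ⬝ᵥ u = (u ᵥ* B) ⬝ᵥ z := by
    rw [← dotProduct_mulVec]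
  have h2 := dotProduct_sq_le (u ᵥ* B) z
  have h3 := h u
  have hz := dotProduct_self_nonneg' z
  have hu0 := dotProduct_self_nonneg' u
  rw [← h1] at h2
  have h4 : (u ⬝ᵥ u) ^ 2 ≤ (u ⬝ᵥ u) * (q * (z ⬝ᵥ z)) := by
    nlinarith [mul_le_mul_of_nonneg_right h3 hz]
  rcases hu0.eq_or_lt with h0 | h0
  · rw [← h0]; positivity
  · nlinarith

/-- The block of `M` with rows in the set coded by `δ` and columns outside it. -/
def crossBlock (δ : Fin n → Bool) (M : Matrix (Fin n) (Fin n) ℝ) : Matrix (Fin n) (Fin n) ℝ :=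
  Matrix.of fun i j => if δ i = true ∧ δ j = false then M i j else 0

/-- A random set separates a given pair of distinct indices, in a given order, with probability
`1 / 4`. -/
theorem signExp_pair (i j : Fin n) :
    prodExp (unif (Fin n) Bool) (fun δ => if δ i = true ∧ δ j = false then (1 : ℝ) else 0) =
      if i = j then 0 else 1 / 4 := by
  by_cases h : i = j
  · subst h
    simp [prodExp]
  · rw [← isWeight_sign.prodExp_update i]
    have h2 : (fun δ : Fin n → Bool => ∑ b, unif (Fin n) Bool i b *
        (if Function.update δ i b i = true ∧ Function.update δ i b j = false then (1 : ℝ) else 0))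
        = fun δ => (1 / 2) * if δ j = false then (1 : ℝ) else 0 := by
      funext δ
      simp [unif, Ne.symm h]
    rw [h2, prodExp_const_mul, isWeight_sign.prodExp_eval j (fun b => if b = false then 1 else 0)]
    simp [unif, h]
    norm_num

/-- Averaging over a random set of rows recovers a quarter of the off-diagonal part. -/
theorem quad_eq_four_crossBlock (M : Matrix (Fin n) (Fin n) ℝ) (x : Fin n → Bool) :
    sv x ⬝ᵥ M *ᵥ sv x - M.trace =
      prodExp (unif (Fin n) Bool) fun δ => 4 * (sv x ⬝ᵥ crossBlock δ M *ᵥ sv x) := by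
  have h1 : ∀ δ : Fin n → Bool, 4 * (sv x ⬝ᵥ crossBlock δ M *ᵥ sv x) =
      ∑ i, ∑ j, (4 * sv x i * M i j * sv x j) *
        (if δ i = true ∧ δ j = false then (1 : ℝ) else 0) := by
    intro δ
    simp only [dotProduct, mulVec, crossBlock, Matrix.of_apply, Finset.mul_sum]
    refine Finset.sum_congr rfl fun i _ => Finset.sum_congr rfl fun j _ => ?_
    split_ifs <;> ring
  simp only [h1]
  rw [prodExp_sum]
  simp only [prodExp_sum, prodExp_const_mul, signExp_pair]
  simp only [dotProduct, mulVec, Matrix.trace, Matrix.diag, Finset.mul_sum]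
  rw [← Finset.sum_sub_distrib]
  refine Finset.sum_congr rfl fun i _ => ?_
  have h2 : M i i = ∑ j, if i = j then sv x i * (M i j * sv x j) else 0 := by
    simp only [Finset.sum_ite_eq, Finset.mem_univ, if_true]
    have := sg_sq (x i)
    simp only [sv]
    linear_combination (-M i i) * this
  rw [h2, ← Finset.sum_sub_distrib]
  refine Finset.sum_congr rfl fun j _ => ?_
  split_ifs <;> ring

/-- Conditionally on its coordinates in the random set, a decoupled form is a Rademacher sum. -/
theorem signExp_exp_crossBlock_le (M : Matrix (Fin n) (Fin n) ℝ) (δ : Fin n → Bool) :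
    (signExp fun x => Real.exp (4 * (sv x ⬝ᵥ crossBlock δ M *ᵥ sv x))) ≤
      signExp fun x => Real.exp (8 * ((sv x ᵥ* crossBlock δ M) ⬝ᵥ (sv x ᵥ* crossBlock δ M))) := by
  set S : Finset (Fin n) := Finset.univ.filter fun i => δ i = false with hS
  unfold signExp
  rw [← isWeight_sign.prodExp_piecewise S]
  refine isWeight_sign.prodExp_mono fun x => ?_
  have h1 : ∀ x' : Fin n → Bool, sv (S.piecewise x' x) ᵥ* crossBlock δ M =
      sv x ᵥ* crossBlock δ M := by
    intro x'
    funext j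
    simp only [vecMul, dotProduct, crossBlock, Matrix.of_apply, sv]
    refine Finset.sum_congr rfl fun i _ => ?_
    by_cases hi : δ i = true
    · have : i ∉ S := by simp [hS, hi]
      rw [Finset.piecewise_eq_of_notMem _ _ _ this]
    · simp [hi]
  have h2 : ∀ x' : Fin n → Bool,
      (sv x ᵥ* crossBlock δ M) ⬝ᵥ sv (S.piecewise x' x) = (sv x ᵥ* crossBlock δ M) ⬝ᵥ sv x' := by
    intro x'
    refine Finset.sum_congr rfl fun j _ => ?_
    by_cases hj : δ j = false
    · have : j ∈ S := by simp [hS, hj]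
      simp only [sv, Finset.piecewise_eq_of_mem _ _ _ this]
    · have : (sv x ᵥ* crossBlock δ M) j = 0 := by
        simp [vecMul, dotProduct, crossBlock, hj]
      rw [this, zero_mul, zero_mul]
  have h3 : ∀ x' : Fin n → Bool, Real.exp (4 * (sv (S.piecewise x' x) ⬝ᵥ
      crossBlock δ M *ᵥ sv (S.piecewise x' x))) =
      Real.exp (((4 : ℝ) • (sv x ᵥ* crossBlock δ M)) ⬝ᵥ sv x') := by
    intro x'
    rw [dotProduct_mulVec, h1, h2, smul_dotProduct, smul_eq_mul]
  simp only [h3]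
  refine (signExp_exp_le _).trans_eq ?_
  congr 1
  simp only [smul_dotProduct, dotProduct_smul, smul_eq_mul]
  ring

/-- Decoupling. The off-diagonal part of a quadratic form is the mean over `δ` of four times its
`δ`-block, so Jensen's inequality leaves bilinear forms in disjoint sets of signs, one of which can be
integrated out. -/
theorem signExp_exp_quad_le (M : Matrix (Fin n) (Fin n) ℝ) :
    (signExp fun x => Real.exp (sv x ⬝ᵥ M *ᵥ sv x)) ≤
      Real.exp M.trace * signExp fun δ => signExp fun x =>
        Real.exp (8 * ((sv x ᵥ* crossBlock δ M) ⬝ᵥ (sv x ᵥ* crossBlock δ M))) := by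
  have h1 : ∀ x : Fin n → Bool, Real.exp (sv x ⬝ᵥ M *ᵥ sv x) ≤ Real.exp M.trace *
      signExp fun δ => Real.exp (4 * (sv x ⬝ᵥ crossBlock δ M *ᵥ sv x)) := by
    intro x
    have h2 := quad_eq_four_crossBlock M x
    have h3 : sv x ⬝ᵥ M *ᵥ sv x = M.trace + signExp fun δ =>
        4 * (sv x ⬝ᵥ crossBlock δ M *ᵥ sv x) := by
      rw [signExp, ← h2]; ring
    rw [h3, Real.exp_add]
    exact mul_le_mul_of_nonneg_left (isWeight_sign.exp_prodExp_le _) (Real.exp_pos _).le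
  refine (isWeight_sign.prodExp_mono h1).trans ?_
  rw [prodExp_const_mul]
  refine mul_le_mul_of_nonneg_left ?_ (Real.exp_pos _).le
  have hcomm : (signExp fun x : Fin n → Bool => signExp fun δ =>
      Real.exp (4 * (sv x ⬝ᵥ crossBlock δ M *ᵥ sv x))) =
      signExp fun δ => signExp fun x : Fin n → Bool =>
        Real.exp (4 * (sv x ⬝ᵥ crossBlock δ M *ᵥ sv x)) := by
    simp only [signExp, prodExp, Finset.mul_sum]
    rw [Finset.sum_comm]
    exact Finset.sum_congr rfl fun _ _ => Finset.sum_congr rfl fun _ _ => by ring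
  refine hcomm.trans_le (isWeight_sign.prodExp_mono fun δ => ?_)
  exact signExp_exp_crossBlock_le M δ

theorem frob_crossBlock_le (δ : Fin n → Bool) (M : Matrix (Fin n) (Fin n) ℝ) :
    frob (crossBlock δ M) ^ 2 ≤ frob M ^ 2 := by
  rw [frob_sq, frob_sq]
  refine Finset.sum_le_sum fun i _ => Finset.sum_le_sum fun j _ => ?_
  simp only [crossBlock, Matrix.of_apply]
  split_ifs
  · exact le_rfl
  · simpa using sq_nonneg (M i j)

theorem OpSqLE.crossBlock {M : Matrix (Fin n) (Fin n) ℝ} {q : ℝ} (hq : 0 ≤ q) (h : OpSqLE M q)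
    (δ : Fin n → Bool) : OpSqLE (crossBlock δ M) q := by
  intro z
  set z' : Fin n → ℝ := fun i => if δ i = true then z i else 0 with hz'
  have h1 : (z ᵥ* AttentionLearning.crossBlock δ M) ⬝ᵥ (z ᵥ* AttentionLearning.crossBlock δ M) ≤
      (z' ᵥ* M) ⬝ᵥ (z' ᵥ* M) := by
    refine Finset.sum_le_sum fun j _ => ?_
    by_cases hj : δ j = false
    · have : (z ᵥ* AttentionLearning.crossBlock δ M) j = (z' ᵥ* M) j := by
        simp only [vecMul, dotProduct, AttentionLearning.crossBlock, Matrix.of_apply, hz', hj]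
        refine Finset.sum_congr rfl fun i _ => ?_
        by_cases hi : δ i = true <;> simp [hi]
      rw [this]
    · have : (z ᵥ* AttentionLearning.crossBlock δ M) j = 0 := by
        simp [vecMul, dotProduct, AttentionLearning.crossBlock, hj]
      rw [this, zero_mul]
      exact mul_self_nonneg _
  have h2 : z' ⬝ᵥ z' ≤ z ⬝ᵥ z := by
    refine Finset.sum_le_sum fun i _ => ?_
    simp only [hz']
    split_ifs
    · exact le_rfl
    · simpa using mul_self_nonneg (z i)
  exact h1.trans ((h z').trans (mul_le_mul_of_nonneg_left h2 hq))

/-- `‖B Bᵀ‖_F² ≤ ‖B‖_op² ‖B‖_F²`, and more generally for products. -/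
theorem frob_mul_transpose_sq_le {A B : Matrix (Fin n) (Fin n) ℝ} {q : ℝ} (hq : 0 ≤ q)
    (h : OpSqLE B q) : frob (A * Bᵀ) ^ 2 ≤ q * frob A ^ 2 := by
  rw [frob_sq, frob_sq, Finset.mul_sum]
  refine Finset.sum_le_sum fun i _ => ?_
  have h1 := h.transpose hq (A i)
  have h2 : ∀ j, (A * Bᵀ) i j = (A i ᵥ* Bᵀ) j := fun j => rfl
  simp only [h2]
  simpa [dotProduct, sq] using h1

theorem OpSqLE.mul_transpose {B : Matrix (Fin n) (Fin n) ℝ} {q : ℝ} (hq : 0 ≤ q)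
    (h : OpSqLE B q) : OpSqLE (B * Bᵀ) (q ^ 2) := by
  intro z
  rw [← vecMul_vecMul]
  calc _ ≤ q * ((z ᵥ* B) ⬝ᵥ (z ᵥ* B)) := h.transpose hq _
    _ ≤ q * (q * (z ⬝ᵥ z)) := mul_le_mul_of_nonneg_left (h z) hq
    _ = q ^ 2 * (z ⬝ᵥ z) := by ring

theorem frob_smul_sq {a b : ℕ} (c : ℝ) (M : Matrix (Fin a) (Fin b) ℝ) :
    frob (c • M) ^ 2 = c ^ 2 * frob M ^ 2 := by
  simp only [frob_sq, Matrix.smul_apply, smul_eq_mul, mul_pow, Finset.mul_sum]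

theorem trace_mul_transpose_self (B : Matrix (Fin n) (Fin n) ℝ) : (B * Bᵀ).trace = frob B ^ 2 := by
  rw [frob_sq]
  simp [Matrix.trace, Matrix.mul_apply, sq]

theorem quad_mul_transpose (B : Matrix (Fin n) (Fin n) ℝ) (z : Fin n → ℝ) :
    z ⬝ᵥ (B * Bᵀ) *ᵥ z = (z ᵥ* B) ⬝ᵥ (z ᵥ* B) := by
  rw [dotProduct_mulVec, ← vecMul_vecMul, ← dotProduct_mulVec, mulVec_transpose]

/-- Each step of the recursion replaces `B` by `√8` times a block of `B Bᵀ`, which halves the bound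
on the squared operator norm. -/
theorem signExp_exp_sq_le_aux (k : ℕ) : ∀ (q : ℝ) (B : Matrix (Fin n) (Fin n) ℝ), 0 ≤ q →
    q ≤ 1 / 16 → OpSqLE B q →
    (signExp fun x => Real.exp ((sv x ᵥ* B) ⬝ᵥ (sv x ᵥ* B))) ≤
      Real.exp (2 * frob B ^ 2 + q * n / 2 ^ k) := by
  induction k with
  | zero =>
    intro q B hq _ h
    refine (isWeight_sign.prodExp_mono (G := fun _ => Real.exp (2 * frob B ^ 2 + q * n / 2 ^ 0))
      fun x => Real.exp_le_exp.mpr ?_).trans_eq (isWeight_sign.prodExp_const _)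
    have := h (sv x)
    rw [sv_dotProduct_self] at this
    have h2 := sq_nonneg (frob B)
    simp only [pow_zero, div_one]
    linarith
  | succ k ih =>
    intro q B hq hq16 h
    have h1 := signExp_exp_quad_le (B * Bᵀ)
    simp only [quad_mul_transpose] at h1
    rw [trace_mul_transpose_self] at h1
    refine h1.trans ?_
    have h2 : ∀ δ : Fin n → Bool, (signExp fun x => Real.exp (8 *
        ((sv x ᵥ* crossBlock δ (B * Bᵀ)) ⬝ᵥ (sv x ᵥ* crossBlock δ (B * Bᵀ))))) ≤
        Real.exp (frob B ^ 2 + q * n / 2 ^ (k + 1)) := by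
      intro δ
      set C := crossBlock δ (B * Bᵀ) with hC
      have hs : Real.sqrt 8 * Real.sqrt 8 = 8 := Real.mul_self_sqrt (by norm_num)
      have h3 : ∀ z : Fin n → ℝ, (z ᵥ* (Real.sqrt 8 • C)) ⬝ᵥ (z ᵥ* (Real.sqrt 8 • C)) =
          8 * ((z ᵥ* C) ⬝ᵥ (z ᵥ* C)) := by
        intro z
        simp only [vecMul_smul, smul_dotProduct, dotProduct_smul, smul_eq_mul, ← mul_assoc, hs]
      have hop : OpSqLE (Real.sqrt 8 • C) (q / 2) := by
        intro z
        rw [h3]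
        have h4 := (h.mul_transpose hq).crossBlock (sq_nonneg q) δ z
        have h5 := dotProduct_self_nonneg' z
        rw [← hC] at h4
        -- this is where `q ≤ 1 / 16` is used: the recursion at least halves the bound `q`
        have h6 : 8 * q ^ 2 ≤ q / 2 := by nlinarith
        nlinarith [mul_le_mul_of_nonneg_right h6 h5]
      have h7 := ih (q / 2) (Real.sqrt 8 • C) (by linarith) (by linarith) hop
      simp only [h3] at h7
      refine h7.trans (Real.exp_le_exp.mpr ?_)
      rw [frob_smul_sq]
      have h8 : frob C ^ 2 ≤ q * frob B ^ 2 :=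
        (frob_crossBlock_le δ _).trans (frob_mul_transpose_sq_le hq h)
      have h9 : Real.sqrt 8 ^ 2 = 8 := Real.sq_sqrt (by norm_num)
      have h10 : q / 2 * n / 2 ^ k = q * n / 2 ^ (k + 1) := by rw [pow_succ]; field_simp
      rw [h9, h10]
      have h11 := mul_le_mul_of_nonneg_right hq16 (sq_nonneg (frob B))
      linarith
    calc _ ≤ Real.exp (frob B ^ 2) * Real.exp (frob B ^ 2 + q * n / 2 ^ (k + 1)) :=
          mul_le_mul_of_nonneg_left ((isWeight_sign.prodExp_mono h2).trans_eq
            (isWeight_sign.prodExp_const _)) (Real.exp_pos _).le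
      _ = _ := by rw [← Real.exp_add]; ring_nf

/-- The exponential moment of a squared length, free of the dimension. Decoupling turns the form with
matrix `B Bᵀ` into a squared length of the same kind with a smaller operator norm; after `k` rounds the
dimension enters only through `q * n / 2 ^ k`. -/
theorem signExp_exp_sq_le {q : ℝ} {B : Matrix (Fin n) (Fin n) ℝ} (hq : 0 ≤ q)
    (hq16 : q ≤ 1 / 16) (h : OpSqLE B q) :
    (signExp fun x => Real.exp ((sv x ᵥ* B) ⬝ᵥ (sv x ᵥ* B))) ≤ Real.exp (2 * frob B ^ 2) := by
  -- the term with the dimension vanishes as the number of rounds grows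
  have hlim : Filter.Tendsto (fun k : ℕ => Real.exp (2 * frob B ^ 2 + q * n / 2 ^ k)) Filter.atTop
      (nhds (Real.exp (2 * frob B ^ 2 + 0))) := by
    refine (Real.continuous_exp.tendsto _).comp (Filter.Tendsto.add tendsto_const_nhds ?_)
    have h1 := (tendsto_pow_atTop_nhds_zero_of_lt_one (by norm_num : (0 : ℝ) ≤ 1 / 2)
      (by norm_num)).const_mul (q * n)
    rw [mul_zero] at h1
    refine h1.congr fun k => ?_
    rw [one_div, inv_pow, div_eq_mul_inv]
  rw [add_zero] at hlim
  exact ge_of_tendsto' hlim fun k => signExp_exp_sq_le_aux k q B hq hq16 h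

/-- The Hanson–Wright inequality for random signs, in the form of a bound on exponential moments. -/
theorem hansonWright {M : Matrix (Fin n) (Fin n) ℝ} {q : ℝ} (hq : 0 ≤ q) (hq128 : q ≤ 1 / 128)
    (h : OpSqLE M q) :
    (signExp fun x => Real.exp (sv x ⬝ᵥ M *ᵥ sv x)) ≤ Real.exp (M.trace + 16 * frob M ^ 2) := by
  refine (signExp_exp_quad_le M).trans ?_
  rw [Real.exp_add]
  refine mul_le_mul_of_nonneg_left ?_ (Real.exp_pos _).le
  refine (isWeight_sign.prodExp_mono (G := fun _ => Real.exp (16 * frob M ^ 2))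
    fun δ => ?_).trans_eq (isWeight_sign.prodExp_const _)
  have hs : Real.sqrt 8 * Real.sqrt 8 = 8 := Real.mul_self_sqrt (by norm_num)
  have h3 : ∀ z : Fin n → ℝ, (z ᵥ* (Real.sqrt 8 • crossBlock δ M)) ⬝ᵥ
      (z ᵥ* (Real.sqrt 8 • crossBlock δ M)) = 8 * ((z ᵥ* crossBlock δ M) ⬝ᵥ
        (z ᵥ* crossBlock δ M)) := by
    intro z
    simp only [vecMul_smul, smul_dotProduct, dotProduct_smul, smul_eq_mul, ← mul_assoc, hs]
  have hop : OpSqLE (Real.sqrt 8 • crossBlock δ M) (8 * q) := by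
    intro z
    rw [h3, mul_assoc]
    exact mul_le_mul_of_nonneg_left (h.crossBlock hq δ z) (by norm_num)
  have h7 := signExp_exp_sq_le (by linarith) (by linarith) hop
  simp only [h3] at h7
  refine h7.trans (Real.exp_le_exp.mpr ?_)
  rw [frob_smul_sq, Real.sq_sqrt (by norm_num)]
  linarith [frob_crossBlock_le δ M]

end HansonWright

end

noncomputable section

/-! ### A fourth-order Lindeberg comparison -/

section Lindeberg

open ProbabilityTheory NNReal

/-- A bound on the derivative by `C |a| ^ k` integrates to a bound by `C |a| ^ (k + 1)`. -/
theorem abs_le_of_hasDerivAt_le {h h' : ℝ → ℝ} {C : ℝ} {k : ℕ} (hC : 0 ≤ C) (h0 : h 0 = 0)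
    (hd : ∀ a, HasDerivAt h (h' a) a) (hb : ∀ a, |h' a| ≤ C * |a| ^ k) (a : ℝ) :
    |h a| ≤ C * |a| ^ (k + 1) := by
  have h1 := (convex_uIcc (0 : ℝ) a).norm_image_sub_le_of_norm_hasDerivWithin_le
    (f := h) (f' := h') (C := C * |a| ^ k) (x := 0) (y := a)
    (fun x _ => (hd x).hasDerivWithinAt)
    (fun x hx => by
      have hx' : |x| ≤ |a| := by
        have := Set.abs_sub_left_of_mem_uIcc hx
        simpa using this
      exact (hb x).trans (mul_le_mul_of_nonneg_left (pow_le_pow_left₀ (abs_nonneg _) hx' k) hC))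
    Set.left_mem_uIcc Set.right_mem_uIcc
  simpa [h0, pow_succ, mul_assoc] using h1

/-- A test function with values in `[0, 1]` that is `1` on `[-1, 1]` and `0` off `[-2, 2]`, with a
third-order Taylor expansion. -/
structure IsWindow (f f₁ f₂ f₃ : ℝ → ℝ) (K : ℝ) : Prop where
  cont : Continuous f
  nonneg : ∀ u, 0 ≤ f u
  le_one : ∀ u, f u ≤ 1
  eq_one : ∀ u, |u| ≤ 1 → f u = 1
  eq_zero : ∀ u, 2 ≤ |u| → f u = 0
  pos : 0 < K
  third_le : ∀ u, |f₃ u| ≤ K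
  taylor : ∀ u a, |f (u + a) - f u - f₁ u * a - f₂ u * a ^ 2 / 2 - f₃ u * a ^ 3 / 6| ≤ K * a ^ 4

/-- Window functions exist: a smooth bump function, whose derivatives are bounded by compactness of its
support. -/
theorem exists_isWindow : ∃ (f f₁ f₂ f₃ : ℝ → ℝ) (K : ℝ), IsWindow f f₁ f₂ f₃ K := by
  let φ : ContDiffBump (0 : ℝ) := ⟨1, 2, one_pos, one_lt_two⟩
  have hsm : ContDiff ℝ (⊤ : ℕ∞) (φ : ℝ → ℝ) := φ.contDiff
  have hsm' : ∀ k : ℕ, ContDiff ℝ (⊤ : ℕ∞) (deriv^[k] (φ : ℝ → ℝ)) := fun k =>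
    hsm.iterate_deriv k
  have hcs : ∀ k : ℕ, HasCompactSupport (deriv^[k] (φ : ℝ → ℝ)) := by
    intro k
    induction k with
    | zero => exact φ.hasCompactSupport
    | succ k ih => rw [Function.iterate_succ_apply']; exact ih.deriv
  have hder : ∀ (k : ℕ) (u : ℝ), HasDerivAt (deriv^[k] (φ : ℝ → ℝ)) (deriv^[k + 1] φ u) u := by
    intro k u
    rw [Function.iterate_succ_apply']
    exact ((hsm' k).differentiable (by simp)).differentiableAt.hasDerivAt
  obtain ⟨K₃, hK₃⟩ := (hcs 3).exists_bound_of_continuous (hsm' 3).continuous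
  obtain ⟨K₄, hK₄⟩ := (hcs 4).exists_bound_of_continuous (hsm' 4).continuous
  set K := max (max K₃ K₄) 1 with hK
  have hKpos : 0 < K := lt_of_lt_of_le one_pos (le_max_right _ _)
  set f : ℕ → ℝ → ℝ := fun k => deriv^[k] (φ : ℝ → ℝ) with hf
  have hd : ∀ (k : ℕ) (u a : ℝ), HasDerivAt (fun a => f k (u + a)) (f (k + 1) (u + a)) a :=
    fun k u a => (hder k (u + a)).comp_const_add u a
  have h3 : ∀ u a, |f 3 (u + a) - f 3 u| ≤ K * |a| ^ 1 := by
    intro u a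
    refine abs_le_of_hasDerivAt_le (h := fun a => f 3 (u + a) - f 3 u)
      (h' := fun a => f 4 (u + a)) hKpos.le (by simp) (fun a => (hd 3 u a).sub_const _)
      (fun a => ?_) a
    have := hK₄ (u + a)
    rw [pow_zero, mul_one]
    exact this.trans ((le_max_right _ _).trans (le_max_left _ _))
  have h2 : ∀ u a, |f 2 (u + a) - f 2 u - f 3 u * a| ≤ K * |a| ^ 2 := by
    intro u a
    refine abs_le_of_hasDerivAt_le (h := fun a => f 2 (u + a) - f 2 u - f 3 u * a)
      (h' := fun a => f 3 (u + a) - f 3 u) hKpos.le (by simp) (fun a => ?_) (h3 u) a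
    have := ((hd 2 u a).sub_const (f 2 u)).sub ((hasDerivAt_id a).const_mul (f 3 u))
    refine this.congr_deriv ?_
    ring
  have h1 : ∀ u a, |f 1 (u + a) - f 1 u - f 2 u * a - f 3 u * a ^ 2 / 2| ≤ K * |a| ^ 3 := by
    intro u a
    refine abs_le_of_hasDerivAt_le
      (h := fun a => f 1 (u + a) - f 1 u - f 2 u * a - f 3 u * a ^ 2 / 2)
      (h' := fun a => f 2 (u + a) - f 2 u - f 3 u * a) hKpos.le (by simp) (fun a => ?_) (h2 u) a
    have := (((hd 1 u a).sub_const (f 1 u)).sub ((hasDerivAt_id a).const_mul (f 2 u))).sub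
      (((hasDerivAt_pow 2 a).const_mul (f 3 u)).div_const 2)
    refine this.congr_deriv ?_
    push_cast; ring
  have h0 : ∀ u a, |f 0 (u + a) - f 0 u - f 1 u * a - f 2 u * a ^ 2 / 2 - f 3 u * a ^ 3 / 6| ≤
      K * |a| ^ 4 := by
    intro u a
    refine abs_le_of_hasDerivAt_le
      (h := fun a => f 0 (u + a) - f 0 u - f 1 u * a - f 2 u * a ^ 2 / 2 - f 3 u * a ^ 3 / 6)
      (h' := fun a => f 1 (u + a) - f 1 u - f 2 u * a - f 3 u * a ^ 2 / 2) hKpos.le (by simp)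
      (fun a => ?_) (h1 u) a
    have := ((((hd 0 u a).sub_const (f 0 u)).sub ((hasDerivAt_id a).const_mul (f 1 u))).sub
      (((hasDerivAt_pow 2 a).const_mul (f 2 u)).div_const 2)).sub
      (((hasDerivAt_pow 3 a).const_mul (f 3 u)).div_const 6)
    refine this.congr_deriv ?_
    push_cast; ring
  refine ⟨φ, f 1, f 2, f 3, K, ⟨φ.continuous, fun u => φ.nonneg, fun u => φ.le_one, ?_, ?_, hKpos,
    fun u => (hK₃ u).trans ((le_max_left _ _).trans (le_max_left _ _)), fun u a => ?_⟩⟩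
  · intro u hu
    exact φ.one_of_mem_closedBall (by simpa [φ, Real.dist_eq] using hu)
  · intro u hu
    exact φ.zero_of_le_dist (by simpa [φ, Real.dist_eq] using hu)
  · have := h0 u a
    rwa [show |a| ^ 4 = a ^ 4 from by rw [← abs_pow]; exact abs_of_nonneg (by positivity)] at this

/-- The fourth moment of the standard normal law. -/
def gaussFour : ℝ := ∫ x, x ^ 4 ∂gaussianReal 0 1

theorem gaussFour_nonneg : 0 ≤ gaussFour := integral_nonneg fun x => by positivity

theorem integrable_pow_gaussian (k : ℕ) (V : ℝ≥0) :
    Integrable (fun x : ℝ => x ^ k) (gaussianReal 0 V) := by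
  rcases Nat.eq_zero_or_pos k with rfl | hk
  · simp
  have h := memLp_id_gaussianReal (μ := 0) (v := V) k
  have h2 := h.integrable_norm_pow (by exact_mod_cast hk.ne')
  refine h2.mono' (by fun_prop) (Filter.Eventually.of_forall fun x => ?_)
  simp

theorem integral_pow_four_gaussian (V : ℝ≥0) :
    ∫ x, x ^ 4 ∂gaussianReal 0 V = V ^ 2 * gaussFour := by
  have h := gaussianReal_map_const_mul (μ := 0) (v := 1) (Real.sqrt V)
  have h2 : gaussianReal 0 V = (gaussianReal 0 1).map (fun x => Real.sqrt V * x) := by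
    rw [h]
    congr 1
    · simp
    · ext; simp
  rw [h2, integral_map (by fun_prop) (by fun_prop), gaussFour, ← integral_const_mul]
  congr 1
  funext x
  rw [mul_pow, show Real.sqrt V ^ 4 = (Real.sqrt V ^ 2) ^ 2 from by ring,
    Real.sq_sqrt V.coe_nonneg]

theorem integral_sq_gaussian (V : ℝ≥0) : ∫ x, x ^ 2 ∂gaussianReal 0 V = V := by
  have h := variance_fun_id_gaussianReal (μ := 0) (v := V)
  rw [variance_eq_integral (by fun_prop)] at h
  simpa using h

theorem integral_pow_three_gaussian (V : ℝ≥0) : ∫ x, x ^ 3 ∂gaussianReal 0 V = 0 := by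
  have h := gaussianReal_map_neg (μ := 0) (v := V)
  rw [neg_zero] at h
  have h2 : ∫ x, x ^ 3 ∂gaussianReal 0 V = ∫ x, (-x) ^ 3 ∂gaussianReal 0 V := by
    conv_lhs => rw [← h]
    rw [integral_map (by fun_prop) (by fun_prop)]
  have h3 : ∫ x, (-x) ^ 3 ∂gaussianReal 0 V = -∫ x, x ^ 3 ∂gaussianReal 0 V := by
    rw [← integral_neg]
    congr 1; funext x; ring
  linarith

/-- Replacing a centred two-point variable by a normal variable of the same variance. -/
theorem abs_twoPoint_sub_gaussian_le {f f₁ f₂ f₃ : ℝ → ℝ} {K : ℝ} (hc : Continuous f)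
    (hK : 0 ≤ K) (h3 : ∀ u, |f₃ u| ≤ K)
    (ht : ∀ u a, |f (u + a) - f u - f₁ u * a - f₂ u * a ^ 2 / 2 - f₃ u * a ^ 3 / 6| ≤ K * a ^ 4)
    {w a : Bool → ℝ} {V : ℝ≥0} {M₃ M₄ : ℝ} (hw : ∀ b, 0 ≤ w b) (hw1 : ∑ b, w b = 1)
    (hmean : ∑ b, w b * a b = 0) (hvar : ∑ b, w b * a b ^ 2 = V)
    (hthird : |∑ b, w b * a b ^ 3| ≤ M₃) (hfour : ∑ b, w b * a b ^ 4 ≤ M₄) (u : ℝ) :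
    |∑ b, w b * f (u + a b) - ∫ x, f (u + x) ∂gaussianReal 0 V| ≤
      K * (M₃ + M₄ + V ^ 2 * gaussFour) := by
  set R : ℝ → ℝ := fun a => f (u + a) - f u - f₁ u * a - f₂ u * a ^ 2 / 2 - f₃ u * a ^ 3 / 6
    with hR
  have hfe : ∀ a, f (u + a) = f u + f₁ u * a + f₂ u * a ^ 2 / 2 + f₃ u * a ^ 3 / 6 + R a := by
    intro a; simp only [hR]; ring
  have hRle : ∀ a, |R a| ≤ K * a ^ 4 := ht u
  have e1 : ∑ b, w b * f (u + a b) =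
      f u + f₂ u * V / 2 + f₃ u * (∑ b, w b * a b ^ 3) / 6 + ∑ b, w b * R (a b) := by
    rw [← hvar]
    simp only [hfe]
    have hm : f₁ u * ∑ b, w b * a b = 0 := by rw [hmean, mul_zero]
    have hs : f u * ∑ b, w b = f u := by rw [hw1, mul_one]
    simp only [Fintype.sum_bool] at *
    linear_combination hm + hs
  have iR : Integrable R (gaussianReal 0 V) := by
    refine ((integrable_pow_gaussian 4 V).const_mul K).mono' ?_ (Filter.Eventually.of_forall hRle)
    simp only [hR]
    exact (by fun_prop : Continuous fun a => f (u + a) - f u - f₁ u * a - f₂ u * a ^ 2 / 2 -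
      f₃ u * a ^ 3 / 6).aestronglyMeasurable
  have e2 : ∫ x, f (u + x) ∂gaussianReal 0 V = f u + f₂ u * V / 2 + ∫ x, R x ∂gaussianReal 0 V := by
    have i1 : Integrable (fun x : ℝ => f₁ u * x) (gaussianReal 0 V) := by
      simpa using (integrable_pow_gaussian 1 V).const_mul (f₁ u)
    have i2 : Integrable (fun x : ℝ => f₂ u * x ^ 2 / 2) (gaussianReal 0 V) :=
      ((integrable_pow_gaussian 2 V).const_mul _).div_const _
    have i3 : Integrable (fun x : ℝ => f₃ u * x ^ 3 / 6) (gaussianReal 0 V) :=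
      ((integrable_pow_gaussian 3 V).const_mul _).div_const _
    have i0 : Integrable (fun _ : ℝ => f u) (gaussianReal 0 V) := integrable_const _
    simp only [hfe]
    rw [integral_add (f := fun x => f u + f₁ u * x + f₂ u * x ^ 2 / 2 + f₃ u * x ^ 3 / 6)
        (((i0.add i1).add i2).add i3) iR,
      integral_add (f := fun x => f u + f₁ u * x + f₂ u * x ^ 2 / 2) ((i0.add i1).add i2) i3,
      integral_add (f := fun x => f u + f₁ u * x) (i0.add i1) i2, integral_add i0 i1, integral_div, integral_div,
      integral_const_mul, integral_const_mul, integral_const_mul, integral_sq_gaussian,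
      integral_pow_three_gaussian, integral_id_gaussianReal]
    simp
  have b1 : |∑ b, w b * R (a b)| ≤ K * M₄ := by
    refine (Finset.abs_sum_le_sum_abs _ _).trans ?_
    calc ∑ b, |w b * R (a b)| ≤ ∑ b, K * (w b * a b ^ 4) := by
          refine Finset.sum_le_sum fun b _ => ?_
          rw [abs_mul, abs_of_nonneg (hw b)]
          have := mul_le_mul_of_nonneg_left (hRle (a b)) (hw b)
          linarith
      _ = K * ∑ b, w b * a b ^ 4 := by rw [Finset.mul_sum]
      _ ≤ K * M₄ := mul_le_mul_of_nonneg_left hfour hK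
  have b2 : |∫ x, R x ∂gaussianReal 0 V| ≤ K * (V ^ 2 * gaussFour) := by
    rw [← integral_pow_four_gaussian, ← integral_const_mul]
    exact norm_integral_le_of_norm_le (f := R) ((integrable_pow_gaussian 4 V).const_mul K)
      (Filter.Eventually.of_forall fun x => hRle x)
  have b3 : |f₃ u * (∑ b, w b * a b ^ 3) / 6| ≤ K * M₃ := by
    rw [abs_div, abs_mul, abs_of_pos (by norm_num : (0 : ℝ) < 6)]
    have := mul_le_mul (h3 u) hthird (abs_nonneg _) hK
    have h0 : 0 ≤ |f₃ u| * |∑ b, w b * a b ^ 3| := by positivity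
    linarith
  rw [e1, e2]
  rw [abs_le] at b1 b2 b3 ⊢
  constructor <;> linarith

/-- Lindeberg replacement: the summands in `S` are exchanged for independent Gaussian ones, one at a
time, at the cost of the errors of the single exchanges. -/
theorem lindeberg {n : ℕ} {w : Fin n → Bool → ℝ} (hw : IsWeight w) {a : Fin n → Bool → ℝ}
    {V : Fin n → ℝ≥0} {f : ℝ → ℝ} (hc : Continuous f) (hbd : ∀ u, |f u| ≤ 1) {err : Fin n → ℝ}
    (S : Finset (Fin n))
    (hstep : ∀ j ∈ S, ∀ u, |∑ b, w j b * f (u + a j b) - ∫ x, f (u + x) ∂gaussianReal 0 (V j)| ≤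
      err j) (z : ℝ) :
    |prodExp w (fun y => f (z + ∑ j ∈ S, a j (y j))) -
      ∫ x, f (z + x) ∂gaussianReal 0 (∑ j ∈ S, V j)| ≤ ∑ j ∈ S, err j := by
  have hint : ∀ (W : ℝ≥0) (u : ℝ), Integrable (fun x => f (u + x)) (gaussianReal 0 W) := by
    intro W u
    exact Integrable.of_bound (by fun_prop) 1 (Filter.Eventually.of_forall fun x => hbd _)
  induction S using Finset.induction_on generalizing z with
  | empty => simp [hw.prodExp_const]
  | insert j S hj ih =>
    have ih' := ih fun i hi => hstep i (Finset.mem_insert_of_mem hi)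
    have hs := hstep j (Finset.mem_insert_self _ _)
    set W := ∑ j ∈ S, V j with hW
    have e1 : prodExp w (fun y => f (z + ∑ i ∈ insert j S, a i (y i))) =
        ∑ b, w j b * prodExp w (fun y => f (z + a j b + ∑ i ∈ S, a i (y i))) := by
      rw [← hw.prodExp_update j, prodExp_sum]
      refine Finset.sum_congr rfl fun b _ => ?_
      rw [prodExp_const_mul]
      congr 2
      funext y
      rw [Finset.sum_insert hj, Function.update_self, add_assoc]
      congr 3
      refine Finset.sum_congr rfl fun i hi => ?_
      rw [Function.update_of_ne (fun h : i = j => hj (h ▸ hi))]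
    have e2 : ∫ x, f (z + x) ∂gaussianReal 0 (∑ i ∈ insert j S, V i) =
        ∫ x, ∫ y, f (z + x + y) ∂gaussianReal 0 (V j) ∂gaussianReal 0 W := by
      have hconv := gaussianReal_conv_gaussianReal (m₁ := 0) (m₂ := 0) (v₁ := W) (v₂ := V j)
      rw [Finset.sum_insert hj, ← hW, add_comm (V j) W]
      rw [zero_add] at hconv
      rw [← hconv, integral_conv]
      · simp only [add_assoc]
      · rw [hconv]; exact hint _ z
    have e3 : ∑ b, w j b * ∫ x, f (z + a j b + x) ∂gaussianReal 0 W =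
        ∫ x, ∑ b, w j b * f (z + x + a j b) ∂gaussianReal 0 W := by
      rw [integral_finsetSum]
      · refine Finset.sum_congr rfl fun b _ => ?_
        rw [integral_const_mul]
        simp only [add_right_comm z (a j b)]
      · intro b _
        refine Integrable.const_mul ?_ _
        simpa only [add_right_comm z (a j b)] using hint W (z + a j b)
    have b1 : |∑ b, w j b * prodExp w (fun y => f (z + a j b + ∑ i ∈ S, a i (y i))) -
        ∑ b, w j b * ∫ x, f (z + a j b + x) ∂gaussianReal 0 W| ≤ ∑ i ∈ S, err i := by
      rw [← Finset.sum_sub_distrib]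
      refine (Finset.abs_sum_le_sum_abs _ _).trans ?_
      calc _ ≤ ∑ b, w j b * ∑ i ∈ S, err i := by
            refine Finset.sum_le_sum fun b _ => ?_
            rw [← mul_sub, abs_mul, abs_of_nonneg (hw.nonneg j b)]
            exact mul_le_mul_of_nonneg_left (ih' _) (hw.nonneg j b)
        _ = _ := by rw [← Finset.sum_mul, hw.sum_eq, one_mul]
    have b2 : |∫ x, ∑ b, w j b * f (z + x + a j b) ∂gaussianReal 0 W -
        ∫ x, ∫ y, f (z + x + y) ∂gaussianReal 0 (V j) ∂gaussianReal 0 W| ≤ err j := by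
      have hm : StronglyMeasurable fun x => ∫ y, f (z + x + y) ∂gaussianReal 0 (V j) := by
        have : StronglyMeasurable (Function.uncurry fun x y => f (z + x + y)) :=
          (by fun_prop : Continuous (Function.uncurry fun x y => f (z + x + y))).stronglyMeasurable
        exact this.integral_prod_right
      have hi2 : Integrable (fun x => ∫ y, f (z + x + y) ∂gaussianReal 0 (V j))
          (gaussianReal 0 W) := by
        refine Integrable.of_bound hm.aestronglyMeasurable 1 (Filter.Eventually.of_forall fun x => ?_)
        refine (norm_integral_le_of_norm_le_const (C := 1)
          (Filter.Eventually.of_forall fun y => hbd _)).trans ?_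
        simp
      have hi1 : Integrable (fun x => ∑ b, w j b * f (z + x + a j b)) (gaussianReal 0 W) := by
        refine integrable_finsetSum _ fun b _ => Integrable.const_mul ?_ _
        simpa only [add_right_comm z (a j b)] using hint W (z + a j b)
      rw [← integral_sub hi1 hi2]
      have := norm_integral_le_of_norm_le_const (μ := gaussianReal 0 W) (C := err j)
        (f := fun x => ∑ b, w j b * f (z + x + a j b) - ∫ y, f (z + x + y) ∂gaussianReal 0 (V j))
        (Filter.Eventually.of_forall fun x => hs (z + x))
      simpa using this
    rw [e1, e2, Finset.sum_insert hj]
    rw [← e3] at b2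
    rw [abs_le] at b1 b2 ⊢
    constructor <;> linarith

end Lindeberg

end

noncomputable section

/-! ### Gaussian windows -/

section RademacherTail

open ProbabilityTheory NNReal

/-- A Gaussian variable of standard deviation at least `R / 2` falls into a window of bounded width
with probability `O(1 / R)`, because its density is bounded. -/
theorem gaussian_window_le {f f₁ f₂ f₃ : ℝ → ℝ} {K : ℝ} (hf : IsWindow f f₁ f₂ f₃ K) {W : ℝ≥0}
    {R : ℝ} (hR : 0 < R) (hW : R ^ 2 / 4 ≤ W) (u : ℝ) :
    ∫ x, f (u + x) ∂gaussianReal 0 W ≤ 4 / R := by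
  have hWpos : (0 : ℝ) < W := lt_of_lt_of_le (by positivity) hW
  have hW0 : W ≠ 0 := fun h => by rw [h] at hWpos; simp at hWpos
  have hsq : R ≤ Real.sqrt (2 * Real.pi * W) := by
    refine Real.le_sqrt_of_sq_le ?_
    nlinarith [Real.pi_gt_three]
  have hpdf : ∀ x, gaussianPDFReal 0 W x ≤ 1 / R := by
    intro x
    rw [gaussianPDFReal_def]
    have h1 : (Real.sqrt (2 * Real.pi * W))⁻¹ ≤ 1 / R := by
      rw [← one_div]; exact one_div_le_one_div_of_le hR hsq
    have h2 : Real.exp (-(x - 0) ^ 2 / (2 * W)) ≤ 1 := by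
      rw [Real.exp_le_one_iff]
      exact div_nonpos_of_nonpos_of_nonneg (by nlinarith [sq_nonneg (x - 0)]) (by positivity)
    calc _ ≤ 1 / R * 1 := mul_le_mul h1 h2 (Real.exp_pos _).le (by positivity)
      _ = _ := mul_one _
  rw [integral_gaussianReal_eq_integral_smul hW0]
  have hle : ∀ x, gaussianPDFReal 0 W x • f (u + x) ≤
      (Set.Icc (-2 - u) (2 - u)).indicator (fun _ => 1 / R) x := by
    intro x
    rw [Set.indicator_apply, smul_eq_mul]
    split_ifs with hx
    · calc _ ≤ 1 / R * 1 := mul_le_mul (hpdf x) (hf.le_one _) (hf.nonneg _) (by positivity)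
        _ = _ := mul_one _
    · rw [hf.eq_zero, mul_zero]
      by_contra hlt
      push Not at hlt
      rw [abs_lt] at hlt
      exact hx ⟨by linarith, by linarith⟩
  have hi : Integrable ((Set.Icc (-2 - u) (2 - u)).indicator (fun _ : ℝ => 1 / R)) := by
    rw [integrable_indicator_iff measurableSet_Icc]
    exact integrableOn_const (by simp)
  calc _ ≤ ∫ x, (Set.Icc (-2 - u) (2 - u)).indicator (fun _ => 1 / R) x :=
        integral_mono_of_nonneg (Filter.Eventually.of_forall fun x =>
          mul_nonneg (gaussianPDFReal_nonneg _ _ _) (hf.nonneg _)) hi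
          (Filter.Eventually.of_forall hle)
    _ = 4 / R := by
        rw [integral_indicator measurableSet_Icc, setIntegral_const, smul_eq_mul,
          Real.volume_real_Icc_of_le (by linarith)]
        ring

/-- A Gaussian variable of standard deviation between `R / 2` and `R` falls into a window near the
origin with probability of order `1 / R`. -/
theorem le_gaussian_window {f f₁ f₂ f₃ : ℝ → ℝ} {K : ℝ} (hf : IsWindow f f₁ f₂ f₃ K) {W : ℝ≥0}
    {R : ℝ} (hR : 1 ≤ R) (hW : R ^ 2 / 4 ≤ W) (hW' : (W : ℝ) ≤ R ^ 2) {u : ℝ} (hu : |u| ≤ 5) :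
    Real.exp (-72) / (2 * R) ≤ ∫ x, f (u + x) ∂gaussianReal 0 W := by
  have hWpos : (0 : ℝ) < W := lt_of_lt_of_le (by positivity) hW
  have hW0 : W ≠ 0 := fun h => by rw [h] at hWpos; simp at hWpos
  have hsq : Real.sqrt (2 * Real.pi * W) ≤ 4 * R := by
    rw [Real.sqrt_le_left (by positivity)]
    nlinarith [Real.pi_lt_four]
  have hsq0 : 0 < Real.sqrt (2 * Real.pi * W) := Real.sqrt_pos.mpr (by positivity)
  rw [abs_le] at hu
  have hpdf : ∀ x ∈ Set.Icc (-1 - u) (1 - u),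
      Real.exp (-72) / (4 * R) ≤ gaussianPDFReal 0 W x := by
    intro x hx
    rw [gaussianPDFReal_def, div_eq_inv_mul]
    have h1 : (4 * R)⁻¹ ≤ (Real.sqrt (2 * Real.pi * W))⁻¹ := inv_anti₀ hsq0 hsq
    -- `|x| ≤ 6` on the window, and the variance is at least `1 / 4`, so the exponent is at most `72`
    have h2 : Real.exp (-72) ≤ Real.exp (-(x - 0) ^ 2 / (2 * W)) := by
      rw [Real.exp_le_exp, le_div_iff₀ (by positivity)]
      have : x ^ 2 ≤ 36 := by nlinarith [hx.1, hx.2]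
      nlinarith
    exact mul_le_mul h1 h2 (Real.exp_pos _).le (by positivity)
  rw [integral_gaussianReal_eq_integral_smul hW0]
  have hle : ∀ x, (Set.Icc (-1 - u) (1 - u)).indicator (fun _ => Real.exp (-72) / (4 * R)) x ≤
      gaussianPDFReal 0 W x • f (u + x) := by
    intro x
    rw [Set.indicator_apply, smul_eq_mul]
    split_ifs with hx
    · rw [hf.eq_one _ (abs_le.mpr ⟨by linarith [hx.1], by linarith [hx.2]⟩), mul_one]
      exact hpdf x hx
    · exact mul_nonneg (gaussianPDFReal_nonneg _ _ _) (hf.nonneg _)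
  have hi : Integrable (fun x => gaussianPDFReal 0 W x • f (u + x)) := by
    refine (integrable_gaussianPDFReal 0 W).mono' ?_ (Filter.Eventually.of_forall fun x => ?_)
    · exact ((measurable_gaussianPDFReal 0 W).smul
        (hf.cont.measurable.comp (measurable_const_add u))).aestronglyMeasurable
    · rw [smul_eq_mul, Real.norm_eq_abs, abs_of_nonneg (mul_nonneg (gaussianPDFReal_nonneg _ _ _)
        (hf.nonneg _))]
      exact mul_le_of_le_one_right (gaussianPDFReal_nonneg _ _ _) (hf.le_one _)
  calc Real.exp (-72) / (2 * R) =
      ∫ x, (Set.Icc (-1 - u) (1 - u)).indicator (fun _ => Real.exp (-72) / (4 * R)) x := by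
        rw [integral_indicator measurableSet_Icc, setIntegral_const, smul_eq_mul,
          Real.volume_real_Icc_of_le (by linarith)]
        field_simp; ring
    _ ≤ _ := integral_mono_of_nonneg (Filter.Eventually.of_forall fun x =>
        Set.indicator_nonneg (fun _ _ => by positivity) x) hi (Filter.Eventually.of_forall hle)

/-! ### The exponentially tilted law of a sign vector -/

/-- The weights of a sign vector whose density with respect to the uniform law is proportional to
`exp ⟨z, y⟩`. -/
def tilt {n : ℕ} (z : Fin n → ℝ) : Fin n → Bool → ℝ := fun j b => (1 + Real.tanh (z j) * sg b) / 2

theorem abs_tanh_le_one (z : ℝ) : |Real.tanh z| ≤ 1 := (Real.abs_tanh_lt_one z).le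

/-- The tilted weights are proportional to `exp (z j * sg b)`. -/
theorem tilt_eq {n : ℕ} (z : Fin n → ℝ) (j : Fin n) (b : Bool) :
    tilt z j b = Real.exp (z j * sg b) / (2 * Real.cosh (z j)) := by
  have h := Real.cosh_pos (z j)
  unfold tilt
  rw [Real.tanh_eq_sinh_div_cosh]
  cases b
  · simp only [sg, Bool.false_eq_true, if_false, mul_neg, mul_one, ← Real.cosh_sub_sinh]
    field_simp
    ring
  · simp only [sg, if_true, mul_one, ← Real.cosh_add_sinh]
    field_simp

theorem isWeight_tilt {n : ℕ} (z : Fin n → ℝ) : IsWeight (tilt z) where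
  nonneg j b := by
    rw [tilt_eq]
    have := Real.cosh_pos (z j)
    positivity
  sum_eq j := by simp [tilt, sg]; ring

/-- Change of measure from the uniform to the tilted law. -/
theorem signExp_eq_tilt {n : ℕ} (z : Fin n → ℝ) (F : (Fin n → Bool) → ℝ) :
    signExp F = (∏ j, Real.cosh (z j)) *
      prodExp (tilt z) fun y => Real.exp (-(z ⬝ᵥ sv y)) * F y := by
  simp only [signExp, prodExp, Finset.mul_sum]
  refine Finset.sum_congr rfl fun y _ => ?_
  have h1 : Real.exp (z ⬝ᵥ sv y) = ∏ j, Real.exp (z j * sg (y j)) := by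
    rw [dotProduct, Real.exp_sum]; rfl
  have h2 : (∏ j, Real.cosh (z j)) * ∏ j, tilt z j (y j) =
      (∏ j, unif (Fin n) Bool j (y j)) * Real.exp (z ⬝ᵥ sv y) := by
    rw [h1, ← Finset.prod_mul_distrib, ← Finset.prod_mul_distrib]
    refine Finset.prod_congr rfl fun j _ => ?_
    rw [tilt_eq]
    have := (Real.cosh_pos (z j)).ne'
    simp only [unif, Fintype.card_bool]
    push_cast
    field_simp
  have h3 : Real.exp (z ⬝ᵥ sv y) * Real.exp (-(z ⬝ᵥ sv y)) = 1 := by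
    rw [← Real.exp_add, add_neg_cancel, Real.exp_zero]
  linear_combination (-(∏ j, unif (Fin n) Bool j (y j)) * F y) * h3 -
    (Real.exp (-(z ⬝ᵥ sv y)) * F y) * h2

theorem mul_tanh_le_sq (z : ℝ) : z * Real.tanh z ≤ z ^ 2 := by
  have key : ∀ x : ℝ, 0 ≤ x → Real.tanh x ≤ x := by
    intro x hx
    rw [Real.tanh_eq_sinh_div_cosh, div_le_iff₀ (Real.cosh_pos x)]
    have hd : ∀ y : ℝ, HasDerivAt (fun y => y * Real.cosh y - Real.sinh y)
        (y * Real.sinh y) y := by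
      intro y
      have := ((hasDerivAt_id y).mul (Real.hasDerivAt_cosh y)).sub (Real.hasDerivAt_sinh y)
      refine this.congr_deriv ?_
      simp
    have hmono : MonotoneOn (fun y => y * Real.cosh y - Real.sinh y) (Set.Ici 0) := by
      refine monotoneOn_of_hasDerivWithinAt_nonneg (f' := fun y => y * Real.sinh y) (convex_Ici 0)
        (fun y _ => (hd y).continuousAt.continuousWithinAt) (fun y _ => (hd y).hasDerivWithinAt)
        (fun y hy => ?_)
      rw [interior_Ici] at hy
      exact mul_nonneg (le_of_lt hy) (Real.sinh_nonneg_iff.mpr (le_of_lt hy))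
    have := hmono (Set.mem_Ici.mpr le_rfl) (Set.mem_Ici.mpr hx) hx
    simp at this
    exact this
  rcases le_total 0 z with h | h
  · have := mul_le_mul_of_nonneg_left (key z h) h
    linarith [sq z]
  · have := mul_le_mul_of_nonneg_left (key (-z) (by linarith)) (by linarith : (0 : ℝ) ≤ -z)
    rw [Real.tanh_neg] at this
    nlinarith

theorem abs_tanh_le (z : ℝ) : |Real.tanh z| ≤ |z| := by
  rcases eq_or_ne z 0 with rfl | hz
  · simp
  have h := mul_tanh_le_sq |z|
  have hz' : 0 < |z| := abs_pos.mpr hz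
  have h2 : Real.tanh |z| ≤ |z| := by nlinarith
  have h3 : |Real.tanh z| = Real.tanh |z| := by
    have hn : ∀ x : ℝ, 0 ≤ x → 0 ≤ Real.tanh x := fun x hx => by
      rw [Real.tanh_eq_sinh_div_cosh]
      exact div_nonneg (Real.sinh_nonneg_iff.mpr hx) (Real.cosh_pos x).le
    rcases le_total 0 z with h0 | h0
    · rw [abs_of_nonneg h0, abs_of_nonneg (hn z h0)]
    · have := hn (-z) (by linarith)
      rw [abs_of_nonpos h0, Real.tanh_neg, abs_of_nonpos]
      rw [Real.tanh_neg] at this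
      linarith
  rwa [h3]

theorem half_sq_le_mul_tanh {z : ℝ} (hz : z ^ 2 ≤ 1) : z ^ 2 / 2 ≤ z * Real.tanh z := by
  have key : ∀ x : ℝ, 0 ≤ x → x ^ 2 ≤ 1 → x ^ 2 / 2 ≤ x * Real.tanh x := by
    intro x hx hx1
    rw [Real.tanh_eq_sinh_div_cosh, ← mul_div_assoc, le_div_iff₀ (Real.cosh_pos x)]
    have h1 := Real.cosh_le_exp_half_sq x
    have h2 : x ≤ Real.sinh x := Real.self_le_sinh_iff.mpr hx
    have h3 : Real.exp (x ^ 2 / 2) ≤ 2 := by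
      have h4 : Real.exp (x ^ 2 / 2) ≤ Real.exp (1 / 2) := Real.exp_le_exp.mpr (by linarith)
      have h5 : Real.exp (1 / 2) ^ 2 = Real.exp 1 := by
        rw [← Real.exp_nat_mul]; norm_num
      nlinarith [Real.exp_one_lt_d9, Real.exp_pos (1 / 2)]
    nlinarith [Real.cosh_pos x, sq_nonneg x]
  rcases le_total 0 z with h | h
  · exact key z h hz
  · have := key (-z) (by linarith) (by linarith [neg_sq z])
    rw [Real.tanh_neg] at this
    linarith [neg_sq z]

/-- The Gaussian lower bound for `cosh`, with an error of fourth order. -/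
theorem exp_le_cosh (z : ℝ) : Real.exp (z ^ 2 / 2 - z ^ 4 / 8) ≤ Real.cosh z := by
  have h1 : 1 + z ^ 2 / 2 ≤ Real.cosh z := by
    have h2 : Real.cosh z = Real.cosh (z / 2) ^ 2 + Real.sinh (z / 2) ^ 2 := by
      rw [← Real.cosh_two_mul]; ring_nf
    have h3 := Real.cosh_sq (z / 2)
    have h4 : |z / 2| ≤ Real.sinh |z / 2| := Real.self_le_sinh_iff.mpr (abs_nonneg _)
    have h5 : (z / 2) ^ 2 ≤ Real.sinh (z / 2) ^ 2 := by
      rw [← sq_abs (z / 2), ← sq_abs (Real.sinh (z / 2)), Real.abs_sinh]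
      exact pow_le_pow_left₀ (abs_nonneg _) h4 2
    nlinarith
  refine le_trans ?_ h1
  have hu : (0 : ℝ) ≤ z ^ 2 / 2 := by positivity
  rw [← Real.le_log_iff_exp_le (by linarith)]
  refine le_trans ?_ (Real.le_log_one_add_of_nonneg hu)
  rw [le_div_iff₀ (by linarith)]
  have : 0 ≤ z ^ 2 * z ^ 4 := by positivity
  nlinarith

end RademacherTail

end

noncomputable section

/-! ### Windows under the tilted law -/

section TiltedWindows

open ProbabilityTheory NNReal

variable {n : ℕ}

/-- The centred contribution of one coordinate under the tilted law. -/
def centred (z : Fin n → ℝ) (j : Fin n) (b : Bool) : ℝ := z j * (sg b - Real.tanh (z j))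

theorem dotProduct_eq_centred (z : Fin n → ℝ) (y : Fin n → Bool) :
    z ⬝ᵥ sv y = ∑ j, z j * Real.tanh (z j) + ∑ j, centred z j (y j) := by
  rw [← Finset.sum_add_distrib]
  exact Finset.sum_congr rfl fun j _ => by simp only [centred, sv]; ring

/-- The variance of the contribution of one coordinate under the tilted law. -/
def tiltVar (z : Fin n → ℝ) (j : Fin n) : ℝ≥0 :=
  ⟨z j ^ 2 * (1 - Real.tanh (z j) ^ 2), by
    have h := abs_tanh_le_one (z j)
    have : Real.tanh (z j) ^ 2 ≤ 1 := by rw [← sq_abs]; nlinarith [abs_nonneg (Real.tanh (z j))]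
    exact mul_nonneg (sq_nonneg _) (by linarith)⟩

theorem coe_tiltVar (z : Fin n → ℝ) (j : Fin n) :
    (tiltVar z j : ℝ) = z j ^ 2 * (1 - Real.tanh (z j) ^ 2) := rfl

theorem tanh_sq_le_one (z : ℝ) : Real.tanh z ^ 2 ≤ 1 := by
  have h := abs_tanh_le_one z
  rw [← sq_abs]; nlinarith [abs_nonneg (Real.tanh z)]

/-- The tilted third moment is of fourth order, because the law is nearly symmetric. -/
theorem abs_tilt_sub_gaussian_le {f f₁ f₂ f₃ : ℝ → ℝ} {K : ℝ} (hf : IsWindow f f₁ f₂ f₃ K)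
    (z : Fin n → ℝ) (j : Fin n) (u : ℝ) :
    |∑ b, tilt z j b * f (u + centred z j b) - ∫ x, f (u + x) ∂gaussianReal 0 (tiltVar z j)| ≤
      K * (18 + gaussFour) * z j ^ 4 := by
  set τ := Real.tanh (z j) with hτ
  have hτ1 : τ ^ 2 ≤ 1 := tanh_sq_le_one (z j)
  have hτa : |τ| ≤ |z j| := abs_tanh_le (z j)
  have h := abs_twoPoint_sub_gaussian_le (M₃ := 2 * z j ^ 4) (M₄ := 16 * z j ^ 4) hf.cont hf.pos.le
    hf.third_le hf.taylor (w := tilt z j) (a := centred z j) (V := tiltVar z j)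
    ((isWeight_tilt z).nonneg j) ((isWeight_tilt z).sum_eq j)
    (by simp only [Fintype.sum_bool, tilt, centred, sg, ← hτ]; simp; ring)
    (by simp only [Fintype.sum_bool, tilt, centred, sg, coe_tiltVar, ← hτ]; simp; ring)
    (by
      have e : ∑ b, tilt z j b * centred z j b ^ 3 = -(2 * τ * (1 - τ ^ 2)) * z j ^ 3 := by
        simp only [Fintype.sum_bool, tilt, centred, sg, ← hτ]; simp; ring
      rw [e, abs_mul, abs_neg, abs_mul, abs_mul, abs_pow, abs_of_pos (by norm_num : (0 : ℝ) < 2),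
        abs_of_nonneg (by linarith : 0 ≤ 1 - τ ^ 2)]
      have h4 : z j ^ 4 = |z j| * |z j| ^ 3 := by
        have : |z j| ^ 4 = z j ^ 4 := by
          rw [← abs_pow]; exact abs_of_nonneg (by positivity)
        rw [← this]; ring
      rw [h4]
      have h5 : |τ| * (1 - τ ^ 2) ≤ |z j| := by nlinarith [abs_nonneg τ, sq_nonneg τ]
      have := mul_le_mul_of_nonneg_right h5 (by positivity : 0 ≤ |z j| ^ 3)
      linarith)
    (by
      have e : ∑ b, tilt z j b * centred z j b ^ 4 = (1 - τ ^ 2) * (1 + 3 * τ ^ 2) * z j ^ 4 := by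
        simp only [Fintype.sum_bool, tilt, centred, sg, ← hτ]; simp; ring
      rw [e]
      refine mul_le_mul_of_nonneg_right ?_ (by positivity)
      nlinarith [sq_nonneg τ])
    u
  refine h.trans ?_
  rw [mul_assoc]
  refine mul_le_mul_of_nonneg_left ?_ hf.pos.le
  have h1 : (tiltVar z j : ℝ) ^ 2 ≤ z j ^ 4 := by
    rw [coe_tiltVar, mul_pow, ← hτ]
    have h2 : (z j ^ 2) ^ 2 = z j ^ 4 := by ring
    have h3 : (1 - τ ^ 2) ^ 2 ≤ 1 := by nlinarith [sq_nonneg τ]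
    have h4 : (0 : ℝ) ≤ z j ^ 4 := by positivity
    rw [h2]
    nlinarith
  have := mul_le_mul_of_nonneg_right h1 gaussFour_nonneg
  linarith

/-- The assumptions under which windows of unit width have the Gaussian order of magnitude. The
coordinates outside `S` are too large for the Gaussian comparison, but negligible in total. -/
structure GoodTilt (K : ℝ) (z : Fin n → ℝ) (S : Finset (Fin n)) (R : ℝ) : Prop where
  one_le : 1 ≤ R
  sum_sq : ∑ j, z j ^ 2 = R ^ 2
  le : ∀ j, z j ^ 2 ≤ 1 / 16
  heavy : ∑ j ∈ Sᶜ, z j ^ 2 ≤ 1 / 16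
  light : K * (18 + gaussFour) * ∑ j ∈ S, z j ^ 4 ≤ Real.exp (-72) / (4 * R)

/-- The coordinates outside `S` are frozen, and those in `S` are resampled independently of them. -/
theorem prodExp_window_eq {f : ℝ → ℝ} (z : Fin n → ℝ) (S : Finset (Fin n)) (u : ℝ) :
    prodExp (tilt z) (fun y => f (u + ∑ j, centred z j (y j))) =
      prodExp (tilt z) fun y => prodExp (tilt z) fun y' =>
        f ((u + ∑ j ∈ Sᶜ, centred z j (y j)) + ∑ j ∈ S, centred z j (y' j)) := by
  rw [← (isWeight_tilt z).prodExp_piecewise S]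
  congr 1; funext y; congr 1; funext y'
  rw [← Finset.sum_compl_add_sum S (fun j => centred z j (S.piecewise y' y j)), ← add_assoc]
  have h1 : ∑ j ∈ Sᶜ, centred z j (S.piecewise y' y j) = ∑ j ∈ Sᶜ, centred z j (y j) :=
    Finset.sum_congr rfl fun j hj => by
      rw [Finset.piecewise_eq_of_notMem _ _ _ (Finset.mem_compl.mp hj)]
  have h2 : ∑ j ∈ S, centred z j (S.piecewise y' y j) = ∑ j ∈ S, centred z j (y' j) :=
    Finset.sum_congr rfl fun j hj => by rw [Finset.piecewise_eq_of_mem _ _ _ hj]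
  rw [h1, h2]

/-- The sum of the coordinates in `S` is close to a Gaussian variable, as seen by a window. -/
theorem GoodTilt.compare {f f₁ f₂ f₃ : ℝ → ℝ} {K R : ℝ} (hf : IsWindow f f₁ f₂ f₃ K)
    {z : Fin n → ℝ} {S : Finset (Fin n)} (h : GoodTilt K z S R) (u : ℝ) :
    |prodExp (tilt z) (fun y => f (u + ∑ j ∈ S, centred z j (y j))) -
      ∫ x, f (u + x) ∂gaussianReal 0 (∑ j ∈ S, tiltVar z j)| ≤ Real.exp (-72) / (4 * R) := by
  refine (lindeberg (isWeight_tilt z) hf.cont (fun u => ?_) S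
    (fun j _ u => abs_tilt_sub_gaussian_le hf z j u) u).trans ?_
  · rw [abs_of_nonneg (hf.nonneg u)]; exact hf.le_one u
  · rw [← Finset.mul_sum]; exact h.light

theorem GoodTilt.var_le {K R : ℝ} {z : Fin n → ℝ} {S : Finset (Fin n)} (h : GoodTilt K z S R) :
    ((∑ j ∈ S, tiltVar z j : ℝ≥0) : ℝ) ≤ R ^ 2 := by
  rw [NNReal.coe_sum, ← h.sum_sq]
  calc _ ≤ ∑ j ∈ S, z j ^ 2 := by
        refine Finset.sum_le_sum fun j _ => ?_
        rw [coe_tiltVar]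
        nlinarith [sq_nonneg (z j), sq_nonneg (Real.tanh (z j)),
          mul_nonneg (sq_nonneg (z j)) (sq_nonneg (Real.tanh (z j)))]
    _ ≤ _ := Finset.sum_le_univ_sum_of_nonneg fun _ => sq_nonneg _

theorem GoodTilt.le_var {K R : ℝ} {z : Fin n → ℝ} {S : Finset (Fin n)} (h : GoodTilt K z S R) :
    R ^ 2 / 4 ≤ ((∑ j ∈ S, tiltVar z j : ℝ≥0) : ℝ) := by
  rw [NNReal.coe_sum]
  have h1 : ∑ j ∈ S, z j ^ 2 * (1 / 2) ≤ ∑ j ∈ S, (tiltVar z j : ℝ) := by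
    refine Finset.sum_le_sum fun j _ => ?_
    rw [coe_tiltVar]
    refine mul_le_mul_of_nonneg_left ?_ (sq_nonneg _)
    have h2 : Real.tanh (z j) ^ 2 ≤ z j ^ 2 := sq_le_sq.mpr (abs_tanh_le (z j))
    linarith [h.le j]
  have h2 := Finset.sum_compl_add_sum S fun j => z j ^ 2
  rw [← Finset.sum_mul] at h1
  have h3 := h.heavy
  have h4 := h.sum_sq
  have h5 := h.one_le
  nlinarith

/-- Every window has probability `O(1 / R)`; this holds for any value of the frozen coordinates. -/
theorem GoodTilt.window_le {f f₁ f₂ f₃ : ℝ → ℝ} {K R : ℝ} (hf : IsWindow f f₁ f₂ f₃ K)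
    {z : Fin n → ℝ} {S : Finset (Fin n)} (h : GoodTilt K z S R) (u : ℝ) :
    prodExp (tilt z) (fun y => f (u + ∑ j, centred z j (y j))) ≤ 5 / R := by
  have hR : 0 < R := by linarith [h.one_le]
  rw [prodExp_window_eq z S]
  refine ((isWeight_tilt z).prodExp_mono (G := fun _ => 5 / R) fun y => ?_).trans_eq
    ((isWeight_tilt z).prodExp_const _)
  have h1 := (abs_le.mp (h.compare hf (u + ∑ j ∈ Sᶜ, centred z j (y j)))).2
  have h2 := gaussian_window_le hf hR h.le_var (u + ∑ j ∈ Sᶜ, centred z j (y j))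
  have h3 : Real.exp (-72) / (4 * R) ≤ 1 / R := by
    rw [div_le_div_iff₀ (by positivity) hR]
    have : Real.exp (-72) ≤ 1 := Real.exp_le_one_iff.mpr (by norm_num)
    nlinarith
  have h4 : 5 / R = 4 / R + 1 / R := by ring
  linarith

/-- The coordinates are uncorrelated, with variances at most `z j ^ 2`. -/
theorem prodExp_tilt_sq_le (z : Fin n → ℝ) (S : Finset (Fin n)) :
    prodExp (tilt z) (fun y => (∑ j ∈ S, centred z j (y j)) ^ 2) ≤ ∑ j ∈ S, z j ^ 2 := by
  induction S using Finset.induction_on with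
  | empty => simp [(isWeight_tilt z).prodExp_const]
  | insert j S hj ih =>
    rw [Finset.sum_insert hj, ← (isWeight_tilt z).prodExp_update j]
    have e : ∀ y : Fin n → Bool, ∑ b, tilt z j b *
        (∑ i ∈ insert j S, centred z i (Function.update y j b i)) ^ 2 =
        tiltVar z j + (∑ i ∈ S, centred z i (y i)) ^ 2 := by
      intro y
      have h1 : ∀ b, ∑ i ∈ insert j S, centred z i (Function.update y j b i) =
          centred z j b + ∑ i ∈ S, centred z i (y i) := by
        intro b
        rw [Finset.sum_insert hj, Function.update_self]
        congr 1
        exact Finset.sum_congr rfl fun i hi => by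
          rw [Function.update_of_ne (fun h : i = j => hj (h ▸ hi))]
      simp only [h1]
      set t := ∑ i ∈ S, centred z i (y i)
      simp only [Fintype.sum_bool, coe_tiltVar, tilt, centred, sg]
      simp
      ring
    simp only [e]
    rw [prodExp_add, (isWeight_tilt z).prodExp_const]
    have : (tiltVar z j : ℝ) ≤ z j ^ 2 := by
      rw [coe_tiltVar]
      nlinarith [mul_nonneg (sq_nonneg (z j)) (sq_nonneg (Real.tanh (z j)))]
    linarith

/-- Windows near the origin have probability of order `1 / R`. The frozen coordinates have second
moment at most `1 / 16`, so they displace the window by more than one only rarely. -/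
theorem GoodTilt.le_window {f f₁ f₂ f₃ : ℝ → ℝ} {K R : ℝ} (hf : IsWindow f f₁ f₂ f₃ K)
    {z : Fin n → ℝ} {S : Finset (Fin n)} (h : GoodTilt K z S R) {u : ℝ} (hu : |u| ≤ 4) :
    Real.exp (-72) / (8 * R) ≤ prodExp (tilt z) (fun y => f (u + ∑ j, centred z j (y j))) := by
  have hR : 0 < R := by linarith [h.one_le]
  have he := Real.exp_pos (-72)
  rw [prodExp_window_eq z S]
  set c := Real.exp (-72) / (4 * R) with hc
  have hc0 : 0 < c := by positivity
  -- the factor `1 - t ^ 2` minorizes the indicator of `|t| ≤ 1`, and has an explicit mean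
  have hlow : ∀ y : Fin n → Bool, c * (1 - (∑ j ∈ Sᶜ, centred z j (y j)) ^ 2) ≤
      prodExp (tilt z) fun y' =>
        f ((u + ∑ j ∈ Sᶜ, centred z j (y j)) + ∑ j ∈ S, centred z j (y' j)) := by
    intro y
    set t := ∑ j ∈ Sᶜ, centred z j (y j) with ht
    by_cases h1 : t ^ 2 ≤ 1
    · have habs : |u + t| ≤ 5 := (abs_add_le _ _).trans (by linarith [(sq_le_one_iff_abs_le_one t).mp h1])
      have h2 := le_gaussian_window hf h.one_le h.le_var h.var_le habs
      have h3 := (abs_le.mp (h.compare hf (u + t))).1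
      have h4 : Real.exp (-72) / (2 * R) = 2 * c := by rw [hc]; field_simp; ring
      nlinarith [sq_nonneg t]
    · have h2 : 0 ≤ prodExp (tilt z) fun y' => f ((u + t) + ∑ j ∈ S, centred z j (y' j)) :=
        (isWeight_tilt z).prodExp_nonneg fun _ => hf.nonneg _
      push Not at h1
      nlinarith
  refine le_trans ?_ ((isWeight_tilt z).prodExp_mono hlow)
  rw [prodExp_const_mul, prodExp_sub, (isWeight_tilt z).prodExp_const]
  have h5 := (prodExp_tilt_sq_le z Sᶜ).trans h.heavy
  have h6 : Real.exp (-72) / (8 * R) = c * (1 / 2) := by rw [hc]; field_simp; ring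
  rw [h6]
  exact mul_le_mul_of_nonneg_left (by linarith) hc0.le

/-- Flip one coordinate. -/
def flip (y : Fin n → Bool) (j : Fin n) : Fin n → Bool := Function.update y j (!y j)

theorem dotProduct_sv_flip (z : Fin n → ℝ) (y : Fin n → Bool) (j : Fin n) :
    z ⬝ᵥ sv (flip y j) = z ⬝ᵥ sv y - 2 * z j * sg (y j) := by
  have h : z ⬝ᵥ sv (flip y j) - z ⬝ᵥ sv y = ∑ i, if i = j then -(2 * z j * sg (y j)) else 0 := by
    rw [dotProduct, dotProduct, ← Finset.sum_sub_distrib]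
    refine Finset.sum_congr rfl fun i _ => ?_
    by_cases hi : i = j
    · subst hi; simp [sv, flip, sg_not]; ring
    · simp [sv, flip, hi]
  simp at h
  linarith

open Classical in
/-- The upper tail of a sum in terms of its tilted law: the window of unit width above the threshold
carries a constant fraction of it. -/
theorem GoodTilt.tail_le {f f₁ f₂ f₃ : ℝ → ℝ} {K R : ℝ} (hf : IsWindow f f₁ f₂ f₃ K)
    {z : Fin n → ℝ} {S : Finset (Fin n)} (h : GoodTilt K z S R) :
    signExp (fun y => if ∑ j, z j * Real.tanh (z j) < z ⬝ᵥ sv y then 1 else 0) ≤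
      (∏ j, Real.cosh (z j)) * Real.exp (-∑ j, z j * Real.tanh (z j)) * (10 / R) := by
  set Θ := ∑ j, z j * Real.tanh (z j) with hΘ
  rw [signExp_eq_tilt z, mul_assoc]
  refine mul_le_mul_of_nonneg_left ?_ (Finset.prod_nonneg fun j _ => (Real.cosh_pos _).le)
  set X : (Fin n → Bool) → ℝ := fun y => ∑ j, centred z j (y j) with hX
  have hXle : ∀ y, X y < (n + 1 : ℕ) := by
    intro y
    have : X y ≤ ∑ _j : Fin n, (1 : ℝ) := by
      refine Finset.sum_le_sum fun j _ => ?_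
      have h1 : |z j| ≤ 1 / 4 := by
        rw [← Real.sqrt_sq_eq_abs]
        rw [Real.sqrt_le_left (by norm_num)]
        linarith [h.le j]
      have h2 : |sg (y j) - Real.tanh (z j)| ≤ 2 :=
        (abs_sub _ _).trans (by rw [abs_sg]; linarith [abs_tanh_le_one (z j)])
      have h3 := mul_le_mul h1 h2 (abs_nonneg _) (by norm_num)
      rw [← abs_mul] at h3
      exact (le_abs_self _).trans (h3.trans (by norm_num))
    simp at this
    push_cast
    linarith
  -- the tail is covered by intervals of length one; on the `k`-th the density `exp (-X)` is at most `2⁻ᵏ`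
  have key : ∀ y, Real.exp (-(z ⬝ᵥ sv y)) * (if Θ < z ⬝ᵥ sv y then 1 else 0) ≤
      Real.exp (-Θ) * ∑ k ∈ Finset.range (n + 1), (1 / 2 : ℝ) ^ k * f (-((k : ℝ) + 1 / 2) + X y) := by
    intro y
    have hd : z ⬝ᵥ sv y = Θ + X y := dotProduct_eq_centred z y
    have hsum0 : ∀ k ∈ Finset.range (n + 1),
        0 ≤ (1 / 2 : ℝ) ^ k * f (-((k : ℝ) + 1 / 2) + X y) := fun k _ =>
      mul_nonneg (by positivity) (hf.nonneg _)
    split_ifs with hy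
    · rw [mul_one, hd, neg_add, Real.exp_add]
      refine mul_le_mul_of_nonneg_left ?_ (Real.exp_pos _).le
      have hpos : 0 ≤ X y := by linarith
      set k := ⌊X y⌋₊ with hk
      have hk1 : (k : ℝ) ≤ X y := Nat.floor_le hpos
      have hk2 : X y < k + 1 := Nat.lt_floor_add_one _
      have hkn : k ∈ Finset.range (n + 1) := by
        rw [Finset.mem_range]
        exact_mod_cast lt_of_le_of_lt hk1 (hXle y)
      refine le_trans ?_ (Finset.single_le_sum hsum0 hkn)
      rw [hf.eq_one _ (abs_le.mpr ⟨by linarith, by linarith⟩), mul_one]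
      calc Real.exp (-X y) ≤ Real.exp (-(k : ℝ)) := Real.exp_le_exp.mpr (by linarith)
        _ = Real.exp (-1) ^ k := by rw [← Real.exp_nat_mul]; ring_nf
        _ ≤ (1 / 2) ^ k := by
            refine pow_le_pow_left₀ (Real.exp_pos _).le ?_ k
            rw [Real.exp_neg, inv_eq_one_div]
            exact one_div_le_one_div_of_le (by norm_num) (by linarith [Real.exp_one_gt_d9])
    · rw [mul_zero]
      exact mul_nonneg (Real.exp_pos _).le (Finset.sum_nonneg hsum0)
  refine ((isWeight_tilt z).prodExp_mono key).trans ?_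
  rw [prodExp_const_mul, prodExp_sum]
  refine mul_le_mul_of_nonneg_left ?_ (Real.exp_pos _).le
  have hR : 0 < R := by linarith [h.one_le]
  calc _ ≤ ∑ k ∈ Finset.range (n + 1), (1 / 2 : ℝ) ^ k * (5 / R) := by
        refine Finset.sum_le_sum fun k _ => ?_
        rw [prodExp_const_mul]
        exact mul_le_mul_of_nonneg_left (h.window_le hf _) (by positivity)
    _ ≤ 2 * (5 / R) := by
        rw [← Finset.sum_mul]
        exact mul_le_mul_of_nonneg_right (sum_geometric_two_le _) (by positivity)
    _ = 10 / R := by ring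

open Classical in
/-- The lower tail bound, together with its stability under a flip: on the window around `3` of
half-width `2` the centred sum exceeds `1`, and a flip changes it by at most `1 / 2`. -/
theorem GoodTilt.le_tail_flip {f f₁ f₂ f₃ : ℝ → ℝ} {K R : ℝ} (hf : IsWindow f f₁ f₂ f₃ K)
    {z : Fin n → ℝ} {S : Finset (Fin n)} (h : GoodTilt K z S R) (j : Fin n) :
    (∏ j, Real.cosh (z j)) * Real.exp (-∑ j, z j * Real.tanh (z j)) * (Real.exp (-77) / (8 * R)) ≤
      signExp (fun y => if ∑ j, z j * Real.tanh (z j) < z ⬝ᵥ sv y ∧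
        ∑ j, z j * Real.tanh (z j) < z ⬝ᵥ sv (flip y j) then 1 else 0) := by
  set Θ := ∑ j, z j * Real.tanh (z j) with hΘ
  rw [signExp_eq_tilt z, mul_assoc]
  refine mul_le_mul_of_nonneg_left ?_ (Finset.prod_nonneg fun j _ => (Real.cosh_pos _).le)
  set X : (Fin n → Bool) → ℝ := fun y => ∑ j, centred z j (y j) with hX
  have key : ∀ y, Real.exp (-Θ) * Real.exp (-5) * f (-3 + X y) ≤
      Real.exp (-(z ⬝ᵥ sv y)) * (if Θ < z ⬝ᵥ sv y ∧ Θ < z ⬝ᵥ sv (flip y j) then 1 else 0) := by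
    intro y
    have hd : z ⬝ᵥ sv y = Θ + X y := dotProduct_eq_centred z y
    by_cases hy : |-3 + X y| < 2
    · rw [abs_lt] at hy
      have h1 : Θ < z ⬝ᵥ sv (flip y j) := by
        rw [dotProduct_sv_flip, hd]
        have h1 : |z j| ≤ 1 / 4 := by
          rw [← Real.sqrt_sq_eq_abs, Real.sqrt_le_left (by norm_num)]
          linarith [h.le j]
        have h2 : z j * sg (y j) ≤ |z j| := by
          refine (le_abs_self _).trans ?_
          rw [abs_mul, abs_sg, mul_one]
        linarith
      rw [if_pos ⟨by linarith, h1⟩, mul_one, ← Real.exp_add, hd]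
      calc _ ≤ Real.exp (-Θ + -5) * 1 :=
            mul_le_mul_of_nonneg_left (hf.le_one _) (Real.exp_pos _).le
        _ ≤ _ := by rw [mul_one]; exact Real.exp_le_exp.mpr (by linarith)
    · rw [hf.eq_zero _ (not_lt.mp hy), mul_zero]
      exact mul_nonneg (Real.exp_pos _).le (by split_ifs <;> norm_num)
  refine le_trans ?_ ((isWeight_tilt z).prodExp_mono key)
  rw [prodExp_const_mul, mul_assoc]
  refine mul_le_mul_of_nonneg_left ?_ (Real.exp_pos _).le
  have h1 := h.le_window hf (u := -3) (by norm_num)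
  have h2 : Real.exp (-77) / (8 * R) = Real.exp (-5) * (Real.exp (-72) / (8 * R)) := by
    rw [← mul_div_assoc, ← Real.exp_add]; norm_num
  rw [h2]
  exact mul_le_mul_of_nonneg_left h1 (Real.exp_pos _).le

end TiltedWindows

end

noncomputable section

/-! ### The tail of a Rademacher sum and its stability under flips -/

section RademacherCore

variable {n : ℕ}

/-- There is a tilt of order `T / N` whose mean is the threshold, by the intermediate value theorem. -/
theorem exists_tilt {v : Fin n → ℝ} {θ N T : ℝ} (hN : 0 < N) (hv : ∑ j, v j ^ 2 = N ^ 2)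
    (hT : 1 ≤ T) (hθ : θ = T * N) (hsmall : ∀ j, v j ^ 2 ≤ N ^ 2 / (4 * T ^ 2)) :
    ∃ s, T / N ≤ s ∧ s ≤ 2 * T / N ∧ ∑ j, v j * Real.tanh (s * v j) = θ := by
  have hT0 : 0 < T := by linarith
  set g : ℝ → ℝ := fun s => ∑ j, v j * Real.tanh (s * v j) with hg
  have hcont : Continuous g := by
    have ht : Continuous Real.tanh := by
      have : Real.tanh = fun x => Real.sinh x / Real.cosh x :=
        funext Real.tanh_eq_sinh_div_cosh
      rw [this]
      exact Real.continuous_sinh.div Real.continuous_cosh fun x => (Real.cosh_pos x).ne'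
    refine continuous_finsetSum _ fun j _ => continuous_const.mul (ht.comp ?_)
    fun_prop
  -- `x tanh x ≤ x²` shows that the tilt `T / N` is too small
  have h1 : ∀ s, 0 < s → g s ≤ s * N ^ 2 := by
    intro s hs
    rw [← hv, Finset.mul_sum]
    refine Finset.sum_le_sum fun j _ => ?_
    have := mul_tanh_le_sq (s * v j)
    have h2 : s * (v j * Real.tanh (s * v j)) ≤ s * (s * v j ^ 2) := by nlinarith
    exact le_of_mul_le_mul_left h2 hs
  -- `x tanh x ≥ x² / 2` for `|x| ≤ 1` shows that the tilt `2 T / N` is large enough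
  have h2 : θ ≤ g (2 * T / N) := by
    set s := 2 * T / N with hs
    have hs0 : 0 < s := by positivity
    have h3 : ∀ j, s * v j ^ 2 / 2 ≤ v j * Real.tanh (s * v j) := by
      intro j
      have hz : (s * v j) ^ 2 ≤ 1 := by
        rw [mul_pow, hs, div_pow]
        have := mul_le_mul_of_nonneg_left (hsmall j) (by positivity : 0 ≤ (2 * T) ^ 2 / N ^ 2)
        refine this.trans_eq ?_
        field_simp
        ring
      have h4 := half_sq_le_mul_tanh hz
      have h5 : s * (s * v j ^ 2 / 2) ≤ s * (v j * Real.tanh (s * v j)) := by nlinarith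
      exact le_of_mul_le_mul_left h5 hs0
    have h6 : ∑ j, s * v j ^ 2 / 2 = θ := by
      rw [← Finset.sum_div, ← Finset.mul_sum, hv, hθ, hs]
      field_simp
    rw [← h6]
    exact Finset.sum_le_sum fun j _ => h3 j
  have h4 : g (T / N) ≤ θ := by
    refine (h1 _ (by positivity)).trans_eq ?_
    rw [hθ]; field_simp
  have hle : T / N ≤ 2 * T / N := by
    rw [div_le_div_iff_of_pos_right hN]; linarith
  obtain ⟨s, hs, hgs⟩ := intermediate_value_Icc hle hcont.continuousOn ⟨h4, h2⟩
  exact ⟨s, hs.1, hs.2, hgs⟩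

open Classical in
set_option maxHeartbeats 1000000 in
/-- Gaussian lower bound for the tail of a Rademacher sum at the height of `T` standard deviations,
and stability of the tail event under the flip of one sign. The coordinates outside `S` may be
large, but have a negligible total variance. -/
theorem rademacher_tail : ∃ c τ₀ : ℝ, 0 < c ∧ 0 < τ₀ ∧ ∀ (n : ℕ) (v : Fin n → ℝ) (θ N T τ : ℝ)
    (S : Finset (Fin n)), 0 < N → ∑ j, v j ^ 2 = N ^ 2 → 1 ≤ T → θ = T * N →
    (∀ j ∈ S, |v j| ≤ τ * N) → T ^ 5 * τ ^ 2 ≤ τ₀ →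
    ∑ j ∈ Sᶜ, v j ^ 2 ≤ τ₀ * (N ^ 2 / T ^ 2) →
    c / T * Real.exp (-(T ^ 2 / 2)) ≤ signExp (fun y => if θ < v ⬝ᵥ sv y then 1 else 0) ∧
    ∀ j, c * signExp (fun y => if θ < v ⬝ᵥ sv y then 1 else 0) ≤
      signExp (fun y => if θ < v ⬝ᵥ sv y ∧ θ < v ⬝ᵥ sv (flip y j) then 1 else 0) := by
  obtain ⟨f, f₁, f₂, f₃, K, hf⟩ := exists_isWindow
  set C := K * (18 + gaussFour) with hC
  have hC0 : 0 < C := mul_pos hf.pos (by linarith [gaussFour_nonneg])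
  have he := Real.exp_pos (-72)
  refine ⟨Real.exp (-77) * Real.exp (-1) / 80, min (1 / 64) (Real.exp (-72) / (128 * C)),
    by positivity, by positivity, ?_⟩
  intro n v θ N T τ S hN hv hT hθ hlight hτ hheavy
  set τ₀ := min (1 / 64) (Real.exp (-72) / (128 * C)) with hτ₀
  have hτ₀1 : τ₀ ≤ 1 / 64 := min_le_left _ _
  have hτ₀2 : 128 * C * τ₀ ≤ Real.exp (-72) := by
    have := (le_div_iff₀ (by positivity)).mp (min_le_right (1 / 64) (Real.exp (-72) / (128 * C)))
    linarith
  have hτ₀0 : 0 < τ₀ := by positivity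
  have hT0 : 0 < T := by linarith
  have hNT : 0 < N ^ 2 / T ^ 2 := by positivity
  have hsq : ∀ j, v j ^ 2 ≤ τ₀ * (N ^ 2 / T ^ 2) := by
    intro j
    by_cases hj : j ∈ S
    · have h1 : v j ^ 2 ≤ τ ^ 2 * N ^ 2 := by
        rw [← sq_abs, ← mul_pow]
        exact pow_le_pow_left₀ (abs_nonneg _) (hlight j hj) 2
      refine h1.trans ?_
      rw [← mul_div_assoc, le_div_iff₀ (by positivity)]
      have h2 : T ^ 2 * τ ^ 2 ≤ T ^ 5 * τ ^ 2 :=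
        mul_le_mul_of_nonneg_right (pow_le_pow_right₀ hT (by norm_num)) (sq_nonneg _)
      nlinarith [sq_nonneg N]
    · exact (Finset.single_le_sum (f := fun j => v j ^ 2) (fun i _ => sq_nonneg _)
        (Finset.mem_compl.mpr hj)).trans hheavy
  obtain ⟨s, hs1, hs2, hs3⟩ := exists_tilt hN hv hT hθ (fun j => (hsq j).trans (by
    rw [show N ^ 2 / (4 * T ^ 2) = 1 / 4 * (N ^ 2 / T ^ 2) from by field_simp]
    exact mul_le_mul_of_nonneg_right (by linarith) hNT.le))
  have hs0 : 0 < s := lt_of_lt_of_le (by positivity) hs1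
  have hsT : T ≤ s * N := by rwa [div_le_iff₀ hN] at hs1
  have hsT2 : s * N ≤ 2 * T := by rwa [le_div_iff₀ hN] at hs2
  have hsN : s ^ 2 * (N ^ 2 / T ^ 2) ≤ 4 := by
    rw [← mul_div_assoc, div_le_iff₀ (by positivity), ← mul_pow]
    nlinarith [mul_pos hs0 hN]
  set z : Fin n → ℝ := fun j => s * v j with hz
  have hsum : ∑ j, z j * Real.tanh (z j) = s * θ := by
    rw [← hs3, Finset.mul_sum]
    exact Finset.sum_congr rfl fun j _ => by simp only [hz]; ring
  have hzsq : ∑ j, z j ^ 2 = (s * N) ^ 2 := by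
    simp only [hz, mul_pow, ← Finset.mul_sum, hv]
  have hheavy' : ∑ j ∈ Sᶜ, z j ^ 2 ≤ 1 / 16 := by
    simp only [hz, mul_pow, ← Finset.mul_sum]
    nlinarith [mul_le_mul_of_nonneg_left hheavy (sq_nonneg s)]
  have hzle : ∀ j, z j ^ 2 ≤ 1 / 16 := by
    intro j
    simp only [hz, mul_pow]
    nlinarith [mul_le_mul_of_nonneg_left (hsq j) (sq_nonneg s)]
  -- the fourth-order sum governs both the Gaussian comparison and the error in `log cosh`
  have hfour : ∑ j ∈ S, z j ^ 4 ≤ 16 * τ₀ / T := by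
    have h1 : ∀ j ∈ S, z j ^ 4 ≤ ((s * N) ^ 2 * τ ^ 2) * z j ^ 2 := by
      intro j hj
      have h2 : v j ^ 2 ≤ τ ^ 2 * N ^ 2 := by
        rw [← sq_abs, ← mul_pow]
        exact pow_le_pow_left₀ (abs_nonneg _) (hlight j hj) 2
      have h3 : z j ^ 2 ≤ (s * N) ^ 2 * τ ^ 2 := by
        simp only [hz]
        nlinarith [mul_le_mul_of_nonneg_left h2 (sq_nonneg s)]
      have := mul_le_mul_of_nonneg_right h3 (sq_nonneg (z j))
      calc z j ^ 4 = z j ^ 2 * z j ^ 2 := by ring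
        _ ≤ _ := this
    calc ∑ j ∈ S, z j ^ 4 ≤ ∑ j ∈ S, ((s * N) ^ 2 * τ ^ 2) * z j ^ 2 := Finset.sum_le_sum h1
      _ = ((s * N) ^ 2 * τ ^ 2) * ∑ j ∈ S, z j ^ 2 := by rw [Finset.mul_sum]
      _ ≤ ((s * N) ^ 2 * τ ^ 2) * (s * N) ^ 2 := by
          refine mul_le_mul_of_nonneg_left ?_ (by positivity)
          rw [← hzsq]
          exact Finset.sum_le_univ_sum_of_nonneg fun _ => sq_nonneg _
      _ = (s * N) ^ 4 * τ ^ 2 := by ring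
      _ ≤ (2 * T) ^ 4 * τ ^ 2 :=
          mul_le_mul_of_nonneg_right (pow_le_pow_left₀ (by positivity) hsT2 4) (sq_nonneg _)
      _ ≤ 16 * τ₀ / T := by
          rw [le_div_iff₀ hT0]
          nlinarith
  have hgood : GoodTilt K z S (s * N) := by
    refine ⟨by linarith, hzsq, hzle, hheavy', ?_⟩
    rw [le_div_iff₀ (by positivity), ← hC]
    have h1 : C * ∑ j ∈ S, z j ^ 4 ≤ C * (16 * τ₀ / T) := mul_le_mul_of_nonneg_left hfour hC0.le
    have h2 : C * (∑ j ∈ S, z j ^ 4) * (4 * (s * N)) ≤ C * (16 * τ₀ / T) * (4 * (2 * T)) :=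
      mul_le_mul h1 (by linarith) (by positivity) (by positivity)
    refine h2.trans ?_
    have h3 : C * (16 * τ₀ / T) * (4 * (2 * T)) = 128 * C * τ₀ := by field_simp; ring
    rw [h3]; exact hτ₀2
  -- the mean under the tilt by `z = s v` is the rescaled threshold, so the tail events coincide
  have hevent : ∀ y : Fin n → Bool,
      (∑ j, z j * Real.tanh (z j) < z ⬝ᵥ sv y) = (θ < v ⬝ᵥ sv y) := by
    intro y
    have h1 : z ⬝ᵥ sv y = s * (v ⬝ᵥ sv y) := by
      simp only [hz, dotProduct, Finset.mul_sum, mul_assoc]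
    rw [hsum, h1, mul_lt_mul_iff_right₀ hs0]
  have htail := hgood.tail_le hf
  have hflip := hgood.le_tail_flip hf
  simp only [hevent] at htail hflip
  rw [hsum] at htail hflip
  set M := (∏ j, Real.cosh (z j)) * Real.exp (-(s * θ)) with hM
  have hM0 : 0 < M := mul_pos (Finset.prod_pos fun j _ => Real.cosh_pos _) (Real.exp_pos _)
  have hR0 : 0 < s * N := mul_pos hs0 hN
  have he1 : Real.exp (-1) ≤ 1 := Real.exp_le_one_iff.mpr (by norm_num)
  refine ⟨?_, fun j => ?_⟩
  · have hMle : Real.exp (-(T ^ 2 / 2)) * Real.exp (-1) ≤ M := by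
      have h1 : Real.exp (∑ j, (z j ^ 2 / 2 - z j ^ 4 / 8)) ≤ ∏ j, Real.cosh (z j) := by
        rw [Real.exp_sum]
        exact Finset.prod_le_prod (fun j _ => (Real.exp_pos _).le) fun j _ => exp_le_cosh _
      have h2 : ∑ j, z j ^ 4 / 8 ≤ 1 := by
        rw [← Finset.sum_div, ← Finset.sum_compl_add_sum S]
        have h3 : ∑ j ∈ Sᶜ, z j ^ 4 ≤ ∑ j ∈ Sᶜ, z j ^ 2 := by
          refine Finset.sum_le_sum fun j _ => ?_
          nlinarith [hzle j, sq_nonneg (z j)]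
        have h4 : 16 * τ₀ / T ≤ 1 := by
          rw [div_le_one hT0]; linarith
        linarith
      -- `R ^ 2 / 2 - R T ≥ -T ^ 2 / 2` for `R = s N`: the value of `s` itself is irrelevant
      have h5 : -(T ^ 2 / 2) + -1 ≤ ∑ j, (z j ^ 2 / 2 - z j ^ 4 / 8) + -(s * θ) := by
        rw [Finset.sum_sub_distrib, ← Finset.sum_div, hzsq, hθ]
        nlinarith [sq_nonneg (s * N - T)]
      calc _ = Real.exp (-(T ^ 2 / 2) + -1) := by rw [Real.exp_add]
        _ ≤ Real.exp (∑ j, (z j ^ 2 / 2 - z j ^ 4 / 8) + -(s * θ)) := Real.exp_le_exp.mpr h5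
        _ = Real.exp (∑ j, (z j ^ 2 / 2 - z j ^ 4 / 8)) * Real.exp (-(s * θ)) := Real.exp_add _ _
        _ ≤ M := mul_le_mul_of_nonneg_right h1 (Real.exp_pos _).le
    have hn : 0 < n := by
      rcases Nat.eq_zero_or_pos n with rfl | h
      · simp at hv; exact absurd hv.symm (by positivity)
      · exact h
    have h6 := hflip ⟨0, hn⟩
    have h7 : M * (Real.exp (-77) / (8 * (s * N))) ≤
        signExp (fun y => if θ < v ⬝ᵥ sv y then 1 else 0) := by
      refine h6.trans (isWeight_sign.prodExp_mono fun y => ?_)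
      by_cases hy : θ < v ⬝ᵥ sv y
      · rw [if_pos hy]; split_ifs <;> norm_num
      · rw [if_neg hy, if_neg fun h => hy h.1]
    refine le_trans ?_ h7
    have h8 : Real.exp (-77) / (16 * T) ≤ Real.exp (-77) / (8 * (s * N)) :=
      div_le_div_of_nonneg_left (Real.exp_pos _).le (by positivity) (by linarith)
    have h9 := mul_le_mul hMle h8 (by positivity) hM0.le
    refine le_trans ?_ h9
    have e1 : Real.exp (-(T ^ 2 / 2)) * Real.exp (-1) * (Real.exp (-77) / (16 * T)) =
        5 * (Real.exp (-77) * Real.exp (-1) / 80 / T * Real.exp (-(T ^ 2 / 2))) := by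
      field_simp
      ring
    rw [e1]
    have : 0 ≤ Real.exp (-77) * Real.exp (-1) / 80 / T * Real.exp (-(T ^ 2 / 2)) := by positivity
    linarith
  · refine le_trans ?_ (hflip j)
    have h1 := mul_le_mul_of_nonneg_left htail
      (by positivity : 0 ≤ Real.exp (-77) * Real.exp (-1) / 80)
    refine h1.trans ?_
    have e1 : Real.exp (-77) * Real.exp (-1) / 80 * (M * (10 / (s * N))) =
        M * (Real.exp (-77) / (8 * (s * N))) * Real.exp (-1) := by
      field_simp; ring
    rw [e1]
    exact mul_le_of_le_one_right (by positivity) he1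

end RademacherCore

end

noncomputable section

/-! ### Frobenius and operator norms -/

section Norms

variable {n : ℕ}

/-- The operator norm of `M` is at most `c`, stated for the action on row vectors. -/
def OpLE (M : Matrix (Fin n) (Fin n) ℝ) (c : ℝ) : Prop := OpSqLE M (c ^ 2)

theorem OpLE.add {A B : Matrix (Fin n) (Fin n) ℝ} {a b : ℝ} (ha : 0 ≤ a) (hb : 0 ≤ b)
    (hA : OpLE A a) (hB : OpLE B b) : OpLE (A + B) (a + b) := by
  intro z
  have h1 := hA z
  have h2 := hB z
  have h3 := dotProduct_sq_le (z ᵥ* A) (z ᵥ* B)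
  have h0 := dotProduct_self_nonneg' z
  have h4 : (z ᵥ* A) ⬝ᵥ (z ᵥ* B) ≤ a * b * (z ⬝ᵥ z) := by
    refine abs_le_of_sq_le_sq' (h3.trans ?_) (by positivity) |>.2
    calc _ ≤ (a ^ 2 * (z ⬝ᵥ z)) * (b ^ 2 * (z ⬝ᵥ z)) :=
          mul_le_mul h1 h2 (dotProduct_self_nonneg' _) (by positivity)
      _ = _ := by ring
  rw [vecMul_add, add_dotProduct, dotProduct_add, dotProduct_add,
    dotProduct_comm (z ᵥ* B) (z ᵥ* A)]
  nlinarith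

theorem OpLE.smul {A : Matrix (Fin n) (Fin n) ℝ} {a : ℝ} (hA : OpLE A a) (c : ℝ) :
    OpLE (c • A) (|c| * a) := by
  intro z
  rw [vecMul_smul, smul_dotProduct, dotProduct_smul, smul_eq_mul, smul_eq_mul, mul_pow, sq_abs]
  have := mul_le_mul_of_nonneg_left (hA z) (sq_nonneg c)
  nlinarith

theorem OpLE.mono {A : Matrix (Fin n) (Fin n) ℝ} {a b : ℝ} (hA : OpLE A a) (ha : 0 ≤ a)
    (hab : a ≤ b) : OpLE A b := fun z =>
  (hA z).trans (mul_le_mul_of_nonneg_right (pow_le_pow_left₀ ha hab 2) (dotProduct_self_nonneg' z))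

theorem OpLE.mul_transpose {A : Matrix (Fin n) (Fin n) ℝ} {a : ℝ} (hA : OpLE A a) :
    OpLE (A * Aᵀ) (a ^ 2) := OpSqLE.mul_transpose (sq_nonneg a) hA

theorem opLE_zero : OpLE (0 : Matrix (Fin n) (Fin n) ℝ) 0 := by
  intro z; simp

theorem OpLE.sum {ι : Type*} (s : Finset ι) {A : ι → Matrix (Fin n) (Fin n) ℝ} {a : ι → ℝ}
    (ha : ∀ i, 0 ≤ a i) (h : ∀ i, OpLE (A i) (a i)) : OpLE (∑ i ∈ s, A i) (∑ i ∈ s, a i) := by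
  classical
  induction s using Finset.induction_on with
  | empty => simpa using opLE_zero
  | insert i s hi ih =>
    rw [Finset.sum_insert hi, Finset.sum_insert hi]
    exact (h i).add (ha i) (Finset.sum_nonneg fun _ _ => ha _) ih

theorem opLE_frob (A : Matrix (Fin n) (Fin n) ℝ) : OpLE A (frob A) := by
  intro z
  rw [frob_sq, dotProduct]
  have h1 : ∀ j, (z ᵥ* A) j * (z ᵥ* A) j ≤ (z ⬝ᵥ z) * ∑ i, A i j ^ 2 := by
    intro j
    have := dotProduct_sq_le z (fun i => A i j)
    rw [← sq]
    simpa [vecMul, dotProduct, sq] using this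
  refine (Finset.sum_le_sum fun j _ => h1 j).trans_eq ?_
  rw [← Finset.mul_sum, Finset.sum_comm, mul_comm]

theorem frobInner_self (A : Matrix (Fin n) (Fin n) ℝ) : frobInner A A = frob A ^ 2 := by
  rw [frob_sq]; simp [frobInner, sq]

theorem frobInner_add_left (A B C : Matrix (Fin n) (Fin n) ℝ) :
    frobInner (A + B) C = frobInner A C + frobInner B C := by
  simp [frobInner, add_mul, Finset.sum_add_distrib]

theorem frobInner_comm (A B : Matrix (Fin n) (Fin n) ℝ) : frobInner A B = frobInner B A := by
  simp [frobInner, mul_comm]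

theorem frobInner_smul_left (c : ℝ) (A B : Matrix (Fin n) (Fin n) ℝ) :
    frobInner (c • A) B = c * frobInner A B := by
  simp [frobInner, Finset.mul_sum, mul_assoc]

theorem frobInner_sum_left {ι : Type*} (s : Finset ι) (A : ι → Matrix (Fin n) (Fin n) ℝ)
    (B : Matrix (Fin n) (Fin n) ℝ) : frobInner (∑ i ∈ s, A i) B = ∑ i ∈ s, frobInner (A i) B := by
  classical
  induction s using Finset.induction_on with
  | empty => simp [frobInner]
  | insert i s hi ih => rw [Finset.sum_insert hi, Finset.sum_insert hi, frobInner_add_left, ih]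

theorem abs_frobInner_le (A B : Matrix (Fin n) (Fin n) ℝ) :
    |frobInner A B| ≤ frob A * frob B := by
  refine abs_le_of_sq_le_sq ?_ (mul_nonneg (frob_nonneg _) (frob_nonneg _))
  rw [mul_pow, frob_sq, frob_sq]
  have h := Finset.sum_mul_sq_le_sq_mul_sq Finset.univ (fun p : Fin n × Fin n => A p.1 p.2)
    (fun p => B p.1 p.2)
  simpa [frobInner, Fintype.sum_prod_type] using h

theorem frob_add_sq (A B : Matrix (Fin n) (Fin n) ℝ) :
    frob (A + B) ^ 2 = frob A ^ 2 + 2 * frobInner A B + frob B ^ 2 := by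
  rw [← frobInner_self, frobInner_add_left, frobInner_comm A, frobInner_comm B, frobInner_add_left,
    frobInner_add_left, frobInner_self, frobInner_self, frobInner_comm B A]
  ring

theorem frob_add_le (A B : Matrix (Fin n) (Fin n) ℝ) : frob (A + B) ≤ frob A + frob B := by
  refine abs_le_of_sq_le_sq' ?_ (add_nonneg (frob_nonneg _) (frob_nonneg _)) |>.2
  rw [frob_add_sq]
  have := (abs_le.mp (abs_frobInner_le A B)).2
  nlinarith

theorem frob_smul (c : ℝ) (A : Matrix (Fin n) (Fin n) ℝ) : frob (c • A) = |c| * frob A := by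
  have h := frob_smul_sq c A
  rw [← sq_abs c, ← mul_pow] at h
  exact (pow_left_inj₀ (frob_nonneg _) (mul_nonneg (abs_nonneg _) (frob_nonneg _)) two_ne_zero).mp h

theorem frob_neg (A : Matrix (Fin n) (Fin n) ℝ) : frob (-A) = frob A := by
  simp [frob]

theorem frob_transpose (A : Matrix (Fin n) (Fin n) ℝ) : frob Aᵀ = frob A := by
  unfold frob
  rw [Finset.sum_comm]
  rfl

theorem frob_add_sq_le (A B : Matrix (Fin n) (Fin n) ℝ) :
    frob (A + B) ^ 2 ≤ 2 * frob A ^ 2 + 2 * frob B ^ 2 := by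
  rw [frob_sq, frob_sq, frob_sq, Finset.mul_sum, Finset.mul_sum, ← Finset.sum_add_distrib]
  refine Finset.sum_le_sum fun i _ => ?_
  rw [Finset.mul_sum, Finset.mul_sum, ← Finset.sum_add_distrib]
  refine Finset.sum_le_sum fun j _ => ?_
  rw [Matrix.add_apply]
  nlinarith [sq_nonneg (A i j - B i j)]

/-- Only the Frobenius norm of the perturbation `D` enters. -/
theorem frob_add_mul_transpose_sq_le {B₀ D : Matrix (Fin n) (Fin n) ℝ} {a : ℝ} (h : OpLE B₀ a) :
    frob ((B₀ + D) * (B₀ + D)ᵀ) ^ 2 ≤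
      4 * (a ^ 2 * frob B₀ ^ 2 + 2 * a ^ 2 * frob D ^ 2 + frob D ^ 4) := by
  have e : (B₀ + D) * (B₀ + D)ᵀ = (B₀ * B₀ᵀ + D * B₀ᵀ) + ((D * B₀ᵀ)ᵀ + D * Dᵀ) := by
    rw [transpose_mul, transpose_transpose, transpose_add, Matrix.add_mul, Matrix.mul_add,
      Matrix.mul_add]
    abel
  have h1 := frob_mul_transpose_sq_le (A := B₀) (sq_nonneg a) h
  have h2 := frob_mul_transpose_sq_le (A := D) (sq_nonneg a) h
  have h3 := frob_mul_transpose_sq_le (A := D) (sq_nonneg _) (opLE_frob D)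
  have h4 := frob_add_sq_le (B₀ * B₀ᵀ + D * B₀ᵀ) ((D * B₀ᵀ)ᵀ + D * Dᵀ)
  have h5 := frob_add_sq_le (B₀ * B₀ᵀ) (D * B₀ᵀ)
  have h6 := frob_add_sq_le (D * B₀ᵀ)ᵀ (D * Dᵀ)
  rw [frob_transpose] at h6
  rw [e]
  nlinarith

/-- Exponential moments of `½ ‖(B₀ + D)ᵀ x‖² + xᵀ M x`, where `D` is small in Frobenius norm, but
its operator norm is not controlled otherwise. -/
theorem signExp_exp_quad_add_le {B₀ D M : Matrix (Fin n) (Fin n) ℝ} {a c : ℝ} (ha : 0 ≤ a)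
    (hc : 0 ≤ c) (hB : OpLE B₀ a) (hM : OpLE M c) (hs : (a + frob D) ^ 2 / 2 + c ≤ 1 / 12) :
    (signExp fun x => Real.exp (((sv x ᵥ* (B₀ + D)) ⬝ᵥ (sv x ᵥ* (B₀ + D))) / 2 +
      sv x ⬝ᵥ M *ᵥ sv x)) ≤
      Real.exp (frob (B₀ + D) ^ 2 / 2 + M.trace +
        32 * (a ^ 2 * frob B₀ ^ 2 + 2 * a ^ 2 * frob D ^ 2 + frob D ^ 4) + 32 * frob M ^ 2) := by
  set B := B₀ + D with hBdef
  have hop : OpLE ((1 / 2 : ℝ) • (B * Bᵀ) + M) ((a + frob D) ^ 2 / 2 + c) := by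
    refine OpLE.add (by positivity) hc ?_ hM
    have h1 := ((hB.add ha (frob_nonneg D) (opLE_frob D)).mul_transpose).smul (1 / 2)
    rw [abs_of_pos (by norm_num : (0 : ℝ) < 1 / 2)] at h1
    convert h1 using 1
    ring
  have h2 := hansonWright (M := (1 / 2 : ℝ) • (B * Bᵀ) + M) (sq_nonneg ((a + frob D) ^ 2 / 2 + c))
    (by
      have : 0 ≤ (a + frob D) ^ 2 / 2 + c := by positivity
      nlinarith) hop
  have e : ∀ x : Fin n → Bool, sv x ⬝ᵥ ((1 / 2 : ℝ) • (B * Bᵀ) + M) *ᵥ sv x =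
      ((sv x ᵥ* B) ⬝ᵥ (sv x ᵥ* B)) / 2 + sv x ⬝ᵥ M *ᵥ sv x := by
    intro x
    rw [add_mulVec, dotProduct_add, smul_mulVec, dotProduct_smul, quad_mul_transpose, smul_eq_mul]
    ring
  simp only [e] at h2
  refine h2.trans (Real.exp_le_exp.mpr ?_)
  rw [trace_add, trace_smul, trace_mul_transpose_self, smul_eq_mul]
  have h3 := frob_add_sq_le ((1 / 2 : ℝ) • (B * Bᵀ)) M
  rw [frob_smul_sq] at h3
  have h4 := frob_add_mul_transpose_sq_le (D := D) hB
  rw [← hBdef] at h4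
  linarith

/-- The bound on the operator norm in the form in which it is used, for row vectors. -/
theorem opLE_of_opNorm_le {M : Matrix (Fin n) (Fin n) ℝ} {c : ℝ} (h : opNorm M ≤ c) : OpLE M c := by
  have hc : 0 ≤ c := (norm_nonneg _).trans h
  have h1 : OpSqLE Mᵀ (c ^ 2) := by
    intro z
    rw [vecMul_transpose]
    have h2 := (Matrix.toEuclideanCLM (n := Fin n) (𝕜 := ℝ) M).le_opNorm (WithLp.toLp 2 z)
    have h3 : ‖Matrix.toEuclideanCLM (n := Fin n) (𝕜 := ℝ) M (WithLp.toLp 2 z)‖ ^ 2 =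
        (M *ᵥ z) ⬝ᵥ (M *ᵥ z) := by
      rw [EuclideanSpace.real_norm_sq_eq]
      simp [dotProduct, sq]
    have h4 : ‖(WithLp.toLp 2 z : EuclideanSpace ℝ (Fin n))‖ ^ 2 = z ⬝ᵥ z := by
      rw [EuclideanSpace.real_norm_sq_eq]
      simp [dotProduct, sq]
    rw [← h3, ← h4, ← mul_pow]
    exact pow_le_pow_left₀ (norm_nonneg _)
      (h2.trans (mul_le_mul_of_nonneg_right h (norm_nonneg _))) 2
  have h2 := h1.transpose (sq_nonneg c)
  rwa [transpose_transpose] at h2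

end Norms

/-! ### Independent rows -/

section Rows

variable {k d : ℕ}

/-- The expectation over a uniformly random point of the cube. -/
abbrev cubeExp (F : Cube k d → ℝ) : ℝ := prodExp (unif (Fin k) (Fin d → Bool)) F

theorem isWeight_cube : IsWeight (unif (Fin k) (Fin d → Bool)) := isWeight_unif

theorem sum_unif_eq_signExp (a : Fin k) (g : (Fin d → Bool) → ℝ) :
    ∑ y, unif (Fin k) (Fin d → Bool) a y * g y = signExp g := by
  rw [signExp, prodExp_unif]
  simp only [unif, ← Finset.mul_sum]
  ring

/-- Integrate out one row. -/
theorem cubeExp_row (a : Fin k) (F : Cube k d → ℝ) :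
    cubeExp (fun X => signExp fun y => F (Function.update X a y)) = cubeExp F := by
  conv_rhs => rw [cubeExp, ← isWeight_cube.prodExp_update a]
  congr 1; funext X
  rw [sum_unif_eq_signExp]

theorem cubeExp_eval (a : Fin k) (g : (Fin d → Bool) → ℝ) :
    cubeExp (fun X => g (X a)) = signExp g := by
  rw [cubeExp, isWeight_cube.prodExp_eval, sum_unif_eq_signExp]

theorem cubeExp_two {a b : Fin k} (hab : a ≠ b) (F : (Fin d → Bool) → (Fin d → Bool) → ℝ) :
    cubeExp (fun X => F (X a) (X b)) = signExp fun x => signExp fun y => F x y := by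
  rw [← cubeExp_row b, ← cubeExp_eval a]
  simp [Function.update_of_ne hab]

end Rows

end

noncomputable section

/-! ### Exponential Chernoff bounds for the acceptance event -/

section Chernoff

variable {k d : ℕ}

/-- The bilinear form `xᵀ M y` in two rows of a point of the cube. -/
def form (M : Matrix (Fin d) (Fin d) ℝ) (X : Cube k d) (a b : Fin k) : ℝ :=
  (sv (X a) ᵥ* M) ⬝ᵥ sv (X b)

theorem form_eq (M : Matrix (Fin d) (Fin d) ℝ) (X : Cube k d) (a b : Fin k) :
    (signMatrix X * M * (signMatrix X)ᵀ) a b = form M X a b := by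
  rw [Matrix.mul_apply, form, dotProduct]
  exact Finset.sum_congr rfl fun j _ => rfl

/-- The squared length of `Mᵀ x`. -/
def sqLen (M : Matrix (Fin d) (Fin d) ℝ) (x : Fin d → Bool) : ℝ := (sv x ᵥ* M) ⬝ᵥ (sv x ᵥ* M)

open Classical in
/-- Acceptance together with an event about the first row only. -/
theorem cubeExp_accept_quad_le [NeZero k] (h01 : (0 : Fin k) ≠ 1) (V M : Matrix (Fin d) (Fin d) ℝ)
    {θ s ζ : ℝ} (hs : 0 ≤ s) (p : (Fin d → Bool) → Prop)
    (hp : ∀ x, p x → ζ ≤ sv x ⬝ᵥ M *ᵥ sv x) :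
    cubeExp (k := k) (fun X => if θ < form V X 0 1 ∧ p (X 0) then 1 else 0) ≤
      Real.exp (-(s * θ) - ζ) *
        signExp fun x => Real.exp (sqLen (s • V) x / 2 + sv x ⬝ᵥ M *ᵥ sv x) := by
  have h1 : cubeExp (k := k) (fun X => if θ < form V X 0 1 ∧ p (X 0) then 1 else 0) ≤
      cubeExp (k := k) fun X => Real.exp (-(s * θ) - ζ) * (Real.exp ((sv (X 0) ᵥ* (s • V)) ⬝ᵥ
        sv (X 1)) * Real.exp (sv (X 0) ⬝ᵥ M *ᵥ sv (X 0))) := by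
    refine isWeight_cube.prodExp_mono fun X => ?_
    split_ifs with h
    · rw [← Real.exp_add, ← Real.exp_add, vecMul_smul, smul_dotProduct, smul_eq_mul]
      refine Real.one_le_exp ?_
      have h2 := mul_le_mul_of_nonneg_left h.1.le hs
      have h3 := hp _ h.2
      rw [form] at h2
      linarith
    · positivity
  refine h1.trans ?_
  rw [cubeExp, prodExp_const_mul]
  refine mul_le_mul_of_nonneg_left ?_ (Real.exp_pos _).le
  rw [← cubeExp, cubeExp_two h01 (fun x y => Real.exp ((sv x ᵥ* (s • V)) ⬝ᵥ sv y) *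
    Real.exp (sv x ⬝ᵥ M *ᵥ sv x))]
  refine isWeight_sign.prodExp_mono fun x => ?_
  rw [signExp, prodExp_mul_const, Real.exp_add]
  exact mul_le_mul_of_nonneg_right (signExp_exp_le _) (Real.exp_pos _).le

open Classical in
/-- Acceptance together with a small value of another form in the same two rows. -/
theorem cubeExp_accept_lower_le [NeZero k] (h01 : (0 : Fin k) ≠ 1)
    (V M : Matrix (Fin d) (Fin d) ℝ) {θ s ζ β : ℝ} (hs : 0 ≤ s) (hβ : 0 ≤ β) :
    cubeExp (k := k) (fun X => if θ < form V X 0 1 ∧ form M X 0 1 < ζ then 1 else 0) ≤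
      Real.exp (-(s * θ) + β * ζ) * signExp fun x => Real.exp (sqLen (s • V - β • M) x / 2) := by
  have h1 : cubeExp (k := k) (fun X => if θ < form V X 0 1 ∧ form M X 0 1 < ζ then 1 else 0) ≤
      cubeExp (k := k) fun X => Real.exp (-(s * θ) + β * ζ) * Real.exp ((sv (X 0) ᵥ*
        (s • V - β • M)) ⬝ᵥ sv (X 1)) := by
    refine isWeight_cube.prodExp_mono fun X => ?_
    split_ifs with h
    · rw [← Real.exp_add, vecMul_sub, vecMul_smul, vecMul_smul, sub_dotProduct, smul_dotProduct,
        smul_dotProduct, smul_eq_mul, smul_eq_mul]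
      refine Real.one_le_exp ?_
      have h2 := mul_le_mul_of_nonneg_left h.1.le hs
      have h3 := mul_le_mul_of_nonneg_left h.2.le hβ
      rw [form] at h2 h3
      linarith
    · positivity
  refine h1.trans ?_
  rw [cubeExp, prodExp_const_mul]
  refine mul_le_mul_of_nonneg_left ?_ (Real.exp_pos _).le
  rw [← cubeExp, cubeExp_two h01 (fun x y => Real.exp ((sv x ᵥ* (s • V - β • M)) ⬝ᵥ sv y))]
  exact isWeight_sign.prodExp_mono fun x => signExp_exp_le _

open Classical in
/-- Acceptance together with a large value of a form in the first row and a third one. -/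
theorem cubeExp_accept_upper_le [NeZero k] (h01 : (0 : Fin k) ≠ 1) {a : Fin k} (ha0 : a ≠ 0)
    (ha1 : a ≠ 1) (V M : Matrix (Fin d) (Fin d) ℝ) {θ s ζ β : ℝ} (hs : 0 ≤ s) (hβ : 0 ≤ β) :
    cubeExp (k := k) (fun X => if θ < form V X 0 1 ∧ ζ < form M X 0 a then 1 else 0) ≤
      Real.exp (-(s * θ) - β * ζ) * signExp fun x => Real.exp (sqLen (s • V) x / 2 +
        sv x ⬝ᵥ ((β ^ 2 / 2) • (M * Mᵀ)) *ᵥ sv x) := by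
  have h1 : cubeExp (k := k) (fun X => if θ < form V X 0 1 ∧ ζ < form M X 0 a then 1 else 0) ≤
      cubeExp (k := k) fun X => Real.exp (-(s * θ) - β * ζ) * (Real.exp ((sv (X 0) ᵥ* (s • V)) ⬝ᵥ
        sv (X 1)) * Real.exp ((sv (X 0) ᵥ* (β • M)) ⬝ᵥ sv (X a))) := by
    refine isWeight_cube.prodExp_mono fun X => ?_
    split_ifs with h
    · rw [← Real.exp_add, ← Real.exp_add, vecMul_smul, vecMul_smul, smul_dotProduct,
        smul_dotProduct, smul_eq_mul, smul_eq_mul]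
      refine Real.one_le_exp ?_
      have h2 := mul_le_mul_of_nonneg_left h.1.le hs
      have h3 := mul_le_mul_of_nonneg_left h.2.le hβ
      rw [form] at h2 h3
      linarith
    · positivity
  refine h1.trans ?_
  rw [cubeExp, prodExp_const_mul]
  refine mul_le_mul_of_nonneg_left ?_ (Real.exp_pos _).le
  rw [← cubeExp, ← cubeExp_row a]
  have h2 : ∀ X : Cube k d, (signExp fun y => Real.exp ((sv (Function.update X a y 0) ᵥ*
      (s • V)) ⬝ᵥ sv (Function.update X a y 1)) * Real.exp ((sv (Function.update X a y 0) ᵥ*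
        (β • M)) ⬝ᵥ sv (Function.update X a y a))) ≤
      Real.exp ((sv (X 0) ᵥ* (s • V)) ⬝ᵥ sv (X 1)) * Real.exp (sqLen (β • M) (X 0) / 2) := by
    intro X
    simp only [Function.update_of_ne ha0.symm, Function.update_of_ne ha1.symm,
      Function.update_self]
    rw [signExp, prodExp_const_mul]
    exact mul_le_mul_of_nonneg_left (signExp_exp_le _) (Real.exp_pos _).le
  refine (isWeight_cube.prodExp_mono h2).trans ?_
  rw [← cubeExp, cubeExp_two h01 (fun x y => Real.exp ((sv x ᵥ* (s • V)) ⬝ᵥ sv y) *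
    Real.exp (sqLen (β • M) x / 2))]
  refine isWeight_sign.prodExp_mono fun x => ?_
  rw [signExp, prodExp_mul_const, Real.exp_add]
  refine mul_le_mul (signExp_exp_le _) (Real.exp_le_exp.mpr (le_of_eq ?_)) (Real.exp_pos _).le
    (Real.exp_pos _).le
  rw [smul_mulVec, dotProduct_smul, quad_mul_transpose, sqLen, vecMul_smul, smul_dotProduct,
    dotProduct_smul]
  simp only [smul_eq_mul]
  ring

end Chernoff

end

noncomputable section

/-! ### The acceptance event in the small-parameter regime -/

section Regime

variable {m k d : ℕ}

/-- The quantitative assumptions under which the acceptance test with the matrix `V₀ + D` and the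
threshold `θ` is analysed. Here `S` is the largest Frobenius norm of an attention matrix, `ρ` the
approximate Frobenius norm of `V₀ + D`, `o` a bound on operator norms, `δ` a bound on the
perturbation `D`, `h` a bound on the columns of `V₀`, and `ℓ` the number of standard deviations
beyond which events are negligible. -/
structure Regime (ε₁ γ₁ d₀ : ℝ) (Θ : Fin m → Matrix (Fin d) (Fin d) ℝ)
    (V₀ D : Matrix (Fin d) (Fin d) ℝ) (S ρ θ δ h o ℓ : ℝ) : Prop where
  ε_pos : 0 < ε₁
  ε_le : ε₁ ≤ 1 / 1000000
  γ_ge : 1000 ≤ γ₁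
  ρ_pos : 0 < ρ
  ρ_le : ρ ≤ S
  one_le_ℓ : 1 ≤ ℓ
  log_le : Real.log d ≤ ℓ ^ 2
  d_ge : d₀ ≤ d
  d_large : 100 ≤ (d : ℝ)
  frob_le : ∀ i, frob (Θ i) ≤ S
  frob_ge : 99 / 100 * ρ ≤ frob (V₀ + D)
  frob_le' : frob (V₀ + D) ≤ 101 / 100 * ρ
  frob_V₀ : frob V₀ ≤ 101 / 100 * ρ
  o_nonneg : 0 ≤ o
  op_Θ : ∀ i, OpLE (Θ i) o
  op_V₀ : OpLE V₀ o
  inner_ge : ∀ i, 97 / 100 * ρ ^ 2 ≤ frobInner (V₀ + D) (Θ i)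
  δ_pos : 0 < δ
  frob_D : frob D ≤ δ
  h_pos : 0 < h
  col_le : ∀ j, ∑ l, V₀ l j ^ 2 ≤ h ^ 2
  θ_ge : γ₁ * ℓ * S ≤ θ
  θ_o : θ * o ≤ ε₁ * ρ ^ 2
  θ_o_sq : (θ / ρ) ^ 2 * (θ * o / ρ ^ 2) ^ 2 ≤ ε₁ * ℓ ^ 2
  θ_δ : θ * δ * ℓ ≤ ε₁ * ρ ^ 2
  trace_le : ∀ i, |(Θ i).trace| ≤ ℓ * S
  light : (θ / ρ) ^ 5 * (ℓ * h / ρ) ^ 2 ≤ ε₁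
  size : (θ / ρ) ^ 2 ≤ d

variable {ε₁ γ₁ d₀ : ℝ} {Θ : Fin m → Matrix (Fin d) (Fin d) ℝ} {V₀ D : Matrix (Fin d) (Fin d) ℝ}
  {S ρ θ δ h o ℓ : ℝ}

namespace Regime

variable (R : Regime ε₁ γ₁ d₀ Θ V₀ D S ρ θ δ h o ℓ)
include R

theorem S_pos : 0 < S := R.ρ_pos.trans_le R.ρ_le

theorem θ_ge_S : 1000 * ℓ * S ≤ θ := by
  refine le_trans ?_ R.θ_ge
  exact mul_le_mul_of_nonneg_right (mul_le_mul_of_nonneg_right R.γ_ge (by linarith [R.one_le_ℓ]))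
    R.S_pos.le

theorem θ_ge_ρ : 1000 * ℓ * ρ ≤ θ :=
  (mul_le_mul_of_nonneg_left R.ρ_le (by linarith [R.one_le_ℓ])).trans R.θ_ge_S

theorem θ_pos : 0 < θ :=
  lt_of_lt_of_le (mul_pos (by linarith [R.one_le_ℓ]) R.ρ_pos) R.θ_ge_ρ

theorem σ_pos : 0 < frob (V₀ + D) := lt_of_lt_of_le (by linarith [R.ρ_pos]) R.frob_ge

theorem ρ_sq_le : 98 / 100 * ρ ^ 2 ≤ frob (V₀ + D) ^ 2 := by
  nlinarith [R.frob_ge, R.ρ_pos]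

theorem le_ρ_sq : frob (V₀ + D) ^ 2 ≤ 1021 / 1000 * ρ ^ 2 := by
  nlinarith [R.frob_le', R.ρ_pos, R.σ_pos]

/-- The tilting parameter is `θ / ‖V₀ + D‖_F²`, of order `θ / ρ²`. -/
theorem tilt_le : θ / frob (V₀ + D) ^ 2 ≤ 103 / 100 * (θ / ρ ^ 2) := by
  have hρ := R.ρ_pos
  have hσ := R.σ_pos
  rw [div_le_iff₀ (by positivity)]
  have h1 := R.ρ_sq_le
  have h2 : θ = θ / ρ ^ 2 * ρ ^ 2 := by field_simp
  have h3 : 0 < θ / ρ ^ 2 := div_pos R.θ_pos (by positivity)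
  nlinarith

/-- The perturbation and the higher-order terms of an exponential moment are a small fraction of
`ℓ ^ 2`. The norm of `B₀` may be as large as `2 θ / ρ`; this is compensated by the bound on
`(θ / ρ) ^ 2 * (θ * o / ρ ^ 2) ^ 2`. -/
theorem extra_le {B₀ D' : Matrix (Fin d) (Fin d) ℝ} {a : ℝ} (ha0 : 0 ≤ a)
    (ha : a ≤ 2 * (θ * o / ρ ^ 2)) (hF : frob B₀ ≤ 2 * (θ / ρ)) (hD : frob D' ≤ 2 * ε₁) :
    32 * (a ^ 2 * frob B₀ ^ 2 + 2 * a ^ 2 * frob D' ^ 2 + frob D' ^ 4) ≤ ℓ ^ 2 / 1000 := by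
  have hε := R.ε_pos
  have hε' := R.ε_le
  have hℓ : 1 ≤ ℓ ^ 2 := by nlinarith [R.one_le_ℓ]
  have hψ : θ * o / ρ ^ 2 ≤ ε₁ := by
    rw [div_le_iff₀ (by have := R.ρ_pos; positivity)]; exact R.θ_o
  have hB := frob_nonneg B₀
  have hD0 := frob_nonneg D'
  have h1 : a ^ 2 * frob B₀ ^ 2 ≤ 16 * (ε₁ * ℓ ^ 2) := by
    calc a ^ 2 * frob B₀ ^ 2 ≤ (2 * (θ * o / ρ ^ 2)) ^ 2 * (2 * (θ / ρ)) ^ 2 :=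
          mul_le_mul (pow_le_pow_left₀ ha0 ha 2) (pow_le_pow_left₀ hB hF 2) (by positivity)
            (by positivity)
      _ = 16 * ((θ / ρ) ^ 2 * (θ * o / ρ ^ 2) ^ 2) := by ring
      _ ≤ _ := mul_le_mul_of_nonneg_left R.θ_o_sq (by norm_num)
  have h2 : frob D' ^ 2 ≤ 4 * ε₁ ^ 2 := by nlinarith
  have h3 : a ^ 2 ≤ 4 * ε₁ ^ 2 := by nlinarith
  have h4 : a ^ 2 * frob D' ^ 2 ≤ 4 * ε₁ ^ 2 * (4 * ε₁ ^ 2) :=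
    mul_le_mul h3 h2 (by positivity) (by positivity)
  have h5 : frob D' ^ 4 ≤ 4 * ε₁ ^ 2 * (4 * ε₁ ^ 2) := by
    have : frob D' ^ 4 = frob D' ^ 2 * frob D' ^ 2 := by ring
    rw [this]; exact mul_le_mul h2 h2 (by positivity) (by positivity)
  have h6 : ε₁ ^ 2 ≤ 1 / 1000000 * ε₁ := by nlinarith
  have h7 : 4 * ε₁ ^ 2 * (4 * ε₁ ^ 2) ≤ ε₁ / 100 := by nlinarith [sq_nonneg ε₁]
  nlinarith

theorem frob_smul_D : frob ((θ / frob (V₀ + D) ^ 2) • D) ≤ 2 * ε₁ := by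
  have hρ := R.ρ_pos
  have hθ := R.θ_pos
  have hσ := R.σ_pos
  rw [frob_smul, abs_of_pos (by positivity)]
  have h1 : θ / frob (V₀ + D) ^ 2 * frob D ≤ 103 / 100 * (θ / ρ ^ 2) * δ :=
    mul_le_mul R.tilt_le R.frob_D (frob_nonneg _) (by positivity)
  have h2 : θ / ρ ^ 2 * δ ≤ ε₁ := by
    rw [div_mul_eq_mul_div, div_le_iff₀ (by positivity)]
    refine le_trans ?_ R.θ_δ
    exact le_mul_of_one_le_right (mul_pos hθ R.δ_pos).le R.one_le_ℓ
  nlinarith [R.ε_pos]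

theorem op_smul_V₀ : OpLE ((θ / frob (V₀ + D) ^ 2) • V₀) (103 / 100 * (θ * o / ρ ^ 2)) := by
  have hρ := R.ρ_pos
  have hθ := R.θ_pos
  have hσ := R.σ_pos
  have h1 := R.op_V₀.smul (θ / frob (V₀ + D) ^ 2)
  rw [abs_of_pos (by positivity)] at h1
  refine h1.mono (mul_nonneg (by positivity) R.o_nonneg) ?_
  calc _ ≤ 103 / 100 * (θ / ρ ^ 2) * o := mul_le_mul_of_nonneg_right R.tilt_le R.o_nonneg
    _ = _ := by ring

theorem frob_smul_V₀ : frob ((θ / frob (V₀ + D) ^ 2) • V₀) ≤ 11 / 10 * (θ / ρ) := by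
  have hρ := R.ρ_pos
  have hθ := R.θ_pos
  have hσ := R.σ_pos
  rw [frob_smul, abs_of_pos (by positivity)]
  have h1 : θ / frob (V₀ + D) ^ 2 * frob V₀ ≤ 103 / 100 * (θ / ρ ^ 2) * (101 / 100 * ρ) :=
    mul_le_mul R.tilt_le R.frob_V₀ (frob_nonneg _) (by positivity)
  refine h1.trans ?_
  have h2 : 103 / 100 * (θ / ρ ^ 2) * (101 / 100 * ρ) = 103 / 100 * (101 / 100) * (θ / ρ) := by
    field_simp
  rw [h2]
  exact mul_le_mul_of_nonneg_right (by norm_num) (by positivity)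

theorem ψ_le : θ * o / ρ ^ 2 ≤ ε₁ := by
  rw [div_le_iff₀ (by have := R.ρ_pos; positivity)]; exact R.θ_o

theorem ψ_nonneg : 0 ≤ θ * o / ρ ^ 2 :=
  div_nonneg (mul_nonneg R.θ_pos.le R.o_nonneg) (sq_nonneg _)

/-- The tilted exponential moment of a quadratic form in the first row. -/
theorem signExp_tilt_quad_le {M : Matrix (Fin d) (Fin d) ℝ} {c : ℝ} (hc0 : 0 ≤ c)
    (hc : c ≤ 1 / 50) (hM : OpLE M c) :
    (signExp fun x => Real.exp (sqLen ((θ / frob (V₀ + D) ^ 2) • (V₀ + D)) x / 2 +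
      sv x ⬝ᵥ M *ᵥ sv x)) ≤
    Real.exp (θ ^ 2 / frob (V₀ + D) ^ 2 / 2 + M.trace + 32 * frob M ^ 2 + ℓ ^ 2 / 1000) := by
  have hρ := R.ρ_pos
  have hθ := R.θ_pos
  have hσ := R.σ_pos
  set s := θ / frob (V₀ + D) ^ 2 with hs
  have hψ := R.ψ_le
  have hψ0 := R.ψ_nonneg
  have hε := R.ε_le
  have hD := R.frob_smul_D
  have hD0 := frob_nonneg (s • D)
  have h1 := signExp_exp_quad_add_le (B₀ := s • V₀) (D := s • D) (by positivity) hc0 R.op_smul_V₀ hM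
    (by nlinarith)
  have h2 := R.extra_le (B₀ := s • V₀) (D' := s • D) (a := 103 / 100 * (θ * o / ρ ^ 2))
    (by positivity) (by linarith)
    (R.frob_smul_V₀.trans (mul_le_mul_of_nonneg_right (by norm_num) (by positivity))) hD
  rw [← smul_add] at h1
  refine h1.trans (Real.exp_le_exp.mpr ?_)
  have h3 : frob (s • (V₀ + D)) ^ 2 = θ ^ 2 / frob (V₀ + D) ^ 2 := by
    rw [frob_smul_sq, hs]; field_simp
  rw [h3]
  linarith

/-- The gain in the exponents below dominates all errors of order `ℓ ^ 2`. -/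
theorem q_ge : 1000000 * ℓ ^ 2 ≤ θ ^ 2 / S ^ 2 := by
  have hS := R.S_pos
  rw [le_div_iff₀ (by positivity)]
  have h1 := R.θ_ge_S
  have h2 : 0 ≤ 1000 * ℓ * S := by
    have := R.one_le_ℓ
    positivity
  nlinarith

open Classical in
/-- Acceptance together with a large diagonal form. -/
theorem accept_self_le [NeZero k] (h01 : (0 : Fin k) ≠ 1) (i : Fin m) :
    cubeExp (k := k) (fun X => if θ < form (V₀ + D) X 0 1 ∧ θ / 4 < form (Θ i) X 0 0
      then 1 else 0) ≤
    Real.exp (-(θ ^ 2 / frob (V₀ + D) ^ 2 / 2) - θ ^ 2 / S ^ 2 / 2500) := by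
  have hρ := R.ρ_pos
  have hθ := R.θ_pos
  have hσ := R.σ_pos
  have hS := R.S_pos
  have hℓ := R.one_le_ℓ
  set q := θ ^ 2 / S ^ 2 with hq
  have hqℓ := R.q_ge
  rw [← hq] at hqℓ
  -- for a small multiplier the gain `β θ / 4` beats both the trace and the quadratic term
  set β := θ / (400 * S ^ 2) with hβ
  have hβ0 : 0 < β := by positivity
  have hop : OpLE (β • Θ i) (β * o) := by
    have := (R.op_Θ i).smul β
    rwa [abs_of_pos hβ0] at this
  have hβo : β * o ≤ 1 / 50 := by
    have h1 : β * o ≤ θ * o / ρ ^ 2 := by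
      rw [hβ, div_mul_eq_mul_div]
      refine div_le_div_of_nonneg_left (mul_nonneg hθ.le R.o_nonneg) (by positivity) ?_
      nlinarith [R.ρ_le]
    linarith [R.ψ_le, R.ε_le]
  have h1 := cubeExp_accept_quad_le h01 (V₀ + D) (β • Θ i) (θ := θ)
    (s := θ / frob (V₀ + D) ^ 2) (ζ := β * (θ / 4)) (by positivity)
    (fun x => θ / 4 < sv x ⬝ᵥ Θ i *ᵥ sv x) (fun x hx => by
      rw [smul_mulVec, dotProduct_smul, smul_eq_mul]
      exact mul_le_mul_of_nonneg_left hx.le hβ0.le)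
  have h2 := R.signExp_tilt_quad_le (mul_nonneg hβ0.le R.o_nonneg) hβo hop
  have h3 := h1.trans (mul_le_mul_of_nonneg_left h2 (Real.exp_pos _).le)
  have e : ∀ X : Cube k d, form (Θ i) X 0 0 = sv (X 0) ⬝ᵥ Θ i *ᵥ sv (X 0) := fun X => by
    rw [form, dotProduct_mulVec]
  simp only [e]
  refine h3.trans ?_
  rw [← Real.exp_add]
  refine Real.exp_le_exp.mpr ?_
  have e1 : θ / frob (V₀ + D) ^ 2 * θ = θ ^ 2 / frob (V₀ + D) ^ 2 := by ring
  have e2 : β * (θ / 4) = q / 1600 := by rw [hβ, hq]; field_simp; norm_num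
  have e3 : frob (β • Θ i) ^ 2 ≤ q / 160000 := by
    rw [frob_smul_sq]
    have : frob (Θ i) ^ 2 ≤ S ^ 2 := pow_le_pow_left₀ (frob_nonneg _) (R.frob_le i) 2
    refine (mul_le_mul_of_nonneg_left this (sq_nonneg β)).trans_eq ?_
    rw [hβ, hq]; field_simp; norm_num
  have e4 : (β • Θ i).trace ≤ q / 400000 := by
    rw [trace_smul, smul_eq_mul]
    have h5 : (Θ i).trace ≤ ℓ * S := (le_abs_self _).trans (R.trace_le i)
    have h6 : ℓ * S ≤ θ / 1000 := by linarith [R.θ_ge_S]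
    refine (mul_le_mul_of_nonneg_left (h5.trans h6) hβ0.le).trans_eq ?_
    rw [hβ, hq]; field_simp; norm_num
  rw [e1, e2]
  nlinarith

set_option maxHeartbeats 400000 in
open Classical in
/-- Acceptance together with a small form of one head in the first two rows. -/
theorem accept_pair_le [NeZero k] (h01 : (0 : Fin k) ≠ 1) (i : Fin m) :
    cubeExp (k := k) (fun X => if θ < form (V₀ + D) X 0 1 ∧ form (Θ i) X 0 1 < θ / 2
      then 1 else 0) ≤
    Real.exp (-(θ ^ 2 / frob (V₀ + D) ^ 2 / 2) - θ ^ 2 / S ^ 2 / 2500) := by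
  have hρ := R.ρ_pos
  have hθ := R.θ_pos
  have hσ := R.σ_pos
  have hS := R.S_pos
  have hℓ := R.one_le_ℓ
  set q := θ ^ 2 / S ^ 2 with hq
  have hqℓ := R.q_ge
  rw [← hq] at hqℓ
  set s := θ / frob (V₀ + D) ^ 2 with hs
  -- the exponent is `-β (0.95 - 1/2) θ + β² S² / 2`, and this choice is near the optimum
  set β := 3 * θ / (10 * S ^ 2) with hβ
  have hβ0 : 0 < β := by positivity
  have hψ := R.ψ_le
  have hψ0 := R.ψ_nonneg
  have hε := R.ε_le
  have hβo : β * o ≤ 3 / 10 * (θ * o / ρ ^ 2) := by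
    have h1 : θ * o / S ^ 2 ≤ θ * o / ρ ^ 2 :=
      div_le_div_of_nonneg_left (mul_nonneg hθ.le R.o_nonneg) (by positivity)
        (pow_le_pow_left₀ hρ.le R.ρ_le 2)
    have h2 : β * o = 3 / 10 * (θ * o / S ^ 2) := by rw [hβ]; field_simp
    rw [h2]; linarith
  have hop : OpLE (s • V₀ + (-β) • Θ i) (103 / 100 * (θ * o / ρ ^ 2) + β * o) := by
    have := (R.op_Θ i).smul (-β)
    rw [abs_neg, abs_of_pos hβ0] at this
    exact R.op_smul_V₀.add (by positivity) (mul_nonneg hβ0.le R.o_nonneg) this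
  have hF : frob (s • V₀ + (-β) • Θ i) ≤ 2 * (θ / ρ) := by
    refine (frob_add_le _ _).trans ?_
    have h1 := R.frob_smul_V₀
    rw [frob_smul (-β), abs_neg, abs_of_pos hβ0]
    have h2 : β * frob (Θ i) ≤ 3 / 10 * (θ / ρ) := by
      refine (mul_le_mul_of_nonneg_left (R.frob_le i) hβ0.le).trans ?_
      have h3 : β * S = 3 / 10 * (θ / S) := by rw [hβ]; field_simp
      have h4 : θ / S ≤ θ / ρ := div_le_div_of_nonneg_left hθ.le hρ R.ρ_le
      rw [h3]; linarith
    have h5 : 0 < θ / ρ := by positivity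
    linarith
  have hD := R.frob_smul_D
  have hD0 := frob_nonneg (s • D)
  have h1 := cubeExp_accept_lower_le h01 (V₀ + D) (Θ i) (θ := θ) (s := s) (ζ := θ / 2)
    (β := β) (by positivity) hβ0.le
  have ha0 : 0 ≤ 103 / 100 * (θ * o / ρ ^ 2) + β * o :=
    add_nonneg (by positivity) (mul_nonneg hβ0.le R.o_nonneg)
  have h2 := signExp_exp_quad_add_le (B₀ := s • V₀ + (-β) • Θ i) (D := s • D) (M := 0) (c := 0)
    ha0 le_rfl hop opLE_zero (by nlinarith)
  have h3 := R.extra_le (B₀ := s • V₀ + (-β) • Θ i) (D' := s • D)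
    (a := 103 / 100 * (θ * o / ρ ^ 2) + β * o) ha0 (by linarith) hF hD
  have e : s • V₀ + (-β) • Θ i + s • D = s • (V₀ + D) - β • Θ i := by
    rw [smul_add, neg_smul]; abel
  rw [e] at h2
  have h0 : frob (0 : Matrix (Fin d) (Fin d) ℝ) = 0 := by simp [frob]
  simp only [zero_mulVec, dotProduct_zero, add_zero, trace_zero, h0] at h2
  refine h1.trans ((mul_le_mul_of_nonneg_left h2 (Real.exp_pos _).le).trans ?_)
  rw [← Real.exp_add]
  refine Real.exp_le_exp.mpr ?_
  have e1 : s * θ = θ ^ 2 / frob (V₀ + D) ^ 2 := by rw [hs]; ring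
  have e2 : frob (s • (V₀ + D) - β • Θ i) ^ 2 = θ ^ 2 / frob (V₀ + D) ^ 2 -
      2 * β * (s * frobInner (V₀ + D) (Θ i)) + β ^ 2 * frob (Θ i) ^ 2 := by
    rw [sub_eq_add_neg, ← neg_smul, frob_add_sq, frob_smul_sq, frob_smul_sq, frobInner_smul_left,
      frobInner_comm, frobInner_smul_left, frobInner_comm (Θ i), hs]
    field_simp
    ring
  have e3 : 95 / 100 * θ ≤ s * frobInner (V₀ + D) (Θ i) := by
    have h5 := R.le_ρ_sq
    have h6 := mul_le_mul_of_nonneg_left (R.inner_ge i) (by positivity : 0 ≤ s)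
    refine le_trans ?_ h6
    have h7 : s * frob (V₀ + D) ^ 2 = θ := by rw [hs]; field_simp
    have h8 := mul_le_mul_of_nonneg_left h5 (by positivity : 0 ≤ s)
    linarith
  have e4 : β * θ = 3 / 10 * q := by rw [hβ, hq]; field_simp
  have e5 : β ^ 2 * frob (Θ i) ^ 2 ≤ 9 / 100 * q := by
    have : frob (Θ i) ^ 2 ≤ S ^ 2 := pow_le_pow_left₀ (frob_nonneg _) (R.frob_le i) 2
    refine (mul_le_mul_of_nonneg_left this (sq_nonneg β)).trans_eq ?_
    rw [hβ, hq]; field_simp; norm_num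
  have e6 := mul_le_mul_of_nonneg_left e3 hβ0.le
  rw [e2, e1]
  linarith [sq_nonneg ℓ]

open Classical in
/-- Acceptance together with a large form of one head in the first row and a third one. -/
theorem accept_other_le [NeZero k] (h01 : (0 : Fin k) ≠ 1) {a : Fin k} (ha0 : a ≠ 0) (ha1 : a ≠ 1)
    (i : Fin m) :
    cubeExp (k := k) (fun X => if θ < form (V₀ + D) X 0 1 ∧ θ / 4 < form (Θ i) X 0 a
      then 1 else 0) ≤
    Real.exp (-(θ ^ 2 / frob (V₀ + D) ^ 2 / 2) - θ ^ 2 / S ^ 2 / 2500) := by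
  have hρ := R.ρ_pos
  have hθ := R.θ_pos
  have hσ := R.σ_pos
  have hS := R.S_pos
  have hℓ := R.one_le_ℓ
  set q := θ ^ 2 / S ^ 2 with hq
  have hqℓ := R.q_ge
  rw [← hq] at hqℓ
  set s := θ / frob (V₀ + D) ^ 2 with hs
  -- the exponent `-β θ / 4 + β² S² / 2` is minimal here
  set β := θ / (4 * S ^ 2) with hβ
  have hβ0 : 0 < β := by positivity
  have hψ := R.ψ_le
  have hψ0 := R.ψ_nonneg
  have hε := R.ε_le
  have hβo0 : 0 ≤ β * o := mul_nonneg hβ0.le R.o_nonneg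
  have hβo : β * o ≤ ε₁ := by
    refine le_trans ?_ hψ
    rw [hβ, div_mul_eq_mul_div]
    refine div_le_div_of_nonneg_left (mul_nonneg hθ.le R.o_nonneg) (by positivity) ?_
    nlinarith [R.ρ_le]
  have hβo2 : (β * o) ^ 2 ≤ 1 / 1000000 := by nlinarith
  have hop : OpLE ((β ^ 2 / 2) • (Θ i * (Θ i)ᵀ)) (β ^ 2 / 2 * o ^ 2) := by
    have := ((R.op_Θ i).mul_transpose).smul (β ^ 2 / 2)
    rwa [abs_of_pos (by positivity)] at this
  have h1 := cubeExp_accept_upper_le h01 ha0 ha1 (V₀ + D) (Θ i) (θ := θ) (s := s) (ζ := θ / 4)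
    (β := β) (by positivity) hβ0.le
  have h2 := R.signExp_tilt_quad_le (by positivity) (by nlinarith) hop
  refine h1.trans ((mul_le_mul_of_nonneg_left h2 (Real.exp_pos _).le).trans ?_)
  rw [← Real.exp_add]
  refine Real.exp_le_exp.mpr ?_
  have hfi : frob (Θ i) ^ 2 ≤ S ^ 2 := pow_le_pow_left₀ (frob_nonneg _) (R.frob_le i) 2
  have hβS : β ^ 2 * S ^ 2 = q / 16 := by rw [hβ, hq]; field_simp; norm_num
  have hβΘ : β ^ 2 * frob (Θ i) ^ 2 ≤ q / 16 := by
    rw [← hβS]; exact mul_le_mul_of_nonneg_left hfi (sq_nonneg _)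
  have e1 : s * θ = θ ^ 2 / frob (V₀ + D) ^ 2 := by rw [hs]; ring
  have e2 : β * (θ / 4) = q / 16 := by rw [hβ, hq]; field_simp; norm_num
  have e3 : ((β ^ 2 / 2) • (Θ i * (Θ i)ᵀ)).trace ≤ q / 32 := by
    rw [trace_smul, trace_mul_transpose_self, smul_eq_mul]
    linarith
  have e4 : frob ((β ^ 2 / 2) • (Θ i * (Θ i)ᵀ)) ^ 2 ≤ q / 1000000 := by
    rw [frob_smul_sq]
    have h5 := frob_mul_transpose_sq_le (A := Θ i) (sq_nonneg o) (R.op_Θ i)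
    have h6 := mul_le_mul_of_nonneg_left h5 (sq_nonneg (β ^ 2 / 2))
    refine h6.trans ?_
    have h7 : (β ^ 2 / 2) ^ 2 * (o ^ 2 * frob (Θ i) ^ 2) =
        (β * o) ^ 2 * (β ^ 2 * frob (Θ i) ^ 2) / 4 := by ring
    rw [h7]
    have h8 : 0 ≤ β ^ 2 * frob (Θ i) ^ 2 := by positivity
    nlinarith
  rw [e1, e2]
  nlinarith

end Regime

end Regime

end

noncomputable section

/-! ### Second moments of sign vectors and sign flips -/

section Flip

variable {n : ℕ}

theorem flip_flip (y : Fin n → Bool) (j : Fin n) : flip (flip y j) j = y := by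
  simp [flip]

/-- Flipping one sign preserves the uniform distribution. -/
theorem signExp_flip (j : Fin n) (F : (Fin n → Bool) → ℝ) :
    (signExp fun y => F (flip y j)) = signExp F := by
  have hinv : Function.Involutive fun y : Fin n → Bool => flip y j := fun y => flip_flip y j
  rw [signExp, signExp, prodExp_unif, prodExp_unif]
  congr 1
  exact Equiv.sum_comp hinv.toPerm F

theorem signExp_sg_mul (i j : Fin n) :
    (signExp fun x => sg (x i) * sg (x j)) = if i = j then 1 else 0 := by
  by_cases h : i = j
  · subst h
    simp only [sg_sq, if_true]
    exact isWeight_sign.prodExp_const 1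
  · have h1 := signExp_flip i fun x : Fin n → Bool => sg (x i) * sg (x j)
    have h2 : ∀ x : Fin n → Bool, sg (flip x i i) * sg (flip x i j) =
        (-1) * (sg (x i) * sg (x j)) := by
      intro x
      simp [flip, sg_not, Function.update_of_ne (Ne.symm h)]
    simp only [h2] at h1
    rw [signExp, prodExp_const_mul] at h1
    rw [if_neg h]
    unfold signExp at h1 ⊢
    linarith

theorem sq_dotProduct_eq (u x : Fin n → ℝ) :
    (u ⬝ᵥ x) ^ 2 = ∑ i, ∑ j, u i * u j * (x i * x j) := by
  rw [sq, dotProduct, Finset.sum_mul_sum]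
  exact Finset.sum_congr rfl fun i _ => Finset.sum_congr rfl fun j _ => by ring

theorem signExp_sq_dotProduct (u : Fin n → ℝ) :
    (signExp fun x => (u ⬝ᵥ sv x) ^ 2) = ∑ i, u i ^ 2 := by
  simp only [sq_dotProduct_eq, signExp]
  rw [prodExp_sum]
  refine Finset.sum_congr rfl fun i _ => ?_
  rw [prodExp_sum]
  have h : ∀ j, prodExp (unif (Fin n) Bool) (fun x => u i * u j * (sv x i * sv x j)) =
      if i = j then u i ^ 2 else 0 := by
    intro j
    rw [prodExp_const_mul]
    have := signExp_sg_mul i j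
    rw [signExp] at this
    simp only [sv, this]
    split_ifs with h
    · subst h; ring
    · ring
  simp [h]

theorem sqLen_eq_sum (M : Matrix (Fin n) (Fin n) ℝ) (x : Fin n → Bool) :
    sqLen M x = ∑ j, ((fun i => M i j) ⬝ᵥ sv x) ^ 2 := by
  simp only [sqLen, dotProduct, vecMul, sq]
  refine Finset.sum_congr rfl fun j _ => ?_
  simp only [mul_comm]

theorem signExp_sqLen (M : Matrix (Fin n) (Fin n) ℝ) :
    (signExp fun x => sqLen M x) = frob M ^ 2 := by
  simp only [sqLen_eq_sum, signExp]
  rw [prodExp_sum, frob_sq, Finset.sum_comm]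
  refine Finset.sum_congr rfl fun j _ => ?_
  exact signExp_sq_dotProduct _

theorem sqLen_le (M : Matrix (Fin n) (Fin n) ℝ) (x : Fin n → Bool) :
    sqLen M x ≤ n * frob M ^ 2 := by
  have h := opLE_frob M (sv x)
  rw [sv_dotProduct_self] at h
  rw [sqLen]
  linarith

/-- If flips of every coordinate keep an event with conditional probability at least `c`, then
conditionally on the event the second moment of a linear form is at least `c / n` times the
squared length of its coefficient vector. -/
theorem le_signExp_sq_of_flip {p : (Fin n → Bool) → Prop} [DecidablePred p] {c : ℝ}
    (h : ∀ j, c * (signExp fun y => if p y then 1 else 0) ≤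
      signExp fun y => if p y ∧ p (flip y j) then 1 else 0) (w : Fin n → ℝ) :
    c * (w ⬝ᵥ w) * (signExp fun y => if p y then 1 else 0) ≤
      n * signExp fun y => if p y then (w ⬝ᵥ sv y) ^ 2 else 0 := by
  have h1 : ∀ j, c * w j ^ 2 * (signExp fun y => if p y then 1 else 0) ≤
      signExp fun y => if p y then (w ⬝ᵥ sv y) ^ 2 else 0 := by
    intro j
    have h2 := signExp_flip j fun y => if p y then (w ⬝ᵥ sv y) ^ 2 else 0
    -- if `y` and its flip both lie in the event, then the values of the form differ by `2 w j` in absolute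
    -- value, so the sum of their squares is at least `2 (w j)²`
    have h3 : (signExp fun y => 2 * w j ^ 2 * if p y ∧ p (flip y j) then 1 else 0) ≤
        signExp fun y => (if p y then (w ⬝ᵥ sv y) ^ 2 else 0) +
          if p (flip y j) then (w ⬝ᵥ sv (flip y j)) ^ 2 else 0 := by
      refine isWeight_sign.prodExp_mono fun y => ?_
      have hs := sg_sq (y j)
      have hsq : w j ^ 2 = (w j * sg (y j)) ^ 2 := by rw [mul_pow, sq (sg _), hs, mul_one]
      by_cases hy : p y <;> by_cases hf : p (flip y j)
      · simp only [hy, hf, if_true, and_self, dotProduct_sv_flip]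
        rw [hsq]
        nlinarith [sq_nonneg (w ⬝ᵥ sv y - w j * sg (y j))]
      all_goals simp [hy, hf]
      all_goals positivity
    rw [signExp, prodExp_const_mul, signExp, prodExp_add] at h3
    have h4 := mul_le_mul_of_nonneg_left (h j) (sq_nonneg (w j))
    unfold signExp at h2 h4 ⊢
    linarith
  have h5 := Finset.sum_le_sum fun j (_ : j ∈ Finset.univ) => h1 j
  rw [← Finset.sum_mul, ← Finset.mul_sum, Finset.sum_const, Finset.card_univ, Fintype.card_fin,
    nsmul_eq_mul] at h5
  have h6 : w ⬝ᵥ w = ∑ j, w j ^ 2 := by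
    rw [dotProduct]; exact Finset.sum_congr rfl fun j _ => (sq _).symm
  rw [h6]
  exact h5

end Flip

/-! ### Typical first rows -/

section Typical

variable {m k d : ℕ} {ε₁ γ₁ d₀ : ℝ} {Θ : Fin m → Matrix (Fin d) (Fin d) ℝ}
  {V₀ D : Matrix (Fin d) (Fin d) ℝ} {S ρ θ δ h o ℓ : ℝ}

/-- An event about the first row that is negligible, both by itself and jointly with acceptance. -/
def Rare (k : ℕ) [NeZero k] (V : Matrix (Fin d) (Fin d) ℝ) (θ g : ℝ) (p : (Fin d → Bool) → Prop) :
    Prop :=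
  open Classical in
  cubeExp (k := k) (fun X => if θ < form V X 0 1 ∧ p (X 0) then 1 else 0) ≤
      Real.exp (-(θ ^ 2 / frob V ^ 2 / 2) - g) ∧
    signExp (fun x => if p x then 1 else 0) ≤ Real.exp (-g)

namespace Regime

variable (R : Regime ε₁ γ₁ d₀ Θ V₀ D S ρ θ δ h o ℓ)
include R

/-- A sufficient condition for rarity: a quadratic form in the first row is large on the event, while
its exponential moment, also under the tilt by acceptance, is under control. -/
theorem rare_of_quad [NeZero k] (h01 : (0 : Fin k) ≠ 1) {M : Matrix (Fin d) (Fin d) ℝ} {c ζ : ℝ}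
    (hc0 : 0 ≤ c) (hc : c ≤ 1 / 50) (hM : OpLE M c) {p : (Fin d → Bool) → Prop}
    (hp : ∀ x, p x → ζ ≤ sv x ⬝ᵥ M *ᵥ sv x)
    (hg : M.trace + 32 * frob M ^ 2 - ζ ≤ -(31 * ℓ ^ 2)) :
    Rare k (V₀ + D) θ (30 * ℓ ^ 2) p := by
  classical
  have hθ := R.θ_pos
  have hσ := R.σ_pos
  constructor
  · have h1 := cubeExp_accept_quad_le h01 (V₀ + D) M (θ := θ)
      (s := θ / frob (V₀ + D) ^ 2) (by positivity) p hp
    have h2 := R.signExp_tilt_quad_le hc0 hc hM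
    refine le_trans (by convert h1) ((mul_le_mul_of_nonneg_left h2 (Real.exp_pos _).le).trans ?_)
    rw [← Real.exp_add]
    refine Real.exp_le_exp.mpr ?_
    have e1 : θ / frob (V₀ + D) ^ 2 * θ = θ ^ 2 / frob (V₀ + D) ^ 2 := by ring
    rw [e1]
    linarith [sq_nonneg ℓ]
  · have h1 : (signExp fun x => if p x then (1 : ℝ) else 0) ≤
        signExp fun x => Real.exp (-ζ) * Real.exp (sv x ⬝ᵥ M *ᵥ sv x) := by
      refine isWeight_sign.prodExp_mono fun x => ?_
      split_ifs with hx
      · rw [← Real.exp_add]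
        exact Real.one_le_exp (by linarith [hp x hx])
      · positivity
    rw [signExp, signExp, prodExp_const_mul] at h1
    have h2 := hansonWright (sq_nonneg c) (by nlinarith) hM
    refine le_trans (by convert h1) ((mul_le_mul_of_nonneg_left h2 (Real.exp_pos _).le).trans ?_)
    rw [← Real.exp_add]
    refine Real.exp_le_exp.mpr ?_
    nlinarith [sq_nonneg ℓ, sq_nonneg (frob M)]

/-- The squared length of `x B` rarely exceeds its mean by more than a factor of order `ℓ ^ 2`. -/
theorem rare_sqLen [NeZero k] (h01 : (0 : Fin k) ≠ 1) {B : Matrix (Fin d) (Fin d) ℝ} {b : ℝ}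
    (hb : 0 < b) (hB : frob B ≤ b) :
    Rare k (V₀ + D) θ (30 * ℓ ^ 2) fun x => 4096 * ℓ ^ 2 * b ^ 2 < sqLen B x := by
  have hℓ := R.one_le_ℓ
  have h0 := frob_nonneg B
  have h2 : frob B ^ 2 ≤ b ^ 2 := pow_le_pow_left₀ h0 hB 2
  -- the form is scaled so that its matrix has operator norm at most `1 / 100`
  have hop := ((opLE_frob B).mono h0 hB).mul_transpose.smul (1 / (100 * b ^ 2))
  rw [abs_of_pos (by positivity)] at hop
  have e : 1 / (100 * b ^ 2) * b ^ 2 = 1 / 100 := by field_simp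
  rw [e] at hop
  refine R.rare_of_quad h01 (by norm_num) (by norm_num) hop
    (ζ := 4096 / 100 * ℓ ^ 2) (fun x hx => ?_) ?_
  · rw [smul_mulVec, dotProduct_smul, quad_mul_transpose, smul_eq_mul, one_div_mul_eq_div,
      le_div_iff₀ (by positivity)]
    rw [sqLen] at hx
    linarith
  · rw [trace_smul, trace_mul_transpose_self, frob_smul_sq, smul_eq_mul]
    have h3 := frob_mul_transpose_sq_le (A := B) (sq_nonneg _) (opLE_frob B)
    have h4 : 1 / (100 * b ^ 2) * frob B ^ 2 ≤ 1 / 100 := by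
      rw [← e]; exact mul_le_mul_of_nonneg_left h2 (by positivity)
    have h6 : (1 / (100 * b ^ 2)) ^ 2 * frob (B * Bᵀ) ^ 2 ≤ (1 / 100) ^ 2 := by
      calc _ ≤ (1 / (100 * b ^ 2)) ^ 2 * (frob B ^ 2 * frob B ^ 2) :=
            mul_le_mul_of_nonneg_left h3 (by positivity)
        _ = (1 / (100 * b ^ 2) * frob B ^ 2) ^ 2 := by ring
        _ ≤ _ := pow_le_pow_left₀ (by positivity) h4 2
    nlinarith

theorem ℓ_mul_o_le : ℓ * o ≤ ρ / 1000000000 := by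
  have h1 := R.θ_o
  have h2 := R.θ_ge_ρ
  have h3 := mul_le_mul_of_nonneg_right h2 R.o_nonneg
  have hρ := R.ρ_pos
  have h4 : (ℓ * o) * ρ ≤ ρ / 1000000000 * ρ := by
    nlinarith [R.ε_le, sq_nonneg ρ]
  exact le_of_mul_le_mul_right h4 hρ

theorem ℓ_mul_δ_le : ℓ * δ ≤ ρ / 1000000000 := by
  have h1 := R.θ_δ
  have h2 : 1000 * ρ ≤ θ := by nlinarith [R.θ_ge_ρ, R.one_le_ℓ, R.ρ_pos]
  have hδ := R.δ_pos
  have hℓ := R.one_le_ℓ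
  have h3 := mul_le_mul_of_nonneg_right h2 (by positivity : 0 ≤ δ * ℓ)
  have hρ := R.ρ_pos
  have h4 : (ℓ * δ) * ρ ≤ ρ / 1000000000 * ρ := by
    nlinarith [R.ε_le, sq_nonneg ρ]
  exact le_of_mul_le_mul_right h4 hρ

/-- The Gram matrix of `V₀ + D` has small Frobenius norm compared to its trace, which is what makes
the length of `x (V₀ + D)` concentrate. -/
theorem frob_gram_le : ℓ ^ 2 * frob ((V₀ + D) * (V₀ + D)ᵀ) ^ 2 ≤
    frob (V₀ + D) ^ 4 / 1000000000 := by
  have h1 := frob_add_mul_transpose_sq_le (D := D) R.op_V₀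
  have ho := R.ℓ_mul_o_le
  have hδ := R.ℓ_mul_δ_le
  have hℓ := R.one_le_ℓ
  have hρ := R.ρ_pos
  have h0 := R.o_nonneg
  have hδ0 := R.δ_pos
  have hσ := R.ρ_sq_le
  have hD0 := frob_nonneg D
  have hF : frob V₀ ^ 2 ≤ 2 * ρ ^ 2 := by nlinarith [R.frob_V₀, frob_nonneg V₀]
  have hD : frob D ^ 2 ≤ δ ^ 2 := pow_le_pow_left₀ hD0 R.frob_D 2
  have ho2 : ℓ ^ 2 * o ^ 2 ≤ ρ ^ 2 / 1000000000000 := by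
    rw [← mul_pow]
    refine (pow_le_pow_left₀ (by positivity) ho 2).trans ?_
    nlinarith [sq_nonneg ρ]
  have hd2 : ℓ ^ 2 * δ ^ 2 ≤ ρ ^ 2 / 1000000000000 := by
    rw [← mul_pow]
    refine (pow_le_pow_left₀ (by positivity) hδ 2).trans ?_
    nlinarith [sq_nonneg ρ]
  have hδρ : δ ^ 2 ≤ ρ ^ 2 := by
    have : δ ^ 2 ≤ ℓ ^ 2 * δ ^ 2 := le_mul_of_one_le_left (sq_nonneg _) (by nlinarith)
    nlinarith [sq_nonneg ρ]
  have e1 : ℓ ^ 2 * o ^ 2 * frob V₀ ^ 2 ≤ ρ ^ 2 / 1000000000000 * (2 * ρ ^ 2) :=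
    mul_le_mul ho2 hF (sq_nonneg _) (by positivity)
  have e2 : ℓ ^ 2 * o ^ 2 * frob D ^ 2 ≤ ρ ^ 2 / 1000000000000 * ρ ^ 2 :=
    mul_le_mul ho2 (hD.trans hδρ) (sq_nonneg _) (by positivity)
  have e3 : ℓ ^ 2 * frob D ^ 4 ≤ ρ ^ 2 / 1000000000000 * ρ ^ 2 := by
    calc ℓ ^ 2 * frob D ^ 4 = ℓ ^ 2 * frob D ^ 2 * frob D ^ 2 := by ring
      _ ≤ ℓ ^ 2 * δ ^ 2 * ρ ^ 2 := mul_le_mul (mul_le_mul_of_nonneg_left hD (sq_nonneg _))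
          (hD.trans hδρ) (sq_nonneg _) (by positivity)
      _ ≤ _ := mul_le_mul_of_nonneg_right hd2 (sq_nonneg _)
  have e4 := mul_le_mul_of_nonneg_left h1 (sq_nonneg ℓ)
  have e5 : (98 / 100 * ρ ^ 2) ^ 2 ≤ (frob (V₀ + D) ^ 2) ^ 2 :=
    pow_le_pow_left₀ (by positivity) hσ 2
  have e6 : frob (V₀ + D) ^ 4 = (frob (V₀ + D) ^ 2) ^ 2 := by ring
  rw [e6]
  have e7 : 0 ≤ (ρ ^ 2) ^ 2 := sq_nonneg _
  nlinarith

theorem opLE_gram : OpLE ((V₀ + D) * (V₀ + D)ᵀ) ((o + δ) ^ 2) := by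
  exact (R.op_V₀.add R.o_nonneg R.δ_pos.le
    ((opLE_frob D).mono (frob_nonneg _) R.frob_D)).mul_transpose

theorem scaled_op_le : 160 * ℓ ^ 2 / frob (V₀ + D) ^ 2 * (o + δ) ^ 2 ≤ 1 / 50 := by
  have hσ := R.σ_pos
  have h1 := R.ρ_sq_le
  have h2 : (ℓ * o + ℓ * δ) ^ 2 ≤ (ρ / 1000) ^ 2 := by
    have hℓ := R.one_le_ℓ
    have h0 := R.o_nonneg
    have hδ0 := R.δ_pos
    refine pow_le_pow_left₀ (by positivity) ?_ 2
    linarith [R.ℓ_mul_o_le, R.ℓ_mul_δ_le, R.ρ_pos]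
  rw [div_mul_eq_mul_div, div_le_iff₀ (by positivity)]
  nlinarith

theorem scaled_frob_le :
    32 * ((160 * ℓ ^ 2 / frob (V₀ + D) ^ 2) ^ 2 * frob ((V₀ + D) * (V₀ + D)ᵀ) ^ 2) ≤ ℓ ^ 2 := by
  have hσ := R.σ_pos
  have h1 := R.frob_gram_le
  have h2 : (160 * ℓ ^ 2 / frob (V₀ + D) ^ 2) ^ 2 * frob ((V₀ + D) * (V₀ + D)ᵀ) ^ 2 =
      25600 * ℓ ^ 2 / frob (V₀ + D) ^ 4 * (ℓ ^ 2 * frob ((V₀ + D) * (V₀ + D)ᵀ) ^ 2) := by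
    field_simp; ring
  have h3 : 25600 * ℓ ^ 2 / frob (V₀ + D) ^ 4 * (ℓ ^ 2 * frob ((V₀ + D) * (V₀ + D)ᵀ) ^ 2) ≤
      25600 * ℓ ^ 2 / frob (V₀ + D) ^ 4 * (frob (V₀ + D) ^ 4 / 1000000000) :=
    mul_le_mul_of_nonneg_left h1 (by positivity)
  have h4 : 25600 * ℓ ^ 2 / frob (V₀ + D) ^ 4 * (frob (V₀ + D) ^ 4 / 1000000000) =
      25600 * ℓ ^ 2 / 1000000000 := by field_simp
  rw [h2]
  nlinarith [sq_nonneg ℓ]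

/-- The coefficient vector is rarely much longer than on average. -/
theorem rare_long [NeZero k] (h01 : (0 : Fin k) ≠ 1) :
    Rare k (V₀ + D) θ (30 * ℓ ^ 2) fun x => 5 / 4 * frob (V₀ + D) ^ 2 < sqLen (V₀ + D) x := by
  have hσ := R.σ_pos
  have hop := R.opLE_gram.smul (160 * ℓ ^ 2 / frob (V₀ + D) ^ 2)
  rw [abs_of_nonneg (by positivity)] at hop
  -- scaled to trace `160 ℓ²`, the form is at least `200 ℓ²` on the event; the gap of `40 ℓ²` is enough
  -- for the `31 ℓ²` required and the `ℓ²` of the fluctuations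
  refine R.rare_of_quad h01 (by positivity) R.scaled_op_le hop (ζ := 200 * ℓ ^ 2)
    (fun x hx => ?_) ?_
  · rw [smul_mulVec, dotProduct_smul, quad_mul_transpose, smul_eq_mul, div_mul_eq_mul_div,
      le_div_iff₀ (by positivity)]
    rw [sqLen] at hx
    nlinarith [sq_nonneg ℓ]
  · rw [trace_smul, trace_mul_transpose_self, frob_smul_sq, smul_eq_mul]
    have e : 160 * ℓ ^ 2 / frob (V₀ + D) ^ 2 * frob (V₀ + D) ^ 2 = 160 * ℓ ^ 2 := by field_simp
    rw [e]
    linarith [R.scaled_frob_le, sq_nonneg ℓ]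

/-- The coefficient vector is rarely much shorter than on average. -/
theorem rare_short [NeZero k] (h01 : (0 : Fin k) ≠ 1) :
    Rare k (V₀ + D) θ (30 * ℓ ^ 2) fun x => sqLen (V₀ + D) x < 3 / 4 * frob (V₀ + D) ^ 2 := by
  have hσ := R.σ_pos
  have hop := R.opLE_gram.smul (-(160 * ℓ ^ 2 / frob (V₀ + D) ^ 2))
  rw [abs_neg, abs_of_nonneg (by positivity)] at hop
  -- the same computation for the negated form, of trace `-160 ℓ²`
  refine R.rare_of_quad h01 (by positivity) R.scaled_op_le hop (ζ := -(120 * ℓ ^ 2))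
    (fun x hx => ?_) ?_
  · rw [smul_mulVec, dotProduct_smul, quad_mul_transpose, smul_eq_mul, neg_mul,
      div_mul_eq_mul_div, neg_le_neg_iff, div_le_iff₀ (by positivity)]
    rw [sqLen] at hx
    nlinarith [sq_nonneg ℓ]
  · rw [trace_smul, trace_mul_transpose_self, frob_smul_sq, smul_eq_mul, neg_sq]
    have e : -(160 * ℓ ^ 2 / frob (V₀ + D) ^ 2) * frob (V₀ + D) ^ 2 = -(160 * ℓ ^ 2) := by
      field_simp
    rw [e]
    linarith [R.scaled_frob_le, sq_nonneg ℓ]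

end Regime

/-- First rows for which the acceptance test is a well-conditioned Rademacher tail event: the
coefficient vector has about its mean length, and its coordinates are small up to a negligible
perturbation. -/
structure Typical (V₀ D : Matrix (Fin d) (Fin d) ℝ) (δ h ℓ : ℝ) (x : Fin d → Bool) : Prop where
  short : sqLen (V₀ + D) x ≤ 5 / 4 * frob (V₀ + D) ^ 2
  long : 3 / 4 * frob (V₀ + D) ^ 2 ≤ sqLen (V₀ + D) x
  pert : sqLen D x ≤ 4096 * ℓ ^ 2 * δ ^ 2
  coord : ∀ j, (sv x ᵥ* V₀) j ^ 2 ≤ 4096 * ℓ ^ 2 * h ^ 2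

/-- The matrix with one column kept. -/
def keepCol (V : Matrix (Fin d) (Fin d) ℝ) (j : Fin d) : Matrix (Fin d) (Fin d) ℝ :=
  Matrix.of fun i l => if l = j then V i j else 0

theorem frob_keepCol (V : Matrix (Fin d) (Fin d) ℝ) (j : Fin d) :
    frob (keepCol V j) ^ 2 = ∑ l, V l j ^ 2 := by
  rw [frob_sq]
  refine Finset.sum_congr rfl fun i _ => ?_
  simp [keepCol]

theorem sqLen_keepCol (V : Matrix (Fin d) (Fin d) ℝ) (j : Fin d) (x : Fin d → Bool) :
    sqLen (keepCol V j) x = (sv x ᵥ* V) j ^ 2 := by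
  have h : ∀ l, (sv x ᵥ* keepCol V j) l = if l = j then (sv x ᵥ* V) j else 0 := by
    intro l
    by_cases hl : l = j <;> simp [vecMul, dotProduct, keepCol, hl]
  rw [sqLen, dotProduct]
  simp [h, sq]

/-- Atypical first rows are negligible, with and without acceptance: a union bound over the length, the
perturbation, and the `d` coordinates. -/
theorem Regime.rare_not_typical [NeZero k] (R : Regime ε₁ γ₁ d₀ Θ V₀ D S ρ θ δ h o ℓ)
    (h01 : (0 : Fin k) ≠ 1) :
    open Classical in
    cubeExp (k := k) (fun X => if θ < form (V₀ + D) X 0 1 ∧ ¬ Typical V₀ D δ h ℓ (X 0)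
        then 1 else 0) ≤
      (d + 3) * Real.exp (-(θ ^ 2 / frob (V₀ + D) ^ 2 / 2) - 30 * ℓ ^ 2) ∧
    signExp (fun x => if ¬ Typical V₀ D δ h ℓ x then 1 else 0) ≤
      (d + 3) * Real.exp (-(30 * ℓ ^ 2)) := by
  classical
  have r1 := R.rare_short h01
  have r2 := R.rare_long h01
  have r3 := R.rare_sqLen h01 R.δ_pos R.frob_D
  have r4 : ∀ j, Rare k (V₀ + D) θ (30 * ℓ ^ 2)
      fun x => 4096 * ℓ ^ 2 * h ^ 2 < sqLen (keepCol V₀ j) x := fun j => by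
    refine R.rare_sqLen h01 R.h_pos ?_
    refine abs_le_of_sq_le_sq' ?_ R.h_pos.le |>.2
    rw [frob_keepCol]; exact R.col_le j
  have key : ∀ x, ¬ Typical V₀ D δ h ℓ x →
      sqLen (V₀ + D) x < 3 / 4 * frob (V₀ + D) ^ 2 ∨ 5 / 4 * frob (V₀ + D) ^ 2 < sqLen (V₀ + D) x ∨
      4096 * ℓ ^ 2 * δ ^ 2 < sqLen D x ∨ ∃ j, 4096 * ℓ ^ 2 * h ^ 2 < sqLen (keepCol V₀ j) x := by
    intro x hx
    by_contra! hcon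
    obtain ⟨a1, a2, a3, a4⟩ := hcon
    exact hx ⟨a2, a1, a3, fun j => by rw [← sqLen_keepCol]; exact a4 j⟩
  have ind : ∀ {α : Prop} (x), (if α ∧ ¬ Typical V₀ D δ h ℓ x then (1 : ℝ) else 0) ≤
      (if α ∧ sqLen (V₀ + D) x < 3 / 4 * frob (V₀ + D) ^ 2 then 1 else 0) +
      (if α ∧ 5 / 4 * frob (V₀ + D) ^ 2 < sqLen (V₀ + D) x then 1 else 0) +
      (if α ∧ 4096 * ℓ ^ 2 * δ ^ 2 < sqLen D x then 1 else 0) +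
      ∑ j, if α ∧ 4096 * ℓ ^ 2 * h ^ 2 < sqLen (keepCol V₀ j) x then 1 else 0 := by
    intro α x
    have n0 : ∀ (p : Prop) [Decidable p], (0 : ℝ) ≤ if p then 1 else 0 := fun p _ => by split_ifs <;> norm_num
    have n1 := n0 (α ∧ sqLen (V₀ + D) x < 3 / 4 * frob (V₀ + D) ^ 2)
    have n2 := n0 (α ∧ 5 / 4 * frob (V₀ + D) ^ 2 < sqLen (V₀ + D) x)
    have n3 := n0 (α ∧ 4096 * ℓ ^ 2 * δ ^ 2 < sqLen D x)
    have n4 : (0 : ℝ) ≤ ∑ j, if α ∧ 4096 * ℓ ^ 2 * h ^ 2 < sqLen (keepCol V₀ j) x then 1 else 0 :=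
      Finset.sum_nonneg fun j _ => n0 _
    by_cases hx : α ∧ ¬ Typical V₀ D δ h ℓ x
    · rw [if_pos hx]
      rcases key x hx.2 with h1 | h1 | h1 | ⟨j, h1⟩
      · rw [if_pos (⟨hx.1, h1⟩ : α ∧ _)]; linarith
      · rw [if_pos (⟨hx.1, h1⟩ : α ∧ 5 / 4 * frob (V₀ + D) ^ 2 < sqLen (V₀ + D) x)]; linarith
      · rw [if_pos (⟨hx.1, h1⟩ : α ∧ 4096 * ℓ ^ 2 * δ ^ 2 < sqLen D x)]; linarith
      · have h2 := Finset.single_le_sum (f := fun j => if α ∧ 4096 * ℓ ^ 2 * h ^ 2 <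
          sqLen (keepCol V₀ j) x then (1 : ℝ) else 0) (fun j _ => n0 _) (Finset.mem_univ j)
        rw [if_pos ⟨hx.1, h1⟩] at h2
        linarith
    · rw [if_neg hx]; linarith
  constructor
  · have h1 := isWeight_cube.prodExp_mono fun X : Cube k d => ind (α := θ < form (V₀ + D) X 0 1) (X 0)
    rw [prodExp_add, prodExp_add, prodExp_add, prodExp_sum] at h1
    refine h1.trans ?_
    have h2 := Finset.sum_le_sum fun j (_ : j ∈ Finset.univ) => (r4 j).1
    rw [Finset.sum_const, Finset.card_univ, Fintype.card_fin, nsmul_eq_mul] at h2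
    have h3 := r1.1
    have h4 := r2.1
    have h5 := r3.1
    unfold cubeExp at h2 h3 h4 h5
    linarith
  · have h1 := isWeight_sign.prodExp_mono fun x : Fin d → Bool => ind (α := True) x
    simp only [true_and] at h1
    rw [prodExp_add, prodExp_add, prodExp_add, prodExp_sum] at h1
    refine h1.trans ?_
    have h2 := Finset.sum_le_sum fun j (_ : j ∈ Finset.univ) => (r4 j).2
    rw [Finset.sum_const, Finset.card_univ, Fintype.card_fin, nsmul_eq_mul] at h2
    have h3 := r1.2
    have h4 := r2.2
    have h5 := r3.2
    unfold signExp at h2 h3 h4 h5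
    linarith

end Typical

end

noncomputable section

/-! ### Conditional behaviour given acceptance -/

section Acceptance

variable {m k d : ℕ} {ε₁ γ₁ d₀ : ℝ} {Θ : Fin m → Matrix (Fin d) (Fin d) ℝ}
  {V₀ D : Matrix (Fin d) (Fin d) ℝ} {S ρ θ δ h o ℓ : ℝ}

/-- The constant of the Rademacher tail estimate. -/
def tailConst : ℝ := Classical.choose rademacher_tail

/-- The smallness threshold of the Rademacher tail estimate. -/
def tailSmall : ℝ := Classical.choose (Classical.choose_spec rademacher_tail)

theorem tailConst_pos : 0 < tailConst :=
  (Classical.choose_spec (Classical.choose_spec rademacher_tail)).1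

theorem tailSmall_pos : 0 < tailSmall :=
  (Classical.choose_spec (Classical.choose_spec rademacher_tail)).2.1

/-- Acceptance, conditionally on a typical first row. -/
theorem Regime.tail_of_typical (R : Regime ε₁ γ₁ d₀ Θ V₀ D S ρ θ δ h o ℓ)
    (hε : ε₁ ≤ tailSmall / 1000000) {x : Fin d → Bool} (hx : Typical V₀ D δ h ℓ x) :
    open Classical in
    tailConst / (θ / Real.sqrt (sqLen (V₀ + D) x)) *
        Real.exp (-(θ ^ 2 / sqLen (V₀ + D) x / 2)) ≤
      signExp (fun y => if θ < (sv x ᵥ* (V₀ + D)) ⬝ᵥ sv y then 1 else 0) ∧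
    ∀ j, tailConst * signExp (fun y => if θ < (sv x ᵥ* (V₀ + D)) ⬝ᵥ sv y then 1 else 0) ≤
      signExp (fun y => if θ < (sv x ᵥ* (V₀ + D)) ⬝ᵥ sv y ∧
        θ < (sv x ᵥ* (V₀ + D)) ⬝ᵥ sv (flip y j) then 1 else 0) := by
  classical
  have hτ₀ := tailSmall_pos
  have hρ := R.ρ_pos
  have hθ := R.θ_pos
  have hσ := R.σ_pos
  have hℓ := R.one_le_ℓ
  have hh := R.h_pos
  have hs1 := R.ρ_sq_le
  have hs2 := R.le_ρ_sq
  have hlong := hx.long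
  have hshort := hx.short
  set v := sv x ᵥ* (V₀ + D) with hv
  have hq0 : 0 < sqLen (V₀ + D) x := lt_of_lt_of_le (by positivity) hlong
  set N := Real.sqrt (sqLen (V₀ + D) x) with hN
  have hN0 : 0 < N := Real.sqrt_pos.mpr hq0
  have hN2 : N ^ 2 = sqLen (V₀ + D) x := Real.sq_sqrt hq0.le
  have hNlow : 85 / 100 * ρ ≤ N := by
    refine Real.le_sqrt_of_sq_le ?_
    nlinarith [sq_nonneg ρ]
  have hNup : N ≤ 2 * ρ := by
    rw [hN, Real.sqrt_le_left (by positivity)]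
    nlinarith [sq_nonneg ρ]
  set τ := 256 * (ℓ * h / ρ) with hτ
  have hτ0 : 0 ≤ τ := by positivity
  have hθN : θ = θ / N * N := by field_simp
  have hθρ : θ / N ≤ 100 / 85 * (θ / ρ) := by
    rw [div_le_iff₀ hN0]
    have : 100 / 85 * (θ / ρ) * (85 / 100 * ρ) ≤ 100 / 85 * (θ / ρ) * N :=
      mul_le_mul_of_nonneg_left hNlow (by positivity)
    refine le_trans (le_of_eq ?_) this
    field_simp
  have hT1 : 1 ≤ θ / N := by
    rw [one_le_div hN0]
    have := R.θ_ge_ρ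
    nlinarith
  have hv2 : ∑ j, v j ^ 2 = N ^ 2 := by
    rw [hN2, sqLen, dotProduct]
    exact Finset.sum_congr rfl fun j _ => sq _
  have hTτ : (θ / N) ^ 5 * τ ^ 2 ≤ tailSmall := by
    have h1 := R.light
    calc (θ / N) ^ 5 * τ ^ 2 ≤ (100 / 85 * (θ / ρ)) ^ 5 * τ ^ 2 :=
          mul_le_mul_of_nonneg_right (pow_le_pow_left₀ (by positivity) hθρ 5) (sq_nonneg _)
      _ = (100 / 85) ^ 5 * 65536 * ((θ / ρ) ^ 5 * (ℓ * h / ρ) ^ 2) := by rw [hτ]; ring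
      _ ≤ (100 / 85) ^ 5 * 65536 * ε₁ := mul_le_mul_of_nonneg_left h1 (by norm_num)
      _ ≤ (100 / 85) ^ 5 * 65536 * (tailSmall / 1000000) :=
          mul_le_mul_of_nonneg_left hε (by norm_num)
      _ ≤ tailSmall := by nlinarith
  have hve : ∀ j, v j = (sv x ᵥ* V₀) j + (sv x ᵥ* D) j := fun j => by
    rw [hv, vecMul_add]; rfl
  -- a coordinate outside the light set exceeds twice the bound for `V₀`, so that the perturbation `D`
  -- contributes at least half of it
  have hheavy : ∑ j ∈ (Finset.univ.filter fun j => |v j| ≤ τ * N)ᶜ, v j ^ 2 ≤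
      tailSmall * (N ^ 2 / (θ / N) ^ 2) := by
    have h1 : ∀ j ∈ (Finset.univ.filter fun j => |v j| ≤ τ * N)ᶜ,
        v j ^ 2 ≤ 4 * (sv x ᵥ* D) j ^ 2 := by
      intro j hj
      simp only [Finset.mem_compl, Finset.mem_filter, Finset.mem_univ, true_and, not_le] at hj
      have h2 : |(sv x ᵥ* V₀) j| ≤ 64 * (ℓ * h) := by
        refine abs_le_of_sq_le_sq ?_ (by positivity)
        refine (hx.coord j).trans_eq (by ring)
      have h3 : 128 * (ℓ * h) ≤ τ * N := by
        have : τ * (85 / 100 * ρ) ≤ τ * N := mul_le_mul_of_nonneg_left hNlow hτ0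
        refine le_trans ?_ this
        have e : τ * (85 / 100 * ρ) = 256 * (85 / 100) * (ℓ * h) := by rw [hτ]; field_simp
        rw [e]
        exact mul_le_mul_of_nonneg_right (by norm_num) (by positivity)
      have h4 : |v j| ≤ |(sv x ᵥ* V₀) j| + |(sv x ᵥ* D) j| := by rw [hve]; exact abs_add_le _ _
      have h5 : |v j| ≤ 2 * |(sv x ᵥ* D) j| := by linarith
      rw [← sq_abs (v j), ← sq_abs ((sv x ᵥ* D) j)]
      nlinarith [abs_nonneg (v j)]
    have h2 : ∑ j ∈ (Finset.univ.filter fun j => |v j| ≤ τ * N)ᶜ, v j ^ 2 ≤ 4 * sqLen D x := by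
      refine (Finset.sum_le_sum h1).trans ?_
      rw [← Finset.mul_sum, sqLen, dotProduct]
      refine mul_le_mul_of_nonneg_left ?_ (by norm_num)
      refine (Finset.sum_le_sum_of_subset_of_nonneg (Finset.subset_univ _)
        fun j _ _ => sq_nonneg _).trans_eq ?_
      exact Finset.sum_congr rfl fun j _ => sq _
    refine h2.trans ?_
    have h3 : N ^ 2 / (θ / N) ^ 2 = N ^ 4 / θ ^ 2 := by field_simp
    rw [h3, ← mul_div_assoc, le_div_iff₀ (by positivity)]
    have h4 : (θ * δ * ℓ) ^ 2 ≤ (ε₁ * ρ ^ 2) ^ 2 :=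
      pow_le_pow_left₀ (by have := R.δ_pos; positivity) R.θ_δ 2
    have h5 : 4 * sqLen D x * θ ^ 2 ≤ 16384 * (θ * δ * ℓ) ^ 2 := by
      nlinarith [mul_le_mul_of_nonneg_right hx.pert (sq_nonneg θ)]
    have h6 : (85 / 100 * ρ) ^ 4 ≤ N ^ 4 := pow_le_pow_left₀ (by positivity) hNlow 4
    have h7 : ε₁ ^ 2 ≤ tailSmall / 1000000 * (1 / 1000000) := by
      rw [sq]; exact mul_le_mul hε R.ε_le R.ε_pos.le (by positivity)
    have h8 : (ε₁ * ρ ^ 2) ^ 2 ≤ tailSmall / 1000000 * (1 / 1000000) * ρ ^ 4 := by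
      have : (ε₁ * ρ ^ 2) ^ 2 = ε₁ ^ 2 * ρ ^ 4 := by ring
      rw [this]
      exact mul_le_mul_of_nonneg_right h7 (by positivity)
    have h9 := mul_le_mul_of_nonneg_left h6 hτ₀.le
    have h10 : 0 < tailSmall * ρ ^ 4 := by positivity
    nlinarith
  have key := (Classical.choose_spec (Classical.choose_spec rademacher_tail)).2.2 d v θ N (θ / N) τ
    (Finset.univ.filter fun j => |v j| ≤ τ * N) hN0 hv2 hT1 hθN (fun j hj => by simpa using hj)
    hTτ hheavy
  have e : (θ / N) ^ 2 = θ ^ 2 / sqLen (V₀ + D) x := by rw [div_pow, hN2]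
  rw [e] at key
  refine ⟨?_, fun j => ?_⟩
  · exact key.1
  · exact key.2 j

theorem Regime.exp_log_le (R : Regime ε₁ γ₁ d₀ Θ V₀ D S ρ θ δ h o ℓ) {a : ℝ} (ha : 0 ≤ a) :
    Real.exp (-(a * ℓ ^ 2)) ≤ (d : ℝ) ^ (-a) := by
  have hd : (0 : ℝ) < d := by linarith [R.d_large]
  rw [Real.rpow_def_of_pos hd]
  refine Real.exp_le_exp.mpr ?_
  nlinarith [mul_le_mul_of_nonneg_left R.log_le ha]

/-- Since `ℓ ^ 2` is at least `log d`, the factor `exp (-a ℓ ^ 2)` absorbs `d ^ a`. -/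
theorem Regime.exp_log_le_pow (R : Regime ε₁ γ₁ d₀ Θ V₀ D S ρ θ δ h o ℓ) (a : ℕ) :
    (d : ℝ) ^ a * Real.exp (-(a * ℓ ^ 2)) ≤ 1 := by
  have hd : (0 : ℝ) < d := by linarith [R.d_large]
  have h1 := R.exp_log_le (a := (a : ℝ)) (by positivity)
  have h2 := mul_le_mul_of_nonneg_left h1 (by positivity : 0 ≤ (d : ℝ) ^ a)
  rw [Real.rpow_neg hd.le, Real.rpow_natCast, mul_inv_cancel₀ (by positivity)] at h2
  exact h2

/-- The acceptance probability. -/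
def accProb (k : ℕ) [NeZero k] (V : Matrix (Fin d) (Fin d) ℝ) (θ : ℝ) : ℝ :=
  open Classical in cubeExp (k := k) fun X => if θ < form V X 0 1 then 1 else 0

open Classical in
/-- The acceptance probability involves only the first two rows. -/
theorem accProb_eq [NeZero k] (h01 : (0 : Fin k) ≠ 1) (V : Matrix (Fin d) (Fin d) ℝ) (θ : ℝ) :
    accProb k V θ = signExp fun x => signExp fun y =>
      if θ < (sv x ᵥ* V) ⬝ᵥ sv y then 1 else 0 := by
  rw [accProb, ← cubeExp_two h01 (fun x y => if θ < (sv x ᵥ* V) ⬝ᵥ sv y then (1 : ℝ) else 0)]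
  rfl

/-- With probability at least of order `1 / d²` the coefficient vector is almost as long as its
root mean square. -/
theorem Regime.long_prob (R : Regime ε₁ γ₁ d₀ Θ V₀ D S ρ θ δ h o ℓ) :
    open Classical in
    1 / (2 * (d : ℝ) ^ 2) ≤ signExp fun x =>
      if frob (V₀ + D) ^ 2 * (1 - 1 / (θ ^ 2 / frob (V₀ + D) ^ 2)) ≤ sqLen (V₀ + D) x
        then 1 else 0 := by
  classical
  have hθ := R.θ_pos
  have hσ := R.σ_pos
  have hd : (0 : ℝ) < d := by linarith [R.d_large]
  have hρ := R.ρ_pos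
  set σ := frob (V₀ + D) with hσd
  -- the squared length has mean `σ²` and is at most `d σ²`, so it exceeds `σ² (1 - 1 / t²)` with
  -- probability at least `1 / (d t²)`
  set t2 := θ ^ 2 / σ ^ 2 with ht2
  have ht0 : 0 < t2 := by positivity
  have ht : t2 ≤ 2 * d := by
    have h1 := R.size
    have h2 := R.ρ_sq_le
    rw [ht2, div_le_iff₀ (by positivity)]
    rw [div_pow, div_le_iff₀ (by positivity)] at h1
    nlinarith
  set P := signExp fun x => if σ ^ 2 * (1 - 1 / t2) ≤ sqLen (V₀ + D) x then (1 : ℝ) else 0 with hP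
  have h1 : (signExp fun x => sqLen (V₀ + D) x) ≤ signExp fun x => σ ^ 2 * (1 - 1 / t2) +
      d * σ ^ 2 * (if σ ^ 2 * (1 - 1 / t2) ≤ sqLen (V₀ + D) x then (1 : ℝ) else 0) := by
    refine isWeight_sign.prodExp_mono fun x => ?_
    have ht1 : 1 / t2 ≤ 1 := by
      rw [div_le_one ht0, ht2, le_div_iff₀ (by positivity)]
      have := R.θ_ge_ρ
      have h3 := R.le_ρ_sq
      have h4 : 1000 * ρ ≤ θ := by nlinarith [R.one_le_ℓ]
      nlinarith
    split_ifs with hx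
    · have h3 := sqLen_le (V₀ + D) x
      have h4 : 0 ≤ σ ^ 2 * (1 - 1 / t2) := mul_nonneg (sq_nonneg _) (by linarith)
      linarith
    · linarith
  rw [signExp_sqLen, signExp, prodExp_add, isWeight_sign.prodExp_const, prodExp_const_mul] at h1
  change σ ^ 2 ≤ σ ^ 2 * (1 - 1 / t2) + d * σ ^ 2 * P at h1
  have h2 : σ ^ 2 * (1 / t2) ≤ σ ^ 2 * (d * P) := by linarith
  have h3 := le_of_mul_le_mul_left h2 (by positivity)
  have h4 : 1 / (2 * (d : ℝ)) ≤ 1 / t2 := one_div_le_one_div_of_le ht0 ht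
  have h5 : 1 / (2 * (d : ℝ) ^ 2) = 1 / (2 * d) / d := by field_simp
  rw [h5, div_le_iff₀ hd]
  linarith

/-- Numerical form of the bound on atypical rows. -/
theorem Regime.atypical_le (R : Regime ε₁ γ₁ d₀ Θ V₀ D S ρ θ δ h o ℓ) :
    (d + 3) * Real.exp (-(30 * ℓ ^ 2)) ≤ 1 / (d : ℝ) ^ 28 := by
  have hd := R.d_large
  have hd0 : (0 : ℝ) < d := by linarith
  have h1 := R.exp_log_le_pow 30
  push_cast at h1
  rw [le_div_iff₀ (by positivity)]
  refine le_trans ?_ h1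
  have h2 : (d : ℝ) ^ 30 * Real.exp (-(30 * ℓ ^ 2)) =
      d * d * (Real.exp (-(30 * ℓ ^ 2)) * d ^ 28) := by ring
  rw [h2, mul_assoc]
  exact mul_le_mul_of_nonneg_right (by nlinarith) (by positivity)

/-- A lower bound for the acceptance probability. -/
theorem Regime.accProb_ge [NeZero k] (h01 : (0 : Fin k) ≠ 1)
    (R : Regime ε₁ γ₁ d₀ Θ V₀ D S ρ θ δ h o ℓ)
    (hε : ε₁ ≤ tailSmall / 1000000) (hd₀ : 24 / tailConst ≤ d₀) :
    1 / (d : ℝ) ^ 4 * Real.exp (-(θ ^ 2 / frob (V₀ + D) ^ 2 / 2)) ≤ accProb k (V₀ + D) θ := by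
  classical
  have hc := tailConst_pos
  have hθ := R.θ_pos
  have hσ := R.σ_pos
  have hdl := R.d_large
  have hd : (0 : ℝ) < d := by linarith
  have hρ := R.ρ_pos
  have hs2 := R.le_ρ_sq
  have hs1 := R.ρ_sq_le
  set σ := frob (V₀ + D) with hσd
  set t2 := θ ^ 2 / σ ^ 2 with ht2
  have ht2' : 2 ≤ t2 := by
    rw [ht2, le_div_iff₀ (by positivity)]
    have h4 : 1000 * ρ ≤ θ := by nlinarith [R.θ_ge_ρ, R.one_le_ℓ]
    nlinarith
  have htd : t2 ≤ 2 * d := by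
    have h1 := R.size
    rw [ht2, div_le_iff₀ (by positivity)]
    rw [div_pow, div_le_iff₀ (by positivity)] at h1
    nlinarith
  set c₁ := tailConst / (2 * d) * (Real.exp (-(t2 / 2)) * (1 / 3)) with hc₁
  have hc₁0 : 0 < c₁ := by positivity
  rw [accProb_eq h01]
  -- replacing `σ²` by `σ² (1 - 1 / t²)` in the Gaussian exponent costs only the factor `e`
  have hx : ∀ x : Fin d → Bool, c₁ * ((if σ ^ 2 * (1 - 1 / t2) ≤ sqLen (V₀ + D) x then 1 else 0) -
      if ¬ Typical V₀ D δ h ℓ x then 1 else 0) ≤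
      signExp fun y => if θ < (sv x ᵥ* (V₀ + D)) ⬝ᵥ sv y then 1 else 0 := by
    intro x
    have h0 : 0 ≤ signExp fun y => if θ < (sv x ᵥ* (V₀ + D)) ⬝ᵥ sv y then (1 : ℝ) else 0 :=
      isWeight_sign.prodExp_nonneg fun y => by split_ifs <;> norm_num
    by_cases hT : Typical V₀ D δ h ℓ x
    · rw [if_neg (not_not.mpr hT)]
      split_ifs with hl
      · refine le_trans ?_ (R.tail_of_typical hε hT).1
        have hq0 : 0 < sqLen (V₀ + D) x := lt_of_lt_of_le (by positivity) hT.long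
        have hTt : θ ^ 2 / sqLen (V₀ + D) x ≤ t2 + 2 := by
          rw [div_le_iff₀ hq0]
          have h1 : (t2 + 2) * (σ ^ 2 * (1 - 1 / t2)) ≤ (t2 + 2) * sqLen (V₀ + D) x :=
            mul_le_mul_of_nonneg_left hl (by linarith)
          refine le_trans ?_ h1
          have h2 : θ ^ 2 = t2 * σ ^ 2 := by rw [ht2]; field_simp
          have h3 : (t2 + 2) * (σ ^ 2 * (1 - 1 / t2)) = σ ^ 2 * ((t2 + 2) * (1 - 1 / t2)) := by ring
          rw [h2, h3, mul_comm]
          refine mul_le_mul_of_nonneg_left ?_ (sq_nonneg _)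
          have h4 : (t2 + 2) * (1 - 1 / t2) = t2 + 1 - 2 / t2 := by field_simp; ring
          have h5 : 2 / t2 ≤ 1 := by rw [div_le_one (by linarith)]; exact ht2'
          linarith
        have hT2 : θ / Real.sqrt (sqLen (V₀ + D) x) ≤ 2 * d := by
          refine abs_le_of_sq_le_sq' ?_ (by positivity) |>.2
          rw [div_pow, Real.sq_sqrt hq0.le]
          nlinarith
        have hpos : 0 < θ / Real.sqrt (sqLen (V₀ + D) x) := div_pos hθ (Real.sqrt_pos.mpr hq0)
        rw [sub_zero, mul_one, hc₁]
        refine mul_le_mul (div_le_div_of_nonneg_left hc.le hpos hT2) ?_ (by positivity)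
          (by positivity)
        have h3 : Real.exp (-(t2 / 2)) * (1 / 3) ≤ Real.exp (-(t2 / 2)) * Real.exp (-1) := by
          refine mul_le_mul_of_nonneg_left ?_ (Real.exp_pos _).le
          rw [Real.exp_neg, one_div]
          exact inv_anti₀ (Real.exp_pos _) (by linarith [Real.exp_one_lt_d9])
        refine h3.trans ?_
        rw [← Real.exp_add]
        exact Real.exp_le_exp.mpr (by linarith)
      · rw [sub_zero, mul_zero]; exact h0
    · rw [if_pos hT]
      refine le_trans ?_ h0
      refine mul_nonpos_of_nonneg_of_nonpos hc₁0.le ?_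
      split_ifs <;> norm_num
  refine le_trans ?_ (isWeight_sign.prodExp_mono hx)
  rw [prodExp_const_mul, prodExp_sub]
  have h1 := R.long_prob
  have h2 := (R.rare_not_typical h01).2
  have h3 := R.atypical_le
  simp only [← hσd, ← ht2] at h1
  unfold signExp at h1 h2
  have h4 : 1 / (d : ℝ) ^ 28 ≤ 1 / (4 * (d : ℝ) ^ 2) := by
    refine one_div_le_one_div_of_le (by positivity) ?_
    have e : (d : ℝ) ^ 28 = d ^ 26 * d ^ 2 := by ring
    rw [e]
    refine mul_le_mul_of_nonneg_right ?_ (by positivity)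
    have : (d : ℝ) ^ 1 ≤ d ^ 26 := pow_le_pow_right₀ (by linarith) (by norm_num)
    linarith
  have h5 : 1 / (2 * (d : ℝ) ^ 2) = 2 * (1 / (4 * (d : ℝ) ^ 2)) := by field_simp; norm_num
  have h6 : c₁ * (1 / (4 * (d : ℝ) ^ 2)) ≤ c₁ * (prodExp (unif (Fin d) Bool) (fun x =>
      if σ ^ 2 * (1 - 1 / t2) ≤ sqLen (V₀ + D) x then (1 : ℝ) else 0) -
      prodExp (unif (Fin d) Bool) fun x => if ¬ Typical V₀ D δ h ℓ x then 1 else 0) := by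
    refine mul_le_mul_of_nonneg_left ?_ hc₁0.le
    linarith
  refine le_trans ?_ h6
  have h7 : c₁ * (1 / (4 * (d : ℝ) ^ 2)) = tailConst * d / 24 *
      (1 / (d : ℝ) ^ 4 * Real.exp (-(t2 / 2))) := by rw [hc₁]; field_simp; norm_num
  rw [h7]
  refine le_mul_of_one_le_left (by positivity) ?_
  have h8 := hd₀.trans R.d_ge
  rw [div_le_iff₀ hc] at h8
  linarith

/-- Acceptance with an atypical first row has at most half of the acceptance probability. -/
theorem Regime.accept_atypical_le [NeZero k] (h01 : (0 : Fin k) ≠ 1)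
    (R : Regime ε₁ γ₁ d₀ Θ V₀ D S ρ θ δ h o ℓ)
    (hε : ε₁ ≤ tailSmall / 1000000) (hd₀ : 24 / tailConst ≤ d₀) :
    open Classical in
    cubeExp (k := k) (fun X => if θ < form (V₀ + D) X 0 1 ∧ ¬ Typical V₀ D δ h ℓ (X 0)
        then 1 else 0) ≤ accProb k (V₀ + D) θ / 2 := by
  have h1 := (R.rare_not_typical h01).1
  have h2 := R.accProb_ge h01 hε hd₀
  have hd := R.d_large
  have hd0 : (0 : ℝ) < d := by linarith
  refine h1.trans ?_
  rw [sub_eq_add_neg, Real.exp_add]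
  have h3 := mul_le_mul_of_nonneg_left R.atypical_le
    (Real.exp_pos (-(θ ^ 2 / frob (V₀ + D) ^ 2 / 2))).le
  have h4 : 1 / (d : ℝ) ^ 28 ≤ 1 / (d : ℝ) ^ 4 / 2 := by
    rw [div_div]
    refine one_div_le_one_div_of_le (by positivity) ?_
    have e : (d : ℝ) ^ 28 = d ^ 4 * d ^ 24 := by ring
    rw [e]
    refine mul_le_mul_of_nonneg_left ?_ (by positivity)
    have : (d : ℝ) ^ 1 ≤ d ^ 24 := pow_le_pow_right₀ (by linarith) (by norm_num)
    linarith
  have h5 := mul_le_mul_of_nonneg_left h4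
    (Real.exp_pos (-(θ ^ 2 / frob (V₀ + D) ^ 2 / 2))).le
  linarith

/-- Given acceptance, the second row is well-conditioned. -/
theorem Regime.gram_ge [NeZero k] (h01 : (0 : Fin k) ≠ 1)
    (R : Regime ε₁ γ₁ d₀ Θ V₀ D S ρ θ δ h o ℓ)
    (hε : ε₁ ≤ tailSmall / 1000000) (hd₀ : 24 / tailConst ≤ d₀) (w : Fin d → ℝ) :
    open Classical in
    tailConst / (2 * d) * (w ⬝ᵥ w) * accProb k (V₀ + D) θ ≤
      cubeExp (k := k) fun X => if θ < form (V₀ + D) X 0 1 then (w ⬝ᵥ sv (X 1)) ^ 2 else 0 := by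
  classical
  have hc := tailConst_pos
  have hd : (0 : ℝ) < d := by linarith [R.d_large]
  have hw := dotProduct_self_nonneg' w
  have h1 := R.accept_atypical_le h01 hε hd₀
  have h2 : accProb k (V₀ + D) θ = cubeExp (k := k) (fun X => if θ < form (V₀ + D) X 0 1 ∧
      ¬ Typical V₀ D δ h ℓ (X 0) then 1 else 0) + cubeExp (k := k) (fun X =>
      if θ < form (V₀ + D) X 0 1 ∧ Typical V₀ D δ h ℓ (X 0) then 1 else 0) := by
    rw [accProb, cubeExp, cubeExp, cubeExp, ← prodExp_add]
    congr 1; funext X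
    by_cases ha : θ < form (V₀ + D) X 0 1 <;> by_cases hb : Typical V₀ D δ h ℓ (X 0) <;>
      simp [ha, hb]
  have h3 : accProb k (V₀ + D) θ / 2 ≤ cubeExp (k := k) (fun X =>
      if θ < form (V₀ + D) X 0 1 ∧ Typical V₀ D δ h ℓ (X 0) then 1 else 0) := by
    linarith
  have e1 : cubeExp (k := k) (fun X =>
      if θ < form (V₀ + D) X 0 1 ∧ Typical V₀ D δ h ℓ (X 0) then (1 : ℝ) else 0) =
      signExp fun x => signExp fun y =>
        if θ < (sv x ᵥ* (V₀ + D)) ⬝ᵥ sv y ∧ Typical V₀ D δ h ℓ x then 1 else 0 := by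
    rw [← cubeExp_two h01 (fun x y => if θ < (sv x ᵥ* (V₀ + D)) ⬝ᵥ sv y ∧ Typical V₀ D δ h ℓ x
      then (1 : ℝ) else 0)]
    rfl
  have e2 : (cubeExp (k := k) fun X => if θ < form (V₀ + D) X 0 1 then (w ⬝ᵥ sv (X 1)) ^ 2 else 0) =
      signExp fun x => signExp fun y =>
        if θ < (sv x ᵥ* (V₀ + D)) ⬝ᵥ sv y then (w ⬝ᵥ sv y) ^ 2 else 0 := by
    rw [← cubeExp_two h01 (fun x y => if θ < (sv x ᵥ* (V₀ + D)) ⬝ᵥ sv y then (w ⬝ᵥ sv y) ^ 2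
      else 0)]
    rfl
  rw [e1] at h3
  rw [e2]
  have h4 : (signExp fun x => tailConst / d * (w ⬝ᵥ w) * signExp fun y =>
      if θ < (sv x ᵥ* (V₀ + D)) ⬝ᵥ sv y ∧ Typical V₀ D δ h ℓ x then 1 else 0) ≤
      signExp fun x => signExp fun y =>
        if θ < (sv x ᵥ* (V₀ + D)) ⬝ᵥ sv y then (w ⬝ᵥ sv y) ^ 2 else 0 := by
    refine isWeight_sign.prodExp_mono fun x => ?_
    by_cases hT : Typical V₀ D δ h ℓ x
    · simp only [hT, and_true]
      have h5 := le_signExp_sq_of_flip (R.tail_of_typical hε hT).2 w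
      have h6 : tailConst / d * (w ⬝ᵥ w) * (signExp fun y =>
          if θ < (sv x ᵥ* (V₀ + D)) ⬝ᵥ sv y then (1 : ℝ) else 0) = tailConst * (w ⬝ᵥ w) *
          (signExp fun y => if θ < (sv x ᵥ* (V₀ + D)) ⬝ᵥ sv y then (1 : ℝ) else 0) / d := by
        field_simp
      rw [h6, div_le_iff₀ hd, mul_comm _ (d : ℝ)]
      exact h5
    · simp only [hT, and_false, if_false]
      rw [signExp, isWeight_sign.prodExp_const, mul_zero]
      exact isWeight_sign.prodExp_nonneg fun y => by split_ifs <;> positivity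
  refine le_trans ?_ h4
  rw [signExp, prodExp_const_mul]
  have h7 : tailConst / (2 * d) * (w ⬝ᵥ w) * accProb k (V₀ + D) θ =
      tailConst / d * (w ⬝ᵥ w) * (accProb k (V₀ + D) θ / 2) := by field_simp
  rw [h7]
  exact mul_le_mul_of_nonneg_left h3 (by positivity)

/-- The samples on which every head attends from the first to the second token. -/
def Focused [NeZero k] (Θ : Fin m → Matrix (Fin d) (Fin d) ℝ) (θ : ℝ) (X : Cube k d) : Prop :=
  ∀ i, θ / 2 ≤ form (Θ i) X 0 1 ∧ ∀ a, a ≠ 1 → form (Θ i) X 0 a ≤ θ / 4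

/-- Given acceptance, unfocused samples are rare. -/
theorem Regime.accept_unfocused_le [NeZero k] (h01 : (0 : Fin k) ≠ 1)
    (R : Regime ε₁ γ₁ d₀ Θ V₀ D S ρ θ δ h o ℓ)
    (hε : ε₁ ≤ tailSmall / 1000000) (hd₀ : 24 / tailConst ≤ d₀) (hmk : (m : ℝ) * k ≤ d) {Γ : ℕ}
    (hΓ : 2500 * ((Γ : ℝ) + 6) ≤ γ₁) :
    open Classical in
    (d : ℝ) ^ Γ * cubeExp (k := k) (fun X => if θ < form (V₀ + D) X 0 1 ∧ ¬ Focused Θ θ X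
        then 1 else 0) ≤ accProb k (V₀ + D) θ := by
  classical
  have hd := R.d_large
  have hd0 : (0 : ℝ) < d := by linarith
  set E := Real.exp (-(θ ^ 2 / frob (V₀ + D) ^ 2 / 2) - θ ^ 2 / S ^ 2 / 2500) with hE
  have key : ∀ X : Cube k d, ¬ Focused Θ θ X → ∃ i, form (Θ i) X 0 1 < θ / 2 ∨
      ∃ a, a ≠ 1 ∧ θ / 4 < form (Θ i) X 0 a := by
    intro X hX
    simp only [Focused, not_forall] at hX
    obtain ⟨i, hi⟩ := hX
    refine ⟨i, ?_⟩
    by_contra! hcon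
    exact hi ⟨hcon.1, hcon.2⟩
  have n0 : ∀ (p : Prop) [Decidable p], (0 : ℝ) ≤ if p then 1 else 0 := fun p _ => by
    split_ifs <;> norm_num
  have ind : ∀ X : Cube k d, (if θ < form (V₀ + D) X 0 1 ∧ ¬ Focused Θ θ X then (1 : ℝ) else 0) ≤
      ∑ i, ((if θ < form (V₀ + D) X 0 1 ∧ form (Θ i) X 0 1 < θ / 2 then 1 else 0) +
      ∑ a, if a ≠ 1 then (if θ < form (V₀ + D) X 0 1 ∧ θ / 4 < form (Θ i) X 0 a then 1 else 0)
        else 0) := by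
    intro X
    have n1 : ∀ i a, (0 : ℝ) ≤ if a ≠ 1 then (if θ < form (V₀ + D) X 0 1 ∧
        θ / 4 < form (Θ i) X 0 a then 1 else 0) else 0 := fun i a => by
      by_cases ha : a ≠ 1
      · rw [if_pos ha]; exact n0 _
      · rw [if_neg ha]
    have n2 : ∀ i, (0 : ℝ) ≤ (if θ < form (V₀ + D) X 0 1 ∧ form (Θ i) X 0 1 < θ / 2 then 1 else 0) +
      ∑ a, if a ≠ 1 then (if θ < form (V₀ + D) X 0 1 ∧ θ / 4 < form (Θ i) X 0 a then 1 else 0)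
        else 0 := fun i => add_nonneg (n0 _) (Finset.sum_nonneg fun a _ => n1 i a)
    by_cases hX : θ < form (V₀ + D) X 0 1 ∧ ¬ Focused Θ θ X
    · rw [if_pos hX]
      obtain ⟨i, hi⟩ := key X hX.2
      refine le_trans ?_ (Finset.single_le_sum (fun i _ => n2 i) (Finset.mem_univ i))
      rcases hi with hi | ⟨a, ha, hi⟩
      · rw [if_pos ⟨hX.1, hi⟩]
        linarith [Finset.sum_nonneg fun a (_ : a ∈ Finset.univ) => n1 i a]
      · have h1 := Finset.single_le_sum (fun a _ => n1 i a) (Finset.mem_univ a)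
        rw [if_pos ha, if_pos ⟨hX.1, hi⟩] at h1
        linarith [n0 (θ < form (V₀ + D) X 0 1 ∧ form (Θ i) X 0 1 < θ / 2)]
    · rw [if_neg hX]
      exact Finset.sum_nonneg fun i _ => n2 i
  have h1 := isWeight_cube.prodExp_mono ind
  rw [prodExp_sum] at h1
  have h2 : ∀ i, prodExp (unif (Fin k) (Fin d → Bool)) (fun X : Cube k d =>
      (if θ < form (V₀ + D) X 0 1 ∧ form (Θ i) X 0 1 < θ / 2 then 1 else 0) +
      ∑ a, if a ≠ 1 then (if θ < form (V₀ + D) X 0 1 ∧ θ / 4 < form (Θ i) X 0 a then 1 else 0)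
        else 0) ≤ (1 + k) * E := by
    intro i
    rw [prodExp_add, prodExp_sum, add_mul, one_mul]
    refine add_le_add (R.accept_pair_le h01 i) ?_
    have h3 : ∀ a : Fin k, prodExp (unif (Fin k) (Fin d → Bool)) (fun X : Cube k d =>
        if a ≠ 1 then (if θ < form (V₀ + D) X 0 1 ∧ θ / 4 < form (Θ i) X 0 a then (1 : ℝ) else 0)
          else 0) ≤ E := by
      intro a
      by_cases ha1 : a = 1
      · simp only [ha1, ne_eq, not_true_eq_false, if_false]
        rw [isWeight_cube.prodExp_const]
        exact (Real.exp_pos _).le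
      · simp only [ne_eq, ha1, not_false_eq_true, if_true]
        by_cases ha0 : a = 0
        · subst ha0
          exact R.accept_self_le h01 i
        · exact R.accept_other_le h01 ha0 ha1 i
    refine (Finset.sum_le_sum fun a _ => h3 a).trans_eq ?_
    simp
  have h4 := h1.trans (Finset.sum_le_sum fun i _ => h2 i)
  rw [Finset.sum_const, Finset.card_univ, Fintype.card_fin, nsmul_eq_mul] at h4
  have hℓ := R.one_le_ℓ
  -- `Γ + 6` powers of `d` are needed: four for the lower bound on the acceptance probability, and two
  -- for the union over heads and tokens
  have hE1 : E ≤ Real.exp (-(θ ^ 2 / frob (V₀ + D) ^ 2 / 2)) *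
      Real.exp (-(((Γ + 6 : ℕ) : ℝ) * ℓ ^ 2)) := by
    rw [← Real.exp_add, hE]
    refine Real.exp_le_exp.mpr ?_
    have hS := R.S_pos
    have h5 : γ₁ * ℓ ^ 2 ≤ θ ^ 2 / S ^ 2 := by
      rw [le_div_iff₀ (by positivity)]
      have h6 : (γ₁ * ℓ * S) ^ 2 ≤ θ ^ 2 := by
        have := R.γ_ge
        exact pow_le_pow_left₀ (by positivity) R.θ_ge 2
      refine le_trans ?_ h6
      have h7 : γ₁ ≤ γ₁ ^ 2 := by nlinarith [R.γ_ge]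
      have h8 := mul_le_mul_of_nonneg_right h7 (by positivity : 0 ≤ ℓ ^ 2 * S ^ 2)
      nlinarith
    have h9 := mul_le_mul_of_nonneg_right hΓ (sq_nonneg ℓ)
    push_cast
    linarith
  have h5 := R.exp_log_le_pow (Γ + 6)
  have h6 := R.accProb_ge h01 hε hd₀
  have hmk2 : (m : ℝ) * (1 + k) ≤ d ^ 2 := by
    have hk : (1 : ℝ) ≤ k := by exact_mod_cast Nat.one_le_iff_ne_zero.mpr (NeZero.ne k)
    have hm : (m : ℝ) * 1 ≤ m * k := mul_le_mul_of_nonneg_left hk (by positivity)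
    nlinarith
  have hE0 : 0 < E := Real.exp_pos _
  set F := Real.exp (-(θ ^ 2 / frob (V₀ + D) ^ 2 / 2)) with hF
  set G := Real.exp (-(((Γ + 6 : ℕ) : ℝ) * ℓ ^ 2)) with hG
  have hF0 : 0 < F := Real.exp_pos _
  calc (d : ℝ) ^ Γ * cubeExp (k := k) (fun X => if θ < form (V₀ + D) X 0 1 ∧ ¬ Focused Θ θ X
        then 1 else 0) ≤ d ^ Γ * (m * ((1 + k) * E)) :=
        mul_le_mul_of_nonneg_left h4 (by positivity)
    _ = m * (1 + k) * (d ^ Γ * E) := by ring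
    _ ≤ d ^ 2 * (d ^ Γ * (F * G)) := by gcongr
    _ = 1 / (d : ℝ) ^ 4 * F * (d ^ (Γ + 6) * G) := by
        rw [pow_add]; field_simp
    _ ≤ 1 / (d : ℝ) ^ 4 * F * 1 := mul_le_mul_of_nonneg_left h5 (by positivity)
    _ ≤ _ := by rw [mul_one]; exact h6

end Acceptance

end

noncomputable section

/-! ### The weighted average of nearly orthogonal matrices -/

section WeightedAverage

variable {m d : ℕ} {Θ : Fin m → Matrix (Fin d) (Fin d) ℝ}

theorem frobInner_weightedAverage (B : Matrix (Fin d) (Fin d) ℝ)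
    (hZ : 0 < weightZ Θ) :
    weightZ Θ * frobInner (weightedAverage Θ) B = ∑ i, 1 / frob (Θ i) ^ 2 * frobInner (Θ i) B := by
  rw [weightedAverage, frobInner_smul_left, frobInner_sum_left]
  simp only [frobInner_smul_left]
  field_simp

/-- The weights of the average are such that its inner product with every `Θ i` is about `1 / Z`. -/
theorem abs_inner_weightedAverage_le {η : ℝ} (hf : ∀ i, 0 < frob (Θ i)) (hZ : 0 < weightZ Θ)
    (h : ∀ i j, i ≠ j → |frobInner (Θ i) (Θ j)| ≤ η * frob (Θ i) ^ 2) (hη : 0 ≤ η) (i : Fin m) :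
    |weightZ Θ * frobInner (weightedAverage Θ) (Θ i) - 1| ≤ m * η := by
  rw [frobInner_weightedAverage _ hZ]
  have h1 : ∑ j, 1 / frob (Θ j) ^ 2 * frobInner (Θ j) (Θ i) - 1 =
      ∑ j, (1 / frob (Θ j) ^ 2 * frobInner (Θ j) (Θ i) - if j = i then 1 else 0) := by
    rw [Finset.sum_sub_distrib]; simp
  rw [h1]
  refine (Finset.abs_sum_le_sum_abs _ _).trans ?_
  refine (Finset.sum_le_sum (g := fun _ => η) fun j _ => ?_).trans_eq (by simp)
  have hj := hf j
  by_cases hji : j = i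
  · subst hji
    rw [frobInner_self, if_pos rfl, one_div_mul_cancel (by positivity)]
    simpa using hη
  · rw [if_neg hji, sub_zero, abs_mul, abs_of_pos (by positivity), one_div_mul_eq_div,
      div_le_iff₀ (by positivity)]
    exact h j i hji

/-- The squared norm of the weighted average is about `1 / Z`. -/
theorem abs_frob_weightedAverage_le {η : ℝ} (hf : ∀ i, 0 < frob (Θ i)) (hZ : 0 < weightZ Θ)
    (h : ∀ i, |weightZ Θ * frobInner (weightedAverage Θ) (Θ i) - 1| ≤ η) :
    |weightZ Θ * frob (weightedAverage Θ) ^ 2 - 1| ≤ η := by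
  have h1 := frobInner_weightedAverage (weightedAverage Θ) hZ
  rw [frobInner_self] at h1
  have h2 : weightZ Θ * (weightZ Θ * frob (weightedAverage Θ) ^ 2 - 1) =
      ∑ i, 1 / frob (Θ i) ^ 2 * (weightZ Θ * frobInner (weightedAverage Θ) (Θ i) - 1) := by
    simp only [mul_sub, Finset.sum_sub_distrib, mul_one]
    rw [h1, Finset.mul_sum]
    congr 1
    refine Finset.sum_congr rfl fun i _ => ?_
    rw [frobInner_comm (Θ i)]; ring
  have h3 : weightZ Θ * |weightZ Θ * frob (weightedAverage Θ) ^ 2 - 1| ≤ weightZ Θ * η := by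
    rw [← abs_of_pos hZ, ← abs_mul, abs_of_pos hZ, h2]
    refine (Finset.abs_sum_le_sum_abs _ _).trans ?_
    rw [weightZ, Finset.sum_mul]
    refine Finset.sum_le_sum fun i _ => ?_
    have := hf i
    rw [abs_mul, abs_of_pos (by positivity)]
    exact mul_le_mul_of_nonneg_left (h i) (by positivity)
  exact le_of_mul_le_mul_left h3 hZ

theorem opLE_weightedAverage {o : ℝ} (hf : ∀ i, 0 < frob (Θ i)) (hZ : 0 < weightZ Θ) (ho : 0 ≤ o)
    (h : ∀ i, OpLE (Θ i) o) : OpLE (weightedAverage Θ) o := by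
  have h1 : ∀ i, OpLE ((1 / frob (Θ i) ^ 2) • Θ i) (1 / frob (Θ i) ^ 2 * o) := fun i => by
    have := hf i
    have h2 := (h i).smul (1 / frob (Θ i) ^ 2)
    rwa [abs_of_pos (by positivity)] at h2
  have h3 := (OpLE.sum Finset.univ (fun i => by have := hf i; positivity) h1).smul (1 / weightZ Θ)
  rw [abs_of_pos (by positivity), ← Finset.sum_mul] at h3
  have e : 1 / weightZ Θ * ((∑ i, 1 / frob (Θ i) ^ 2) * o) = o := by
    change 1 / weightZ Θ * (weightZ Θ * o) = o
    field_simp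
  rw [e] at h3
  exact h3

/-- The Cauchy–Schwarz inequality with weights. -/
theorem sq_sum_mul_le {ι : Type*} (s : Finset ι) (w a : ι → ℝ) (hw : ∀ i, 0 ≤ w i) :
    (∑ i ∈ s, w i * a i) ^ 2 ≤ (∑ i ∈ s, w i) * ∑ i ∈ s, w i * a i ^ 2 := by
  have h := Finset.sum_mul_sq_le_sq_mul_sq s (fun i => Real.sqrt (w i))
    (fun i => Real.sqrt (w i) * a i)
  have e1 : ∀ i, Real.sqrt (w i) * (Real.sqrt (w i) * a i) = w i * a i := fun i => by
    rw [← mul_assoc, Real.mul_self_sqrt (hw i)]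
  have e2 : ∀ i, Real.sqrt (w i) ^ 2 = w i := fun i => Real.sq_sqrt (hw i)
  simpa only [e1, mul_pow, e2] using h

/-- The columns of the weighted average are as short as those of the averaged matrices. -/
theorem weightedAverage_col_le {h : ℝ} (hf : ∀ i, 0 < frob (Θ i)) (hZ : 0 < weightZ Θ)
    (j : Fin d) (hc : ∀ i, ∑ l, Θ i l j ^ 2 ≤ h ^ 2) :
    ∑ l, weightedAverage Θ l j ^ 2 ≤ h ^ 2 := by
  have h1 : ∀ l, weightedAverage Θ l j ^ 2 ≤
      1 / weightZ Θ * ∑ i, 1 / frob (Θ i) ^ 2 * Θ i l j ^ 2 := by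
    intro l
    have e : weightedAverage Θ l j = 1 / weightZ Θ * ∑ i, 1 / frob (Θ i) ^ 2 * Θ i l j := by
      simp [weightedAverage, Matrix.sum_apply]
    rw [e, mul_pow]
    have h2 := sq_sum_mul_le Finset.univ (fun i => 1 / frob (Θ i) ^ 2) (fun i => Θ i l j)
      fun i => by have := hf i; positivity
    refine (mul_le_mul_of_nonneg_left h2 (sq_nonneg _)).trans_eq ?_
    change (1 / weightZ Θ) ^ 2 * (weightZ Θ * _) = _
    field_simp
  refine (Finset.sum_le_sum fun l _ => h1 l).trans ?_
  rw [← Finset.mul_sum, Finset.sum_comm]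
  have h3 : ∑ i, ∑ l, 1 / frob (Θ i) ^ 2 * Θ i l j ^ 2 ≤ weightZ Θ * h ^ 2 := by
    rw [weightZ, Finset.sum_mul]
    refine Finset.sum_le_sum fun i _ => ?_
    rw [← Finset.mul_sum]
    have := hf i
    exact mul_le_mul_of_nonneg_left (hc i) (by positivity)
  calc _ ≤ 1 / weightZ Θ * (weightZ Θ * h ^ 2) := mul_le_mul_of_nonneg_left h3 (by positivity)
    _ = _ := by field_simp

end WeightedAverage

/-! ### Consequences of the smallness of the parameters -/

section Parameters

/-- The constant `ε` of the non-degeneracy assumptions that leads to the regime with the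
parameters `ε₁`, `γ₁`, `d₀`. -/
def smallConst (A ε₁ γ₁ d₀ : ℝ) : ℝ :=
  min (ε₁ ^ 2 / (16 * γ₁ ^ 4)) (min (1 / 1000) (min (1 / d₀) (1 / (1 + A ^ 3))))

/-- Standing assumptions on real parameters, freed of fractional powers. -/
structure SmallParams (ε A ε₁ γ₁ d₀ : ℝ) (m k d lam κ r υ ω L : ℝ) : Prop where
  ε_pos : 0 < ε
  ε_le : ε ≤ 1 / 1000
  ε_le₁ : 16 * γ₁ ^ 4 * ε ≤ ε₁ ^ 2
  ε₁_pos : 0 < ε₁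
  ε₁_le : ε₁ ≤ 1 / 1000000
  γ_ge : 1000 ≤ γ₁
  A_pos : 0 < A
  ε_A : A ^ 3 * ε ≤ 1
  one_le_m : 1 ≤ m
  one_le_k : 1 ≤ k
  d_ge : d₀ ≤ d
  d_large : 100 ≤ d
  lam_pos : 0 < lam
  lam_le : lam ≤ 1
  κ_pos : 0 < κ
  κ_le : κ * m ^ 6 * L ^ 2 ≤ ε * lam ^ 6
  one_le_r : 1 ≤ r
  r_le : r ^ 4 ≤ d
  υ_pos : 1 ≤ υ
  υ_le : υ * r ^ 2 ≤ ε * Real.sqrt d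
  one_le_ω : 1 ≤ ω
  ω_le : ω ^ 2 * L ≤ ε ^ 2 * lam ^ 3 * m * κ * r
  one_le_L : 1 ≤ L
  m_le : m ≤ A * k
  k_le : k ≤ A * r
  r_le' : r ^ 2 ≤ ε ^ 2 * d

namespace SmallParams

variable {ε A ε₁ γ₁ d₀ : ℝ} {m k d lam κ r υ ω L : ℝ}
  (P : SmallParams ε A ε₁ γ₁ d₀ m k d lam κ r υ ω L)
include P

theorem mk_le : m * k ≤ d := by
  have hA := P.A_pos
  have h1 := P.one_le_k
  have hr := P.one_le_r
  have hε := P.ε_pos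
  calc m * k ≤ A * k * k := mul_le_mul_of_nonneg_right P.m_le (by linarith)
    _ = A * k ^ 2 := by ring
    _ ≤ A * (A * r) ^ 2 :=
        mul_le_mul_of_nonneg_left (pow_le_pow_left₀ (by linarith) P.k_le 2) hA.le
    _ = A ^ 3 * r ^ 2 := by ring
    _ ≤ A ^ 3 * (ε ^ 2 * d) := mul_le_mul_of_nonneg_left P.r_le' (by positivity)
    _ = (A ^ 3 * ε) * (ε * d) := by ring
    _ ≤ 1 * (1 * d) := by
        have := P.d_large
        refine mul_le_mul P.ε_A (mul_le_mul_of_nonneg_right ?_ (by linarith)) (by positivity)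
          (by norm_num)
        linarith [P.ε_le]
    _ = d := by ring

theorem ε_le_ε₁ : ε ≤ ε₁ ^ 2 := by
  have h1 := P.γ_ge
  have h2 : 1 ≤ 16 * γ₁ ^ 4 := by
    have : (1 : ℝ) ≤ γ₁ ^ 4 := one_le_pow₀ (by linarith)
    linarith
  nlinarith [P.ε_le₁, P.ε_pos]

theorem γε_le : 16 * γ₁ ^ 4 * ε ^ 3 ≤ ε₁ ^ 2 := by
  refine le_trans ?_ P.ε_le₁
  have h0 := P.ε_pos
  have h1 : ε ^ 3 ≤ ε := by
    have : ε ^ 3 = ε * (ε * ε) := by ring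
    rw [this]
    have := P.ε_le
    exact mul_le_of_le_one_right h0.le (by nlinarith)
  exact mul_le_mul_of_nonneg_left h1 (by positivity)

/-- Here and below `t` stands for `θ / ρ`, the threshold in standard deviations; its square is much
smaller than the effective rank. -/
theorem t_sq_le {t : ℝ} (ht : t ^ 2 * lam ^ 4 ≤ 4 * γ₁ ^ 2 * (ω ^ 2 * L) * m) :
    t ^ 2 * (m ^ 4 * L ^ 2) ≤ 4 * γ₁ ^ 2 * ε ^ 3 * lam ^ 5 * r := by
  have hl := P.lam_pos
  have hm := P.one_le_m
  have hr := P.one_le_r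
  have hε := P.ε_pos
  have hL := P.one_le_L
  have h1 : t ^ 2 * lam ^ 4 ≤ 4 * γ₁ ^ 2 * (ε ^ 2 * lam ^ 3 * m * κ * r) * m :=
    ht.trans (by have := P.ω_le; gcongr)
  have h2 : lam ^ 4 * (t ^ 2 * (m ^ 4 * L ^ 2)) ≤
      4 * γ₁ ^ 2 * ε ^ 2 * lam ^ 3 * r * (κ * m ^ 6 * L ^ 2) := by
    have := mul_le_mul_of_nonneg_right h1 (by positivity : 0 ≤ m ^ 4 * L ^ 2)
    nlinarith
  have h3 : 4 * γ₁ ^ 2 * ε ^ 2 * lam ^ 3 * r * (κ * m ^ 6 * L ^ 2) ≤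
      4 * γ₁ ^ 2 * ε ^ 2 * lam ^ 3 * r * (ε * lam ^ 6) :=
    mul_le_mul_of_nonneg_left P.κ_le (by positivity)
  have h4 : 4 * γ₁ ^ 2 * ε ^ 2 * lam ^ 3 * r * (ε * lam ^ 6) =
      lam ^ 4 * (4 * γ₁ ^ 2 * ε ^ 3 * lam ^ 5 * r) := by ring
  exact le_of_mul_le_mul_left (h2.trans (h3.trans_eq h4)) (by positivity)

theorem one_le_mL : 1 ≤ m ^ 3 * L ^ 2 := by
  have h1 : (1 : ℝ) ≤ m ^ 3 := one_le_pow₀ P.one_le_m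
  have h2 : (1 : ℝ) ≤ L ^ 2 := one_le_pow₀ P.one_le_L
  nlinarith

/-- The product `t² m / (lam r)` is small; `m / (lam r)` bounds the square of `o / ρ`. -/
theorem ψ_sq_le {t : ℝ} (ht : t ^ 2 * lam ^ 4 ≤ 4 * γ₁ ^ 2 * (ω ^ 2 * L) * m) :
    t ^ 2 * (m / (lam * r)) ≤ 4 * γ₁ ^ 2 * ε ^ 3 * lam ^ 4 / (m ^ 3 * L ^ 2) := by
  have hl := P.lam_pos
  have hm := P.one_le_m
  have hr := P.one_le_r
  have hL := P.one_le_L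
  have h1 := P.t_sq_le ht
  rw [mul_div_assoc', div_le_div_iff₀ (by positivity) (by positivity)]
  calc t ^ 2 * m * (m ^ 3 * L ^ 2) = t ^ 2 * (m ^ 4 * L ^ 2) := by ring
    _ ≤ _ := h1
    _ = _ := by ring

theorem ψ_sq_le_sq {t : ℝ} (ht : t ^ 2 * lam ^ 4 ≤ 4 * γ₁ ^ 2 * (ω ^ 2 * L) * m) :
    t ^ 2 * (m / (lam * r)) ≤ ε₁ ^ 2 := by
  have hε := P.ε_pos
  have hl := P.lam_pos
  refine (P.ψ_sq_le ht).trans ?_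
  refine (div_le_self (by positivity) P.one_le_mL).trans ?_
  have h1 : lam ^ 4 ≤ 1 := pow_le_one₀ P.lam_pos.le P.lam_le
  have h2 : γ₁ ^ 2 ≤ γ₁ ^ 4 := pow_le_pow_right₀ (by linarith [P.γ_ge]) (by norm_num)
  have h3 : 4 * γ₁ ^ 2 * ε ^ 3 * lam ^ 4 ≤ 4 * γ₁ ^ 2 * ε ^ 3 * 1 :=
    mul_le_mul_of_nonneg_left h1 (by positivity)
  have h4 := mul_le_mul_of_nonneg_right h2 (by positivity : 0 ≤ ε ^ 3)
  have h5 := P.γε_le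
  have h6 : 0 ≤ γ₁ ^ 4 * ε ^ 3 := by positivity
  linarith

theorem t_sq_ψ_sq_le {t : ℝ} (ht : t ^ 2 * lam ^ 4 ≤ 4 * γ₁ ^ 2 * (ω ^ 2 * L) * m) :
    t ^ 2 * (t ^ 2 * (m / (lam * r))) ≤ ε₁ * (ω ^ 2 * L) := by
  have hε := P.ε_pos
  have hε₁ := P.ε₁_pos
  have hl := P.lam_pos
  have hm := P.one_le_m
  have hL := P.one_le_L
  have hω := P.one_le_ω
  have h1 := mul_le_mul_of_nonneg_left (P.ψ_sq_le ht) (sq_nonneg t)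
  refine h1.trans ?_
  rw [mul_div_assoc', div_le_iff₀ (by positivity)]
  have h2 : t ^ 2 * (4 * γ₁ ^ 2 * ε ^ 3 * lam ^ 4) = 4 * γ₁ ^ 2 * ε ^ 3 * (t ^ 2 * lam ^ 4) := by
    ring
  rw [h2]
  have h3 := mul_le_mul_of_nonneg_left ht (by positivity : 0 ≤ 4 * γ₁ ^ 2 * ε ^ 3)
  refine h3.trans ?_
  have h4 : 4 * γ₁ ^ 2 * ε ^ 3 * (4 * γ₁ ^ 2 * (ω ^ 2 * L) * m) =
      (16 * γ₁ ^ 4 * ε ^ 3) * ((ω ^ 2 * L) * m) := by ring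
  rw [h4]
  have h5 : 16 * γ₁ ^ 4 * ε ^ 3 ≤ ε₁ := P.γε_le.trans (by nlinarith [P.ε₁_le])
  have h6 : m ≤ m ^ 3 * L ^ 2 := by
    have h7 : m ^ 1 ≤ m ^ 3 := pow_le_pow_right₀ hm (by norm_num)
    have h8 : (1 : ℝ) ≤ L ^ 2 := one_le_pow₀ hL
    nlinarith
  calc _ ≤ ε₁ * ((ω ^ 2 * L) * (m ^ 3 * L ^ 2)) := by gcongr
    _ = _ := by ring

theorem t_sq_le_r {t : ℝ} (ht : t ^ 2 * lam ^ 4 ≤ 4 * γ₁ ^ 2 * (ω ^ 2 * L) * m) : t ^ 2 ≤ r := by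
  have hl := P.lam_pos
  have hr := P.one_le_r
  have hm := P.one_le_m
  have h1 := P.ψ_sq_le_sq ht
  have h2 : ε₁ ^ 2 ≤ 1 := by nlinarith [P.ε₁_pos, P.ε₁_le]
  have h3 := h1.trans h2
  rw [mul_div_assoc', div_le_one (by positivity)] at h3
  have h4 : t ^ 2 ≤ t ^ 2 * m := le_mul_of_one_le_right (sq_nonneg _) hm
  have h5 : lam * r ≤ r := mul_le_of_le_one_left (by linarith) P.lam_le
  linarith

theorem light {t : ℝ} (h1t : 1 ≤ t) (ht : t ^ 2 * lam ^ 4 ≤ 4 * γ₁ ^ 2 * (ω ^ 2 * L) * m) :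
    t ^ 5 * (ω ^ 2 * L * (m / lam) * (υ ^ 2 / d)) ≤ ε₁ := by
  have hl := P.lam_pos
  have hr := P.one_le_r
  have hm := P.one_le_m
  have hε := P.ε_pos
  have hd : 0 < d := by linarith [P.d_large]
  have hκ := P.κ_pos
  have hω := P.one_le_ω
  have hL := P.one_le_L
  have hυ := P.υ_pos
  have h1 : t ^ 5 ≤ r ^ 3 := by
    have h2 : t ^ 5 ≤ t ^ 6 := pow_le_pow_right₀ h1t (by norm_num)
    have h3 : t ^ 6 = (t ^ 2) ^ 3 := by ring
    exact h2.trans (h3.trans_le (pow_le_pow_left₀ (sq_nonneg _) (P.t_sq_le_r ht) 3))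
  have h2 : υ ^ 2 / d ≤ ε ^ 2 / r ^ 4 := by
    rw [div_le_div_iff₀ hd (by positivity)]
    have h3 : (υ * r ^ 2) ^ 2 ≤ (ε * Real.sqrt d) ^ 2 :=
      pow_le_pow_left₀ (by positivity) P.υ_le 2
    rw [mul_pow, mul_pow, Real.sq_sqrt hd.le] at h3
    linarith
  have h4 : ω ^ 2 * L * (m / lam) ≤ r := by
    rw [mul_div_assoc', div_le_iff₀ hl]
    have h5 := mul_le_mul_of_nonneg_right P.ω_le (by linarith : 0 ≤ m)
    refine h5.trans ?_
    have h6 : κ * m ^ 2 ≤ 1 := by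
      have h7 : κ * m ^ 2 ≤ κ * m ^ 6 * L ^ 2 := by
        have h8 : m ^ 2 ≤ m ^ 6 := pow_le_pow_right₀ hm (by norm_num)
        have h9 : (1 : ℝ) ≤ L ^ 2 := one_le_pow₀ hL
        calc κ * m ^ 2 ≤ κ * m ^ 6 := mul_le_mul_of_nonneg_left h8 hκ.le
          _ ≤ _ := le_mul_of_one_le_right (by positivity) h9
      have h10 : lam ^ 6 ≤ 1 := pow_le_one₀ hl.le P.lam_le
      nlinarith [P.κ_le, P.ε_le]
    have h11 : ε ^ 2 * lam ^ 3 * m * κ * r * m = (κ * m ^ 2) * (ε ^ 2 * lam ^ 2) * (r * lam) := by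
      ring
    rw [h11]
    have h12 : lam ^ 2 ≤ 1 := pow_le_one₀ hl.le P.lam_le
    have h13 : ε ^ 2 ≤ 1 := by nlinarith [P.ε_le]
    have h14 : ε ^ 2 * lam ^ 2 ≤ 1 := mul_le_one₀ h13 (by positivity) h12
    have h15 : (κ * m ^ 2) * (ε ^ 2 * lam ^ 2) ≤ 1 := mul_le_one₀ h6 (by positivity) h14
    exact mul_le_of_le_one_left (by positivity) h15
  calc t ^ 5 * (ω ^ 2 * L * (m / lam) * (υ ^ 2 / d)) ≤ r ^ 3 * (r * (ε ^ 2 / r ^ 4)) := by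
        gcongr
    _ = ε ^ 2 := by field_simp
    _ ≤ ε₁ := by
        have h1 := P.ε_le_ε₁
        have h2 := P.ε₁_le
        have h3 := P.ε₁_pos
        have h4 := P.ε_le
        nlinarith

end SmallParams

end Parameters

end

noncomputable section

/-! ### Non-degenerate layers are in the small-parameter regime -/

theorem sq_le_sqrt {x : ℝ} (h0 : 0 ≤ x) (h1 : x ≤ 1) : x ^ 2 ≤ Real.sqrt x := by
  refine (pow_le_of_le_one h0 h1 two_ne_zero).trans (Real.le_sqrt_of_sq_le ?_)
  exact pow_le_of_le_one h0 h1 two_ne_zero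

section Regime

variable {m k d : ℕ} [NeZero m] {Θ W : Fin m → Matrix (Fin d) (Fin d) ℝ}
  {ε A ε₁ γ₁ d₀ lam κ r υ χ ω : ℝ}

/-- The assumptions on the parameters, squared where they contain fractional powers, and with `d`
large because `r` is large. -/
theorem NonDegenerate.smallParams (nd : NonDegenerate ε A 0 (k := k) Θ W lam κ r υ χ)
    (hε : 0 < ε) (hεs : ε ≤ smallConst A ε₁ γ₁ d₀) (hε₁ : 0 < ε₁) (hε₁' : ε₁ ≤ 1 / 1000000)
    (hγ : 1000 ≤ γ₁) (hd₀ : 0 < d₀) (hA : 0 < A) (hω1 : 1 ≤ ω)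
    (hω : ω ≤ ε * (lam ^ (7 / 4 : ℝ) * Real.sqrt (m * κ * r / Real.log d))) :
    SmallParams ε A ε₁ γ₁ d₀ m k d lam κ r υ ω (Real.log d) := by
  have hl := nd.lam_pos
  have hl1 := nd.lam_lt_one
  have hκ := nd.κ_pos
  have e1 : ε ≤ ε₁ ^ 2 / (16 * γ₁ ^ 4) := hεs.trans (min_le_left _ _)
  have e2 : ε ≤ 1 / 1000 := hεs.trans ((min_le_right _ _).trans (min_le_left _ _))
  have e3 : ε ≤ 1 / d₀ :=
    hεs.trans ((min_le_right _ _).trans ((min_le_right _ _).trans (min_le_left _ _)))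
  have e4 : ε ≤ 1 / (1 + A ^ 3) :=
    hεs.trans ((min_le_right _ _).trans ((min_le_right _ _).trans (min_le_right _ _)))
  have hm : (1 : ℝ) ≤ m := by exact_mod_cast Nat.one_le_iff_ne_zero.mpr (NeZero.ne m)
  have hk : (1 : ℝ) ≤ k := by exact_mod_cast (by norm_num : 1 ≤ 2).trans nd.two_le_k
  have hd2 : (2 : ℝ) ≤ d := by exact_mod_cast nd.two_le_d
  have hd0 : (0 : ℝ) < d := by linarith
  have hL0 : 69 / 100 ≤ Real.log d :=
    (by linarith [Real.log_two_gt_d9] : (69 / 100 : ℝ) ≤ Real.log 2).trans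
      (Real.log_le_log (by norm_num) hd2)
  have hLpos : 0 < Real.log d := by linarith
  have hlp : lam ^ (13 / 2 : ℝ) ≤ lam ^ 6 := by
    rw [← Real.rpow_natCast lam 6]
    exact Real.rpow_le_rpow_of_exponent_ge hl hl1.le (by norm_num)
  have hmp : (m : ℝ) ^ 6 ≤ (m : ℝ) ^ (13 / 2 : ℝ) := by
    rw [← Real.rpow_natCast (m : ℝ) 6]
    exact Real.rpow_le_rpow_of_exponent_le hm (by norm_num)
  have hκ1 : κ * (m : ℝ) ^ 6 * Real.log d ^ 2 ≤ ε * lam ^ 6 := by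
    have h1 := nd.κ_le
    rw [le_div_iff₀ (by positivity)] at h1
    calc κ * (m : ℝ) ^ 6 * Real.log d ^ 2 = κ * ((m : ℝ) ^ 6 * Real.log d ^ 2) := by ring
      _ ≤ κ * ((m : ℝ) ^ (13 / 2 : ℝ) * Real.log d ^ 2) := by gcongr
      _ ≤ ε * lam ^ (13 / 2 : ℝ) := h1
      _ ≤ _ := mul_le_mul_of_nonneg_left hlp hε.le
  have hκ3 : κ ≤ 3 * ε := by
    have h1 : (1 : ℝ) ≤ (m : ℝ) ^ 6 := one_le_pow₀ hm
    have h2 : lam ^ 6 ≤ 1 := pow_le_one₀ hl.le hl1.le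
    have h3 : (1 / 3 : ℝ) ≤ (m : ℝ) ^ 6 * Real.log d ^ 2 := by nlinarith
    have h4 := mul_le_mul_of_nonneg_left h3 hκ.le
    nlinarith
  have hr1 : 1 / (3 * ε ^ 2) ≤ r := by
    have h1 := nd.r_big
    rw [pow_zero, div_le_iff₀ (by positivity)] at h1
    rw [div_le_iff₀ (by positivity)]
    have hr0 : 0 < r := by
      by_contra hcon
      have : ε * r * (κ * lam) ≤ 0 :=
        mul_nonpos_of_nonpos_of_nonneg (mul_nonpos_of_nonneg_of_nonpos hε.le (not_lt.mp hcon))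
          (by positivity)
      linarith
    have h2 : κ * lam ≤ 3 * ε := by nlinarith
    have h3 := mul_le_mul_of_nonneg_left h2 (by positivity : 0 ≤ ε * r)
    linarith
  have hr100 : 100 ≤ r := by
    refine le_trans ?_ hr1
    rw [le_div_iff₀ (by positivity)]
    nlinarith
  set x := (d : ℝ) ^ (1 / 4 : ℝ) with hx
  have hx4 : x ^ 4 = d := by
    rw [hx, ← Real.rpow_natCast, ← Real.rpow_mul hd0.le]; norm_num
  have hrx : r ≤ ε * x := nd.r_small
  have hx0 : 0 < x := Real.rpow_pos_of_pos hd0 _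
  have hxr : r ≤ x := by nlinarith
  have hx1 : 1 ≤ x := by linarith
  have hxε : 1 / ε ≤ x := by
    rw [div_le_iff₀ hε]; linarith
  have hdx : x ≤ d := by
    rw [← hx4]
    exact le_self_pow₀ hx1 (by norm_num)
  have hxsq : x ^ 2 ≤ d := by
    rw [← hx4]; exact pow_le_pow_right₀ hx1 (by norm_num)
  exact
  { ε_pos := hε
    ε_le := e2
    ε_le₁ := by
      rw [le_div_iff₀ (by positivity)] at e1
      linarith
    ε₁_pos := hε₁
    ε₁_le := hε₁'
    γ_ge := hγ
    A_pos := hA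
    ε_A := by
      rw [le_div_iff₀ (by positivity)] at e4
      nlinarith
    one_le_m := hm
    one_le_k := hk
    d_ge := by
      have h1 : d₀ ≤ 1 / ε := by
        rw [le_div_iff₀ hε]
        rw [le_div_iff₀ hd₀] at e3
        linarith
      exact h1.trans (hxε.trans hdx)
    d_large := hr100.trans (hxr.trans hdx)
    lam_pos := hl
    lam_le := hl1.le
    κ_pos := hκ
    κ_le := hκ1
    one_le_r := by linarith
    r_le := by
      rw [← hx4]; exact pow_le_pow_left₀ (by linarith) hxr 4
    υ_pos := nd.one_le_υ
    υ_le := by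
      have h1 := nd.υ_small
      have hr2 : 0 < r ^ 2 := by positivity
      have h2 := mul_le_mul_of_nonneg_right h1 hr2.le
      refine h2.trans_eq ?_
      field_simp
    one_le_ω := hω1
    ω_le := by
      have hr0 : 0 < r := by linarith
      have h1 : ω ^ 2 ≤ (ε * (lam ^ (7 / 4 : ℝ) * Real.sqrt (m * κ * r / Real.log d))) ^ 2 :=
        pow_le_pow_left₀ (by linarith) hω 2
      rw [mul_pow, mul_pow, Real.sq_sqrt (by positivity)] at h1
      have h2 : (lam ^ (7 / 4 : ℝ)) ^ 2 ≤ lam ^ 3 := by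
        rw [← Real.rpow_natCast, ← Real.rpow_mul hl.le, ← Real.rpow_natCast lam 3]
        exact Real.rpow_le_rpow_of_exponent_ge hl hl1.le (by norm_num)
      have h3 := mul_le_mul_of_nonneg_right h1 hLpos.le
      refine h3.trans ?_
      calc ε ^ 2 * ((lam ^ (7 / 4 : ℝ)) ^ 2 * (m * κ * r / Real.log d)) * Real.log d
          = ε ^ 2 * (lam ^ (7 / 4 : ℝ)) ^ 2 * (m * κ * r) := by field_simp
        _ ≤ ε ^ 2 * lam ^ 3 * (m * κ * r) := by gcongr
        _ = _ := by ring
    one_le_L := by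
      rw [Real.le_log_iff_exp_le hd0]
      linarith [Real.exp_one_lt_d9]
    m_le := nd.heads_le
    k_le := nd.tokens_le
    r_le' := by
      have h1 : r ^ 2 ≤ (ε * x) ^ 2 := pow_le_pow_left₀ (by linarith) hrx 2
      rw [mul_pow] at h1
      exact h1.trans (mul_le_mul_of_nonneg_left hxsq (sq_nonneg _)) }

theorem NonDegenerate.frob_pos (nd : NonDegenerate ε A 0 (k := k) Θ W lam κ r υ χ) :
    ∀ i, 0 < frob (Θ i) := by
  have h0 : 0 < frob (Θ 0) := by
    refine lt_of_le_of_ne (frob_nonneg _) fun h => nd.Θ_ne_zero ?_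
    have h1 := frob_sq (Θ 0)
    ext i j
    have h2 : Θ 0 i j ^ 2 ≤ ∑ j, Θ 0 i j ^ 2 :=
      Finset.single_le_sum (f := fun j => Θ 0 i j ^ 2) (fun _ _ => sq_nonneg _) (Finset.mem_univ j)
    have h3 : ∑ j, Θ 0 i j ^ 2 ≤ ∑ i, ∑ j, Θ 0 i j ^ 2 :=
      Finset.single_le_sum (f := fun i => ∑ j, Θ 0 i j ^ 2)
        (fun _ _ => Finset.sum_nonneg fun _ _ => sq_nonneg _) (Finset.mem_univ i)
    rw [← h1, ← h] at h3
    have h4 : Θ 0 i j ^ 2 ≤ 0 := by linarith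
    exact pow_eq_zero_iff (two_ne_zero) |>.mp (le_antisymm h4 (sq_nonneg _))
  intro i
  have h1 := nd.le_norm i
  have h2 : 0 < frob (Θ i) ^ 2 := lt_of_lt_of_le (mul_pos nd.lam_pos (by positivity)) h1
  exact lt_of_le_of_ne (frob_nonneg _) fun h => by rw [← h] at h2; norm_num at h2

theorem NonDegenerate.weightZ_pos (nd : NonDegenerate ε A 0 (k := k) Θ W lam κ r υ χ) :
    0 < weightZ Θ :=
  Finset.sum_pos (fun i _ => by have := nd.frob_pos i; positivity) ⟨0, Finset.mem_univ _⟩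

/-- The weighted average has Frobenius norm about `1 / √Z`, and so has its approximation; inner
products with the attention matrices are about `1 / Z`. -/
structure NormBounds (Θ : Fin m → Matrix (Fin d) (Fin d) ℝ) (Θt : Matrix (Fin d) (Fin d) ℝ)
    (lam ρ δ : ℝ) : Prop where
  ρ_pos : 0 < ρ
  ρ_le : ρ ≤ frob (Θ 0)
  sqrt_le : Real.sqrt lam * frob (Θ 0) ≤ Real.sqrt m * ρ
  δ_pos : 0 < δ
  δ_le : frob (Θt - weightedAverage Θ) ≤ δ
  frob_avg : frob (weightedAverage Θ) ≤ 101 / 100 * ρ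
  frob_ge : 99 / 100 * ρ ≤ frob Θt
  frob_le : frob Θt ≤ 101 / 100 * ρ
  inner_ge : ∀ i, 97 / 100 * ρ ^ 2 ≤ frobInner Θt (Θ i)

set_option maxHeartbeats 1000000 in
/-- Norms and inner products of the given approximation of the weighted average. -/
theorem NonDegenerate.normBounds (nd : NonDegenerate ε A 0 (k := k) Θ W lam κ r υ χ)
    (P : SmallParams ε A ε₁ γ₁ d₀ m k d lam κ r υ ω (Real.log d)) {Θt : Matrix (Fin d) (Fin d) ℝ}
    {μ : ℝ} (hμ : μ ≤ ε * (lam ^ (5 / 2 : ℝ) / (ω ^ 3 * m ^ 3 * Real.log d ^ 2)))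
    (hΘt : frob (Θt - weightedAverage Θ) ≤ μ * frob (Θ 0)) :
    NormBounds Θ Θt lam (1 / Real.sqrt (weightZ Θ))
      (ε * (lam ^ 2 * Real.sqrt lam / (ω ^ 3 * m ^ 3 * Real.log d ^ 2)) * frob (Θ 0)) := by
  have hZ := nd.weightZ_pos
  have hf := nd.frob_pos
  have hS := hf 0
  have hl := P.lam_pos
  have hm := P.one_le_m
  have hε := P.ε_pos
  have hκ := P.κ_pos
  have hL := P.one_le_L
  have hω := P.one_le_ω
  set S := frob (Θ 0) with hSd
  set ρ := 1 / Real.sqrt (weightZ Θ) with hρ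
  set δ := ε * (lam ^ 2 * Real.sqrt lam / (ω ^ 3 * m ^ 3 * Real.log d ^ 2)) * S with hδ
  have hρ0 : 0 < ρ := by positivity
  have hρ2 : weightZ Θ * ρ ^ 2 = 1 := by
    rw [hρ, div_pow, Real.sq_sqrt hZ.le]; field_simp
  have hZlow : 1 / S ^ 2 ≤ weightZ Θ :=
    Finset.single_le_sum (f := fun i => 1 / frob (Θ i) ^ 2)
      (fun i _ => by have := hf i; positivity) (Finset.mem_univ 0)
  have hZup : weightZ Θ ≤ m * (1 / (lam * S ^ 2)) := by
    have h1 : ∀ i ∈ Finset.univ, 1 / frob (Θ i) ^ 2 ≤ 1 / (lam * S ^ 2) := fun i _ =>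
      one_div_le_one_div_of_le (by positivity) (nd.le_norm i)
    refine (Finset.sum_le_sum h1).trans_eq ?_
    simp
  have hρS : ρ ≤ S := by
    refine abs_le_of_sq_le_sq' ?_ hS.le |>.2
    have h1 := mul_le_mul_of_nonneg_right hZlow (by positivity : 0 ≤ S ^ 2 * ρ ^ 2)
    have h2 : 1 / S ^ 2 * (S ^ 2 * ρ ^ 2) = ρ ^ 2 := by field_simp
    calc ρ ^ 2 ≤ weightZ Θ * (S ^ 2 * ρ ^ 2) := h2.symm.trans_le h1
      _ = S ^ 2 * (weightZ Θ * ρ ^ 2) := by ring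
      _ = S ^ 2 := by rw [hρ2, mul_one]
  have hsq : Real.sqrt lam * S ≤ Real.sqrt m * ρ := by
    refine abs_le_of_sq_le_sq' ?_ (by positivity) |>.2
    rw [mul_pow, mul_pow, Real.sq_sqrt hl.le, Real.sq_sqrt (by linarith)]
    have h1 := mul_le_mul_of_nonneg_right hZup (by positivity : 0 ≤ lam * S ^ 2 * ρ ^ 2)
    have h2 : m * (1 / (lam * S ^ 2)) * (lam * S ^ 2 * ρ ^ 2) = m * ρ ^ 2 := by field_simp
    have h3 : weightZ Θ * (lam * S ^ 2 * ρ ^ 2) = lam * S ^ 2 * (weightZ Θ * ρ ^ 2) := by ring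
    rw [h2, h3, hρ2] at h1
    linarith
  have hδ0 : 0 < δ := by positivity
  have hDδ : frob (Θt - weightedAverage Θ) ≤ δ := by
    refine hΘt.trans (mul_le_mul_of_nonneg_right (hμ.trans_eq ?_) hS.le)
    have : lam ^ (5 / 2 : ℝ) = lam ^ 2 * Real.sqrt lam := by
      rw [Real.sqrt_eq_rpow, ← Real.rpow_natCast, ← Real.rpow_add hl]; norm_num
    rw [this]
  have hden : m ≤ ω ^ 3 * m ^ 3 * Real.log d ^ 2 := by
    have h1 : (1 : ℝ) ≤ ω ^ 3 := one_le_pow₀ hω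
    have h2 : (1 : ℝ) ≤ Real.log d ^ 2 := one_le_pow₀ hL
    have h3 : (m : ℝ) ^ 1 ≤ m ^ 3 := pow_le_pow_right₀ hm (by norm_num)
    calc (m : ℝ) ≤ 1 * m ^ 3 * 1 := by linarith
      _ ≤ _ := by gcongr
  have hsm : Real.sqrt m * Real.sqrt m = m := Real.mul_self_sqrt (by linarith)
  have hsm1 : 1 ≤ Real.sqrt m := Real.one_le_sqrt.mpr hm
  have hδbound : m * δ ≤ ε * (lam ^ 2 * (Real.sqrt m * ρ)) := by
    have h1 : δ = ε * (lam ^ 2 * (Real.sqrt lam * S) / (ω ^ 3 * m ^ 3 * Real.log d ^ 2)) := by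
      rw [hδ]; ring
    rw [h1]
    have h2 : lam ^ 2 * (Real.sqrt lam * S) / (ω ^ 3 * m ^ 3 * Real.log d ^ 2) ≤
        lam ^ 2 * (Real.sqrt m * ρ) / m := by gcongr
    have h3 := mul_le_mul_of_nonneg_left h2 hε.le
    have h4 := mul_le_mul_of_nonneg_left h3 (by linarith : (0 : ℝ) ≤ m)
    refine h4.trans_eq ?_
    field_simp
  have hlam2 : lam ^ 2 ≤ 1 := pow_le_one₀ hl.le P.lam_le
  have hδρ : δ ≤ ε * ρ := by
    have h1 : Real.sqrt m * (Real.sqrt m * δ) ≤ Real.sqrt m * (ε * ρ) := by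
      rw [← mul_assoc, hsm]
      refine hδbound.trans ?_
      have := mul_le_mul_of_nonneg_left hlam2 (by positivity : 0 ≤ ε * (Real.sqrt m * ρ))
      linarith
    have h2 := le_of_mul_le_mul_left h1 (by linarith)
    exact (le_mul_of_one_le_left hδ0.le hsm1).trans h2
  have hδS : δ * S ≤ ε * ρ ^ 2 := by
    have h1 : lam ^ 2 * S ≤ Real.sqrt m * ρ := by
      refine le_trans (mul_le_mul_of_nonneg_right ?_ hS.le) hsq
      exact sq_le_sqrt hl.le P.lam_le
    have h3 : m * (δ * S) ≤ m * (ε * ρ ^ 2) := by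
      have h4 := mul_le_mul_of_nonneg_right hδbound hS.le
      have h5 := mul_le_mul_of_nonneg_left h1 (by positivity : 0 ≤ ε * (Real.sqrt m * ρ))
      have h6 : ε * (Real.sqrt m * ρ) * (Real.sqrt m * ρ) = m * (ε * ρ ^ 2) := by
          calc _ = (Real.sqrt m * Real.sqrt m) * (ε * ρ ^ 2) := by ring
            _ = _ := by rw [hsm]
      linarith
    exact le_of_mul_le_mul_left h3 (by linarith)
  have hη : (m : ℝ) * (κ / lam) ≤ ε := by
    rw [mul_div_assoc', div_le_iff₀ hl]
    have h1 : m * κ ≤ κ * m ^ 6 * Real.log d ^ 2 := by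
      have h2 : (m : ℝ) ^ 1 ≤ m ^ 6 := pow_le_pow_right₀ hm (by norm_num)
      have h3 : (1 : ℝ) ≤ Real.log d ^ 2 := one_le_pow₀ hL
      calc m * κ = κ * m ^ 1 * 1 := by ring
        _ ≤ _ := by gcongr
    have h4 : lam ^ 6 ≤ lam := pow_le_of_le_one hl.le P.lam_le (by norm_num)
    exact h1.trans (P.κ_le.trans (mul_le_mul_of_nonneg_left h4 hε.le))
  have hin := abs_inner_weightedAverage_le (η := κ / lam) hf hZ (fun i j hij => by
    refine (nd.incoherent i j hij).trans ?_
    have h1 : lam * frob (Θ j) ≤ frob (Θ i) := by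
      refine abs_le_of_sq_le_sq' ?_ (hf i).le |>.2
      refine le_trans ?_ (nd.le_norm i)
      rw [mul_pow]
      have h2 : frob (Θ j) ^ 2 ≤ frob (Θ 0) ^ 2 :=
        pow_le_pow_left₀ (frob_nonneg _) (nd.norm_le j) 2
      have h3 : lam ^ 2 ≤ lam := pow_le_of_le_one hl.le P.lam_le two_ne_zero
      exact mul_le_mul h3 h2 (sq_nonneg _) hl.le
    rw [div_mul_eq_mul_div, le_div_iff₀ hl]
    have h4 := mul_le_mul_of_nonneg_left h1 (by have := hf i; positivity : 0 ≤ κ * frob (Θ i))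
    linarith) (by positivity)
  have hin' : ∀ i, |weightZ Θ * frobInner (weightedAverage Θ) (Θ i) - 1| ≤ ε :=
    fun i => (hin i).trans hη
  have hfr := abs_frob_weightedAverage_le hf hZ hin'
  have hε3 := P.ε_le
  set V₀ := weightedAverage Θ with hV₀
  have hV₀n := frob_nonneg V₀
  have hfr' : frob V₀ ^ 2 ≤ (1 + ε) * ρ ^ 2 ∧ (1 - ε) * ρ ^ 2 ≤ frob V₀ ^ 2 := by
    rw [abs_le] at hfr
    have e : (weightZ Θ * frob V₀ ^ 2) * ρ ^ 2 = frob V₀ ^ 2 := by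
      calc _ = (weightZ Θ * ρ ^ 2) * frob V₀ ^ 2 := by ring
        _ = _ := by rw [hρ2, one_mul]
    have h1 := mul_le_mul_of_nonneg_right
      (by linarith [hfr.2] : weightZ Θ * frob V₀ ^ 2 ≤ 1 + ε) (sq_nonneg ρ)
    have h2 := mul_le_mul_of_nonneg_right
      (by linarith [hfr.1] : 1 - ε ≤ weightZ Θ * frob V₀ ^ 2) (sq_nonneg ρ)
    rw [e] at h1 h2
    exact ⟨h1, h2⟩
  have hup : frob V₀ ≤ 1001 / 1000 * ρ := by
    refine abs_le_of_sq_le_sq' ?_ (by positivity) |>.2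
    refine hfr'.1.trans ?_
    rw [mul_pow]
    exact mul_le_mul_of_nonneg_right (by linarith) (sq_nonneg _)
  have hlow : 999 / 1000 * ρ ≤ frob V₀ := by
    refine abs_le_of_sq_le_sq' ?_ hV₀n |>.2
    refine le_trans ?_ hfr'.2
    rw [mul_pow]
    exact mul_le_mul_of_nonneg_right (by linarith) (sq_nonneg _)
  have hδρ' : δ ≤ ρ / 1000 := hδρ.trans (by
    have := mul_le_mul_of_nonneg_right hε3 hρ0.le
    linarith)
  have hsplit : V₀ + (Θt - V₀) = Θt := by abel
  have hsplit' : Θt + -(Θt - V₀) = V₀ := by abel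
  have htri1 := frob_add_le V₀ (Θt - V₀)
  have htri2 := frob_add_le Θt (-(Θt - V₀))
  rw [hsplit] at htri1
  rw [hsplit', frob_neg] at htri2
  exact
  { ρ_pos := hρ0
    ρ_le := hρS
    sqrt_le := hsq
    δ_pos := hδ0
    δ_le := hDδ
    frob_avg := by linarith
    frob_ge := by linarith
    frob_le := by linarith
    inner_ge := fun i => by
      have h1 : frobInner Θt (Θ i) = frobInner V₀ (Θ i) + frobInner (Θt - V₀) (Θ i) := by
        rw [← frobInner_add_left, hsplit]
      rw [h1]
      have h2 := (abs_le.mp (abs_frobInner_le (Θt - V₀) (Θ i))).1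
      have h3 : frob (Θt - V₀) * frob (Θ i) ≤ δ * S :=
        mul_le_mul hDδ (nd.norm_le i) (frob_nonneg _) hδ0.le
      have h4 := (abs_le.mp (hin' i)).1
      have h5 := mul_le_mul_of_nonneg_right
        (by linarith : 1 - ε ≤ weightZ Θ * frobInner V₀ (Θ i)) (sq_nonneg ρ)
      have h6 : (weightZ Θ * frobInner V₀ (Θ i)) * ρ ^ 2 = frobInner V₀ (Θ i) := by
        calc _ = (weightZ Θ * ρ ^ 2) * frobInner V₀ (Θ i) := by ring
          _ = _ := by rw [hρ2, one_mul]
      rw [h6] at h5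
      have h7 := mul_le_mul_of_nonneg_right hε3 (sq_nonneg ρ)
      linarith [sq_nonneg ρ] }

set_option maxHeartbeats 1000000 in
/-- In the non-degenerate case all assumptions of the analysis hold. -/
theorem NonDegenerate.regime (nd : NonDegenerate ε A 0 (k := k) Θ W lam κ r υ χ)
    (P : SmallParams ε A ε₁ γ₁ d₀ m k d lam κ r υ ω (Real.log d)) {Θt : Matrix (Fin d) (Fin d) ℝ}
    {ρ : ℝ} (B : NormBounds Θ Θt lam ρ
      (ε * (lam ^ 2 * Real.sqrt lam / (ω ^ 3 * m ^ 3 * Real.log d ^ 2)) * frob (Θ 0))) {θ : ℝ}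
    (hθ1 : γ₁ * marginScale d m lam ω * ρ ≤ θ) (hθ2 : θ ≤ 2 * γ₁ * marginScale d m lam ω * ρ) :
    Regime ε₁ γ₁ d₀ Θ (weightedAverage Θ) (Θt - weightedAverage Θ) (frob (Θ 0)) ρ θ
      (ε * (lam ^ 2 * Real.sqrt lam / (ω ^ 3 * m ^ 3 * Real.log d ^ 2)) * frob (Θ 0))
      (υ / Real.sqrt d * frob (Θ 0)) (frob (Θ 0) / Real.sqrt r)
      (ω * Real.sqrt (Real.log d)) := by
  have hZ := nd.weightZ_pos
  have hf := nd.frob_pos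
  have hS := hf 0
  have hl := P.lam_pos
  have hm := P.one_le_m
  have hε := P.ε_pos
  have hκ := P.κ_pos
  have hL := P.one_le_L
  have hω := P.one_le_ω
  have hr := P.one_le_r
  have hγ := P.γ_ge
  have hυ := P.υ_pos
  have hρ0 := B.ρ_pos
  have hsq := B.sqrt_le
  have hd : (0 : ℝ) < d := by linarith [P.d_large]
  have hsplit : weightedAverage Θ + (Θt - weightedAverage Θ) = Θt := by abel
  have hop : ∀ i, OpLE (Θ i) (frob (Θ 0) / Real.sqrt r) := fun i => by
    refine opLE_of_opNorm_le ?_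
    rw [le_div_iff₀ (Real.sqrt_pos.mpr (by linarith))]
    refine le_trans ?_ (nd.norm_le i)
    refine abs_le_of_sq_le_sq' ?_ (frob_nonneg _) |>.2
    rw [mul_pow, Real.sq_sqrt (by linarith)]
    linarith [nd.effective_rank i]
  set S := frob (Θ 0) with hSd
  set L := Real.log d with hLd
  have hLs : Real.sqrt L ^ 2 = L := Real.sq_sqrt (by linarith)
  have hL1 : 1 ≤ Real.sqrt L := Real.one_le_sqrt.mpr hL
  have hℓ2 : (ω * Real.sqrt L) ^ 2 = ω ^ 2 * L := by rw [mul_pow, hLs]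
  have hm1 : 1 ≤ Real.sqrt m := Real.one_le_sqrt.mpr hm
  have hm2 : Real.sqrt m ^ 2 = m := Real.sq_sqrt (by linarith)
  have hms : marginScale d m lam ω * lam ^ 2 = ω * (Real.sqrt m * Real.sqrt L) := by
    rw [marginScale, ← hLd, Real.sqrt_mul (by linarith)]; field_simp
  have hms0 : 0 < marginScale d m lam ω := by
    have : 0 < marginScale d m lam ω * lam ^ 2 := by rw [hms]; positivity
    exact pos_of_mul_pos_left this (by positivity)
  have hθ0 : 0 < θ := lt_of_lt_of_le (by positivity) hθ1
  -- the heads have comparable norms, so `ρ² = 1 / Z` is at least `lam S² / m`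
  have hlm : lam * S ^ 2 ≤ m * ρ ^ 2 := by
    have h1 := pow_le_pow_left₀ (by positivity) hsq 2
    rw [mul_pow, mul_pow, Real.sq_sqrt hl.le, hm2] at h1
    exact h1
  have ht2 : θ / ρ ≤ 2 * γ₁ * marginScale d m lam ω := by rw [div_le_iff₀ hρ0]; exact hθ2
  have ht0 : 0 < θ / ρ := by positivity
  have ht : (θ / ρ) ^ 2 * lam ^ 4 ≤ 4 * γ₁ ^ 2 * (ω ^ 2 * L) * m := by
    have h1 : (θ / ρ * lam ^ 2) ^ 2 ≤ (2 * γ₁ * (ω * (Real.sqrt m * Real.sqrt L))) ^ 2 := by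
      refine pow_le_pow_left₀ (by positivity) ?_ 2
      rw [← hms]
      have := mul_le_mul_of_nonneg_right ht2 (by positivity : 0 ≤ lam ^ 2)
      linarith
    have h2 : (2 * γ₁ * (ω * (Real.sqrt m * Real.sqrt L))) ^ 2 =
        4 * γ₁ ^ 2 * (ω ^ 2 * Real.sqrt L ^ 2) * Real.sqrt m ^ 2 := by ring
    rw [h2, hLs, hm2] at h1
    linarith
  have hψ : (θ * (S / Real.sqrt r) / ρ ^ 2) ^ 2 ≤ (θ / ρ) ^ 2 * (m / (lam * r)) := by
    have h1 : (θ * (S / Real.sqrt r) / ρ ^ 2) ^ 2 = (θ / ρ) ^ 2 * (S ^ 2 / (r * ρ ^ 2)) := by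
      rw [div_pow, mul_pow, div_pow S, Real.sq_sqrt (by linarith)]; field_simp
    rw [h1]
    refine mul_le_mul_of_nonneg_left ?_ (sq_nonneg _)
    rw [div_le_div_iff₀ (by positivity) (by positivity)]
    have := mul_le_mul_of_nonneg_right hlm (by linarith : 0 ≤ r)
    linarith
  have h1t : 1 ≤ θ / ρ := by
    rw [one_le_div hρ0]
    have h1 : 1 ≤ marginScale d m lam ω := by
      rw [marginScale, le_div_iff₀ (by positivity), one_mul]
      have h2 : lam ^ 2 ≤ 1 := pow_le_one₀ hl.le P.lam_le
      have h3 : 1 ≤ Real.sqrt (m * Real.log d) := Real.one_le_sqrt.mpr (by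
        rw [← hLd]; exact one_le_mul_of_one_le_of_one_le hm hL)
      exact h2.trans (one_le_mul_of_one_le_of_one_le hω h3)
    have h4 : 1 ≤ γ₁ * marginScale d m lam ω :=
      one_le_mul_of_one_le_of_one_le (by linarith) h1
    exact (le_mul_of_one_le_left hρ0.le h4).trans hθ1
  exact
  { ε_pos := P.ε₁_pos
    ε_le := P.ε₁_le
    γ_ge := hγ
    ρ_pos := hρ0
    ρ_le := B.ρ_le
    one_le_ℓ := one_le_mul_of_one_le_of_one_le hω hL1
    log_le := by
      rw [hℓ2]
      have : 1 ≤ ω ^ 2 := one_le_pow₀ hω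
      exact le_mul_of_one_le_left (by linarith) this
    d_ge := P.d_ge
    d_large := P.d_large
    frob_le := nd.norm_le
    frob_ge := by rw [hsplit]; exact B.frob_ge
    frob_le' := by rw [hsplit]; exact B.frob_le
    frob_V₀ := B.frob_avg
    o_nonneg := by positivity
    op_Θ := hop
    op_V₀ := opLE_weightedAverage hf hZ (by positivity) hop
    inner_ge := by rw [hsplit]; exact B.inner_ge
    δ_pos := B.δ_pos
    frob_D := B.δ_le
    h_pos := by positivity
    col_le := fun j => by
      refine weightedAverage_col_le hf hZ j fun i => ?_
      have h1 := nd.light_col i j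
      rw [Real.sqrt_le_left (by positivity)] at h1
      exact h1
    θ_ge := by
      refine le_trans ?_ hθ1
      have h1 : lam ^ 2 * S ≤ Real.sqrt m * ρ := by
        refine le_trans (mul_le_mul_of_nonneg_right ?_ hS.le) hsq
        exact sq_le_sqrt hl.le P.lam_le
      have h3 : lam ^ 2 * (γ₁ * (ω * Real.sqrt L) * S) ≤
          lam ^ 2 * (γ₁ * marginScale d m lam ω * ρ) := by
        have h4 := mul_le_mul_of_nonneg_left h1 (by positivity : 0 ≤ γ₁ * (ω * Real.sqrt L))
        have h5 : lam ^ 2 * (γ₁ * marginScale d m lam ω * ρ) =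
            γ₁ * (marginScale d m lam ω * lam ^ 2) * ρ := by ring
        rw [h5, hms]
        linarith
      exact le_of_mul_le_mul_left h3 (by positivity)
    θ_o := by
      have h1 := hψ.trans (P.ψ_sq_le_sq ht)
      have h2 := abs_le_of_sq_le_sq' h1 P.ε₁_pos.le |>.2
      rwa [div_le_iff₀ (by positivity)] at h2
    θ_o_sq := by
      rw [hℓ2]
      exact (mul_le_mul_of_nonneg_left hψ (sq_nonneg _)).trans (P.t_sq_ψ_sq_le ht)
    θ_δ := by
      have h1 : θ * lam ^ 2 ≤ 2 * γ₁ * (ω * (Real.sqrt m * Real.sqrt L)) * ρ := by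
        rw [← hms]
        have := mul_le_mul_of_nonneg_right hθ2 (by positivity : 0 ≤ lam ^ 2)
        linarith
      have h2 : θ * (ε * (lam ^ 2 * Real.sqrt lam / (ω ^ 3 * m ^ 3 * L ^ 2)) * S) *
          (ω * Real.sqrt L) = ε * (θ * lam ^ 2) * (Real.sqrt lam * S) * (ω * Real.sqrt L) /
            (ω ^ 3 * m ^ 3 * L ^ 2) := by ring
      rw [h2, div_le_iff₀ (by positivity)]
      have h3 : ε * (θ * lam ^ 2) * (Real.sqrt lam * S) * (ω * Real.sqrt L) ≤
          ε * (2 * γ₁ * (ω * (Real.sqrt m * Real.sqrt L)) * ρ) * (Real.sqrt m * ρ) *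
            (ω * Real.sqrt L) := by gcongr
      have h4 : ε * (2 * γ₁ * (ω * (Real.sqrt m * Real.sqrt L)) * ρ) * (Real.sqrt m * ρ) *
            (ω * Real.sqrt L) = 2 * γ₁ * ε * ρ ^ 2 * (ω ^ 2 * Real.sqrt m ^ 2 * Real.sqrt L ^ 2) := by
        ring
      rw [h4, hm2, hLs] at h3
      refine h3.trans ?_
      have h5 : 2 * γ₁ * ε ≤ ε₁ := by
        have h6 := P.ε_le₁
        have h7 : γ₁ ≤ γ₁ ^ 4 := le_self_pow₀ (by linarith) (by norm_num)
        have h8 : ε₁ ^ 2 ≤ ε₁ := pow_le_of_le_one P.ε₁_pos.le (by linarith [P.ε₁_le]) two_ne_zero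
        have h9 := mul_le_mul_of_nonneg_right h7 hε.le
        linarith [mul_nonneg (by linarith : 0 ≤ γ₁) hε.le]
      have h6 : ω ^ 2 * m * L ≤ ω ^ 3 * m ^ 3 * L ^ 2 := by
        have a1 : ω ^ 2 ≤ ω ^ 3 := pow_le_pow_right₀ hω (by norm_num)
        have a2 : (m : ℝ) ≤ m ^ 3 := le_self_pow₀ hm (by norm_num)
        have a3 : L ≤ L ^ 2 := le_self_pow₀ hL (by norm_num)
        gcongr
      have h7 := P.ε₁_pos
      gcongr
    trace_le := fun i => by
      refine (nd.trace_le i).trans ?_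
      have h1 : χ ≤ ω * Real.sqrt L := nd.χ_le.trans (by
        rw [← hLd]; exact le_mul_of_one_le_left (Real.sqrt_nonneg _) hω)
      exact mul_le_mul h1 (nd.norm_le i) (frob_nonneg _) (by positivity)
    light := by
      refine le_trans ?_ (P.light h1t ht)
      refine mul_le_mul_of_nonneg_left ?_ (by positivity)
      have h1 : (ω * Real.sqrt L * (υ / Real.sqrt d * S) / ρ) ^ 2 =
          ω ^ 2 * L * (S ^ 2 / ρ ^ 2) * (υ ^ 2 / d) := by
        rw [div_pow, mul_pow, mul_pow, mul_pow, div_pow, hLs, Real.sq_sqrt hd.le]; field_simp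
      rw [h1]
      have h2 : S ^ 2 / ρ ^ 2 ≤ m / lam := by
        rw [div_le_div_iff₀ (by positivity) hl]; linarith
      gcongr
    size := by
      refine (P.t_sq_le_r ht).trans ?_
      refine le_trans ?_ P.r_le
      exact le_self_pow₀ hr (by norm_num) }

end Regime

end

noncomputable section

/-! ### The stream of examples -/

section Stream

variable {m k d : ℕ}

instance : IsProbabilityMeasure
    (ProbabilityTheory.uniformOn (Set.univ : Set (Cube k d))) :=
  ProbabilityTheory.isProbabilityMeasure_uniformOn Set.finite_univ Set.univ_nonempty

instance : IsProbabilityMeasure (uniformStream k d) := by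
  unfold uniformStream; infer_instance

theorem integral_uniformOn_cube (F : Cube k d → ℝ) :
    ∫ x, F x ∂(ProbabilityTheory.uniformOn (Set.univ : Set (Cube k d))) = cubeExp F := by
  rw [integral_fintype (Integrable.of_finite), cubeExp, prodExp_unif, Finset.sum_div]
  refine Finset.sum_congr rfl fun x _ => ?_
  have h : (ProbabilityTheory.uniformOn (Set.univ : Set (Cube k d))).real {x} =
      1 / Fintype.card (Cube k d) := by
    rw [Measure.real, ProbabilityTheory.uniformOn_univ, Measure.count_singleton,
      ENNReal.toReal_div]
    simp
  rw [h, smul_eq_mul, one_div_mul_eq_div]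

theorem integral_uniformStream (F : Cube k d → ℝ) (t : ℕ) :
    ∫ xs, F (xs t) ∂(uniformStream k d) = cubeExp F := by
  rw [← integral_uniformOn_cube F]
  have h := measurePreserving_eval_infinitePi
    (fun _ : ℕ => ProbabilityTheory.uniformOn (Set.univ : Set (Cube k d))) t
  rw [← h.map_eq, integral_map h.measurable.aemeasurable
    (Measurable.of_discrete.aestronglyMeasurable)]
  rfl

theorem memLp_uniformStream (F : Cube k d → ℝ) (t : ℕ) :
    MemLp (fun xs : ℕ → Cube k d => F (xs t)) 2 (uniformStream k d) := by
  have hm : Measurable F := Measurable.of_discrete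
  refine MemLp.of_bound (hm.comp (measurable_pi_apply t)).aestronglyMeasurable (∑ x, ‖F x‖) ?_
  exact Filter.Eventually.of_forall fun xs =>
    Finset.single_le_sum (f := fun x => ‖F x‖) (fun _ _ => norm_nonneg _) (Finset.mem_univ (xs t))

/-- Chebyshev's inequality for an empirical sum. -/
theorem uniformStream_deviation_le (F : Cube k d → ℝ) (T : ℕ) {a : ℝ} (ha : 0 < a) :
    (uniformStream k d).real {xs | a ≤ |∑ t ∈ Finset.range T, F (xs t) - T * cubeExp F|} ≤
      T * cubeExp (fun x => F x ^ 2) / a ^ 2 := by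
  set Y : ℕ → (ℕ → Cube k d) → ℝ := fun t xs => F (xs t) with hY
  have hL : ∀ t, MemLp (Y t) 2 (uniformStream k d) := fun t => memLp_uniformStream F t
  have hind : ProbabilityTheory.iIndepFun Y (uniformStream k d) :=
    ProbabilityTheory.iIndepFun_infinitePi (X := fun _ => F) fun _ => Measurable.of_discrete
  have hvar := ProbabilityTheory.IndepFun.variance_sum (s := Finset.range T) (fun t _ => hL t)
    (fun i _ j _ hij => hind.indepFun hij)
  have hsum : MemLp (∑ t ∈ Finset.range T, Y t) 2 (uniformStream k d) :=
    memLp_finsetSum' _ fun t _ => hL t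
  have hch := ProbabilityTheory.meas_ge_le_variance_div_sq hsum ha
  have hE : ∫ xs, (∑ t ∈ Finset.range T, Y t) xs ∂(uniformStream k d) = T * cubeExp F := by
    simp only [Finset.sum_apply]
    rw [integral_finsetSum _ fun t _ => (hL t).integrable (by norm_num)]
    simp [hY, integral_uniformStream]
  rw [hE] at hch
  have hv1 : ∀ t, ProbabilityTheory.variance (Y t) (uniformStream k d) ≤
      cubeExp fun x => F x ^ 2 := fun t => by
    refine (ProbabilityTheory.variance_le_expectation_sq (hL t).1).trans_eq ?_
    exact integral_uniformStream (fun x => F x ^ 2) t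
  have hv2 : ProbabilityTheory.variance (∑ t ∈ Finset.range T, Y t) (uniformStream k d) ≤
      T * cubeExp fun x => F x ^ 2 := by
    rw [hvar]
    refine (Finset.sum_le_sum fun t _ => hv1 t).trans_eq ?_
    simp
  have h0 : 0 ≤ T * cubeExp (fun x => F x ^ 2) / a ^ 2 :=
    div_nonneg (mul_nonneg (Nat.cast_nonneg _)
      (isWeight_cube.prodExp_nonneg fun _ => sq_nonneg _)) (sq_nonneg _)
  have hset : {xs : ℕ → Cube k d | a ≤ |∑ t ∈ Finset.range T, F (xs t) - T * cubeExp F|} =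
      {xs | a ≤ |(∑ t ∈ Finset.range T, Y t) xs - T * cubeExp F|} := by
    ext xs; simp [hY]
  rw [hset, Measure.real]
  refine ENNReal.toReal_le_of_le_ofReal h0 (hch.trans (ENNReal.ofReal_le_ofReal ?_))
  exact div_le_div_of_nonneg_right hv2 (sq_nonneg _)

open Classical in
/-- Union bound over the first `T` examples. -/
theorem uniformStream_exists_le (p : Cube k d → Prop) (T : ℕ) :
    (uniformStream k d).real {xs | ∃ t < T, p (xs t)} ≤
      T * cubeExp fun x => if p x then 1 else 0 := by
  have h1 : {xs : ℕ → Cube k d | ∃ t < T, p (xs t)} =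
      ⋃ t ∈ Finset.range T, {xs : ℕ → Cube k d | p (xs t)} := by
    ext xs; simp
  rw [h1]
  refine (measureReal_biUnion_finset_le _ _).trans ?_
  have h2 : ∀ t ∈ Finset.range T, (uniformStream k d).real {xs : ℕ → Cube k d | p (xs t)} =
      cubeExp fun x => if p x then 1 else 0 := by
    intro t _
    have hmeas : MeasurableSet {xs : ℕ → Cube k d | p (xs t)} :=
      (measurable_pi_apply t) (MeasurableSet.of_discrete (s := {x | p x}))
    rw [← integral_uniformStream _ t, ← integral_indicator_one hmeas]
    congr 1
  rw [Finset.sum_congr rfl h2]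
  simp

theorem accepts_iff [NeZero k] (Θt : Matrix (Fin d) (Fin d) ℝ) (θ : ℝ) (x : Cube k d) :
    Accepts Θt θ x ↔ θ < form Θt x 0 1 := by
  rw [Accepts, form_eq]

theorem accepted_succ_card [NeZero k] (Θt : Matrix (Fin d) (Fin d) ℝ) (θ : ℝ)
    (xs : ℕ → Cube k d) (T : ℕ) :
    (accepted Θt θ xs (T + 1)).card ≤ (accepted Θt θ xs T).card + 1 := by
  classical
  rw [accepted, Finset.range_add_one, Finset.filter_insert]
  split_ifs
  · exact Finset.card_insert_le _ _
  · exact Nat.le_succ _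

theorem accepted_mono [NeZero k] (Θt : Matrix (Fin d) (Fin d) ℝ) (θ : ℝ)
    (xs : ℕ → Cube k d) {T T' : ℕ} (h : T ≤ T') :
    accepted Θt θ xs T ⊆ accepted Θt θ xs T' :=
  fun t ht => by
    simp only [accepted, Finset.mem_filter, Finset.mem_range] at ht ⊢
    exact ⟨by omega, ht.2⟩

/-- If enough examples have been accepted, the procedure has stopped. -/
theorem exists_stopsAt [NeZero k] {Θt : Matrix (Fin d) (Fin d) ℝ} {θ : ℝ}
    {xs : ℕ → Cube k d} {n T₀ : ℕ} (h : n ≤ (accepted Θt θ xs T₀).card) :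
    ∃ T ≤ T₀, StopsAt Θt θ n xs T := by
  classical
  have hex : ∃ T, n ≤ (accepted Θt θ xs T).card := ⟨T₀, h⟩
  refine ⟨Nat.find hex, Nat.find_min' hex h, ?_, fun T' hT' => not_le.mp (Nat.find_min hex hT')⟩
  refine le_antisymm ?_ (Nat.find_spec hex)
  rcases hT : Nat.find hex with _ | T
  · simp [accepted]
  · have h1 := not_le.mp (Nat.find_min hex (m := T) (by omega))
    have h2 := accepted_succ_card Θt θ xs T
    omega

theorem card_accepted_eq [NeZero k] (Θt : Matrix (Fin d) (Fin d) ℝ) (θ : ℝ)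
    (xs : ℕ → Cube k d) (T : ℕ) :
    open Classical in
    ((accepted Θt θ xs T).card : ℝ) =
      ∑ t ∈ Finset.range T, if θ < form Θt (xs t) 0 1 then (1 : ℝ) else 0 := by
  classical
  rw [← Finset.sum_filter, Finset.sum_const, nsmul_one, accepted]
  congr 2

/-- What is used about the first `T` examples: the procedure stops after them, the accepted samples
are all focused, and the Gram matrix of their second rows is at least `b`. -/
structure GoodRun [NeZero k] (Θ : Fin m → Matrix (Fin d) (Fin d) ℝ)
    (Θt : Matrix (Fin d) (Fin d) ℝ) (θ : ℝ) (n : ℕ) (b : ℝ) (xs : ℕ → Cube k d) (T : ℕ) : Prop where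
  stops : StopsAt Θt θ n xs T
  focused : ∀ t ∈ accepted Θt θ xs T, Focused Θ θ (xs t)
  gram : ∀ w : Fin d → ℝ, b * (w ⬝ᵥ w) ≤ ∑ t ∈ accepted Θt θ xs T, (w ⬝ᵥ sv (xs t 1)) ^ 2

/-- A matrix with entries at most `a` has operator norm at most `a d`. -/
theorem abs_sum_mul_le (w : Fin d → ℝ) {M : Fin d → Fin d → ℝ} {a : ℝ} (ha : 0 ≤ a)
    (hM : ∀ i j, |M i j| ≤ a) :
    |∑ i, ∑ j, w i * w j * M i j| ≤ a * (d * (w ⬝ᵥ w)) := by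
  have h1 : |∑ i, ∑ j, w i * w j * M i j| ≤ ∑ i, ∑ j, |w i| * |w j| * a := by
    refine (Finset.abs_sum_le_sum_abs _ _).trans (Finset.sum_le_sum fun i _ => ?_)
    refine (Finset.abs_sum_le_sum_abs _ _).trans (Finset.sum_le_sum fun j _ => ?_)
    rw [abs_mul, abs_mul]
    exact mul_le_mul_of_nonneg_left (hM i j) (by positivity)
  refine h1.trans ?_
  have h2 : ∑ i, ∑ j, |w i| * |w j| * a = a * (∑ i, |w i|) ^ 2 := by
    rw [sq, Finset.sum_mul_sum, Finset.mul_sum]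
    refine Finset.sum_congr rfl fun i _ => ?_
    rw [Finset.mul_sum]
    exact Finset.sum_congr rfl fun j _ => by ring
  rw [h2]
  refine mul_le_mul_of_nonneg_left ?_ ha
  have h3 := sq_sum_le_card_mul_sum_sq (s := Finset.univ) (f := fun i => |w i|)
  simp only [sq_abs, Finset.card_univ, Fintype.card_fin] at h3
  refine h3.trans_eq ?_
  rw [dotProduct]
  congr 1
  exact Finset.sum_congr rfl fun i _ => sq _

set_option maxHeartbeats 800000 in
/-- With high probability the procedure stops in time, after a good run. -/
theorem goodRun_prob [NeZero k] {Θ : Fin m → Matrix (Fin d) (Fin d) ℝ}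
    {Θt : Matrix (Fin d) (Fin d) ℝ} {θ c : ℝ} {n Γ : ℕ} (hd : 0 < d) (hn : 4 ≤ n) (hc : 0 < c)
    (hp : 0 < accProb k Θt θ)
    (hgram : open Classical in ∀ w : Fin d → ℝ, c / (2 * d) * (w ⬝ᵥ w) * accProb k Θt θ ≤
      cubeExp (k := k) fun X => if θ < form Θt X 0 1 then (w ⬝ᵥ sv (X 1)) ^ 2 else 0)
    (hunf : open Classical in (d : ℝ) ^ Γ * cubeExp (k := k) (fun X =>
      if θ < form Θt X 0 1 ∧ ¬ Focused Θ θ X then 1 else 0) ≤ accProb k Θt θ) :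
    1 - (4 / (n : ℝ) + 128 * d ^ 6 / (c ^ 2 * n) + 3 * n / d ^ Γ) ≤
      (uniformStream k d).real {xs | ∃ T : ℕ, (T : ℝ) ≤ 3 * n / accProb k Θt θ ∧
        GoodRun Θ Θt θ n (c * n / (16 * d)) xs T} := by
  classical
  set p := accProb k Θt θ with hpdef
  have hp1 : p ≤ 1 := by
    rw [hpdef, accProb]
    refine (isWeight_cube.prodExp_mono fun X => ?_).trans_eq (isWeight_cube.prodExp_const 1)
    split_ifs <;> norm_num
  have hn4 : (4 : ℝ) ≤ n := by exact_mod_cast hn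
  have hn0 : (0 : ℝ) < n := by linarith
  have hdR : (0 : ℝ) < d := by exact_mod_cast hd
  -- after `T₁` draws at most `n / 2` acceptances are expected, so the procedure is still running, and
  -- after `T₀` draws at least `2 n`, so it has stopped
  set T₁ := ⌊(n : ℝ) / (2 * p)⌋₊ with hT₁
  set T₀ := ⌈2 * (n : ℝ) / p⌉₊ with hT₀
  have hT₁u : T₁ * p ≤ n / 2 := by
    have := Nat.floor_le (by positivity : 0 ≤ (n : ℝ) / (2 * p))
    have h2 := mul_le_mul_of_nonneg_right this hp.le
    refine h2.trans_eq ?_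
    field_simp
  have hT₁l : (n : ℝ) / 4 ≤ T₁ * p := by
    have := Nat.lt_floor_add_one ((n : ℝ) / (2 * p))
    have h2 := mul_lt_mul_of_pos_right this hp
    have h3 : (n : ℝ) / (2 * p) * p = n / 2 := by field_simp
    rw [h3, add_mul, one_mul] at h2
    linarith
  have hT₀l : 2 * (n : ℝ) ≤ T₀ * p := by
    have := Nat.le_ceil (2 * (n : ℝ) / p)
    rwa [div_le_iff₀ hp] at this
  have hT₀u' : (T₀ : ℝ) ≤ 3 * n / p := by
    have := (Nat.ceil_lt_add_one (by positivity : 0 ≤ 2 * (n : ℝ) / p)).le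
    refine this.trans ?_
    have h1 : 1 ≤ n / p := by rw [one_le_div hp]; linarith
    have h2 : 3 * (n : ℝ) / p = 2 * n / p + n / p := by ring
    rw [h2]; linarith
  have hT₀u : T₀ * p ≤ 3 * n := by rwa [le_div_iff₀ hp] at hT₀u'
  set acc : Cube k d → ℝ := fun X => if θ < form Θt X 0 1 then 1 else 0 with hacc
  have hEacc : cubeExp acc = p := rfl
  have hacc2 : (cubeExp fun X => acc X ^ 2) = p := by
    rw [← hEacc]; congr 1; funext X; simp only [hacc]; split_ifs <;> norm_num
  set G : Fin d → Fin d → Cube k d → ℝ := fun i j X =>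
    if θ < form Θt X 0 1 then sg (X 1 i) * sg (X 1 j) else 0 with hG
  have hG2 : ∀ i j, (cubeExp fun X => G i j X ^ 2) = p := fun i j => by
    rw [← hEacc]; congr 1; funext X; simp only [hG, hacc]
    split_ifs
    · rw [mul_pow, sq, sq, sg_sq, sg_sq]; norm_num
    · norm_num
  -- the entrywise deviation of the Gram matrix that still leaves half of its lower bound
  set a := c * n / (16 * d ^ 2) with ha
  have ha0 : 0 < a := by positivity
  set B₁ : Set (ℕ → Cube k d) :=
    {xs | T₀ * p / 2 ≤ |∑ t ∈ Finset.range T₀, acc (xs t) - T₀ * cubeExp acc|} with hB₁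
  set B₂ : Set (ℕ → Cube k d) :=
    {xs | (n : ℝ) / 2 ≤ |∑ t ∈ Finset.range T₁, acc (xs t) - T₁ * cubeExp acc|} with hB₂
  set B₃ : Set (ℕ → Cube k d) := ⋃ i ∈ (Finset.univ : Finset (Fin d)),
    ⋃ j ∈ (Finset.univ : Finset (Fin d)),
    {xs | a ≤ |∑ t ∈ Finset.range T₁, G i j (xs t) - T₁ * cubeExp (G i j)|} with hB₃
  set B₄ : Set (ℕ → Cube k d) := {xs | ∃ t < T₀, θ < form Θt (xs t) 0 1 ∧ ¬ Focused Θ θ (xs t)}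
    with hB₄
  have m₁ : (uniformStream k d).real B₁ ≤ 2 / n := by
    have hTp : 0 < T₀ * p := by linarith
    have h1 := uniformStream_deviation_le acc T₀ (a := T₀ * p / 2) (by linarith)
    rw [hacc2] at h1
    refine h1.trans ?_
    rw [div_le_div_iff₀ (by positivity) hn0]
    nlinarith
  have m₂ : (uniformStream k d).real B₂ ≤ 2 / n := by
    have h1 := uniformStream_deviation_le acc T₁ (a := n / 2) (by positivity)
    rw [hacc2] at h1
    refine h1.trans ?_
    rw [div_le_div_iff₀ (by positivity) hn0]
    nlinarith
  have m₃ : (uniformStream k d).real B₃ ≤ 128 * d ^ 6 / (c ^ 2 * n) := by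
    refine (measureReal_biUnion_finset_le _ _).trans ?_
    have h1 : ∀ i j, (uniformStream k d).real
        {xs | a ≤ |∑ t ∈ Finset.range T₁, G i j (xs t) - T₁ * cubeExp (G i j)|} ≤
        128 * d ^ 4 / (c ^ 2 * n) := by
      intro i j
      have h2 := uniformStream_deviation_le (G i j) T₁ ha0
      rw [hG2] at h2
      refine h2.trans ?_
      have h3 : (n : ℝ) / 2 / a ^ 2 = 128 * d ^ 4 / (c ^ 2 * n) := by
        rw [ha]; field_simp; norm_num
      rw [← h3]
      exact div_le_div_of_nonneg_right hT₁u (sq_nonneg _)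
    have h2 := Finset.sum_le_sum fun i (_ : i ∈ (Finset.univ : Finset (Fin d))) =>
      (measureReal_biUnion_finset_le (μ := uniformStream k d) (Finset.univ : Finset (Fin d))
        (fun j => {xs | a ≤ |∑ t ∈ Finset.range T₁, G i j (xs t) - T₁ * cubeExp (G i j)|})).trans
        (Finset.sum_le_sum fun j _ => h1 i j)
    refine h2.trans_eq ?_
    simp only [Finset.sum_const, Finset.card_univ, Fintype.card_fin, nsmul_eq_mul]
    ring
  have m₄ : (uniformStream k d).real B₄ ≤ 3 * n / d ^ Γ := by
    have h1 := uniformStream_exists_le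
      (fun X : Cube k d => θ < form Θt X 0 1 ∧ ¬ Focused Θ θ X) T₀
    refine h1.trans ?_
    rw [le_div_iff₀ (by positivity)]
    refine le_trans ?_ hT₀u
    rw [mul_assoc]
    refine mul_le_mul_of_nonneg_left ?_ (Nat.cast_nonneg _)
    rw [mul_comm]
    refine le_trans (le_of_eq ?_) hunf
    congr!
  set E : Set (ℕ → Cube k d) := {xs | ∃ T : ℕ, (T : ℝ) ≤ 3 * n / p ∧
        GoodRun Θ Θt θ n (c * n / (16 * d)) xs T} with hE
  have hsub : (Set.univ : Set (ℕ → Cube k d)) ⊆ E ∪ (B₁ ∪ B₂ ∪ (B₃ ∪ B₄)) := by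
    intro xs _
    by_contra hcon
    simp only [Set.mem_union, not_or] at hcon
    obtain ⟨hxE, ⟨hx1, hx2⟩, hx3, hx4⟩ := hcon
    refine hxE ?_
    simp only [hB₁, hB₂, Set.mem_ofPred_eq, not_le, hEacc] at hx1 hx2
    simp only [hB₄, Set.mem_ofPred_eq, not_exists, not_and, not_not] at hx4
    have hx3' : ∀ i j, |∑ t ∈ Finset.range T₁, G i j (xs t) - T₁ * cubeExp (G i j)| < a := by
      intro i j
      by_contra hcon
      exact hx3 (Set.mem_biUnion (Finset.mem_coe.mpr (Finset.mem_univ i))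
        (Set.mem_biUnion (Finset.mem_coe.mpr (Finset.mem_univ j)) (not_lt.mp hcon)))
    have c0 : ((accepted Θt θ xs T₀).card : ℝ) = ∑ t ∈ Finset.range T₀, acc (xs t) := by
      rw [card_accepted_eq]
    have c1 : ((accepted Θt θ xs T₁).card : ℝ) = ∑ t ∈ Finset.range T₁, acc (xs t) := by
      rw [card_accepted_eq]
    rw [← c0, abs_lt] at hx1
    rw [← c1, abs_lt] at hx2
    have hcard0 : n ≤ (accepted Θt θ xs T₀).card := by
      have : (n : ℝ) ≤ (accepted Θt θ xs T₀).card := by linarith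
      exact_mod_cast this
    have hcard1 : (accepted Θt θ xs T₁).card < n := by
      have : ((accepted Θt θ xs T₁).card : ℝ) < n := by linarith
      exact_mod_cast this
    obtain ⟨T, hT, hhalt⟩ := exists_stopsAt hcard0
    have hT1 : T₁ ≤ T := by
      by_contra hcon
      have := Finset.card_le_card (accepted_mono Θt θ xs (not_le.mp hcon).le)
      rw [hhalt.1] at this
      omega
    refine ⟨T, (Nat.cast_le.mpr hT).trans hT₀u', hhalt, ?_, ?_⟩
    · intro t ht
      simp only [accepted, Finset.mem_filter, Finset.mem_range, accepts_iff] at ht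
      exact hx4 t (by omega) ht.2
    · intro w
      have hw := dotProduct_self_nonneg' w
      -- the number `T` of draws is random; the Gram matrix after the fixed number `T₁` is a lower bound
      have g1 : ∑ t ∈ accepted Θt θ xs T₁, (w ⬝ᵥ sv (xs t 1)) ^ 2 ≤
          ∑ t ∈ accepted Θt θ xs T, (w ⬝ᵥ sv (xs t 1)) ^ 2 :=
        Finset.sum_le_sum_of_subset_of_nonneg (accepted_mono Θt θ xs hT1)
          fun _ _ _ => sq_nonneg _
      refine le_trans ?_ g1
      have g0 : ∀ X : Cube k d, (if θ < form Θt X 0 1 then (w ⬝ᵥ sv (X 1)) ^ 2 else 0) =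
          ∑ i, ∑ j, w i * w j * G i j X := by
        intro X
        simp only [hG]
        split_ifs
        · exact sq_dotProduct_eq _ _
        · simp
      have g2 : ∑ t ∈ accepted Θt θ xs T₁, (w ⬝ᵥ sv (xs t 1)) ^ 2 =
          ∑ i, ∑ j, w i * w j * ∑ t ∈ Finset.range T₁, G i j (xs t) := by
        rw [accepted, Finset.sum_filter]
        simp only [accepts_iff, g0]
        rw [Finset.sum_comm]
        refine Finset.sum_congr rfl fun i _ => ?_
        rw [Finset.sum_comm]
        exact Finset.sum_congr rfl fun j _ => by rw [Finset.mul_sum]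
      have g3 : (cubeExp (k := k) fun X => if θ < form Θt X 0 1 then (w ⬝ᵥ sv (X 1)) ^ 2 else 0) =
          ∑ i, ∑ j, w i * w j * cubeExp (G i j) := by
        simp only [g0, cubeExp]
        rw [prodExp_sum]
        refine Finset.sum_congr rfl fun i _ => ?_
        rw [prodExp_sum]
        exact Finset.sum_congr rfl fun j _ => by rw [prodExp_const_mul]
      have g4 := abs_sum_mul_le w ha0.le fun i j => (hx3' i j).le
      have g5 : ∑ i, ∑ j, w i * w j *
          (∑ t ∈ Finset.range T₁, G i j (xs t) - T₁ * cubeExp (G i j)) =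
          ∑ i, ∑ j, w i * w j * ∑ t ∈ Finset.range T₁, G i j (xs t) -
          T₁ * ∑ i, ∑ j, w i * w j * cubeExp (G i j) := by
        rw [Finset.mul_sum, ← Finset.sum_sub_distrib]
        refine Finset.sum_congr rfl fun i _ => ?_
        rw [Finset.mul_sum, ← Finset.sum_sub_distrib]
        exact Finset.sum_congr rfl fun j _ => by ring
      rw [g5, ← g3, ← g2] at g4
      have g6 := (abs_le.mp g4).1
      have g7 := mul_le_mul_of_nonneg_left (hgram w) (Nat.cast_nonneg (α := ℝ) T₁)
      have g8 : (n : ℝ) / 4 * (c / (2 * d) * (w ⬝ᵥ w)) ≤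
          T₁ * (c / (2 * d) * (w ⬝ᵥ w) * p) := by
        have := mul_le_mul_of_nonneg_right hT₁l
          (by positivity : 0 ≤ c / (2 * d) * (w ⬝ᵥ w))
        linarith
      have g9 : a * (d * (w ⬝ᵥ w)) = c * n / (16 * d) * (w ⬝ᵥ w) := by
        rw [ha]; field_simp
      have g10 : (n : ℝ) / 4 * (c / (2 * d) * (w ⬝ᵥ w)) =
          2 * (c * n / (16 * d) * (w ⬝ᵥ w)) := by field_simp; ring
      linarith
  have h1 : (1 : ℝ) ≤ (uniformStream k d).real (E ∪ (B₁ ∪ B₂ ∪ (B₃ ∪ B₄))) := by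
    have := measureReal_mono (μ := uniformStream k d) hsub
    rwa [probReal_univ] at this
  have h2 := measureReal_union_le (μ := uniformStream k d) E (B₁ ∪ B₂ ∪ (B₃ ∪ B₄))
  have h3 := measureReal_union_le (μ := uniformStream k d) (B₁ ∪ B₂) (B₃ ∪ B₄)
  have h4 := measureReal_union_le (μ := uniformStream k d) B₁ B₂
  have h5 := measureReal_union_le (μ := uniformStream k d) B₃ B₄
  have h6 : 4 / (n : ℝ) = 2 / n + 2 / n := by ring
  rw [h6]
  linarith

end Stream

end

noncomputable section

/-! ### Residuals on focused samples and the least-squares estimate -/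

section LeastSquares

variable {m k d : ℕ}

theorem rowSoftmax_nonneg {a b : ℕ} (M : Matrix (Fin a) (Fin b) ℝ) (i : Fin a) (j : Fin b) :
    0 ≤ rowSoftmax M i j :=
  div_nonneg (Real.exp_pos _).le (Finset.sum_nonneg fun _ _ => (Real.exp_pos _).le)

theorem sum_rowSoftmax {a b : ℕ} [NeZero b] (M : Matrix (Fin a) (Fin b) ℝ) (i : Fin a) :
    ∑ j, rowSoftmax M i j = 1 := by
  simp only [rowSoftmax, Matrix.of_apply]
  rw [← Finset.sum_div, div_self]
  exact (Finset.sum_pos (fun _ _ => Real.exp_pos _) ⟨0, Finset.mem_univ _⟩).ne'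

/-- An entry which is smaller than another one of its row by `g` has softmax weight at most `exp (-g)`. -/
theorem rowSoftmax_le {a b : ℕ} (M : Matrix (Fin a) (Fin b) ℝ) (i : Fin a) {j l : Fin b} {g : ℝ}
    (h : M i j + g ≤ M i l) : rowSoftmax M i j ≤ Real.exp (-g) := by
  have hs : Real.exp (M i l) ≤ ∑ l, Real.exp (M i l) :=
    Finset.single_le_sum (f := fun l => Real.exp (M i l)) (fun _ _ => (Real.exp_pos _).le)
      (Finset.mem_univ l)
  simp only [rowSoftmax, Matrix.of_apply]
  rw [div_le_iff₀ (lt_of_lt_of_le (Real.exp_pos _) hs)]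
  refine le_trans ?_ (mul_le_mul_of_nonneg_left hs (Real.exp_pos _).le)
  rw [← Real.exp_add]
  exact Real.exp_le_exp.mpr (by linarith)

theorem signMatrix_mul_apply (x : Cube k d) (V : Matrix (Fin d) (Fin d) ℝ) (a : Fin k) (j : Fin d) :
    (signMatrix x * V) a j = (sv (x a) ᵥ* V) j := rfl

theorem attention_apply (Θ W : Fin m → Matrix (Fin d) (Fin d) ℝ) (x : Cube k d) (a : Fin k)
    (j : Fin d) : attention Θ W (signMatrix x) a j =
      ∑ i, ∑ b, rowSoftmax (signMatrix x * Θ i * (signMatrix x)ᵀ) a b * (sv (x b) ᵥ* W i) j := by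
  rw [attention, Matrix.sum_apply]
  refine Finset.sum_congr rfl fun i _ => ?_
  rw [Matrix.mul_assoc, Matrix.mul_apply]
  rfl

theorem sum_sq_vecMul_le (u : Fin d → ℝ) {W : Matrix (Fin d) (Fin d) ℝ} (hW : frob W ≤ 1) :
    ∑ j, (u ᵥ* W) j ^ 2 ≤ u ⬝ᵥ u := by
  have h := opLE_frob W u
  have h0 := dotProduct_self_nonneg' u
  have h1 : frob W ^ 2 ≤ 1 := pow_le_one₀ (frob_nonneg _) hW
  have h2 : ∑ j, (u ᵥ* W) j ^ 2 = (u ᵥ* W) ⬝ᵥ (u ᵥ* W) :=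
    Finset.sum_congr rfl fun j _ => sq _
  rw [h2]
  nlinarith

/-- On a focused sample the first row of the output is nearly the second row of the input times
the sum of the projection matrices. -/
theorem Focused.residual_le [NeZero k] {Θ W : Fin m → Matrix (Fin d) (Fin d) ℝ} {θ : ℝ}
    {x : Cube k d} (hx : Focused Θ θ x) (hW : ∀ i, frob (W i) ≤ 1) :
    ∑ j, (attention Θ W (signMatrix x) 0 j - (signMatrix x * ∑ i, W i) 1 j) ^ 2 ≤
      (m * k * Real.exp (-(θ / 4))) ^ 2 * (4 * d) := by
  set P : Fin m → Fin k → ℝ := fun i b =>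
    rowSoftmax (signMatrix x * Θ i * (signMatrix x)ᵀ) 0 b with hP
  set z : Fin m × Fin k → Fin d → ℝ := fun q => (sv (x q.2) - sv (x 1)) ᵥ* W q.1 with hz
  set Q : Fin m × Fin k → ℝ := fun q => if q.2 = 1 then 0 else P q.1 q.2 with hQ
  have hQ0 : ∀ q, 0 ≤ Q q := fun q => by
    simp only [hQ]; split_ifs
    · exact le_rfl
    · exact rowSoftmax_nonneg _ _ _
  have hQ1 : ∀ q, Q q ≤ Real.exp (-(θ / 4)) := fun q => by
    simp only [hQ]; split_ifs with h
    · exact (Real.exp_pos _).le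
    · refine rowSoftmax_le _ _ (l := 1) ?_
      rw [form_eq, form_eq]
      have h1 := (hx q.1).1
      have h2 := (hx q.1).2 _ h
      linarith
  -- softmax weights sum to one, so only the attention outside the second token contributes
  have hres : ∀ j, attention Θ W (signMatrix x) 0 j - (signMatrix x * ∑ i, W i) 1 j =
      ∑ q, Q q * z q j := by
    intro j
    rw [attention_apply, signMatrix_mul_apply, Fintype.sum_prod_type]
    have h1 : (sv (x 1) ᵥ* ∑ i, W i) j = ∑ i, (sv (x 1) ᵥ* W i) j := by
      simp only [vecMul, dotProduct, Matrix.sum_apply, Finset.mul_sum]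
      exact Finset.sum_comm
    rw [h1, ← Finset.sum_sub_distrib]
    refine Finset.sum_congr rfl fun i _ => ?_
    have h2 : (sv (x 1) ᵥ* W i) j = ∑ b, P i b * (sv (x 1) ᵥ* W i) j := by
      rw [← Finset.sum_mul, hP, sum_rowSoftmax, one_mul]
    rw [h2, ← Finset.sum_sub_distrib]
    refine Finset.sum_congr rfl fun b _ => ?_
    simp only [hQ, hz, sub_vecMul, Pi.sub_apply]
    split_ifs with hb
    · subst hb; simp [hP]
    · rw [← mul_sub]
  have hzq : ∀ q, ∑ j, z q j ^ 2 ≤ 4 * d := by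
    intro q
    refine (sum_sq_vecMul_le _ (hW q.1)).trans ?_
    have h1 : ∀ i, (sv (x q.2) i - sv (x 1) i) * (sv (x q.2) i - sv (x 1) i) ≤ 4 := by
      intro i
      simp only [sv]
      rcases x q.2 i <;> rcases x 1 i <;> norm_num [sg]
    refine (Finset.sum_le_sum fun i _ => h1 i).trans_eq ?_
    simp [mul_comm]
  have hQs : ∑ q, Q q ≤ m * k * Real.exp (-(θ / 4)) := by
    refine (Finset.sum_le_sum fun q _ => hQ1 q).trans_eq ?_
    simp
  have hQs0 : 0 ≤ ∑ q, Q q := Finset.sum_nonneg fun q _ => hQ0 q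
  calc ∑ j, (attention Θ W (signMatrix x) 0 j - (signMatrix x * ∑ i, W i) 1 j) ^ 2
      ≤ ∑ j, (∑ q, Q q) * ∑ q, Q q * z q j ^ 2 :=
        Finset.sum_le_sum fun j _ => by
          rw [hres]; exact sq_sum_mul_le _ _ _ hQ0
    _ = (∑ q, Q q) * ∑ q, Q q * ∑ j, z q j ^ 2 := by
        rw [← Finset.mul_sum, Finset.sum_comm]
        congr 1
        exact Finset.sum_congr rfl fun q _ => by rw [Finset.mul_sum]
    _ ≤ (∑ q, Q q) * ∑ q, Q q * (4 * d) :=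
        mul_le_mul_of_nonneg_left (Finset.sum_le_sum fun q _ =>
          mul_le_mul_of_nonneg_left (hzq q) (hQ0 q)) hQs0
    _ = (∑ q, Q q) ^ 2 * (4 * d) := by rw [← Finset.sum_mul]; ring
    _ ≤ _ := mul_le_mul_of_nonneg_right (pow_le_pow_left₀ hQs0 hQs 2) (by positivity)

/-- The squared least-squares objective. -/
def sqLoss [NeZero k] (F : Matrix (Fin k) (Fin d) ℝ → Matrix (Fin k) (Fin d) ℝ)
    (I : Finset ℕ) (xs : ℕ → Cube k d) (V : Matrix (Fin d) (Fin d) ℝ) : ℝ :=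
  ∑ t ∈ I, ∑ j, (F (signMatrix (xs t)) 0 j - (signMatrix (xs t) * V) 1 j) ^ 2

theorem isLSOutput_iff [NeZero k] (F : Matrix (Fin k) (Fin d) ℝ → Matrix (Fin k) (Fin d) ℝ)
    (Θt : Matrix (Fin d) (Fin d) ℝ) (θ : ℝ) (xs : ℕ → Cube k d) (T : ℕ)
    (V : Matrix (Fin d) (Fin d) ℝ) : IsLSOutput F Θt θ xs T V ↔
      ∀ V', sqLoss F (accepted Θt θ xs T) xs V ≤ sqLoss F (accepted Θt θ xs T) xs V' := by
  refine forall_congr' fun V' => ?_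
  exact Real.sqrt_le_sqrt_iff
    (Finset.sum_nonneg fun _ _ => Finset.sum_nonneg fun _ _ => sq_nonneg _)

/-- The lower bound on the Gram matrix, applied to every column of `U`. -/
theorem mul_frob_sq_le_of_gram {I : Finset ℕ} {y : ℕ → Fin d → ℝ} {b : ℝ}
    (h : ∀ w : Fin d → ℝ, b * (w ⬝ᵥ w) ≤ ∑ t ∈ I, (w ⬝ᵥ y t) ^ 2)
    (U : Matrix (Fin d) (Fin d) ℝ) : b * frob U ^ 2 ≤ ∑ t ∈ I, ∑ j, (y t ᵥ* U) j ^ 2 := by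
  rw [Finset.sum_comm, frob_sq, Finset.sum_comm, Finset.mul_sum]
  refine Finset.sum_le_sum fun j _ => ?_
  have h1 := h fun i => U i j
  have h2 : (fun i => U i j) ⬝ᵥ (fun i => U i j) = ∑ i, U i j ^ 2 :=
    Finset.sum_congr rfl fun i _ => (sq _).symm
  rw [h2] at h1
  refine h1.trans_eq (Finset.sum_congr rfl fun t _ => ?_)
  rw [dotProduct_comm]; rfl

/-- The error of any minimizer after a good run. -/
theorem GoodRun.frob_sub_le [NeZero k] {Θ W : Fin m → Matrix (Fin d) (Fin d) ℝ}
    {Θt : Matrix (Fin d) (Fin d) ℝ} {θ b : ℝ} {n : ℕ} {xs : ℕ → Cube k d} {T : ℕ}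
    (R : GoodRun Θ Θt θ n b xs T) (hW : ∀ i, frob (W i) ≤ 1) {V : Matrix (Fin d) (Fin d) ℝ}
    (hV : IsLSOutput (attention Θ W) Θt θ xs T V) :
    b * frob (V - ∑ i, W i) ^ 2 ≤ 16 * n * d * (m * k * Real.exp (-(θ / 4))) ^ 2 := by
  rw [isLSOutput_iff] at hV
  set I := accepted Θt θ xs T with hI
  set V₁ := ∑ i, W i with hV₁
  have h1 : sqLoss (attention Θ W) I xs V₁ ≤ n * ((m * k * Real.exp (-(θ / 4))) ^ 2 * (4 * d)) := by
    refine (Finset.sum_le_sum fun t ht => (R.focused t ht).residual_le hW).trans_eq ?_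
    rw [Finset.sum_const, R.stops.1, nsmul_eq_mul]
  have h2 := mul_frob_sq_le_of_gram R.gram (V - V₁)
  -- `(a - b)² ≤ 2 a² + 2 b²` for the residuals of the two matrices; the minimizer `V` has the smaller loss
  have h3 : ∑ t ∈ I, ∑ j, (sv (xs t 1) ᵥ* (V - V₁)) j ^ 2 ≤
      2 * sqLoss (attention Θ W) I xs V₁ + 2 * sqLoss (attention Θ W) I xs V := by
    rw [sqLoss, sqLoss, Finset.mul_sum, Finset.mul_sum, ← Finset.sum_add_distrib]
    refine Finset.sum_le_sum fun t _ => ?_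
    rw [Finset.mul_sum, Finset.mul_sum, ← Finset.sum_add_distrib]
    refine Finset.sum_le_sum fun j _ => ?_
    rw [signMatrix_mul_apply, signMatrix_mul_apply, vecMul_sub, Pi.sub_apply]
    set Y := attention Θ W (signMatrix (xs t)) 0 j
    nlinarith [sq_nonneg ((Y - (sv (xs t 1) ᵥ* V₁) j) + (Y - (sv (xs t 1) ᵥ* V) j))]
  have h4 := hV V₁
  linarith

/-- Solutions of the normal equations are minimizers. -/
theorem isLSOutput_of_normal [NeZero k] {F : Matrix (Fin k) (Fin d) ℝ → Matrix (Fin k) (Fin d) ℝ}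
    {Θt : Matrix (Fin d) (Fin d) ℝ} {θ : ℝ} {xs : ℕ → Cube k d} {T : ℕ}
    {V : Matrix (Fin d) (Fin d) ℝ}
    (h : ∀ i l, ∑ j, (∑ t ∈ accepted Θt θ xs T, sv (xs t 1) i * sv (xs t 1) j) * V j l =
      ∑ t ∈ accepted Θt θ xs T, sv (xs t 1) i * F (signMatrix (xs t)) 0 l) :
    IsLSOutput F Θt θ xs T V := by
  rw [isLSOutput_iff]
  intro V'
  set I := accepted Θt θ xs T with hI
  have h0 : ∀ i l, ∑ t ∈ I, sv (xs t 1) i *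
      (F (signMatrix (xs t)) 0 l - (sv (xs t 1) ᵥ* V) l) = 0 := by
    intro i l
    simp only [mul_sub, Finset.sum_sub_distrib]
    rw [← h i l, sub_eq_zero]
    simp only [Finset.sum_mul, vecMul, dotProduct, Finset.mul_sum]
    rw [Finset.sum_comm]
    exact Finset.sum_congr rfl fun t _ => Finset.sum_congr rfl fun j _ => by ring
  have h1 : ∑ t ∈ I, ∑ l, (F (signMatrix (xs t)) 0 l - (sv (xs t 1) ᵥ* V) l) *
      (sv (xs t 1) ᵥ* (V - V')) l = 0 := by
    rw [Finset.sum_comm]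
    refine Finset.sum_eq_zero fun l _ => ?_
    have h2 : ∀ t, (F (signMatrix (xs t)) 0 l - (sv (xs t 1) ᵥ* V) l) *
        (sv (xs t 1) ᵥ* (V - V')) l = ∑ i, (V - V') i l * (sv (xs t 1) i *
        (F (signMatrix (xs t)) 0 l - (sv (xs t 1) ᵥ* V) l)) := by
      intro t
      simp only [vecMul, dotProduct]
      rw [Finset.mul_sum]
      exact Finset.sum_congr rfl fun i _ => by ring
    rw [Finset.sum_congr rfl fun t _ => h2 t, Finset.sum_comm]
    refine Finset.sum_eq_zero fun i _ => ?_
    rw [← Finset.mul_sum, h0, mul_zero]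
  have h3 : sqLoss F I xs V + 2 * ∑ t ∈ I, ∑ l, (F (signMatrix (xs t)) 0 l - (sv (xs t 1) ᵥ* V) l) *
      (sv (xs t 1) ᵥ* (V - V')) l ≤ sqLoss F I xs V' := by
    rw [sqLoss, sqLoss, Finset.mul_sum, ← Finset.sum_add_distrib]
    refine Finset.sum_le_sum fun t _ => ?_
    rw [Finset.mul_sum, ← Finset.sum_add_distrib]
    refine Finset.sum_le_sum fun l _ => ?_
    rw [signMatrix_mul_apply, signMatrix_mul_apply, vecMul_sub, Pi.sub_apply]
    nlinarith [sq_nonneg ((sv (xs t 1) ᵥ* V) l - (sv (xs t 1) ᵥ* V') l)]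
  rw [h1] at h3
  linarith

end LeastSquares

end

noncomputable section

/-! ### Reasoning about programs -/

section Programs

variable {S : ℕ → LabelledPair}

/-- Total correctness with a bound on the number of steps: from every state satisfying `P`, the
program halts after at most `B` steps in a state satisfying `Q`. -/
def Triple (S : ℕ → LabelledPair) (P : State → Prop) (p : Cmd) (B : ℕ) (Q : State → Prop) : Prop :=
  ∀ s, P s → ∃ t s', Exec S p s t s' ∧ t ≤ B ∧ Q s'

theorem Triple.seq {P Q R : State → Prop} {p q : Cmd} {B B' : ℕ} (h : Triple S P p B Q)
    (h' : Triple S Q q B' R) : Triple S P (.seq p q) (B + B') R := by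
  intro s hs
  obtain ⟨t, s₁, e₁, ht, h1⟩ := h s hs
  obtain ⟨t', s₂, e₂, ht', h2⟩ := h' s₁ h1
  exact ⟨_, _, .seq e₁ e₂, by omega, h2⟩

theorem Triple.mono {P P' Q Q' : State → Prop} {p : Cmd} {B B' : ℕ} (h : Triple S P p B Q)
    (hP : ∀ s, P' s → P s) (hB : B ≤ B') (hQ : ∀ s, Q s → Q' s) : Triple S P' p B' Q' := by
  intro s hs
  obtain ⟨t, s₁, e₁, ht, h1⟩ := h s (hP s hs)
  exact ⟨t, s₁, e₁, ht.trans hB, hQ _ h1⟩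

/-- Rule for a loop which runs exactly `N` times; every test costs one step. -/
theorem Triple.while {I : ℕ → State → Prop} {i j N B : ℕ} {p : Cmd}
    (hlt : ∀ t < N, ∀ s, I t s → s.idx i < s.idx j) (hN : ∀ s, I N s → ¬ s.idx i < s.idx j)
    (hp : ∀ t < N, Triple S (I t) p B (I (t + 1))) :
    Triple S (I 0) (.whileIdx i j p) (N * (B + 1) + 1) (I N) := by
  have key : ∀ r t, t + r = N → Triple S (I t) (.whileIdx i j p) (r * (B + 1) + 1) (I N) := by
    intro r
    induction r with
    | zero =>
      intro t ht s hs
      obtain rfl : t = N := by omega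
      exact ⟨1, s, .while_false (hN s hs), by omega, hs⟩
    | succ r ih =>
      intro t ht s hs
      obtain ⟨t₁, s₁, e₁, b₁, h₁⟩ := hp t (by omega) s hs
      obtain ⟨t₂, s₂, e₂, b₂, h₂⟩ := ih (t + 1) (by omega) s₁ h₁
      refine ⟨_, _, .while_true (hlt t (by omega) s hs) e₁ e₂, ?_, h₂⟩
      have : (r + 1) * (B + 1) = r * (B + 1) + (B + 1) := by ring
      omega
  exact key N 0 (by omega)

/-- Run `p` with register `r` equal to `0, 1, …` up to the value of register `b`, exclusively;
register `5` holds the constant one. -/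
def forLoop (r b : ℕ) (p : Cmd) : Cmd :=
  .seq (.setIdx r 0) (.whileIdx r b (.seq p (.addIdx r r 5)))

@[simp] theorem putIdx_idx (s : State) (i v j : ℕ) :
    (s.putIdx i v).idx j = if j = i then v else s.idx j := by
  simp [State.putIdx, Function.update_apply]

@[simp] theorem putIdx_mem (s : State) (i v : ℕ) : (s.putIdx i v).mem = s.mem := rfl
@[simp] theorem putIdx_draws (s : State) (i v : ℕ) : (s.putIdx i v).draws = s.draws := rfl

@[simp] theorem put_idx (s : State) (z : Cell) (v : ℝ) : (s.put z v).idx = s.idx := rfl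

theorem put_mem (s : State) (z : Cell) (v : ℝ) (a i j : ℕ) : (s.put z v).mem a i j =
    if a = z.arr ∧ i = s.idx z.row ∧ j = s.idx z.col then v else s.mem a i j := by
  simp only [State.put]
  by_cases ha : a = z.arr
  · subst ha
    by_cases hi : i = s.idx z.row
    · subst hi
      by_cases hj : j = s.idx z.col
      · subst hj
        simp
      · simp [hj]
    · simp [hi]
  · simp [ha]

theorem put_mem_of_ne (s : State) (z : Cell) (v : ℝ) {a : ℕ} (h : a ≠ z.arr) :
    (s.put z v).mem a = s.mem a := by
  funext i j
  rw [put_mem, if_neg fun hh => h hh.1]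

/-- Rule for counting loops. The invariant `J i` must not depend on the loop register, which changes
between two rounds. -/
theorem Triple.forLoop {J : ℕ → State → Prop} {r b N B : ℕ} {p : Cmd}
    (hJ : ∀ i s, J i s → s.idx b = N ∧ s.idx 5 = 1) (hput : ∀ i s v, J i s → J i (s.putIdx r v))
    (hp : ∀ i < N, Triple S (fun s => J i s ∧ s.idx r = i) p B
      (fun s => J (i + 1) s ∧ s.idx r = i)) :
    Triple S (J 0) (AttentionLearning.forLoop r b p) (N * (B + 2) + 2) (J N) := by
  have h1 : Triple S (J 0) (.setIdx r 0) 1 (fun s => J 0 s ∧ s.idx r = 0) := fun s hs =>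
    ⟨_, _, .setIdx _ _ _, le_rfl, hput _ _ _ hs, by simp⟩
  have h2 : Triple S (fun s => J 0 s ∧ s.idx r = 0) (.whileIdx r b (.seq p (.addIdx r r 5)))
      (N * (B + 1 + 1) + 1) (fun s => J N s ∧ s.idx r = N) := by
    refine Triple.while (I := fun i s => J i s ∧ s.idx r = i) (fun t ht s hs => ?_)
      (fun s hs => ?_) fun t ht => ?_
    · rw [hs.2, (hJ _ _ hs.1).1]; exact ht
    · rw [hs.2, (hJ _ _ hs.1).1]; exact lt_irrefl _
    · refine (hp t ht).seq (fun s hs => ⟨_, _, .addIdx _ _ _ _, le_rfl, hput _ _ _ hs.1, ?_⟩)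
      simp [hs.2, (hJ _ _ hs.1).2]
  refine (h1.seq h2).mono (fun _ h => h) ?_ (fun s hs => hs.1)
  show 1 + (N * (B + 2) + 1) ≤ N * (B + 2) + 2
  omega

end Programs

/-! ### The program -/

/-- Multiply-accumulate loop for the score of the drawn sample, in entry `(0, 0)` of array `6`. -/
def scoreCmd : Cmd :=
  .seq (.setReal ⟨6, 4, 4⟩ 0) (forLoop 6 0 (forLoop 7 0
    (.seq (.arith .mul ⟨6, 4, 5⟩ ⟨4, 4, 6⟩ ⟨0, 6, 7⟩)
      (.seq (.arith .mul ⟨6, 4, 5⟩ ⟨6, 4, 5⟩ ⟨4, 5, 7⟩)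
        (.arith .add ⟨6, 4, 4⟩ ⟨6, 4, 4⟩ ⟨6, 4, 5⟩)))))

/-- Add the drawn sample to the normal equations: the Gram matrix is in array `3`, the right-hand
side in array `2`. -/
def accumulateCmd : Cmd :=
  forLoop 6 0 (forLoop 7 0
    (.seq (.arith .mul ⟨6, 4, 5⟩ ⟨4, 5, 6⟩ ⟨4, 5, 7⟩)
      (.seq (.arith .add ⟨3, 6, 7⟩ ⟨3, 6, 7⟩ ⟨6, 4, 5⟩)
        (.seq (.arith .mul ⟨6, 4, 5⟩ ⟨4, 5, 6⟩ ⟨5, 4, 7⟩)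
          (.arith .add ⟨2, 6, 7⟩ ⟨2, 6, 7⟩ ⟨6, 4, 5⟩)))))

/-- Draw an example and process it if it is accepted. Register `9` is never read, and setting it
stands for doing nothing. -/
def drawCmd : Cmd :=
  .seq (.draw 4 5) (.seq scoreCmd (.ifReal ⟨1, 4, 4⟩ ⟨6, 4, 4⟩
    (.seq accumulateCmd (.addIdx 3 3 5)) (.setIdx 9 0)))

/-- Subtract a multiple of the pivot row (register `8`) from the current row (register `6`). -/
def elimRowCmd : Cmd :=
  .seq (.arith .div ⟨6, 4, 4⟩ ⟨3, 6, 8⟩ ⟨3, 8, 8⟩) (forLoop 7 0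
    (.seq (.arith .mul ⟨6, 4, 5⟩ ⟨6, 4, 4⟩ ⟨3, 8, 7⟩)
      (.seq (.arith .sub ⟨3, 6, 7⟩ ⟨3, 6, 7⟩ ⟨6, 4, 5⟩)
        (.seq (.arith .mul ⟨6, 4, 5⟩ ⟨6, 4, 4⟩ ⟨2, 8, 7⟩)
          (.arith .sub ⟨2, 6, 7⟩ ⟨2, 6, 7⟩ ⟨6, 4, 5⟩)))))

/-- Gauss–Jordan elimination without pivoting. -/
def elimCmd : Cmd :=
  forLoop 8 0 (forLoop 6 0 (.ifIdx 6 8 elimRowCmd (.ifIdx 8 6 elimRowCmd (.setIdx 9 0))))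

/-- Divide the right-hand side by the diagonal. -/
def divideCmd : Cmd := forLoop 6 0 (forLoop 7 0 (.arith .div ⟨2, 6, 7⟩ ⟨2, 6, 7⟩ ⟨3, 6, 6⟩))

/-- The whole program: collect the normal equations of the accepted samples, and solve them. -/
def lsProgram : Cmd :=
  .seq (.setIdx 5 1) (.seq (.whileIdx 3 2 drawCmd) (.seq elimCmd divideCmd))

section Invariant

variable {S : ℕ → LabelledPair}

/-- The part of the state that matters between commands: constants and input, the number `c` of
accepted samples, the number `D` of draws, the Gram matrix `A`, the right-hand side `B`, and the
last example `X`, `Y`. -/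
structure Inv (d n c D : ℕ) (Θ : ℕ → ℕ → ℝ) (θ : ℝ) (A B X Y : ℕ → ℕ → ℝ) (s : State) : Prop where
  r0 : s.idx 0 = d
  r2 : s.idx 2 = n
  r3 : s.idx 3 = c
  r4 : s.idx 4 = 0
  r5 : s.idx 5 = 1
  m0 : s.mem 0 = Θ
  m1 : s.mem 1 0 0 = θ
  mA : ∀ i < d, ∀ j < d, s.mem 3 i j = A i j
  mB : ∀ i < d, ∀ j < d, s.mem 2 i j = B i j
  m4 : s.mem 4 = X
  m5 : s.mem 5 = Y
  dr : s.draws = D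

namespace Inv

variable {d n c D : ℕ} {Θ A B X Y : ℕ → ℕ → ℝ} {θ : ℝ} {s : State}

theorem putIdx (h : Inv d n c D Θ θ A B X Y s) {r : ℕ} (hr : 5 < r) (v : ℕ) :
    Inv d n c D Θ θ A B X Y (s.putIdx r v) where
  r0 := by rw [putIdx_idx, if_neg (by omega)]; exact h.r0
  r2 := by rw [putIdx_idx, if_neg (by omega)]; exact h.r2
  r3 := by rw [putIdx_idx, if_neg (by omega)]; exact h.r3
  r4 := by rw [putIdx_idx, if_neg (by omega)]; exact h.r4
  r5 := by rw [putIdx_idx, if_neg (by omega)]; exact h.r5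
  m0 := h.m0
  m1 := h.m1
  mA := h.mA
  mB := h.mB
  m4 := h.m4
  m5 := h.m5
  dr := h.dr

theorem count (h : Inv d n c D Θ θ A B X Y s) (c' : ℕ) :
    Inv d n c' D Θ θ A B X Y (s.putIdx 3 c') where
  r0 := by simpa using h.r0
  r2 := by simpa using h.r2
  r3 := by simp
  r4 := by simpa using h.r4
  r5 := by simpa using h.r5
  m0 := h.m0
  m1 := h.m1
  mA := h.mA
  mB := h.mB
  m4 := h.m4
  m5 := h.m5
  dr := h.dr

theorem scratch (h : Inv d n c D Θ θ A B X Y s) {z : Cell} (hz : z.arr = 6) (v : ℝ) :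
    Inv d n c D Θ θ A B X Y (s.put z v) where
  r0 := h.r0
  r2 := h.r2
  r3 := h.r3
  r4 := h.r4
  r5 := h.r5
  m0 := by rw [put_mem_of_ne _ _ _ (by omega)]; exact h.m0
  m1 := by rw [put_mem_of_ne _ _ _ (by omega)]; exact h.m1
  mA := by rw [put_mem_of_ne _ _ _ (by omega)]; exact h.mA
  mB := by rw [put_mem_of_ne _ _ _ (by omega)]; exact h.mB
  m4 := by rw [put_mem_of_ne _ _ _ (by omega)]; exact h.m4
  m5 := by rw [put_mem_of_ne _ _ _ (by omega)]; exact h.m5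
  dr := h.dr

theorem putA (h : Inv d n c D Θ θ A B X Y s) {z : Cell} (hz : z.arr = 3) (v : ℝ) :
    Inv d n c D Θ θ (fun i j => if i = s.idx z.row ∧ j = s.idx z.col then v else A i j) B X Y
      (s.put z v) where
  r0 := h.r0
  r2 := h.r2
  r3 := h.r3
  r4 := h.r4
  r5 := h.r5
  m0 := by rw [put_mem_of_ne _ _ _ (by omega)]; exact h.m0
  m1 := by rw [put_mem_of_ne _ _ _ (by omega)]; exact h.m1
  mA := fun i hi j hj => by
    rw [put_mem]
    simp only [hz, true_and, h.mA i hi j hj]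
  mB := by rw [put_mem_of_ne _ _ _ (by omega)]; exact h.mB
  m4 := by rw [put_mem_of_ne _ _ _ (by omega)]; exact h.m4
  m5 := by rw [put_mem_of_ne _ _ _ (by omega)]; exact h.m5
  dr := h.dr

theorem putB (h : Inv d n c D Θ θ A B X Y s) {z : Cell} (hz : z.arr = 2) (v : ℝ) :
    Inv d n c D Θ θ A (fun i j => if i = s.idx z.row ∧ j = s.idx z.col then v else B i j) X Y
      (s.put z v) where
  r0 := h.r0
  r2 := h.r2
  r3 := h.r3
  r4 := h.r4
  r5 := h.r5
  m0 := by rw [put_mem_of_ne _ _ _ (by omega)]; exact h.m0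
  m1 := by rw [put_mem_of_ne _ _ _ (by omega)]; exact h.m1
  mA := by rw [put_mem_of_ne _ _ _ (by omega)]; exact h.mA
  mB := fun i hi j hj => by
    rw [put_mem]
    simp only [hz, true_and, h.mB i hi j hj]
  m4 := by rw [put_mem_of_ne _ _ _ (by omega)]; exact h.m4
  m5 := by rw [put_mem_of_ne _ _ _ (by omega)]; exact h.m5
  dr := h.dr

theorem load (h : Inv d n c D Θ θ A B X Y s) (e : LabelledPair) :
    Inv d n c (D + 1) Θ θ A B e.1 e.2 (s.load 4 5 e) where
  r0 := h.r0
  r2 := h.r2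
  r3 := h.r3
  r4 := h.r4
  r5 := h.r5
  m0 := by simpa [State.load, Function.update_apply] using h.m0
  m1 := by simpa [State.load, Function.update_apply] using h.m1
  mA := by simpa [State.load, Function.update_apply] using h.mA
  mB := by simpa [State.load, Function.update_apply] using h.mB
  m4 := by simp [State.load]
  m5 := by simp [State.load]
  dr := by simp [State.load, h.dr]

theorem congr (h : Inv d n c D Θ θ A B X Y s) {A' B' : ℕ → ℕ → ℝ}
    (hA : ∀ i < d, ∀ j < d, A i j = A' i j) (hB : ∀ i < d, ∀ j < d, B i j = B' i j) :
    Inv d n c D Θ θ A' B' X Y s :=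
  { h with
    mA := fun i hi j hj => (h.mA i hi j hj).trans (hA i hi j hj)
    mB := fun i hi j hj => (h.mB i hi j hj).trans (hB i hi j hj) }

end Inv

/-- A matrix whose entries are being overwritten row by row, the overwriting having reached the
entry `(i, j)`. -/
def stage (d i j : ℕ) (M M' : ℕ → ℕ → ℝ) : ℕ → ℕ → ℝ := fun a b =>
  if (a < i ∧ b < d) ∨ (a = i ∧ b < j) then M' a b else M a b

theorem stage_zero (d : ℕ) (M M' : ℕ → ℕ → ℝ) : stage d 0 0 M M' = M := by
  funext a b; simp [stage]

theorem stage_row (d i : ℕ) (M M' : ℕ → ℕ → ℝ) : stage d i d M M' = stage d (i + 1) 0 M M' := by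
  funext a b
  simp only [stage]
  congr 1
  simp only [eq_iff_iff]
  omega

theorem stage_self (d i j : ℕ) (M M' : ℕ → ℕ → ℝ) : stage d i j M M' i j = M i j := by
  simp [stage]

theorem stage_succ (d i j : ℕ) (M M' : ℕ → ℕ → ℝ) {v : ℝ} (hv : v = M' i j) :
    (fun a b => if a = i ∧ b = j then v else stage d i j M M' a b) = stage d i (j + 1) M M' := by
  funext a b
  simp only [stage]
  by_cases h : a = i ∧ b = j
  · obtain ⟨rfl, rfl⟩ := h
    simp [hv]
  · rw [if_neg h]
    congr 1
    simp only [eq_iff_iff]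
    omega

theorem stage_full {d : ℕ} (M M' : ℕ → ℕ → ℝ) {a b : ℕ} (ha : a < d) (hb : b < d) :
    stage d d 0 M M' a b = M' a b := by
  simp [stage, ha, hb]

variable {d n c D : ℕ} {Θ A B X Y : ℕ → ℕ → ℝ} {θ : ℝ}

/-- The score of the current sample is computed in entry `(0, 0)` of array `6`. -/
theorem score_triple : Triple S (Inv d n c D Θ θ A B X Y) scoreCmd
    (1 + (d * (d * (3 + 2) + 2 + 2) + 2))
    (fun s => Inv d n c D Θ θ A B X Y s ∧ s.mem 6 0 0 =
      ∑ a ∈ Finset.range d, ∑ b ∈ Finset.range d, X 0 a * Θ a b * X 1 b) := by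
  refine Triple.seq (Q := fun s => Inv d n c D Θ θ A B X Y s ∧ s.mem 6 0 0 =
      ∑ a ∈ Finset.range 0, ∑ b ∈ Finset.range d, X 0 a * Θ a b * X 1 b) ?_ ?_
  · intro s hs
    refine ⟨_, _, .setReal _ _ _, le_rfl, hs.scratch rfl _, ?_⟩
    simp [put_mem, hs.r4]
  · refine Triple.forLoop (J := fun i s => Inv d n c D Θ θ A B X Y s ∧ s.mem 6 0 0 =
      ∑ a ∈ Finset.range i, ∑ b ∈ Finset.range d, X 0 a * Θ a b * X 1 b)  (fun i s h => ⟨h.1.r0, h.1.r5⟩) (fun i s v h => ⟨h.1.putIdx (by norm_num) v, h.2⟩)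
      fun i hi => ?_
    refine (Triple.forLoop (N := d) (B := 3) (J := fun j s => (Inv d n c D Θ θ A B X Y s ∧
      s.mem 6 0 0 = ∑ a ∈ Finset.range i, ∑ b ∈ Finset.range d, X 0 a * Θ a b * X 1 b +
        ∑ b ∈ Finset.range j, X 0 i * Θ i b * X 1 b) ∧ s.idx 6 = i)
      (fun j s h => ⟨h.1.1.r0, h.1.1.r5⟩)
      (fun j s v h => ⟨⟨h.1.1.putIdx (by norm_num) v, h.1.2⟩, by simpa using h.2⟩)
      fun j hj => ?_).mono (fun s h => ?_) le_rfl fun s h => ?_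
    · rintro s ⟨⟨⟨hs, hsum⟩, h6⟩, h7⟩
      refine ⟨_, _, .seq (.arith _ _ _ _ _) (.seq (.arith _ _ _ _ _) (.arith _ _ _ _ _)), le_rfl,
        ⟨⟨((hs.scratch rfl _).scratch rfl _).scratch rfl _, ?_⟩, by simpa using h6⟩, by simpa using h7⟩
      rw [Finset.sum_range_succ, ← add_assoc, ← hsum]
      simp [put_mem, State.get, hs.r4, hs.r5, h6, h7, RealOp.eval, hs.m0, hs.m4]
    · simpa using h
    · exact ⟨⟨h.1.1, by rw [Finset.sum_range_succ]; exact h.1.2⟩, h.2⟩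

/-- The current sample is added to the normal equations. -/
theorem accumulate_triple : Triple S (Inv d n c D Θ θ A B X Y) accumulateCmd
    (d * (d * (4 + 2) + 2 + 2) + 2)
    (Inv d n c D Θ θ (fun a b => A a b + X 1 a * X 1 b) (fun a b => B a b + X 1 a * Y 0 b) X Y) := by
  set A' : ℕ → ℕ → ℝ := fun a b => A a b + X 1 a * X 1 b with hA'
  set B' : ℕ → ℕ → ℝ := fun a b => B a b + X 1 a * Y 0 b with hB'
  refine (Triple.forLoop (N := d) (B := d * (4 + 2) + 2) (J := fun i s =>
    Inv d n c D Θ θ (stage d i 0 A A') (stage d i 0 B B') X Y s)  (fun i s h => ⟨h.r0, h.r5⟩) (fun i s v h => h.putIdx (by norm_num) v)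
      fun i hi => ?_).mono (fun s h => by rwa [stage_zero, stage_zero]) le_rfl fun s h =>
        h.congr (fun a ha b hb => stage_full _ _ ha hb) (fun a ha b hb => stage_full _ _ ha hb)
  refine (Triple.forLoop (N := d) (B := 4) (J := fun j s =>
    Inv d n c D Θ θ (stage d i j A A') (stage d i j B B') X Y s ∧ s.idx 6 = i)  (fun j s h => ⟨h.1.r0, h.1.r5⟩)
      (fun j s v h => ⟨h.1.putIdx (by norm_num) v, by simpa using h.2⟩)
      fun j hj => ?_).mono (fun s h => h) le_rfl fun s h => ?_
  · rintro s ⟨⟨hs, h6⟩, h7⟩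
    have hAij := hs.mA i hi j hj
    have hBij := hs.mB i hi j hj
    rw [stage_self] at hAij hBij
    refine ⟨_, _, .seq (.arith _ _ _ _ _) (.seq (.arith _ _ _ _ _) (.seq (.arith _ _ _ _ _)
      (.arith _ _ _ _ _))), le_rfl, ⟨?_, by simpa using h6⟩, by simpa using h7⟩
    refine ((((hs.scratch rfl _).putA rfl _).scratch rfl _).putB rfl _).congr
      (fun a _ b _ => ?_) fun a _ b _ => ?_
    · rw [← stage_succ d i j A A' (v := A' i j) rfl]
      simp [put_mem, State.get, hs.r4, hs.r5, h6, h7, RealOp.eval, hs.m4, hAij, hA']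
    · rw [← stage_succ d i j B B' (v := B' i j) rfl]
      simp [put_mem, State.get, hs.r4, hs.r5, h6, h7, RealOp.eval, hs.m4, hs.m5, hBij, hB']
  · exact ⟨by rw [← stage_row, ← stage_row]; exact h.1, h.2⟩

/-- The right-hand side is divided by the diagonal. -/
theorem divide_triple : Triple S (Inv d n c D Θ θ A B X Y) divideCmd
    (d * (d * (1 + 2) + 2 + 2) + 2)
    (Inv d n c D Θ θ A (fun a b => B a b / A a a) X Y) := by
  set B' : ℕ → ℕ → ℝ := fun a b => B a b / A a a with hB'
  refine (Triple.forLoop (N := d) (B := d * (1 + 2) + 2) (J := fun i s =>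
    Inv d n c D Θ θ A (stage d i 0 B B') X Y s)  (fun i s h => ⟨h.r0, h.r5⟩) (fun i s v h => h.putIdx (by norm_num) v)
      fun i hi => ?_).mono (fun s h => by rwa [stage_zero]) le_rfl fun s h =>
        h.congr (fun a ha b hb => rfl) (fun a ha b hb => stage_full _ _ ha hb)
  refine (Triple.forLoop (N := d) (B := 1) (J := fun j s =>
    Inv d n c D Θ θ A (stage d i j B B') X Y s ∧ s.idx 6 = i)  (fun j s h => ⟨h.1.r0, h.1.r5⟩)
      (fun j s v h => ⟨h.1.putIdx (by norm_num) v, by simpa using h.2⟩)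
      fun j hj => ?_).mono (fun s h => h) le_rfl fun s h => ?_
  · rintro s ⟨⟨hs, h6⟩, h7⟩
    have hAii := hs.mA i hi i hi
    have hBij := hs.mB i hi j hj
    rw [stage_self] at hBij
    refine ⟨_, _, .arith _ _ _ _ _, le_rfl, ⟨?_, by simpa using h6⟩, by simpa using h7⟩
    refine (hs.putB rfl _).congr (fun a _ b _ => rfl) fun a _ b _ => ?_
    rw [← stage_succ d i j B B' (v := B' i j) rfl]
    simp [State.get, h6, h7, RealOp.eval, hBij, hAii, hB']
  · exact ⟨by rw [← stage_row]; exact h.1, h.2⟩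

/-- One row operation of the elimination with pivot `p`, applied to the matrix `M`, the
multipliers being computed from `A`. -/
def pivotStep (p : ℕ) (A M : ℕ → ℕ → ℝ) : ℕ → ℕ → ℝ := fun a b =>
  if a = p then M a b else M a b - A a p / A p p * M p b

/-- A matrix in which only the row `i` is being overwritten, up to the column `j`. -/
def rowStage (i j : ℕ) (M M' : ℕ → ℕ → ℝ) : ℕ → ℕ → ℝ := fun a b =>
  if a = i ∧ b < j then M' a b else M a b

theorem rowStage_succ (i j : ℕ) (M M' : ℕ → ℕ → ℝ) :
    (fun a b => if a = i ∧ b = j then M' i j else rowStage i j M M' a b) =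
      rowStage i (j + 1) M M' := by
  funext a b
  simp only [rowStage]
  by_cases h : a = i ∧ b = j
  · obtain ⟨rfl, rfl⟩ := h
    simp
  · rw [if_neg h]
    congr 1
    simp only [eq_iff_iff]
    omega

/-- One row is reduced by the pivot row. The row `i` and the pivot row still have their values in `A₀`
and `B₀`, whatever has become of the other rows. -/
theorem elimRow_triple {A₀ B₀ : ℕ → ℕ → ℝ} {i p : ℕ} (hi : i < d) (hp : p < d) (hip : i ≠ p)
    (hAi : ∀ b, A i b = A₀ i b) (hAp : ∀ b, A p b = A₀ p b) (hBi : ∀ b, B i b = B₀ i b)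
    (hBp : ∀ b, B p b = B₀ p b) :
    Triple S (fun s => (Inv d n c D Θ θ A B X Y s ∧ s.idx 8 = p) ∧ s.idx 6 = i) elimRowCmd
    (1 + (d * (4 + 2) + 2))
    (fun s => (Inv d n c D Θ θ (rowStage i d A (pivotStep p A₀ A₀))
      (rowStage i d B (pivotStep p A₀ B₀)) X Y s ∧ s.idx 8 = p) ∧ s.idx 6 = i) := by
  set f := A₀ i p / A₀ p p with hf
  set A' := pivotStep p A₀ A₀ with hA'
  set B' := pivotStep p A₀ B₀ with hB'
  have hA'i : ∀ b, A' i b = A₀ i b - f * A₀ p b := fun b => by rw [hA', pivotStep, if_neg hip]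
  have hB'i : ∀ b, B' i b = B₀ i b - f * B₀ p b := fun b => by rw [hB', pivotStep, if_neg hip]
  refine Triple.seq (Q := fun s => ((Inv d n c D Θ θ (rowStage i 0 A A') (rowStage i 0 B B') X Y s ∧
    s.mem 6 0 0 = f) ∧ s.idx 8 = p) ∧ s.idx 6 = i) ?_ ?_
  · rintro s ⟨⟨hs, h8⟩, h6⟩
    have e1 := hs.mA i hi p hp
    have e2 := hs.mA p hp p hp
    rw [hAi] at e1
    rw [hAp] at e2
    refine ⟨_, _, .arith _ _ _ _ _, le_rfl, ⟨⟨(hs.scratch rfl _).congr ?_ ?_, ?_⟩,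
      by simpa using h8⟩, by simpa using h6⟩
    · intros; simp [rowStage]
    · intros; simp [rowStage]
    · simp [put_mem, State.get, hs.r4, h6, h8, RealOp.eval, e1, e2, hf]
  · refine (Triple.forLoop (N := d) (B := 4) (J := fun j s =>
      ((Inv d n c D Θ θ (rowStage i j A A') (rowStage i j B B') X Y s ∧
      s.mem 6 0 0 = f) ∧ s.idx 8 = p) ∧ s.idx 6 = i)  (fun j s h => ⟨h.1.1.1.r0, h.1.1.1.r5⟩)
      (fun j s v h => ⟨⟨⟨h.1.1.1.putIdx (by norm_num) v, h.1.1.2⟩, by simpa using h.1.2⟩,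
        by simpa using h.2⟩)
      fun j hj => ?_).mono (fun s h => h) le_rfl fun s h => ⟨⟨h.1.1.1, h.1.2⟩, h.2⟩
    rintro s ⟨⟨⟨⟨hs, hff⟩, h8⟩, h6⟩, h7⟩
    have e1 := hs.mA i hi j hj
    have e2 := hs.mA p hp j hj
    have e3 := hs.mB i hi j hj
    have e4 := hs.mB p hp j hj
    simp only [rowStage, lt_irrefl, and_false, if_false, hip.symm, hAi, hAp, hBi, hBp]
      at e1 e2 e3 e4
    refine ⟨_, _, .seq (.arith _ _ _ _ _) (.seq (.arith _ _ _ _ _) (.seq (.arith _ _ _ _ _)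
      (.arith _ _ _ _ _))), le_rfl, ⟨⟨⟨?_, ?_⟩, by simpa using h8⟩, by simpa using h6⟩,
      by simpa using h7⟩
    · refine ((((hs.scratch rfl _).putA rfl _).scratch rfl _).putB rfl _).congr
        (fun a _ b _ => ?_) fun a _ b _ => ?_
      · rw [← rowStage_succ i j A A', hA'i]
        simp [put_mem, State.get, hs.r4, hs.r5, h6, h7, h8, RealOp.eval, e1, e2, hff]
      · rw [← rowStage_succ i j B B', hB'i]
        simp [put_mem, State.get, hs.r4, hs.r5, h6, h7, h8, RealOp.eval, e3, e4, hff]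
    · simp [put_mem, hs.r4, hs.r5, hff]

/-- A matrix to whose first `i` rows the elimination with pivot `p` has been applied. -/
def pivotStage (i p : ℕ) (A M : ℕ → ℕ → ℝ) : ℕ → ℕ → ℝ := fun a b =>
  if a < i then pivotStep p A M a b else M a b

/-- All rows but the pivot row are reduced; the latter is recognized by two comparisons, and skipped. -/
theorem pivot_triple {p : ℕ} (hp : p < d) :
    Triple S (fun s => Inv d n c D Θ θ A B X Y s ∧ s.idx 8 = p)
    (forLoop 6 0 (.ifIdx 6 8 elimRowCmd (.ifIdx 8 6 elimRowCmd (.setIdx 9 0))))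
    (d * (1 + (d * (4 + 2) + 2) + 2 + 2) + 2)
    (fun s => Inv d n c D Θ θ (pivotStep p A A) (pivotStep p A B) X Y s ∧ s.idx 8 = p) := by
  refine (Triple.forLoop (N := d) (B := 1 + (d * (4 + 2) + 2) + 2) (J := fun i s =>
    Inv d n c D Θ θ (pivotStage i p A A) (pivotStage i p A B) X Y s ∧ s.idx 8 = p)  (fun i s h => ⟨h.1.r0, h.1.r5⟩)
      (fun i s v h => ⟨h.1.putIdx (by norm_num) v, by simpa using h.2⟩)
      fun i hi => ?_).mono (fun s h => ⟨h.1.congr (by simp [pivotStage]) (by simp [pivotStage]), h.2⟩)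
        le_rfl fun s h => ⟨h.1.congr (fun a ha b _ => by simp [pivotStage, ha])
          (fun a ha b _ => by simp [pivotStage, ha]), h.2⟩
  have hrow : ∀ M : ℕ → ℕ → ℝ, ∀ a b, a < d → b < d →
      rowStage i d (pivotStage i p A M) (pivotStep p A M) a b = pivotStage (i + 1) p A M a b := by
    intro M a b _ hb
    simp only [rowStage, pivotStage, hb, and_true]
    rcases lt_trichotomy a i with h | h | h
    · simp [h, h.ne, Nat.lt_succ_of_lt h]
    · simp [h]
    · rw [if_neg (by omega), if_neg (by omega), if_neg (by omega)]
  have hskip : ∀ M : ℕ → ℕ → ℝ, i = p → ∀ a b, a < d → b < d →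
      pivotStage i p A M a b = pivotStage (i + 1) p A M a b := by
    intro M hip a b _ _
    simp only [pivotStage]
    rcases lt_trichotomy a i with h | h | h
    · simp [h, Nat.lt_succ_of_lt h]
    · subst h; subst hip; simp [pivotStep]
    · rw [if_neg (by omega), if_neg (by omega)]
  have helim : i ≠ p → Triple S (fun s => (Inv d n c D Θ θ (pivotStage i p A A)
      (pivotStage i p A B) X Y s ∧ s.idx 8 = p) ∧ s.idx 6 = i) elimRowCmd (1 + (d * (4 + 2) + 2))
      (fun s => (Inv d n c D Θ θ (pivotStage (i + 1) p A A) (pivotStage (i + 1) p A B) X Y s ∧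
        s.idx 8 = p) ∧ s.idx 6 = i) := by
    intro hip
    refine (elimRow_triple hi hp hip (A₀ := A) (B₀ := B) (by simp [pivotStage]) (fun b => ?_)
      (by simp [pivotStage]) (fun b => ?_)).mono (fun s h => h) le_rfl fun s h =>
        ⟨⟨h.1.1.congr (fun a ha b hb => hrow A a b ha hb) (fun a ha b hb => hrow B a b ha hb),
          h.1.2⟩, h.2⟩
    · simp [pivotStage, pivotStep]
    · simp [pivotStage, pivotStep]
  rintro s ⟨⟨hs, h8⟩, h6⟩
  by_cases h1 : s.idx 6 < s.idx 8
  · obtain ⟨t, s', e, ht, h⟩ := helim (by omega) s ⟨⟨hs, h8⟩, h6⟩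
    exact ⟨_, _, .ifIdx_true h1 e, by omega, h⟩
  · by_cases h2 : s.idx 8 < s.idx 6
    · obtain ⟨t, s', e, ht, h⟩ := helim (by omega) s ⟨⟨hs, h8⟩, h6⟩
      exact ⟨_, _, .ifIdx_false h1 (.ifIdx_true h2 e), by omega, h⟩
    · refine ⟨_, _, .ifIdx_false h1 (.ifIdx_false h2 (.setIdx _ _ _)), by omega, ⟨?_, ?_⟩, ?_⟩
      · exact (hs.putIdx (by norm_num) 0).congr
          (fun a ha b hb => hskip A (by omega) a b ha hb)
          (fun a ha b hb => hskip B (by omega) a b ha hb)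
      · simpa using h8
      · simpa using h6

/-- The matrix and the right-hand side after elimination with the first `p` pivots. -/
def gaussJordan (A B : ℕ → ℕ → ℝ) : ℕ → (ℕ → ℕ → ℝ) × (ℕ → ℕ → ℝ)
  | 0 => (A, B)
  | p + 1 => (pivotStep p (gaussJordan A B p).1 (gaussJordan A B p).1,
      pivotStep p (gaussJordan A B p).1 (gaussJordan A B p).2)

/-- The elimination command computes `gaussJordan`. -/
theorem elim_triple : Triple S (Inv d n c D Θ θ A B X Y) elimCmd
    (d * (d * (1 + (d * (4 + 2) + 2) + 2 + 2) + 2 + 2) + 2)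
    (Inv d n c D Θ θ (gaussJordan A B d).1 (gaussJordan A B d).2 X Y) :=
  Triple.forLoop (J := fun p s => Inv d n c D Θ θ (gaussJordan A B p).1 (gaussJordan A B p).2 X Y s)
     (fun p s h => ⟨h.r0, h.r5⟩)
    (fun p s v h => h.putIdx (by norm_num) v) fun _ hp => pivot_triple hp

end Invariant

end

noncomputable section

/-! ### Gauss–Jordan elimination -/

section Elimination

variable {A B : ℕ → ℕ → ℝ}

theorem gaussJordan_fst (A B B' : ℕ → ℕ → ℝ) (p : ℕ) :
    (gaussJordan A B p).1 = (gaussJordan A B' p).1 := by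
  induction p with
  | zero => rfl
  | succ p ih => simp only [gaussJordan, ih]

theorem gaussJordan_zero_snd (A : ℕ → ℕ → ℝ) (p : ℕ) : (gaussJordan A 0 p).2 = 0 := by
  induction p with
  | zero => rfl
  | succ p ih =>
    funext a b
    simp [gaussJordan, ih, pivotStep]

/-- Row operations among the first `P` rows do not change the solutions of the equations in these
rows. -/
theorem gaussJordan_solves_of_le {d p P : ℕ} (hp : p ≤ P) {v : ℕ → ℝ} {l : ℕ}
    (h : ∀ a < P, ∑ b ∈ Finset.range d, (gaussJordan A B p).1 a b * v b = (gaussJordan A B p).2 a l) :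
    ∀ a < P, ∑ b ∈ Finset.range d, A a b * v b = B a l := by
  induction p with
  | zero => exact h
  | succ p ih =>
    refine ih (by omega) fun a ha => ?_
    have hpp := h p (by omega)
    have haa := h a ha
    simp only [gaussJordan, pivotStep, if_true] at hpp haa
    by_cases hap : a = p
    · rw [hap]; exact hpp
    · simp only [if_neg hap, sub_mul, Finset.sum_sub_distrib, mul_assoc, ← Finset.mul_sum] at haa
      rw [hpp] at haa
      linarith

/-- After `p` rounds with nonzero pivots the first `p` columns are diagonal. -/
theorem gaussJordan_columns {p : ℕ} (hpiv : ∀ q < p, (gaussJordan A B q).1 q q ≠ 0) :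
    ∀ b < p, (gaussJordan A B p).1 b b ≠ 0 ∧ ∀ a, a ≠ b → (gaussJordan A B p).1 a b = 0 := by
  induction p with
  | zero => simp
  | succ p ih =>
    have ih := ih fun q hq => hpiv q (by omega)
    have hpp := hpiv p (by omega)
    intro b hb
    simp only [gaussJordan, pivotStep]
    rcases eq_or_ne b p with rfl | hbp
    · refine ⟨by simpa using hpp, fun a ha => ?_⟩
      rw [if_neg ha]
      field_simp
      ring
    · obtain ⟨h1, h2⟩ := ih b (by omega)
      refine ⟨by simpa [hbp, h2 p hbp.symm] using h1, fun a ha => ?_⟩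
      by_cases hap : a = p
      · rw [if_pos hap]; exact h2 a ha
      · rw [if_neg hap, h2 a ha, h2 p hbp.symm]; ring

/-- A positive definite matrix has nonzero pivots: a vanishing pivot would give a nonzero vector
`v`, supported on the first `p + 1` coordinates, such that `A v` vanishes in these coordinates. -/
theorem gaussJordan_pivot_ne_zero {d : ℕ}
    (hpd : ∀ v : ℕ → ℝ, (∃ a < d, v a ≠ 0) →
      0 < ∑ a ∈ Finset.range d, v a * ∑ b ∈ Finset.range d, A a b * v b) :
    ∀ p < d, (gaussJordan A B p).1 p p ≠ 0 := by
  intro p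
  induction p using Nat.strong_induction_on with
  | _ p ih =>
    intro hp h0
    rw [gaussJordan_fst A B 0] at h0
    have hcol := gaussJordan_columns (A := A) (B := 0) (p := p) fun q hq => by
      rw [gaussJordan_fst A 0 B]; exact ih q hq (by omega)
    set M := (gaussJordan A 0 p).1 with hM
    -- the equations in the first `p` rows are diagonal in the first `p` unknowns; they are solved with
    -- `v p = 1` and zeros behind
    set v : ℕ → ℝ := fun b => if b < p then -(M b p / M b b) else if b = p then 1 else 0 with hv
    have hvp : v p = 1 := by simp [hv]
    have hgt : ∀ b, p < b → v b = 0 := fun b hb => by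
      simp [hv, not_lt.mpr hb.le, hb.ne']
    have hres : ∀ a < p + 1, ∑ b ∈ Finset.range d, M a b * v b = (gaussJordan A 0 p).2 a 0 := by
      intro a ha
      rw [gaussJordan_zero_snd, Pi.zero_apply, Pi.zero_apply]
      rcases Nat.lt_succ_iff_lt_or_eq.mp ha with hap | rfl
      · have key : ∀ b ∈ Finset.range d, M a b * v b =
            (if a = b then M a a * v a else 0) + (if p = b then M a p else 0) := by
          intro b _
          rcases lt_trichotomy b p with hb | hb | hb
          · rw [if_neg hb.ne', add_zero]
            by_cases hab : a = b
            · rw [if_pos hab, hab]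
            · rw [if_neg hab, (hcol b hb).2 a hab, zero_mul]
          · rw [if_neg (by omega), if_pos hb.symm, hb, hvp]; ring
          · rw [if_neg (by omega), if_neg (by omega), hgt b hb]; ring
        rw [Finset.sum_congr rfl key, Finset.sum_add_distrib, Finset.sum_ite_eq, Finset.sum_ite_eq,
          if_pos (Finset.mem_range.2 (by omega)), if_pos (Finset.mem_range.2 hp)]
        have := (hcol a hap).1
        simp only [hv, if_pos hap]
        field_simp
        ring
      · refine Finset.sum_eq_zero fun b _ => ?_
        rcases lt_trichotomy b a with hb | rfl | hb
        · rw [(hcol b hb).2 a hb.ne', zero_mul]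
        · rw [h0, zero_mul]
        · rw [hgt b hb, mul_zero]
    have hA := gaussJordan_solves_of_le (by omega) hres
    have hpos := hpd v ⟨p, hp, by rw [hvp]; exact one_ne_zero⟩
    refine hpos.ne' (Finset.sum_eq_zero fun a _ => ?_)
    by_cases ha : a < p + 1
    · rw [hA a ha]; simp
    · rw [hgt a (by omega), zero_mul]

/-- Gauss–Jordan elimination solves positive definite systems. -/
theorem gaussJordan_solves {d : ℕ}
    (hpd : ∀ v : ℕ → ℝ, (∃ a < d, v a ≠ 0) →
      0 < ∑ a ∈ Finset.range d, v a * ∑ b ∈ Finset.range d, A a b * v b) :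
    ∀ l, ∀ a < d, ∑ b ∈ Finset.range d,
      A a b * ((gaussJordan A B d).2 b l / (gaussJordan A B d).1 b b) = B a l := by
  intro l
  have hcol := gaussJordan_columns (B := B) (gaussJordan_pivot_ne_zero hpd)
  refine gaussJordan_solves_of_le (v := fun b => (gaussJordan A B d).2 b l /
    (gaussJordan A B d).1 b b) le_rfl fun a ha => ?_
  rw [Finset.sum_eq_single a]
  · rw [mul_div_cancel₀]; exact (hcol a ha).1
  · intro b hb hba
    rw [(hcol b (Finset.mem_range.1 hb)).2 a hba.symm, zero_mul]
  · intro h; exact absurd (Finset.mem_range.2 ha) h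

end Elimination

/-! ### Correctness of the program -/

section Correctness

variable {k d : ℕ} [NeZero k]

theorem pad_apply {a b : ℕ} (M : Matrix (Fin a) (Fin b) ℝ) (i : Fin a) (j : Fin b) :
    pad M i j = M i j := by
  simp [pad]

theorem pad_zero (M : Matrix (Fin k) (Fin d) ℝ) (j : Fin d) : pad M 0 j = M 0 j := by
  have := pad_apply M 0 j
  simpa using this

theorem pad_one (hk : 1 < k) (M : Matrix (Fin k) (Fin d) ℝ) (j : Fin d) : pad M 1 j = M 1 j := by
  have h1 : ((1 : Fin k) : ℕ) = 1 := by
    rw [Fin.val_one', Nat.mod_eq_of_lt hk]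
  have := pad_apply M 1 j
  rwa [h1] at this

theorem sum_pad_score (hk : 1 < k) (X : Matrix (Fin k) (Fin d) ℝ) (Θ : Matrix (Fin d) (Fin d) ℝ) :
    ∑ a ∈ Finset.range d, ∑ b ∈ Finset.range d, pad X 0 a * pad Θ a b * pad X 1 b =
      (X * Θ * Xᵀ) 0 1 := by
  simp only [Finset.sum_range, pad_zero, pad_one hk, pad_apply, Matrix.mul_apply,
    Matrix.transpose_apply, Finset.sum_mul]
  exact Finset.sum_comm

variable (F : Matrix (Fin k) (Fin d) ℝ → Matrix (Fin k) (Fin d) ℝ)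
  (Θt : Matrix (Fin d) (Fin d) ℝ) (θ : ℝ) (xs : ℕ → Cube k d)

/-- The Gram matrix of the second tokens of the accepted samples, as an array. -/
def normalMatrix (T : ℕ) : ℕ → ℕ → ℝ := fun a b =>
  ∑ t ∈ accepted Θt θ xs T, pad (signMatrix (xs t)) 1 a * pad (signMatrix (xs t)) 1 b

/-- The right-hand side of the normal equations, as an array. -/
def normalRhs (T : ℕ) : ℕ → ℕ → ℝ := fun a b =>
  ∑ t ∈ accepted Θt θ xs T, pad (signMatrix (xs t)) 1 a * pad (F (signMatrix (xs t))) 0 b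

open Classical in
theorem accepted_succ (T : ℕ) : accepted Θt θ xs (T + 1) =
    if Accepts Θt θ (xs T) then insert T (accepted Θt θ xs T) else accepted Θt θ xs T := by
  rw [accepted, Finset.range_add_one, Finset.filter_insert, accepted]

theorem notMem_accepted (T : ℕ) : T ∉ accepted Θt θ xs T := by
  simp [accepted]

/-- The invariant of the sampling loop, after `T` draws. -/
def Sampling (n T : ℕ) (s : State) : Prop :=
  ∃ X Y, Inv d n (accepted Θt θ xs T).card T (pad Θt) θ (normalMatrix Θt θ xs T)
    (normalRhs F Θt θ xs T) X Y s

/-- One round of the sampling loop. -/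
theorem draw_triple (hk : 1 < k) (n T : ℕ) :
    Triple (examples F xs) (Sampling F Θt θ xs n T) drawCmd
      (1 + (1 + (d * (d * (3 + 2) + 2 + 2) + 2) + (d * (d * (4 + 2) + 2 + 2) + 2 + 1 + 1)))
      (Sampling F Θt θ xs n (T + 1)) := by
  rintro s ⟨X, Y, hs⟩
  have hl := hs.load (examples F xs s.draws)
  obtain ⟨t₁, s₁, e₁, b₁, h₁, hscore⟩ := score_triple (S := examples F xs) _ hl
  rw [hs.dr] at h₁ hscore
  simp only [examples] at h₁ hscore
  rw [sum_pad_score hk] at hscore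
  have hg : s₁.get ⟨6, 4, 4⟩ = (signMatrix (xs T) * Θt * (signMatrix (xs T))ᵀ) 0 1 := by
    simp only [State.get, h₁.r4, hscore]
  have hθ : s₁.get ⟨1, 4, 4⟩ = θ := by simp only [State.get, h₁.r4, h₁.m1]
  by_cases hacc : Accepts Θt θ (xs T)
  · obtain ⟨t₂, s₂, e₂, b₂, h₂⟩ := accumulate_triple (S := examples F xs) _ h₁
    have hlt : s₁.get ⟨1, 4, 4⟩ < s₁.get ⟨6, 4, 4⟩ := by rw [hg, hθ]; exact hacc
    refine ⟨_, _, .seq (.draw _ _ _) (.seq e₁ (.ifReal_true hlt (.seq e₂ (.addIdx _ _ _ _)))),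
      by omega, ⟨pad (signMatrix (xs T)), pad (F (signMatrix (xs T))), ?_⟩⟩
    have := h₂.count ((accepted Θt θ xs (T + 1)).card)
    have hcard : s₂.idx 3 + s₂.idx 5 = (accepted Θt θ xs (T + 1)).card := by
      rw [h₂.r3, h₂.r5, accepted_succ, if_pos hacc,
        Finset.card_insert_of_notMem (notMem_accepted Θt θ xs T)]
    rw [hcard]
    refine this.congr (fun a _ b _ => ?_) fun a _ b _ => ?_
    · rw [normalMatrix, normalMatrix, accepted_succ, if_pos hacc,
        Finset.sum_insert (notMem_accepted Θt θ xs T), add_comm]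
    · rw [normalRhs, normalRhs, accepted_succ, if_pos hacc,
        Finset.sum_insert (notMem_accepted Θt θ xs T), add_comm]
  · have hlt : ¬ s₁.get ⟨1, 4, 4⟩ < s₁.get ⟨6, 4, 4⟩ := by rw [hg, hθ]; exact hacc
    refine ⟨_, _, .seq (.draw _ _ _) (.seq e₁ (.ifReal_false hlt (.setIdx _ _ _))),
      by omega, ⟨pad (signMatrix (xs T)), pad (F (signMatrix (xs T))), ?_⟩⟩
    have hE : accepted Θt θ xs (T + 1) = accepted Θt θ xs T := by
      rw [accepted_succ, if_neg hacc]
    refine ((hE ▸ h₁).putIdx (by norm_num) 0).congr (fun a _ b _ => ?_) fun a _ b _ => ?_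
    · rw [normalMatrix, normalMatrix, hE]
    · rw [normalRhs, normalRhs, hE]

omit [NeZero k] in
theorem sv_row (x : Cube k d) (a : Fin k) (j : Fin d) : sv (x a) j = signMatrix x a j := rfl

/-- If the Gram matrix of the accepted samples is positive definite, the program draws until the
procedure stops, and outputs a minimizer of the least-squares objective. -/
theorem lsProgram_correct (hk : 1 < k) {n T : ℕ} (hhalt : StopsAt Θt θ n xs T) {b : ℝ} (hb : 0 < b)
    (hgram : ∀ w : Fin d → ℝ, b * (w ⬝ᵥ w) ≤
      ∑ t ∈ accepted Θt θ xs T, (w ⬝ᵥ sv (xs t 1)) ^ 2) :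
    ∃ (steps : ℕ) (s : State),
      Exec (examples F xs) lsProgram (inputState k n Θt θ) steps s ∧ s.draws = T ∧
      steps ≤ 1 + ((T * (1 + (1 + (d * (d * (3 + 2) + 2 + 2) + 2) +
        (d * (d * (4 + 2) + 2 + 2) + 2 + 1 + 1)) + 1) + 1) +
        ((d * (d * (1 + (d * (4 + 2) + 2) + 2 + 2) + 2 + 2) + 2) +
          (d * (d * (1 + 2) + 2 + 2) + 2))) ∧
      IsLSOutput F Θt θ xs T (s.output d) := by
  have h0 : Sampling F Θt θ xs n 0 ((inputState k n Θt θ).putIdx 5 1) := by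
    refine ⟨fun _ _ => 0, fun _ _ => 0, ?_⟩
    constructor <;> simp [inputState, accepted, normalMatrix, normalRhs]
  have hmono : ∀ t < T, (accepted Θt θ xs t).card < n := hhalt.2
  have hloop := Triple.while (S := examples F xs) (I := Sampling F Θt θ xs n) (i := 3) (j := 2)
    (N := T) (fun t ht s hs => by
      obtain ⟨X, Y, hs⟩ := hs
      rw [hs.r3, hs.r2]; exact hmono t ht)
    (fun s hs => by
      obtain ⟨X, Y, hs⟩ := hs
      rw [hs.r3, hs.r2, hhalt.1]; exact lt_irrefl _)
    fun t _ => draw_triple F Θt θ xs hk n t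
  obtain ⟨t₁, s₁, e₁, b₁, X, Y, h₁⟩ := hloop _ h0
  obtain ⟨t₂, s₂, e₂, b₂, h₂⟩ := (elim_triple.seq divide_triple) _ h₁
  refine ⟨_, s₂, .seq (.setIdx _ _ _) (.seq e₁ e₂), h₂.dr, by omega, ?_⟩
  -- the normal matrix is positive definite, so that elimination needs no pivoting
  have hpd : ∀ v : ℕ → ℝ, (∃ a < d, v a ≠ 0) →
      0 < ∑ a ∈ Finset.range d, v a * ∑ b ∈ Finset.range d, normalMatrix Θt θ xs T a b * v b := by
    rintro v ⟨a, ha, hva⟩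
    set w : Fin d → ℝ := fun i => v i with hw
    have hww : 0 < w ⬝ᵥ w := by
      refine Finset.sum_pos' (fun i _ => mul_self_nonneg _) ⟨⟨a, ha⟩, Finset.mem_univ _, ?_⟩
      exact mul_self_pos.2 hva
    refine (mul_pos hb hww).trans_le ((hgram w).trans (le_of_eq ?_))
    simp only [Finset.sum_range, normalMatrix, pad_one hk, Finset.sum_mul, Finset.mul_sum]
    rw [Finset.sum_congr rfl fun i _ => Finset.sum_comm, Finset.sum_comm]
    refine Finset.sum_congr rfl fun t _ => ?_
    rw [sq, dotProduct, Finset.sum_mul_sum]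
    refine Finset.sum_congr rfl fun i _ => Finset.sum_congr rfl fun j _ => ?_
    simp only [hw, sv_row]
    ring
  refine isLSOutput_of_normal fun i l => ?_
  have := gaussJordan_solves (B := normalRhs F Θt θ xs T) hpd l i i.2
  simp only [Finset.sum_range, normalMatrix, normalRhs, pad_one hk, pad_zero] at this
  refine Eq.trans (Finset.sum_congr rfl fun j _ => ?_) this
  have hout : s₂.output d j l = _ := h₂.mB j j.2 l l.2
  rw [hout]
  rfl

/-- The cubic cost of elimination and the quadratic cost per draw, as a power of `T * d`. -/
theorem steps_le {T d : ℕ} (hT : 1 ≤ T) (hd : 2 ≤ d) :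
    1 + ((T * (1 + (1 + (d * (d * (3 + 2) + 2 + 2) + 2) +
        (d * (d * (4 + 2) + 2 + 2) + 2 + 1 + 1)) + 1) + 1) +
        ((d * (d * (1 + (d * (4 + 2) + 2) + 2 + 2) + 2 + 2) + 2) +
          (d * (d * (1 + 2) + 2 + 2) + 2))) ≤ (T * d) ^ 8 := by
  have h2 : 4 ≤ d ^ 2 := by nlinarith
  have h3 : 8 ≤ d ^ 3 := by
    calc 8 = 2 ^ 3 := by norm_num
      _ ≤ d ^ 3 := Nat.pow_le_pow_left hd 3
  have h32 : 2 * d ^ 2 ≤ d ^ 3 := by nlinarith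
  have h31 : 4 * d ≤ d ^ 3 := by nlinarith
  have h5 : 32 ≤ d ^ 5 := by
    calc 32 = 2 ^ 5 := by norm_num
      _ ≤ d ^ 5 := Nat.pow_le_pow_left hd 5
  have hTd : d ^ 3 ≤ T * d ^ 3 := Nat.le_mul_of_pos_left _ hT
  calc _ = T * (11 * d ^ 2 + 8 * d + 9) + (6 * d ^ 3 + 10 * d ^ 2 + 8 * d + 6) := by ring
    _ ≤ T * (9 * d ^ 3) + (14 * d ^ 3) :=
        Nat.add_le_add (Nat.mul_le_mul_left _ (by omega)) (by omega)
    _ ≤ 32 * (T * d ^ 3) := by nlinarith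
    _ ≤ d ^ 5 * (T * d ^ 3) := Nat.mul_le_mul_right _ h5
    _ = T * d ^ 8 := by ring
    _ ≤ T ^ 8 * d ^ 8 := Nat.mul_le_mul_right _ (Nat.le_self_pow (by norm_num) T)
    _ = (T * d) ^ 8 := by ring

end Correctness

end

noncomputable section

/-! ### The choice of the constants -/

/-- The failure probability: three Chebyshev bounds with `n = d ^ (G + 10)`, and the union bound over
unfocused samples, which have conditional probability at most `d ^ -(2 G + 12)`. -/
theorem failure_le {d G : ℕ} {c γ d₀ : ℝ} (hc : 0 < c) (hγ : γ ≤ G) (hd : 100 ≤ (d : ℝ))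
    (hd₀ : d₀ ≤ d) (hc₀ : 384 / c ^ 2 ≤ d₀) :
    4 / ((d ^ (G + 10) : ℕ) : ℝ) + 128 * d ^ 6 / (c ^ 2 * ((d ^ (G + 10) : ℕ) : ℝ)) +
      3 * ((d ^ (G + 10) : ℕ) : ℝ) / d ^ (2 * G + 12) ≤ (d : ℝ) ^ (-γ) := by
  have hd0 : (0 : ℝ) < d := by linarith
  have hG : ((d : ℝ) ^ G)⁻¹ ≤ (d : ℝ) ^ (-γ) := by
    rw [← Real.rpow_natCast, ← Real.rpow_neg hd0.le]
    exact Real.rpow_le_rpow_of_exponent_le (by linarith) (by linarith)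
  refine le_trans ?_ hG
  push_cast
  have h1 : 4 / (d : ℝ) ^ (G + 10) ≤ ((d : ℝ) ^ G)⁻¹ * (1 / 3) := by
    rw [pow_add, div_le_iff₀ (by positivity)]
    have : (12 : ℝ) ≤ d ^ 10 := by
      calc (12 : ℝ) ≤ d := by linarith
        _ ≤ d ^ 10 := le_self_pow₀ (by linarith) (by norm_num)
    calc (4 : ℝ) ≤ d ^ 10 / 3 := by linarith
      _ = _ := by field_simp
  have h2 : 128 * (d : ℝ) ^ 6 / (c ^ 2 * (d : ℝ) ^ (G + 10)) ≤ ((d : ℝ) ^ G)⁻¹ * (1 / 3) := by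
    rw [pow_add, div_le_iff₀ (by positivity)]
    have h3 : 384 ≤ d * c ^ 2 := by
      have := hc₀.trans hd₀
      rwa [div_le_iff₀ (by positivity)] at this
    have h4 : (d : ℝ) ≤ d ^ 4 := le_self_pow₀ (by linarith) (by norm_num)
    have h5 : 384 ≤ d ^ 4 * c ^ 2 := h3.trans (mul_le_mul_of_nonneg_right h4 (by positivity))
    calc 128 * (d : ℝ) ^ 6 = 384 * d ^ 6 / 3 := by ring
      _ ≤ (d ^ 4 * c ^ 2) * d ^ 6 / 3 := by gcongr
      _ = _ := by field_simp
  have h3 : 3 * (d : ℝ) ^ (G + 10) / d ^ (2 * G + 12) ≤ ((d : ℝ) ^ G)⁻¹ * (1 / 3) := by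
    have : (9 : ℝ) ≤ d ^ 2 := by nlinarith
    rw [show 2 * G + 12 = G + 10 + (G + 2) by ring, pow_add _ (G + 10), pow_add _ G 2,
      div_le_iff₀ (by positivity)]
    calc 3 * (d : ℝ) ^ (G + 10) ≤ d ^ 2 / 3 * d ^ (G + 10) := by gcongr; linarith
      _ = _ := by field_simp
  calc _ ≤ ((d : ℝ) ^ G)⁻¹ * (1 / 3) + ((d : ℝ) ^ G)⁻¹ * (1 / 3) + ((d : ℝ) ^ G)⁻¹ * (1 / 3) := by
        gcongr
    _ = _ := by ring

/-- The number of draws is of the order of `d ^ N` over the acceptance probability, whose lower bound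
`hp` is Gaussian in the threshold. -/
theorem draws_le {m d N : ℕ} {K γ₁ lam ω ρ σ θ p : ℝ} (hd : 100 ≤ (d : ℝ)) (hm : 1 ≤ (m : ℝ))
    (hl : 0 < lam) (hl1 : lam ≤ 1) (hω : 1 ≤ ω) (hρ : 0 < ρ) (hσ : 99 / 100 * ρ ≤ σ)
    (hθ : 0 ≤ θ) (hθ2 : θ ≤ 2 * γ₁ * marginScale d m lam ω * ρ)
    (hK : N + 5 + 3 * γ₁ ^ 2 ≤ K)
    (hp : 1 / (d : ℝ) ^ 4 * Real.exp (-(θ ^ 2 / σ ^ 2 / 2)) ≤ p) :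
    3 * ((d ^ N : ℕ) : ℝ) / p ≤ (d : ℝ) ^ (K * ω ^ 2 * m / lam ^ 4) := by
  have hd0 : (0 : ℝ) < d := by linarith
  have hL : 0 ≤ Real.log d := Real.log_nonneg (by linarith)
  set U := ω ^ 2 * m / lam ^ 4 with hU
  have hU1 : 1 ≤ U := by
    rw [hU, le_div_iff₀ (by positivity)]
    have h1 : lam ^ 4 ≤ 1 := pow_le_one₀ hl.le hl1
    nlinarith [one_le_pow₀ (n := 2) hω]
  have hms : marginScale d m lam ω ^ 2 = U * Real.log d := by
    rw [marginScale, div_pow, mul_pow, Real.sq_sqrt (by positivity), hU]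
    field_simp
  have ht : θ ^ 2 / σ ^ 2 / 2 ≤ 3 * γ₁ ^ 2 * U * Real.log d := by
    have h1 : θ ^ 2 ≤ 4 * γ₁ ^ 2 * (U * Real.log d) * ρ ^ 2 := by
      calc θ ^ 2 ≤ (2 * γ₁ * marginScale d m lam ω * ρ) ^ 2 := pow_le_pow_left₀ hθ hθ2 2
        _ = 4 * γ₁ ^ 2 * marginScale d m lam ω ^ 2 * ρ ^ 2 := by ring
        _ = _ := by rw [hms]
    have h2 : 98 / 100 * ρ ^ 2 ≤ σ ^ 2 := by nlinarith
    have hs : 0 < σ ^ 2 := by nlinarith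
    rw [div_div, div_le_iff₀ (by positivity)]
    have h3 : 0 ≤ γ₁ ^ 2 * (U * Real.log d) := by positivity
    nlinarith [mul_le_mul_of_nonneg_left h2 h3, mul_nonneg h3 (sq_nonneg ρ)]
  have hp0 : 0 < p := lt_of_lt_of_le (by positivity) hp
  rw [div_le_iff₀ hp0]
  have e1 : (d : ℝ) ^ (K * ω ^ 2 * m / lam ^ 4) = Real.exp (Real.log d * (K * U)) := by
    rw [Real.rpow_def_of_pos hd0, hU]
    congr 1
    ring
  have e2 : (d : ℝ) ^ (N + 5) ≤ Real.exp (Real.log d * ((N + 5) * U)) := by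
    rw [← Real.rpow_natCast, Real.rpow_def_of_pos hd0, Real.exp_le_exp]
    push_cast
    refine mul_le_mul_of_nonneg_left ?_ hL
    nlinarith [Nat.cast_nonneg (α := ℝ) N]
  calc 3 * ((d ^ N : ℕ) : ℝ) ≤ d * d ^ N := by
        push_cast
        exact mul_le_mul_of_nonneg_right (by linarith) (by positivity)
    _ = (d : ℝ) ^ (N + 5) * (1 / d ^ 4) := by field_simp; ring
    _ ≤ Real.exp (Real.log d * ((N + 5) * U)) * (1 / d ^ 4) := by gcongr
    _ ≤ Real.exp (Real.log d * (K * U) - θ ^ 2 / σ ^ 2 / 2) * (1 / d ^ 4) := by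
        gcongr
        have h5 : Real.log d * U * (N + 5 + 3 * γ₁ ^ 2) ≤ Real.log d * U * K :=
          mul_le_mul_of_nonneg_left hK (by positivity)
        nlinarith
    _ = Real.exp (Real.log d * (K * U)) *
          (1 / (d : ℝ) ^ 4 * Real.exp (-(θ ^ 2 / σ ^ 2 / 2))) := by
        rw [sub_eq_add_neg, Real.exp_add]; ring
    _ ≤ _ := by rw [e1]; gcongr

/-- On a good run the estimation error is exponentially small in the threshold. -/
theorem error_le {m k d n : ℕ} {c K S θ ω L E : ℝ} (hc : 0 < c) (hn : 0 < n)
    (hd : 0 < (d : ℝ)) (hk : 1 ≤ (k : ℝ)) (hω : 1 ≤ ω) (hK : 8 / Real.sqrt c ≤ K)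
    (hθ : ω * Real.sqrt L * S ≤ θ / 4)
    (h : c * n / (16 * d) * E ^ 2 ≤ 16 * n * d * (m * k * Real.exp (-(θ / 4))) ^ 2) :
    E ≤ 2 * m * d * (k : ℝ) ^ (3 / 2 : ℝ) *
      Real.exp (-(ω * Real.sqrt L * S) + K * ω ^ 2) := by
  have hn' : (0 : ℝ) < n := by exact_mod_cast hn
  have hs := Real.sqrt_pos.2 hc
  have hsq := Real.sq_sqrt hc.le
  have h1 : E ≤ 16 / Real.sqrt c * (m * d * k * Real.exp (-(θ / 4))) := by
    refine le_of_sq_le_sq ?_ (by positivity)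
    have h2 : c * E ^ 2 ≤ 256 * (m * d * k * Real.exp (-(θ / 4))) ^ 2 := by
      have h3 := mul_le_mul_of_nonneg_left h (by positivity : 0 ≤ 16 * (d : ℝ) / n)
      calc c * E ^ 2 = 16 * (d : ℝ) / n * (c * n / (16 * d) * E ^ 2) := by field_simp
        _ ≤ _ := h3
        _ = _ := by field_simp; ring
    rw [mul_pow, div_pow, hsq, div_mul_eq_mul_div, le_div_iff₀ hc]
    linarith
  have hK0 : 0 < K := lt_of_lt_of_le (by positivity) hK
  have h2 : 16 / Real.sqrt c ≤ 2 * Real.exp (K * ω ^ 2) := by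
    have h3 : K ≤ K * ω ^ 2 := le_mul_of_one_le_right hK0.le (one_le_pow₀ hω)
    have h4 := Real.add_one_le_exp (K * ω ^ 2)
    calc 16 / Real.sqrt c = 2 * (8 / Real.sqrt c) := by ring
      _ ≤ _ := by linarith
  have h3 : (k : ℝ) ≤ (k : ℝ) ^ (3 / 2 : ℝ) := by
    calc (k : ℝ) = (k : ℝ) ^ (1 : ℝ) := (Real.rpow_one _).symm
      _ ≤ _ := Real.rpow_le_rpow_of_exponent_le hk (by norm_num)
  calc E ≤ 16 / Real.sqrt c * (m * d * k * Real.exp (-(θ / 4))) := h1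
    _ ≤ 2 * Real.exp (K * ω ^ 2) * (m * d * (k : ℝ) ^ (3 / 2 : ℝ) *
          Real.exp (-(ω * Real.sqrt L * S))) := by gcongr
    _ = _ := by rw [Real.exp_add]; ring

theorem StopsAt.one_le {k d n T : ℕ} [NeZero k] {Θt : Matrix (Fin d) (Fin d) ℝ} {θ : ℝ}
    {xs : ℕ → Cube k d} (h : StopsAt Θt θ n xs T) (hn : 0 < n) : 1 ≤ T := by
  rcases Nat.eq_zero_or_pos T with rfl | hT
  · have := h.1
    simp [accepted] at this
    omega
  · exact hT

end
end AttentionLearning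

open AttentionLearning in
theorem lemma7p1 :
    -- one program for all instances, and the degree of its running time
    ∃ (prog : Cmd) (q : ℕ),
    -- every degree `γ` of the failure probability, and every constant `A` hidden in `≲`
    ∀ (γ A : ℝ), 0 < γ → 0 < A →
    -- absolute constants, and the number of accepted examples as a function of known parameters
    ∃ (ε K γ₁ : ℝ) (c : ℕ) (nAcc : ℕ → ℕ → ℕ → ℝ → ℝ → ℕ), 0 < ε ∧ 0 < K ∧ 0 < γ₁ ∧
    ∀ (m k d : ℕ) [NeZero m] [NeZero k] (Θ W : Fin m → Matrix (Fin d) (Fin d) ℝ)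
      (lam κ r υ χ : ℝ),
      NonDegenerate ε A c (k := k) Θ W lam κ r υ χ →
    ∀ (ω μ : ℝ) (Θt : Matrix (Fin d) (Fin d) ℝ),
      1 ≤ ω →
      ω ≤ ε * (lam ^ (7 / 4 : ℝ) * Real.sqrt (m * κ * r / Real.log d)) →
      μ ≤ ε * (lam ^ (5 / 2 : ℝ) / (ω ^ 3 * m ^ 3 * Real.log d ^ 2)) →
      frob (Θt - weightedAverage Θ) ≤ μ * frob (Θ 0) →
    -- an admissible threshold is known from the input
    (3 / 2 * γ₁ * marginScale d m lam ω * frob Θt ∈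
      Set.Icc (γ₁ * marginScale d m lam ω / Real.sqrt (weightZ Θ))
        (2 * γ₁ * marginScale d m lam ω / Real.sqrt (weightZ Θ))) ∧
    ∀ θ ∈ Set.Icc (γ₁ * marginScale d m lam ω / Real.sqrt (weightZ Θ))
        (2 * γ₁ * marginScale d m lam ω / Real.sqrt (weightZ Θ)),
      1 - (d : ℝ) ^ (-γ) ≤ (uniformStream k d).real {xs |
        ∃ T : ℕ,
          (T : ℝ) ≤ (d : ℝ) ^ (K * ω ^ 2 * m / lam ^ 4) ∧
          StopsAt Θt θ (nAcc d k m lam ω) xs T ∧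
          (∀ V, IsLSOutput (attention Θ W) Θt θ xs T V →
            frob (V - ∑ i, W i) ≤ 2 * m * d * (k : ℝ) ^ (3 / 2 : ℝ) *
              Real.exp (-(ω * Real.sqrt (Real.log d) * frob (Θ 0)) + K * ω ^ 2)) ∧
          ∃ (steps : ℕ) (s : State),
            Exec (examples (attention Θ W) xs) prog
              (inputState k (nAcc d k m lam ω) Θt θ) steps s ∧
            s.draws = T ∧
            steps ≤ (T * d) ^ q ∧
            IsLSOutput (attention Θ W) Θt θ xs T (s.output d)} := by
  refine ⟨lsProgram, 8, fun γ A _ hA => ?_⟩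
  have hc := tailConst_pos
  -- `d ^ -G` is the failure probability; `n = d ^ (G + 10)` examples make the deviations of the Gram
  -- matrix that unlikely, and the margin `γ₁` makes unfocused samples rarer than `d ^ -(2 G + 12)`
  obtain ⟨G, hG⟩ := exists_nat_ge γ
  set γ₁ : ℝ := 2500 * (((2 * G + 12 : ℕ) : ℝ) + 6) with hγ₁
  have hγ : 1000 ≤ γ₁ := by
    have := Nat.cast_nonneg (α := ℝ) (2 * G + 12)
    linarith
  -- `tailSmall` and `tailConst` are the constants of `rademacher_tail`
  set ε₁ : ℝ := min (1 / 1000000) (tailSmall / 1000000) with hε₁d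
  have hε₁ : 0 < ε₁ := lt_min (by norm_num) (div_pos tailSmall_pos (by norm_num))
  set d₀ : ℝ := 24 / tailConst + 384 / tailConst ^ 2 with hd₀d
  have hd₀ : 0 < d₀ := by positivity
  have hε : 0 < smallConst A ε₁ γ₁ d₀ := by
    refine lt_min (by positivity) (lt_min (by norm_num) (lt_min (by positivity) (by positivity)))
  refine ⟨smallConst A ε₁ γ₁ d₀, ((G + 10 : ℕ) : ℝ) + 5 + 3 * γ₁ ^ 2 + 8 / Real.sqrt tailConst, γ₁,
    0, fun d _ _ _ _ => d ^ (G + 10), hε, by positivity, by linarith, ?_⟩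
  intro m k d _ _ Θ W lam κ r υ χ nd ω μ Θt hω1 hω hμ hΘt
  have P := nd.smallParams hε le_rfl hε₁ (min_le_left _ _) hγ hd₀ hA hω1 hω
  have B := nd.normBounds P hμ hΘt
  have hms : 0 ≤ γ₁ * marginScale d m lam ω := by
    have := P.one_le_L
    have := P.lam_pos
    rw [marginScale]
    positivity
  set ρ := 1 / Real.sqrt (weightZ Θ) with hρd
  have hdiv : ∀ x, x / Real.sqrt (weightZ Θ) = x * ρ := fun x => by rw [hρd, mul_one_div]
  have hρ := B.ρ_pos
  simp only [hdiv]
  refine ⟨⟨?_, ?_⟩, ?_⟩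
  · nlinarith [mul_le_mul_of_nonneg_left B.frob_ge hms, mul_nonneg hms hρ.le]
  · nlinarith [mul_le_mul_of_nonneg_left B.frob_le hms, mul_nonneg hms hρ.le]
  rintro θ ⟨hθ1, hθ2⟩
  -- `V₀` is the weighted average, and `D` the deviation of the given matrix from it
  have R := nd.regime P B hθ1 hθ2
  have hV : weightedAverage Θ + (Θt - weightedAverage Θ) = Θt := by abel
  have h01 : (0 : Fin k) ≠ 1 := by
    intro h
    have := congrArg Fin.val h
    rw [Fin.val_one', Nat.mod_eq_of_lt nd.two_le_k] at this
    simp at this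
  have hε' : ε₁ ≤ tailSmall / 1000000 := min_le_right _ _
  have hd₀' : 24 / tailConst ≤ d₀ := le_add_of_nonneg_right (by positivity)
  have hd₀'' : 384 / tailConst ^ 2 ≤ d₀ := le_add_of_nonneg_left (by positivity)
  have h1 := R.accProb_ge h01 hε' hd₀'
  have h2 := R.gram_ge h01 hε' hd₀'
  have h3 := R.accept_unfocused_le h01 hε' hd₀' P.mk_le (Γ := 2 * G + 12) le_rfl
  rw [hV] at h1 h2 h3
  have hd := R.d_large
  have hd0 : (0 : ℝ) < d := by linarith
  have hdN : 0 < d := by exact_mod_cast hd0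
  have hd100 : 100 ≤ d := by exact_mod_cast hd
  have hp : 0 < accProb k Θt θ := lt_of_lt_of_le (by positivity) h1
  have hn : 4 ≤ d ^ (G + 10) := by
    calc 4 ≤ d := by omega
      _ ≤ d ^ (G + 10) := Nat.le_self_pow (by omega) d
  have hgood := goodRun_prob hdN hn hc hp h2 h3
  have hfail := failure_le (G := G) hc hG hd R.d_ge hd₀''
  refine (by linarith : 1 - (d : ℝ) ^ (-γ) ≤ _).trans (hgood.trans ?_)
  refine MeasureTheory.measureReal_mono ?_ (MeasureTheory.measure_ne_top _ _)
  rintro xs ⟨T, hT, run⟩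
  refine ⟨T, hT.trans (draws_le (γ₁ := γ₁) hd P.one_le_m P.lam_pos P.lam_le hω1 hρ B.frob_ge ?_ hθ2
    ?_ h1), run.stops, fun V hV' => ?_, ?_⟩
  · exact (mul_nonneg hms hρ.le).trans hθ1
  · exact le_add_of_nonneg_right (by positivity)
  · refine error_le (n := d ^ (G + 10)) hc (by omega) hd0 P.one_le_k hω1 ?_ ?_
      (run.frob_sub_le nd.W_le hV')
    · exact le_add_of_nonneg_left (by positivity)
    · have h4 := R.θ_ge
      have h5 : 0 ≤ ω * Real.sqrt (Real.log d) * frob (Θ 0) :=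
        mul_nonneg (by positivity) (frob_nonneg _)
      nlinarith [mul_le_mul_of_nonneg_right hγ h5]
  · obtain ⟨steps, s, he, hdr, hst, hls⟩ := lsProgram_correct (attention Θ W) Θt θ xs nd.two_le_k
      run.stops (b := tailConst * ((d ^ (G + 10) : ℕ) : ℝ) / (16 * d))
      (by positivity) run.gram
    exact ⟨steps, s, he, hdr, hst.trans (steps_le (run.stops.one_le (by omega)) (by omega)), hls⟩
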